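/- Let $\mathfrak f$ be a field and let $C$ be a smooth, separated, geometrically integral curve over $\mathfrak f$ (complete or not), given as a finite union of nonempty affine open subvarieties $U_i$, each embedded as a closed subvariety in an affine space $\mathbb A^{n_i}$ over $\mathfrak f$. The structures described by $\mathbf T=ACVF_{C;\mathfrak f}$ have sorts $k$, $C(k)$, $\Gamma$, $VF$, where: - $k$ is an algebraically closed field with an $\mathfrak f$-algebra structure; $C(k)$ is the set of $k$-points of $C$; - $\Gamma$ is an ordered abelian group with a distinguished element $1>0$; - $VF$ is equipped with a map $VF\to C(k)$ whose fibers $VF_x$ are algebraically closed fields; each $VF_x$ has a valuation $v_x$ with value group $\Gamma$ and valuation ring $\mathcal O_x$, a residue homomorphism $\mathrm{res}_x:\mathcal O_x\to k$, and a ring embedding $i_x:k\to\mathcal O_x$ with $\mathrm{res}_x\circ i_x=\mathrm{id}_k$; - for every $x\in C(k)$ there is a point $c(x)\in C(VF_x)$ such that, $k$ being embedded in $VF_x$ by $i_x$, every nonzero rational function $h\in k(C)$ is defined at $c(x)$ and $v_x(h(c(x)))=\mathrm{ord}_x(h)\cdot 1$. The language has predicates for the sorts, the charts $U_i$, the order of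 $\Gamma$ and the valuation rings; the ring operations of $k$ and constants for the elements of $\mathfrak f$; the group operations of $\Gamma$, with $0$ and $1$; the map $VF\to C(k)$ and the ring operations of its fibers; the valuation $VF_x\setminus\{0\}\to\Gamma$; the binary function $\mathrm{res}_x(a/b)$ (with value $0$ if $v_x(a)<v_x(b)$ or $b=0$); the map $(x,a)\mapsto i_x(a)$; and the coordinates, in every chart, of $x$ (with value $0$ if $x\notin U_i$) and of $c(x)$. The disjoint union of the sorts is regarded as a one-sorted structure in which an operation applied outside its domain has the value $0\in k$. $\mathbf T$ is the set of sentences true in all these structures. Then: 1. the models of $\mathbf T$ are, up to isomorphism, exactly the structures described above; 2. $\mathbf T$ has quantifier elimination; 3. $\mathbf T$ is complete (in particular, consistent); 4. $k$ and $\Gamma$ are stably embedded: in every model of $\mathbf T$, every subset of $k^n$ (respectively $\Gamma^n$) that is definable with parameters is definable with parameters from $k$ (respectively $\Gamma$); 5. the induced structure on $k$ is the $\mathfrak f$-algebra structure, and the induced structure on $\Gamma$ is the ordered group structure with distinguished element $1$: in every model, a subset of $k^n$ (respectively $\Gamma^n$) is definable without parameters in the model if and only if it is definable without parameters in the $\mathfrak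 f$-algebra $k$ (respectively in the ordered group $\Gamma$ with the constant $1$). -/

import Mathlib

universe u

open CategoryTheory CategoryTheory.Limits AlgebraicGeometry

noncomputable section

namespace CurveACVF

/-! ### Curves, points and rational functions -/

section Curve

variable {f : Type u} [Field f] {C : Scheme.{u}} (p : C ⟶ Spec (CommRingCat.of f))

/-- The morphism of spectra induced by a ring homomorphism. -/
abbrev specMap {A B : Type u} [CommRing A] [CommRing B] (φ : A →+* B) :
    Spec (CommRingCat.of B) ⟶ Spec (CommRingCat.of A) :=
  Spec.map (CommRingCat.ofHom φ)

/-- The set `C(K)` of `K`-rational points of the `f`-scheme `C`, where `K` is a field which is an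
`f`-algebra through `s : f → K`. -/
def Point {K : Type u} [Field K] (s : f →+* K) : Type u :=
  { y : Spec (CommRingCat.of K) ⟶ C // y ≫ p = specMap s }

/-- The base change of `C` to a field extension `k` of `f`. -/
abbrev baseChange (k : Type u) [Field k] [Algebra f k] : Scheme.{u} :=
  pullback p (specMap (algebraMap f k))

instance baseChange_isIntegral [GeometricallyIntegral p] (k : Type u) [Field k] [Algebra f k] :
    IsIntegral (baseChange p k) :=
  inferInstance

instance baseChange_isLocallyNoetherian [SmoothOfRelativeDimension 1 p]
    (k : Type u) [Field k] [Algebra f k] : IsLocallyNoetherian (baseChange p k) := by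
  have : Smooth p := SmoothOfRelativeDimension.smooth 1 p
  exact LocallyOfFiniteType.isLocallyNoetherian (pullback.snd p (specMap (algebraMap f k)))

/-- The function field `k(C)`: the field of rational functions on the base change of `C` to `k`. -/
abbrev functionField [GeometricallyIntegral p] (k : Type u) [Field k] [Algebra f k] : Type u :=
  (baseChange p k).functionField

variable {p} in
/-- The closed point of the base change of `C` to `k` given by a `k`-rational point of `C`. -/
def Point.closedPoint {k : Type u} [Field k] [Algebra f k] (x : Point p (algebraMap f k)) :
    baseChange p k :=
  (pullback.lift x.1 (𝟙 _) (by simpa using x.2) : Spec (CommRingCat.of k) ⟶ baseChange p k)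
    (IsLocalRing.closedPoint k)

/-- `ord_x h`, the order of vanishing of the rational function `h ∈ k(C)` at the point
`x ∈ C(k)`. -/
def ordAt [SmoothOfRelativeDimension 1 p] [GeometricallyIntegral p]
    {k : Type u} [Field k] [Algebra f k] (x : Point p (algebraMap f k)) (h : functionField p k) :
    ℤ :=
  Scheme.ord h x.closedPoint

/-- Let `K` be an extension of `k`, with `i : k → K`, let `y ∈ C(K)`, and `φ : k(C) → K`.
`IsEvaluationAt p i y φ` says that `y` is a generic point of `C` over `k` and that `φ` is the
evaluation of rational functions `h ↦ h(y)`: the `K`-point of the base change of `C` to `k` with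
components `y` and `i` is the generic point, composed with `Spec φ`. -/
def IsEvaluationAt [GeometricallyIntegral p] {k K : Type u} [Field k] [Algebra f k] [Field K]
    (i : k →+* K) (y : Point p (i.comp (algebraMap f k))) (φ : functionField p k →+* K) : Prop :=
  specMap φ ≫ (baseChange p k).fromSpecStalk (genericPoint (baseChange p k)) ≫
      pullback.fst p (specMap (algebraMap f k)) = y.1 ∧
  specMap φ ≫ (baseChange p k).fromSpecStalk (genericPoint (baseChange p k)) ≫
      pullback.snd p (specMap (algebraMap f k)) = specMap i

/-- A presentation of `C` as a finite union of nonempty affine open subvarieties `U i`, each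
embedded as a closed subvariety of the affine space of dimension `dim i` over `f` by means of
coordinate functions `coord i j`. -/
structure Atlas where
  size : ℕ
  U : Fin size → C.Opens
  affine : ∀ i, IsAffineOpen (U i)
  nonempty : ∀ i, ((U i : C.Opens) : Set C).Nonempty
  cover : ⨆ i, U i = ⊤
  dim : Fin size → ℕ
  coord : ∀ i, Fin (dim i) → Γ(C, U i)
  /-- The coordinates generate the ring of functions of `U i` as an `f`-algebra. -/
  generate : ∀ i, Function.Surjective
    (MvPolynomial.eval₂Hom
      ((Scheme.ΓSpecIso (CommRingCat.of f)).inv ≫ p.appLE ⊤ (U i) le_top).hom (coord i))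

variable {p} (𝒰 : Atlas p)

/-- The point `y` lies in the chart `U i`. -/
def InChart {K : Type u} [Field K] {s : f →+* K} (y : Point p s) (i : Fin 𝒰.size) : Prop :=
  ⊤ ≤ y.1 ⁻¹ᵁ 𝒰.U i

open Classical in
/-- The `j`-th coordinate of the point `y` in the chart `U i`; it is `0` when `y` is not in
`U i`. -/
def coordAt {K : Type u} [Field K] {s : f →+* K} (y : Point p s) (i : Fin 𝒰.size)
    (j : Fin (𝒰.dim i)) : K :=
  if h : InChart 𝒰 y i then
    (y.1.appLE (𝒰.U i) ⊤ h ≫ (Scheme.ΓSpecIso (CommRingCat.of K)).hom).hom (𝒰.coord i j)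
  else 0

end Curve

/-! ### The described structures -/

/-- The valuation ring of an additive valuation. -/
def valuationRing {K Γ : Type u} [Field K] [AddCommGroup Γ] [LinearOrder Γ] [IsOrderedAddMonoid Γ]
    (v : AddValuation K (WithTop Γ)) : Subring K where
  carrier := {a | 0 ≤ v a}
  mul_mem' {a b} ha hb := by
    simp only [Set.mem_ofPred_eq, v.map_mul] at *
    exact add_nonneg ha hb
  one_mem' := by simp
  add_mem' {a b} ha hb := v.map_le_add ha hb
  zero_mem' := by simp
  neg_mem' {a} ha := by simpa using ha

/-- The structures described by the theory of valued fields over the curve `C`. -/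
structure Model {f : Type u} [Field f] {C : Scheme.{u}} (p : C ⟶ Spec (CommRingCat.of f))
    [SmoothOfRelativeDimension 1 p] [GeometricallyIntegral p] where
  /-- an algebraically closed field `k` over the field of constants `f` -/
  k : Type u
  [field_k : Field k]
  [algebra_k : Algebra f k]
  [isAlgClosed_k : IsAlgClosed k]
  /-- an ordered abelian group with a distinguished element `one > 0` -/
  Γ : Type u
  [addCommGroup_Γ : AddCommGroup Γ]
  [linearOrder_Γ : LinearOrder Γ]
  [isOrderedAddMonoid_Γ : IsOrderedAddMonoid Γ]
  one : Γ
  one_pos : 0 < one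
  /-- an algebraically closed field `VF x` for every `x ∈ C(k)` -/
  VF : Point p (algebraMap f k) → Type u
  [field_VF : ∀ x, Field (VF x)]
  [isAlgClosed_VF : ∀ x, IsAlgClosed (VF x)]
  /-- a valuation on `VF x` with value group `Γ` -/
  v : ∀ x, AddValuation (VF x) (WithTop Γ)
  v_surjective : ∀ x (γ : Γ), ∃ a, v x a = γ
  /-- the residue map, with residue field `k` -/
  res : ∀ x, valuationRing (v x) →+* k
  /-- an embedding of the residue field in the valuation ring, a section of the residue map -/
  sec : ∀ x, k →+* valuationRing (v x)
  res_comp_sec : ∀ x, (res x).comp (sec x) = RingHom.id k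
  /-- a point `c x` of `C(VF x)`, for every `x ∈ C(k)` -/
  c : ∀ x, Point p ((((valuationRing (v x)).subtype).comp (sec x)).comp (algebraMap f k))
  /-- `val (h (c x)) = ord_x h · 1` for every nonzero rational function `h ∈ k(C)`. -/
  val_c : ∀ x, ∃ φ : functionField p k →+* VF x,
    IsEvaluationAt p (((valuationRing (v x)).subtype).comp (sec x)) (c x) φ ∧
      ∀ h, h ≠ 0 → v x (φ h) = ((ordAt p x h • one : Γ) : WithTop Γ)

attribute [instance] Model.field_k Model.algebra_k Model.isAlgClosed_k Model.addCommGroup_Γ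
  Model.linearOrder_Γ Model.isOrderedAddMonoid_Γ Model.field_VF Model.isAlgClosed_VF

/-! ### The language

The sorts `k`, `C(k)`, `Γ` and `VF` are unary predicates. An operation that is applied outside its
domain takes the value `0 ∈ k`. -/

section Language

variable {f : Type u} [Field f] {C : Scheme.{u}} {p : C ⟶ Spec (CommRingCat.of f)}

/-- Function symbols. -/
inductive Func (𝒰 : Atlas p) : ℕ → Type u
  /-- the constants of `k` from `f`, and the ring operations of `k` -/
  | const (r : f) : Func 𝒰 0
  | addK : Func 𝒰 2
  | mulK : Func 𝒰 2
  | negK : Func 𝒰 1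
  /-- the coordinates `C(k) → k` in the charts -/
  | coord (i : Fin 𝒰.size) (j : Fin (𝒰.dim i)) : Func 𝒰 1
  /-- the group operations of `Γ`, and its distinguished element -/
  | zeroG : Func 𝒰 0
  | oneG : Func 𝒰 0
  | addG : Func 𝒰 2
  | negG : Func 𝒰 1
  /-- the map `VF → C(k)`, and the ring operations of its fibers -/
  | base : Func 𝒰 1
  | addV : Func 𝒰 2
  | mulV : Func 𝒰 2
  | negV : Func 𝒰 1
  /-- the valuation, defined on nonzero elements -/
  | val : Func 𝒰 1
  /-- the residue `res (a / b)`, defined to be `0` if `val a < val b`, for `a` and `b` in the same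
  fiber -/
  | res : Func 𝒰 2
  /-- the section `(x, a) ↦ i_x a` -/
  | sec : Func 𝒰 2
  /-- the coordinates of the point `c x` in the charts -/
  | gen (i : Fin 𝒰.size) (j : Fin (𝒰.dim i)) : Func 𝒰 1

/-- Relation symbols. -/
inductive Rel (𝒰 : Atlas p) : ℕ → Type u
  /-- the sorts -/
  | isK : Rel 𝒰 1
  | isC : Rel 𝒰 1
  | isG : Rel 𝒰 1
  | isV : Rel 𝒰 1
  /-- the charts -/
  | chart (i : Fin 𝒰.size) : Rel 𝒰 1
  /-- the order of `Γ` -/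
  | le : Rel 𝒰 2
  /-- the union of the valuation rings of the fibers -/
  | integral : Rel 𝒰 1

/-- The language of valued fields over the curve `C`, presented by the atlas `𝒰`. -/
def lang (𝒰 : Atlas p) : FirstOrder.Language.{u, u} := ⟨Func 𝒰, Rel 𝒰⟩

end Language

section Structure

variable {f : Type u} [Field f] {C : Scheme.{u}} {p : C ⟶ Spec (CommRingCat.of f)}
  [SmoothOfRelativeDimension 1 p] [GeometricallyIntegral p]

namespace Model

/-- The elements of all sorts. -/
inductive Carrier (D : Model p) : Type u
  | ofK (a : D.k) : Carrier D
  | ofC (x : Point p (algebraMap f D.k)) : Carrier D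
  | ofG (γ : D.Γ) : Carrier D
  | ofV (x : Point p (algebraMap f D.k)) (a : D.VF x) : Carrier D

variable (D : Model p)

namespace Carrier

variable {D}

/-- The value of an operation outside its domain. -/
def undef : Carrier D := ofK 0

/-- Extends a unary operation of `k`. -/
def mapK (op : D.k → D.k) : Carrier D → Carrier D
  | ofK a => ofK (op a)
  | _ => undef

/-- Extends a binary operation of `k`. -/
def mapK₂ (op : D.k → D.k → D.k) : Carrier D → Carrier D → Carrier D
  | ofK a, ofK b => ofK (op a b)
  | _, _ => undef

/-- Extends an operation on `C(k)`. -/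
def mapC (op : Point p (algebraMap f D.k) → Carrier D) : Carrier D → Carrier D
  | ofC x => op x
  | _ => undef

/-- Extends a unary operation of `Γ`. -/
def mapG (op : D.Γ → D.Γ) : Carrier D → Carrier D
  | ofG a => ofG (op a)
  | _ => undef

/-- Extends a binary operation of `Γ`. -/
def mapG₂ (op : D.Γ → D.Γ → D.Γ) : Carrier D → Carrier D → Carrier D
  | ofG a, ofG b => ofG (op a b)
  | _, _ => undef

/-- Extends an operation on `VF`. -/
def mapV (op : ∀ x, D.VF x → Carrier D) : Carrier D → Carrier D
  | ofV x a => op x a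
  | _ => undef

open Classical in
/-- Extends a binary operation on the fibers of `VF`. -/
def mapV₂ (op : ∀ x, D.VF x → D.VF x → Carrier D) : Carrier D → Carrier D → Carrier D
  | ofV x a, ofV y b => if h : y = x then op x a (h ▸ b) else undef
  | _, _ => undef

/-- Extends the section, as an operation on `C(k) × k`. -/
def secMap : Carrier D → Carrier D → Carrier D
  | ofC x, ofK a => ofV x (D.sec x a : D.VF x)
  | _, _ => undef

end Carrier

open Classical in
/-- The residue of `a / b` if `val a ≥ val b` and `b ≠ 0`, and `0` otherwise. -/
def resDiv (x : Point p (algebraMap f D.k)) (a b : D.VF x) : D.k :=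
  if h : b ≠ 0 ∧ 0 ≤ D.v x (a / b) then D.res x ⟨a / b, h.2⟩ else 0

/-- The value of a nonzero element, as an element of `Γ`. -/
def valElem (x : Point p (algebraMap f D.k)) (a : D.VF x) : Carrier D :=
  match D.v x a with
  | (γ : D.Γ) => .ofG γ
  | ⊤ => .undef

/-- The interpretation of the function symbols. -/
def interpFunc (𝒰 : Atlas p) : ∀ {n : ℕ}, Func 𝒰 n → (Fin n → D.Carrier) → D.Carrier
  | _, .const r, _ => .ofK (algebraMap f D.k r)
  | _, .addK, t => (t 0).mapK₂ (· + ·) (t 1)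
  | _, .mulK, t => (t 0).mapK₂ (· * ·) (t 1)
  | _, .negK, t => (t 0).mapK (- ·)
  | _, .coord i j, t => (t 0).mapC fun x => .ofK (coordAt 𝒰 x i j)
  | _, .zeroG, _ => .ofG 0
  | _, .oneG, _ => .ofG D.one
  | _, .addG, t => (t 0).mapG₂ (· + ·) (t 1)
  | _, .negG, t => (t 0).mapG (- ·)
  | _, .base, t => (t 0).mapV fun x _ => .ofC x
  | _, .addV, t => (t 0).mapV₂ (fun x a b => .ofV x (a + b)) (t 1)
  | _, .mulV, t => (t 0).mapV₂ (fun x a b => .ofV x (a * b)) (t 1)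
  | _, .negV, t => (t 0).mapV fun x a => .ofV x (-a)
  | _, .val, t => (t 0).mapV fun x a => D.valElem x a
  | _, .res, t => (t 0).mapV₂ (fun x a b => .ofK (D.resDiv x a b)) (t 1)
  | _, .sec, t => (t 0).secMap (t 1)
  | _, .gen i j, t => (t 0).mapC fun x => .ofV x (coordAt 𝒰 (D.c x) i j)

/-- The interpretation of the relation symbols. -/
def interpRel (𝒰 : Atlas p) : ∀ {n : ℕ}, Rel 𝒰 n → (Fin n → D.Carrier) → Prop
  | _, .isK, t => ∃ a, t 0 = .ofK a
  | _, .isC, t => ∃ x, t 0 = .ofC x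
  | _, .isG, t => ∃ γ, t 0 = .ofG γ
  | _, .isV, t => ∃ x a, t 0 = .ofV x a
  | _, .chart i, t => ∃ x, t 0 = .ofC x ∧ InChart 𝒰 x i
  | _, .le, t => ∃ γ δ, t 0 = .ofG γ ∧ t 1 = .ofG δ ∧ γ ≤ δ
  | _, .integral, t => ∃ x a, t 0 = .ofV x a ∧ 0 ≤ D.v x a

/-- The first-order structure given by a model. -/
abbrev toStructure (𝒰 : Atlas p) : (lang 𝒰).Structure D.Carrier where
  funMap := D.interpFunc 𝒰
  RelMap := D.interpRel 𝒰

end Model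

/-- The theory `ACVF_{C;f}`: the sentences that hold in all the structures described above. -/
def theory (𝒰 : Atlas p) : (lang 𝒰).Theory :=
  {σ | ∀ D : Model p, letI := D.toStructure 𝒰; D.Carrier ⊨ σ}

end Structure

/-! ### Model-theoretic notions -/

section ModelTheory

open FirstOrder

/-- Every formula (in particular every sentence) is equivalent modulo `T` to a quantifier-free
formula in the same variables. -/
def HasQuantifierElimination {L : FirstOrder.Language.{u, u}} (T : L.Theory) : Prop :=
  ∀ (n : ℕ) (φ : L.Formula (Fin n)), ∃ ψ : L.Formula (Fin n), ψ.IsQF ∧ T ⊨ᵇ φ.iff ψ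

/-- The unary predicate `R` is stably embedded: in every model `M` of `T`, every subset of a
finite power `R(M)^n` which is definable with parameters from `M` is definable with parameters
from `R(M)`. -/
def IsStablyEmbedded {L : FirstOrder.Language.{u, u}} (T : L.Theory) (R : L.Relations 1) : Prop :=
  ∀ (M : Type u) [L.Structure M], M ⊨ T → ∀ (n : ℕ) (X : Set (Fin n → M)),
    (∀ t ∈ X, ∀ j, FirstOrder.Language.Structure.RelMap R ![t j]) →
      Set.univ.Definable L X → {a : M | FirstOrder.Language.Structure.RelMap R ![a]}.Definable L X

/-- Function symbols of the language of ordered groups with a distinguished element. -/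
inductive GroupFunc : ℕ → Type
  | zero : GroupFunc 0
  | one : GroupFunc 0
  | add : GroupFunc 2
  | neg : GroupFunc 1

/-- Relation symbols of the language of ordered groups with a distinguished element. -/
inductive GroupRel : ℕ → Type
  | le : GroupRel 2

/-- The language of ordered groups with a distinguished element. -/
def groupLang : FirstOrder.Language.{0, 0} := ⟨GroupFunc, GroupRel⟩

/-- An ordered group with a distinguished element `e`, as a first-order structure. -/
abbrev groupStructure {G : Type u} [AddCommGroup G] [LinearOrder G] (e : G) :
    groupLang.Structure G where
  funMap
    | .zero, _ => 0
    | .one, _ => e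
    | .add, t => t 0 + t 1
    | .neg, t => - t 0
  RelMap
    | .le, t => t 0 ≤ t 1

variable {f : Type u} [Field f] {C : Scheme.{u}} {p : C ⟶ Spec (CommRingCat.of f)}
  [SmoothOfRelativeDimension 1 p] [GeometricallyIntegral p]

/-- The subset `X` of `k^n` is definable, without parameters, in the `f`-algebra `k`, i.e. it is
definable in the ring `k` with the elements of `f` as constants. -/
def DefinableInAlgebra (D : Model p) {n : ℕ} (X : Set (Fin n → D.k)) : Prop :=
  letI := FirstOrder.Ring.compatibleRingOfRing D.k
  (Set.range (algebraMap f D.k)).Definable FirstOrder.Language.ring X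

/-- The subset `X` of `Γ^n` is definable, without parameters, in the ordered group `Γ` with its
distinguished element. -/
def DefinableInGroup (D : Model p) {n : ℕ} (X : Set (Fin n → D.Γ)) : Prop :=
  letI := groupStructure D.one
  (∅ : Set D.Γ).Definable groupLang X

/-- The subset `X` of a power of the carrier is definable without parameters. -/
def DefinableInModel (𝒰 : Atlas p) (D : Model p) {n : ℕ} (X : Set (Fin n → D.Carrier)) : Prop :=
  letI := D.toStructure 𝒰
  (∅ : Set D.Carrier).Definable (lang 𝒰) X

end ModelTheory

end CurveACVF

end

noncomputable section
namespace CurveACVF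

/-! ### Points of schemes with values in rings -/

section EvHom

variable {X Y : Scheme.{u}} {R S : CommRingCat.{u}}

/-- The evaluation of the sections over `U` at an `R`-valued point of `U`. -/
def evHom (y : Spec R ⟶ X) (U : X.Opens) (h : ⊤ ≤ y ⁻¹ᵁ U) : Γ(X, U) ⟶ R :=
  y.appLE U ⊤ h ≫ (Scheme.ΓSpecIso R).hom

lemma evHom_congr {y z : Spec R ⟶ X} (e : y = z) (U : X.Opens) (h : ⊤ ≤ y ⁻¹ᵁ U) :
    evHom y U h = evHom z U (e ▸ h) := by
  subst e; rfl

lemma specMap_evHom_fromSpec (y : Spec R ⟶ X) {U : X.Opens} (hU : IsAffineOpen U)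
    (h : ⊤ ≤ y ⁻¹ᵁ U) : Spec.map (evHom y U h) ≫ hU.fromSpec = y := by
  have := IsAffineOpen.SpecMap_appLE_fromSpec y hU (isAffineOpen_top (Spec R)) h
  rw [evHom, Spec.map_comp, Category.assoc, this, IsAffineOpen.fromSpec_top,
    Scheme.isoSpec_Spec_inv, ← Spec.map_comp_assoc]
  simp

lemma eq_of_evHom_eq {y z : Spec R ⟶ X} {U : X.Opens} (hU : IsAffineOpen U)
    (hy : ⊤ ≤ y ⁻¹ᵁ U) (hz : ⊤ ≤ z ⁻¹ᵁ U) (h : evHom y U hy = evHom z U hz) : y = z := by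
  rw [← specMap_evHom_fromSpec y hU hy, ← specMap_evHom_fromSpec z hU hz, h]

lemma top_le_preimage_fromSpec {U : X.Opens} (hU : IsAffineOpen U) (φ : Γ(X, U) ⟶ R) :
    ⊤ ≤ (Spec.map φ ≫ hU.fromSpec) ⁻¹ᵁ U := by
  intro x _
  have : hU.fromSpec (Spec.map φ x) ∈ Set.range hU.fromSpec := ⟨_, rfl⟩
  rw [hU.range_fromSpec] at this
  simp

lemma appLE_evHom (y : Spec R ⟶ X) (g : X ⟶ Y) {U : Y.Opens} {V : X.Opens} (e : V ≤ g ⁻¹ᵁ U)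
    (h : ⊤ ≤ y ⁻¹ᵁ V) :
    g.appLE U V e ≫ evHom y V h =
      evHom (y ≫ g) U (h.trans ((TopologicalSpace.Opens.map y.base).map (homOfLE e)).le) := by
  simp only [evHom, ← Category.assoc, Scheme.Hom.appLE_comp_appLE]

lemma ΓSpecIso_inv_evHom (φ : R ⟶ S) : (Scheme.ΓSpecIso R).inv ≫ evHom (Spec.map φ) ⊤ le_top = φ := by
  unfold evHom
  rw [Iso.inv_comp_eq]
  have : (Spec.map φ).appLE ⊤ ⊤ le_top = (Spec.map φ).appTop := by
    rw [Scheme.Hom.appTop, Scheme.Hom.app_eq_appLE]; rfl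
  rw [this, Scheme.ΓSpecIso_naturality]

lemma evHom_specMap_comp (y : Spec R ⟶ X) (φ : R ⟶ S) {U : X.Opens} (h : ⊤ ≤ y ⁻¹ᵁ U)
    (h' : ⊤ ≤ (Spec.map φ ≫ y) ⁻¹ᵁ U) :
    evHom (Spec.map φ ≫ y) U h' = evHom y U h ≫ φ := by
  have h1 := appLE_evHom (Spec.map φ) y h le_top
  have h2 : evHom (Spec.map φ) ⊤ le_top = (Scheme.ΓSpecIso R).hom ≫ φ := by
    rw [← Iso.inv_comp_eq]; exact ΓSpecIso_inv_evHom φ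
  rw [← h1, h2, evHom, Category.assoc]

lemma evHom_fromSpec {U : X.Opens} (hU : IsAffineOpen U) (φ : Γ(X, U) ⟶ R) :
    evHom (Spec.map φ ≫ hU.fromSpec) U (top_le_preimage_fromSpec hU φ) = φ := by
  have h0 : ⊤ ≤ hU.fromSpec ⁻¹ᵁ U := by rw [hU.fromSpec_preimage_self]
  rw [evHom_specMap_comp _ _ h0]
  have : evHom hU.fromSpec U h0 = 𝟙 _ := by
    rw [evHom, Scheme.Hom.appLE, IsAffineOpen.fromSpec_app_self]
    simp only [Category.assoc, ← Functor.map_comp_assoc]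
    rw [Iso.inv_comp_eq, Category.comp_id]
    erw [(Spec Γ(X, U)).presheaf.map_id]
    simp
  rw [this, Category.id_comp]

lemma hom_spec_ext {y z : Spec S ⟶ Spec R}
    (h : (Scheme.ΓSpecIso R).inv ≫ evHom y ⊤ le_top = (Scheme.ΓSpecIso R).inv ≫ evHom z ⊤ le_top) :
    y = z :=
  eq_of_evHom_eq (isAffineOpen_top _) le_top le_top ((cancel_epi _).1 h)

end EvHom

section Points

variable {f : Type u} [Field f] {C : Scheme.{u}} {p : C ⟶ Spec (CommRingCat.of f)} (𝒰 : Atlas p)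

/-- The structure map from the constants to the functions on a chart. -/
abbrev chartConst (i : Fin 𝒰.size) : f →+* Γ(C, 𝒰.U i) :=
  ((Scheme.ΓSpecIso (CommRingCat.of f)).inv ≫ p.appLE ⊤ (𝒰.U i) le_top).hom

variable {K : Type u} [Field K] {s : f →+* K}

/-- Evaluation of functions on a chart at a point. -/
def chartEval {y : Point p s} {i : Fin 𝒰.size} (h : InChart 𝒰 y i) : Γ(C, 𝒰.U i) →+* K :=
  (evHom y.1 (𝒰.U i) h).hom

variable {𝒰}

lemma chartEval_coord {y : Point p s} {i : Fin 𝒰.size} (h : InChart 𝒰 y i) (j) :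
    chartEval 𝒰 h (𝒰.coord i j) = coordAt 𝒰 y i j := by
  rw [coordAt, dif_pos h]; rfl

lemma chartEval_const {y : Point p s} {i : Fin 𝒰.size} (h : InChart 𝒰 y i) :
    (chartEval 𝒰 h).comp (chartConst 𝒰 i) = s := by
  have h1 : (Scheme.ΓSpecIso (CommRingCat.of f)).inv ≫ p.appLE ⊤ (𝒰.U i) le_top ≫
      evHom y.1 (𝒰.U i) h = CommRingCat.ofHom s := by
    refine (congrArg (_ ≫ ·) (appLE_evHom y.1 p (U := ⊤) le_top h)).trans ?_
    rw [evHom_congr y.2, ΓSpecIso_inv_evHom]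
  rw [← Category.assoc] at h1
  exact congrArg CommRingCat.Hom.hom h1

lemma chartEval_eval₂ {y : Point p s} {i : Fin 𝒰.size} (h : InChart 𝒰 y i)
    (F : MvPolynomial (Fin (𝒰.dim i)) f) :
    chartEval 𝒰 h (MvPolynomial.eval₂ (chartConst 𝒰 i) (𝒰.coord i) F) =
      MvPolynomial.eval₂ s (coordAt 𝒰 y i) F := by
  rw [MvPolynomial.hom_eval₂, chartEval_const]
  congr 1
  funext j
  exact chartEval_coord h j

/-- The point of a chart given by a homomorphism. -/
lemma exists_point_of_hom (i : Fin 𝒰.size) (φ : Γ(C, 𝒰.U i) →+* K)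
    (hφ : φ.comp (chartConst 𝒰 i) = s) :
    ∃ (y : Point p s) (h : InChart 𝒰 y i), chartEval 𝒰 h = φ := by
  let y : Spec (CommRingCat.of K) ⟶ C :=
    Spec.map (CommRingCat.ofHom φ) ≫ (𝒰.affine i).fromSpec
  have hy : ⊤ ≤ y ⁻¹ᵁ 𝒰.U i := top_le_preimage_fromSpec _ _
  have hev : evHom y (𝒰.U i) hy = CommRingCat.ofHom φ := evHom_fromSpec _ _
  refine ⟨⟨y, ?_⟩, hy, ?_⟩
  · apply hom_spec_ext
    rw [ΓSpecIso_inv_evHom, ← appLE_evHom y p (U := ⊤) (V := 𝒰.U i) le_top hy, hev,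
      ← Category.assoc]
    ext x
    exact congrArg (fun g : f →+* K => g x) hφ
  · exact congrArg CommRingCat.Hom.hom hev

lemma point_ext {y z : Point p s} {i : Fin 𝒰.size} (hy : InChart 𝒰 y i) (hz : InChart 𝒰 z i)
    (h : ∀ j, coordAt 𝒰 y i j = coordAt 𝒰 z i j) : y = z := by
  refine Subtype.ext (eq_of_evHom_eq (𝒰.affine i) hy hz ?_)
  ext a
  obtain ⟨F, rfl⟩ := 𝒰.generate i a
  have := chartEval_eval₂ hy F
  rw [funext h, ← chartEval_eval₂ hz F] at this
  exact this

/-- The polynomials that vanish on a chart. -/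
def chartIdeal (𝒰 : Atlas p) (i : Fin 𝒰.size) : Ideal (MvPolynomial (Fin (𝒰.dim i)) f) :=
  RingHom.ker (MvPolynomial.eval₂Hom (chartConst 𝒰 i) (𝒰.coord i))

lemma eval₂_coordAt_eq_zero {y : Point p s} {i : Fin 𝒰.size} (h : InChart 𝒰 y i)
    {F : MvPolynomial (Fin (𝒰.dim i)) f} (hF : F ∈ chartIdeal 𝒰 i) :
    MvPolynomial.eval₂ s (coordAt 𝒰 y i) F = 0 := by
  rw [← chartEval_eval₂ h]
  have : MvPolynomial.eval₂ (chartConst 𝒰 i) (𝒰.coord i) F = 0 := hF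
  rw [this, map_zero]

lemma exists_point_of_coords (i : Fin 𝒰.size) (a : Fin (𝒰.dim i) → K)
    (ha : ∀ F ∈ chartIdeal 𝒰 i, MvPolynomial.eval₂ s a F = 0) :
    ∃ y : Point p s, InChart 𝒰 y i ∧ coordAt 𝒰 y i = a := by
  let g := MvPolynomial.eval₂Hom (chartConst 𝒰 i) (𝒰.coord i)
  have hg : Function.Surjective g := 𝒰.generate i
  let φ : Γ(C, 𝒰.U i) →+* K := RingHom.liftOfSurjective g hg ⟨MvPolynomial.eval₂Hom s a, ha⟩
  have hφ : ∀ F, φ (g F) = MvPolynomial.eval₂ s a F := fun F =>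
    RingHom.liftOfRightInverse_comp_apply _ _ _ _ _
  obtain ⟨y, h, hy⟩ := exists_point_of_hom (s := s) i φ (by
    ext r
    have := hφ (MvPolynomial.C r)
    simpa [g] using this)
  refine ⟨y, h, funext fun j => ?_⟩
  rw [← chartEval_coord h, hy]
  have := hφ (MvPolynomial.X j)
  simpa [g] using this

/-- The equations, in the coordinates of two charts, of the diagonal of `C`. -/
lemma exists_diagonal_ideal [IsSeparated p] (i j : Fin 𝒰.size) :
    ∃ J : Ideal (MvPolynomial (Fin (𝒰.dim i) ⊕ Fin (𝒰.dim j)) f),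
      ∀ {K : Type u} [Field K] {s : f →+* K} {y z : Point p s}, InChart 𝒰 y i → InChart 𝒰 z j →
        (y = z ↔ ∀ F ∈ J, MvPolynomial.eval₂ s (Sum.elim (coordAt 𝒰 y i) (coordAt 𝒰 z j)) F = 0) := by
  let _ := (chartConst 𝒰 i).toAlgebra
  let _ := (chartConst 𝒰 j).toAlgebra
  let T := TensorProduct f Γ(C, 𝒰.U i) Γ(C, 𝒰.U j)
  let l₁ : Γ(C, 𝒰.U i) →+* T := Algebra.TensorProduct.includeLeftRingHom
  let l₂ : Γ(C, 𝒰.U j) →+* T :=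
    (Algebra.TensorProduct.includeRight : Γ(C, 𝒰.U j) →ₐ[f] T).toRingHom
  let q₁ : Spec (CommRingCat.of T) ⟶ C := Spec.map (CommRingCat.ofHom l₁) ≫ (𝒰.affine i).fromSpec
  let q₂ : Spec (CommRingCat.of T) ⟶ C := Spec.map (CommRingCat.ofHom l₂) ≫ (𝒰.affine j).fromSpec
  have hl : l₁.comp (chartConst 𝒰 i) = l₂.comp (chartConst 𝒰 j) := by
    ext r
    exact (Algebra.TensorProduct.includeLeft.commutes r).trans
      (Algebra.TensorProduct.includeRight.commutes r).symm
  have hq : q₁ ≫ p = q₂ ≫ p := by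
    apply hom_spec_ext
    have h₁ := appLE_evHom q₁ p (U := ⊤) (V := 𝒰.U i) le_top (top_le_preimage_fromSpec _ _)
    have h₂ := appLE_evHom q₂ p (U := ⊤) (V := 𝒰.U j) le_top (top_le_preimage_fromSpec _ _)
    rw [← h₁, ← h₂, evHom_fromSpec, evHom_fromSpec, ← Category.assoc, ← Category.assoc]
    ext r
    exact congrArg (fun g : f →+* T => g r) hl
  let d : Spec (CommRingCat.of T) ⟶ pullback p p := pullback.lift q₁ q₂ hq
  obtain ⟨J, e, he⟩ := IsClosedImmersion.Spec_iff.1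
    (inferInstance : IsClosedImmersion (pullback.fst d (pullback.diagonal p)))
  let g : MvPolynomial (Fin (𝒰.dim i) ⊕ Fin (𝒰.dim j)) f →+* T :=
    MvPolynomial.eval₂Hom (l₁.comp (chartConst 𝒰 i))
      (Sum.elim (fun a => l₁ (𝒰.coord i a)) (fun a => l₂ (𝒰.coord j a)))
  have hg : Function.Surjective g := by
    intro t
    induction t using TensorProduct.induction_on with
    | zero => exact ⟨0, map_zero _⟩
    | add a b ha hb =>
      obtain ⟨a, rfl⟩ := ha
      obtain ⟨b, rfl⟩ := hb
      exact ⟨a + b, map_add _ _ _⟩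
    | tmul a b =>
      obtain ⟨F, rfl⟩ := 𝒰.generate i a
      obtain ⟨G, rfl⟩ := 𝒰.generate j b
      refine ⟨MvPolynomial.rename Sum.inl F * MvPolynomial.rename Sum.inr G, ?_⟩
      rw [map_mul]
      have h₁ : g (MvPolynomial.rename Sum.inl F) =
          l₁ (MvPolynomial.eval₂Hom (chartConst 𝒰 i) (𝒰.coord i) F) := by
        simp only [g, MvPolynomial.coe_eval₂Hom, MvPolynomial.eval₂_rename, MvPolynomial.hom_eval₂]
        rfl
      have h₂ : g (MvPolynomial.rename Sum.inr G) =
          l₂ (MvPolynomial.eval₂Hom (chartConst 𝒰 j) (𝒰.coord j) G) := by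
        simp only [g, hl, MvPolynomial.coe_eval₂Hom, MvPolynomial.eval₂_rename,
          MvPolynomial.hom_eval₂]
        rfl
      rw [h₁, h₂]
      exact (Algebra.TensorProduct.tmul_mul_tmul _ _ _ _).trans (by rw [mul_one, one_mul])
  refine ⟨J.comap g, fun {K} _ {s} {y} {z} hy hz => ?_⟩
  let _ := s.toAlgebra
  let θ₁ : Γ(C, 𝒰.U i) →ₐ[f] K := ⟨chartEval 𝒰 hy, RingHom.congr_fun (chartEval_const hy)⟩
  let θ₂ : Γ(C, 𝒰.U j) →ₐ[f] K := ⟨chartEval 𝒰 hz, RingHom.congr_fun (chartEval_const hz)⟩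
  let θ : T →+* K := (Algebra.TensorProduct.productMap θ₁ θ₂).toRingHom
  have hθ₁ : θ.comp l₁ = chartEval 𝒰 hy := by
    ext a; exact Algebra.TensorProduct.productMap_left_apply θ₁ θ₂ a
  have hθ₂ : θ.comp l₂ = chartEval 𝒰 hz := by
    ext a; exact Algebra.TensorProduct.productMap_right_apply θ₁ θ₂ a
  have hθ₁' : Spec.map (CommRingCat.ofHom θ) ≫ q₁ = y.1 := by
    rw [← Category.assoc, ← Spec.map_comp, ← CommRingCat.ofHom_comp, hθ₁]
    exact specMap_evHom_fromSpec y.1 (𝒰.affine i) hy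
  have hθ₂' : Spec.map (CommRingCat.ofHom θ) ≫ q₂ = z.1 := by
    rw [← Category.assoc, ← Spec.map_comp, ← CommRingCat.ofHom_comp, hθ₂]
    exact specMap_evHom_fromSpec z.1 (𝒰.affine j) hz
  have hθg : ∀ F, θ (g F) = MvPolynomial.eval₂ s (Sum.elim (coordAt 𝒰 y i) (coordAt 𝒰 z j)) F := by
    intro F
    rw [MvPolynomial.coe_eval₂Hom, MvPolynomial.hom_eval₂, ← RingHom.comp_assoc, hθ₁,
      chartEval_const]
    congr 1
    funext a
    rcases a with a | a
    · exact (RingHom.congr_fun hθ₁ _).trans (chartEval_coord hy a)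
    · exact (RingHom.congr_fun hθ₂ _).trans (chartEval_coord hz a)
  have key : y = z ↔ ∀ t ∈ J, θ t = 0 := by
    constructor
    · intro hyz t ht
      let l : Spec (CommRingCat.of K) ⟶ pullback d (pullback.diagonal p) :=
        pullback.lift (Spec.map (CommRingCat.ofHom θ)) y.1 (by
          have hd₁ : d ≫ pullback.fst p p = q₁ := pullback.lift_fst _ _ _
          have hd₂ : d ≫ pullback.snd p p = q₂ := pullback.lift_snd _ _ _
          apply pullback.hom_ext
          · rw [Category.assoc, hd₁, hθ₁', Category.assoc, pullback.diagonal_fst, Category.comp_id]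
          · rw [Category.assoc, hd₂, hθ₂', Category.assoc, pullback.diagonal_snd, Category.comp_id,
              hyz])
      have h : (l ≫ e.hom) ≫ Spec.map (CommRingCat.ofHom (Ideal.Quotient.mk J)) =
          Spec.map (CommRingCat.ofHom θ) := by
        rw [Category.assoc, ← he, pullback.lift_fst]
      obtain ⟨ψ, hψ⟩ := Spec.map_surjective (l ≫ e.hom)
      rw [← hψ, ← Spec.map_comp] at h
      have h' := Spec.map_injective h
      have h'' := congrArg (fun g => g.hom t) h'
      refine Eq.trans (Eq.symm h'') ?_
      have : Ideal.Quotient.mk J t = 0 := Ideal.Quotient.eq_zero_iff_mem.2 ht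
      simp [this]
    · intro h
      let ψ := Ideal.Quotient.lift J θ h
      have hψ : Spec.map (CommRingCat.ofHom θ) = Spec.map (CommRingCat.ofHom ψ) ≫ e.inv ≫
          pullback.fst d (pullback.diagonal p) := by
        rw [he, Iso.inv_hom_id_assoc, ← Spec.map_comp, ← CommRingCat.ofHom_comp]
        congr 1
      apply Subtype.ext
      have h₀ : pullback.fst d (pullback.diagonal p) ≫ q₁ =
          pullback.fst d (pullback.diagonal p) ≫ q₂ := by
        have h₁ := congrArg (· ≫ pullback.fst p p) (pullback.condition (f := d)
          (g := pullback.diagonal p))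
        have h₂ := congrArg (· ≫ pullback.snd p p) (pullback.condition (f := d)
          (g := pullback.diagonal p))
        simp only [Category.assoc, pullback.diagonal_fst, pullback.diagonal_snd, d,
          pullback.lift_fst, pullback.lift_snd, Category.comp_id] at h₁ h₂
        exact h₁.trans h₂.symm
      rw [← hθ₁', ← hθ₂', hψ]
      simp only [Category.assoc, h₀]
  rw [key]
  constructor
  · intro h F hF
    rw [← hθg]; exact h _ hF
  · intro h t ht
    obtain ⟨F, rfl⟩ := hg t
    rw [hθg]; exact h F ht

end Points
end CurveACVF
end

noncomputable section
namespace CurveACVF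

lemma appLE_comp {X Y Z W : Scheme.{u}} {a : X ⟶ Y} {b : Y ⟶ Z} {c : X ⟶ W} {d : W ⟶ Z}
    (e : a ≫ b = c ≫ d) (V : X.Opens) (U : Y.Opens) (h : V ≤ a ⁻¹ᵁ U) :
    b.appLE ⊤ U le_top ≫ a.appLE U V h = d.appLE ⊤ ⊤ le_top ≫ c.appLE ⊤ V le_top := by
  refine (Scheme.Hom.appLE_comp_appLE a b ⊤ U V le_top h).trans (Eq.trans ?_
    (Scheme.Hom.appLE_comp_appLE c d ⊤ ⊤ V le_top le_top).symm)
  simp only [e]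

lemma top_le_comp_preimage {X Y Z : Scheme.{u}} (a : X ⟶ Y) {b : Y ⟶ Z} {U : Z.Opens}
    (h : ⊤ ≤ b ⁻¹ᵁ U) : ⊤ ≤ (a ≫ b) ⁻¹ᵁ U := by
  intro z _
  have : a z ∈ b ⁻¹ᵁ U := h (Set.mem_univ _)
  simpa using this

lemma specMap_fromSpecStalk {X : Scheme.{u}} (x : X) {U : X.Opens} (hU : IsAffineOpen U) (hx : x ∈ U)
   {R : CommRingCat.{u}} (φ : X.presheaf.stalk x ⟶ R) :
    Spec.map φ ≫ X.fromSpecStalk x = Spec.map (X.presheaf.germ U x hx ≫ φ) ≫ hU.fromSpec := by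
  rw [← hU.fromSpecStalk_eq_fromSpecStalk hx, IsAffineOpen.fromSpecStalk, Spec.map_comp,
    Category.assoc]

lemma evHom_eq {X : Scheme.{u}} {U : X.Opens} (hU : IsAffineOpen U) 
   {R : CommRingCat.{u}} {ψ : Γ(X, U) ⟶ R} {y : Spec R ⟶ X} (e : y = Spec.map ψ ≫ hU.fromSpec)
    (h : ⊤ ≤ y ⁻¹ᵁ U) : evHom y U h = ψ := by
  subst e; exact evHom_fromSpec _ _

lemma evHom_fromSpecStalk {X : Scheme.{u}} (x : X) {U : X.Opens} (hU : IsAffineOpen U) (hx : x ∈ U)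
   {R : CommRingCat.{u}} (φ : X.presheaf.stalk x ⟶ R) {y : Spec R ⟶ X}
   (e : y = Spec.map φ ≫ X.fromSpecStalk x)
    (h : ⊤ ≤ y ⁻¹ᵁ U) :
    evHom y U h = X.presheaf.germ U x hx ≫ φ := 
  evHom_eq hU (e.trans (specMap_fromSpecStalk x hU hx φ)) h
section BaseChange

variable {f : Type u} [Field f] {C : Scheme.{u}} {p : C ⟶ Spec (CommRingCat.of f)}
  (𝒰 : Atlas p) (k : Type u) [Field k] [Algebra f k]

/-- The chart `U i`, after base change to `k`. -/
def chartBC (i : Fin 𝒰.size) : (baseChange p k).Opens :=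
  pullback.fst p (specMap (algebraMap f k)) ⁻¹ᵁ 𝒰.U i

/-- The ring of functions on the chart `U i`, after base change to `k`. -/
abbrev BRing (i : Fin 𝒰.size) : Type u := Γ(baseChange p k, chartBC 𝒰 k i)

lemma isAffineOpen_chartBC (i : Fin 𝒰.size) : IsAffineOpen (chartBC 𝒰 k i) :=
  have : IsAffineHom (pullback.fst p (specMap (algebraMap f k))) :=
    MorphismProperty.of_isPullback (P := @IsAffineHom) (IsPullback.of_hasPullback p _).flip
      (inferInstanceAs (IsAffineHom (Spec.map _)))
  (𝒰.affine i).preimage _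

/-- The constants of the ring of functions on a chart. -/
def bConst (i : Fin 𝒰.size) : k →+* BRing 𝒰 k i :=
  ((Scheme.ΓSpecIso (CommRingCat.of k)).inv ≫
    (pullback.snd p (specMap (algebraMap f k))).appLE ⊤ (chartBC 𝒰 k i) le_top).hom

/-- The pullback of functions on a chart. -/
def bPull (i : Fin 𝒰.size) : Γ(C, 𝒰.U i) →+* BRing 𝒰 k i :=
  ((pullback.fst p (specMap (algebraMap f k))).appLE (𝒰.U i) (chartBC 𝒰 k i) le_rfl).hom

/-- The coordinate functions of a chart. -/
def bCoord (i : Fin 𝒰.size) (j : Fin (𝒰.dim i)) : BRing 𝒰 k i := bPull 𝒰 k i (𝒰.coord i j)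

lemma bConst_comp_algebraMap (i : Fin 𝒰.size) : (bConst 𝒰 k i).comp (algebraMap f k) =
    (bPull 𝒰 k i).comp (chartConst 𝒰 i) := by
  have h₁ := appLE_comp (pullback.condition (f := p) (g := specMap (algebraMap f k)))
    (chartBC 𝒰 k i) (𝒰.U i) le_rfl
  have h₂ : (specMap (algebraMap f k)).appLE ⊤ ⊤ le_top =
      (Scheme.ΓSpecIso _).hom ≫ CommRingCat.ofHom (algebraMap f k) ≫
        (Scheme.ΓSpecIso _).inv := by
    have := ΓSpecIso_inv_evHom (CommRingCat.ofHom (algebraMap f k))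
    rw [Iso.inv_comp_eq] at this
    rw [← Category.assoc, Iso.eq_comp_inv]
    exact this
  rw [h₂] at h₁
  ext r
  have h₃ := congrArg (fun g => g.hom ((Scheme.ΓSpecIso (CommRingCat.of f)).inv.hom r)) h₁
  simp only [CommRingCat.hom_comp, RingHom.comp_apply] at h₃
  refine Eq.trans ?_ h₃.symm
  simp [bConst]

lemma exists_eval₂_eq (i : Fin 𝒰.size) (b : BRing 𝒰 k i) :
    ∃ P : MvPolynomial (Fin (𝒰.dim i)) k, MvPolynomial.eval₂ (bConst 𝒰 k i) (bCoord 𝒰 k i) P = b := by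
  have H := IsPullback.of_hasPullback p (specMap (algebraMap f k))
  have hpush := (isIso_pushoutSection_iff H (US := ⊤) (UT := ⊤) (UX := 𝒰.U i)
    (UY := chartBC 𝒰 k i) le_top le_top (by simp [chartBC])).1
    (isIso_pushoutSection_of_isAffineOpen H _ _ _ (isAffineOpen_top _) (isAffineOpen_top _)
      (𝒰.affine i))
  have hcl := CommRingCat.closure_range_union_range_eq_top_of_isPushout hpush
  let g := MvPolynomial.eval₂Hom (bConst 𝒰 k i) (bCoord 𝒰 k i)
  have hle : Subring.closure (Set.range (bPull 𝒰 k i) ∪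
      Set.range ((pullback.snd p (specMap (algebraMap f k))).appLE ⊤ (chartBC 𝒰 k i) le_top)) ≤
      g.range := by
    rw [Subring.closure_le, Set.union_subset_iff]
    constructor
    · rintro _ ⟨a, rfl⟩
      obtain ⟨F, rfl⟩ := 𝒰.generate i a
      refine ⟨MvPolynomial.map (algebraMap f k) F, ?_⟩
      simp only [g, MvPolynomial.coe_eval₂Hom, MvPolynomial.eval₂_map, MvPolynomial.hom_eval₂,
        bConst_comp_algebraMap]
      rfl
    · rintro _ ⟨a, rfl⟩
      refine ⟨MvPolynomial.C ((Scheme.ΓSpecIso (CommRingCat.of k)).hom a), ?_⟩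
      simp only [g, MvPolynomial.coe_eval₂Hom, MvPolynomial.eval₂_C, bConst]
      simp
  exact hle (hcl.ge trivial)

section Eval

variable {k} {K : Type u} [Field K] {ι : k →+* K}

/-- The `K`-point of the base change given by a `K`-point of `C` and the embedding of `k`. -/
def liftPoint (y : Point p (ι.comp (algebraMap f k))) :
    Spec (CommRingCat.of K) ⟶ baseChange p k :=
  pullback.lift y.1 (specMap ι) (by rw [y.2, ← Spec.map_comp, ← CommRingCat.ofHom_comp])

variable {𝒰}

lemma top_le_chartBC {y : Point p (ι.comp (algebraMap f k))} {i : Fin 𝒰.size} (h : InChart 𝒰 y i) :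
    ⊤ ≤ liftPoint y ⁻¹ᵁ chartBC 𝒰 k i := by
  have : liftPoint y ⁻¹ᵁ chartBC 𝒰 k i = y.1 ⁻¹ᵁ 𝒰.U i := by
    have h' : liftPoint y ≫ pullback.fst _ _ = y.1 := pullback.lift_fst _ _ _
    rw [← h']; rfl
  rw [this]; exact h

/-- Evaluation, at a `K`-point of a chart, of functions on the base change of the chart. -/
def bEval {y : Point p (ι.comp (algebraMap f k))} {i : Fin 𝒰.size} (h : InChart 𝒰 y i) :
    BRing 𝒰 k i →+* K :=
  (evHom (liftPoint y) (chartBC 𝒰 k i) (top_le_chartBC h)).hom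

lemma bEval_const {y : Point p (ι.comp (algebraMap f k))} {i : Fin 𝒰.size} (h : InChart 𝒰 y i)
    (a : k) : bEval h (bConst 𝒰 k i a) = ι a := by
  have h1 : (Scheme.ΓSpecIso (CommRingCat.of k)).inv ≫
      (pullback.snd p (specMap (algebraMap f k))).appLE ⊤ (chartBC 𝒰 k i) le_top ≫
      evHom (liftPoint y) (chartBC 𝒰 k i) (top_le_chartBC h) = CommRingCat.ofHom ι := by
    refine (congrArg (_ ≫ ·) (appLE_evHom (liftPoint y) _ (U := ⊤) le_top (top_le_chartBC h))).trans ?_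
    have h' : liftPoint y ≫ pullback.snd _ _ = specMap ι := pullback.lift_snd _ _ _
    rw [evHom_congr h', ΓSpecIso_inv_evHom]
  rw [← Category.assoc] at h1
  exact congrArg (fun g => g.hom a) h1

lemma bEval_coord {y : Point p (ι.comp (algebraMap f k))} {i : Fin 𝒰.size} (h : InChart 𝒰 y i)
    (j) : bEval h (bCoord 𝒰 k i j) = coordAt 𝒰 y i j := by
  rw [← chartEval_coord h]
  have h' : liftPoint y ≫ pullback.fst _ _ = y.1 := pullback.lift_fst _ _ _
  have h1 := appLE_evHom (liftPoint y) (pullback.fst p (specMap (algebraMap f k)))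
    (U := 𝒰.U i) (V := chartBC 𝒰 k i) le_rfl (top_le_chartBC h)
  rw [evHom_congr h'] at h1
  exact congrArg (fun g => g.hom (𝒰.coord i j)) h1

lemma bEval_eval₂ {y : Point p (ι.comp (algebraMap f k))} {i : Fin 𝒰.size} (h : InChart 𝒰 y i)
    (P : MvPolynomial (Fin (𝒰.dim i)) k) :
    bEval h (MvPolynomial.eval₂ (bConst 𝒰 k i) (bCoord 𝒰 k i) P) =
      MvPolynomial.eval₂ ι (coordAt 𝒰 y i) P := by
  rw [MvPolynomial.hom_eval₂]
  congr 1
  · ext a; exact bEval_const h a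
  · funext j; exact bEval_coord h j

section

variable [GeometricallyIntegral p]

instance chartBC_nonempty (i : Fin 𝒰.size) : Nonempty (chartBC 𝒰 k i) := by
  obtain ⟨x, hx⟩ := 𝒰.nonempty i
  have h₁ : Surjective (specMap (algebraMap f k)) := inferInstance
  have : Surjective (pullback.fst p (specMap (algebraMap f k))) :=
    MorphismProperty.of_isPullback (P := @Surjective) (IsPullback.of_hasPullback p _).flip h₁
  obtain ⟨z, rfl⟩ := (pullback.fst p (specMap (algebraMap f k))).surjective x
  exact ⟨⟨z, hx⟩⟩

/-- Functions on a chart as rational functions. -/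
def bFun (k : Type u) [Field k] [Algebra f k] (i : Fin 𝒰.size) : BRing 𝒰 k i →+* functionField p k :=
  ((baseChange p k).germToFunctionField (chartBC 𝒰 k i)).hom

lemma genericPoint_mem_chartBC (i : Fin 𝒰.size) :
    genericPoint (baseChange p k) ∈ chartBC 𝒰 k i :=
  ((genericPoint_spec (baseChange p k)).mem_open_set_iff (chartBC 𝒰 k i).isOpen).mpr
    (by simpa using chartBC_nonempty (𝒰 := 𝒰) (k := k) i)

lemma top_le_fromSpecStalk (i : Fin 𝒰.size) :
    ⊤ ≤ (baseChange p k).fromSpecStalk (genericPoint (baseChange p k)) ⁻¹ᵁ chartBC 𝒰 k i := by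
  intro z _
  have h : (baseChange p k).fromSpecStalk (genericPoint (baseChange p k)) z ∈
      Set.range ((baseChange p k).fromSpecStalk (genericPoint (baseChange p k))) := ⟨z, rfl⟩
  rw [Scheme.range_fromSpecStalk] at h
  exact h.mem_open (chartBC 𝒰 k i).isOpen (genericPoint_mem_chartBC i)

lemma IsEvaluationAt.liftPoint_eq {y : Point p (ι.comp (algebraMap f k))}
    {φ : functionField p k →+* K} (hφ : IsEvaluationAt p ι y φ) :
    liftPoint y = specMap φ ≫
      (baseChange p k).fromSpecStalk (genericPoint (baseChange p k)) := by
  apply pullback.hom_ext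
  · rw [liftPoint, pullback.lift_fst, Category.assoc]; exact hφ.1.symm
  · rw [liftPoint, pullback.lift_snd, Category.assoc]; exact hφ.2.symm

lemma IsEvaluationAt.inChart {y : Point p (ι.comp (algebraMap f k))} {φ : functionField p k →+* K}
    (hφ : IsEvaluationAt p ι y φ) (i : Fin 𝒰.size) : InChart 𝒰 y i := by
  have h : liftPoint y ≫ pullback.fst _ _ = y.1 := pullback.lift_fst _ _ _
  rw [InChart, ← h, hφ.liftPoint_eq, Category.assoc]
  refine top_le_comp_preimage (U := 𝒰.U i) (specMap φ) ?_
  exact top_le_fromSpecStalk i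

lemma isEvaluationAt_iff {y : Point p (ι.comp (algebraMap f k))} {i : Fin 𝒰.size}
    (h : InChart 𝒰 y i) (φ : functionField p k →+* K) :
    IsEvaluationAt p ι y φ ↔ φ.comp (bFun k i) = bEval h := by
  constructor
  · intro hφ
    exact (congrArg CommRingCat.Hom.hom (evHom_fromSpecStalk _ (isAffineOpen_chartBC 𝒰 k i)
      (genericPoint_mem_chartBC i) _ hφ.liftPoint_eq (top_le_chartBC h))).symm
  · intro hφ
    have h₃ : liftPoint y = specMap φ ≫
        (baseChange p k).fromSpecStalk (genericPoint (baseChange p k)) := by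
      rw [specMap_fromSpecStalk _ (isAffineOpen_chartBC 𝒰 k i) (genericPoint_mem_chartBC i),
        ← specMap_evHom_fromSpec (liftPoint y) (isAffineOpen_chartBC 𝒰 k i) (top_le_chartBC h)]
      congr 2
      exact CommRingCat.hom_ext hφ.symm
    constructor
    · rw [← Category.assoc, ← h₃]; exact pullback.lift_fst _ _ _
    · rw [← Category.assoc, ← h₃]; exact pullback.lift_snd _ _ _

end

end Eval

end BaseChange
end CurveACVF
end

noncomputable section
namespace CurveACVF

section Ring

/-- The maximal ideal of a rational point of a smooth algebra of relative dimension one is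
generated by one element, up to its square. -/
lemma exists_ker_le_span_sup_sq {R A : Type u} [CommRing R] [CommRing A] [Nontrivial A] [Algebra R A]
    [Algebra.IsStandardSmoothOfRelativeDimension 1 R A] (τ : A →ₐ[R] R) :
    ∃ t ∈ RingHom.ker τ, RingHom.ker τ ≤ Ideal.span {t} ⊔ RingHom.ker τ ^ 2 := by
  set m := RingHom.ker τ with hm
  have hmem (a : A) : a - algebraMap R A (τ a) ∈ m := by
    rw [hm, RingHom.mem_ker]; simp
  let D₀ : A →ₗ[R] m.Cotangent :=
    { toFun := fun a => m.toCotangent ⟨a - algebraMap R A (τ a), hmem a⟩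
      map_add' := fun a b => by
        rw [← map_add]; congr 1; ext; simp; ring
      map_smul' := fun r a => by
        rw [RingHom.id_apply, ← algebraMap_smul A r (m.toCotangent _), ← map_smul]; congr 1; ext
        simp [Algebra.smul_def]; ring }
  let D : Derivation R A m.Cotangent := Derivation.mk' D₀ (fun a b => by
    change m.toCotangent _ = a • m.toCotangent _ + b • m.toCotangent _
    rw [← map_smul, ← map_smul, ← map_add, Ideal.toCotangent_eq]
    have := Ideal.mul_mem_mul (hmem a) (hmem b)
    rw [← sq] at this
    rw [← neg_mem_iff]
    convert this using 1
    simp; ring)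
  have hfree : Module.Free A Ω[A⁄R] :=
    have : Algebra.IsStandardSmooth R A :=
      Algebra.IsStandardSmoothOfRelativeDimension.isStandardSmooth 1
    inferInstance
  have hrank : Module.finrank A Ω[A⁄R] = 1 := by
    rw [Module.finrank, Algebra.IsStandardSmoothOfRelativeDimension.rank_kaehlerDifferential 1]
    simp
  let b := Module.basisUnique Unit hrank
  obtain ⟨⟨t, ht⟩, htw⟩ := m.toCotangent_surjective (D.liftKaehlerDifferential (b ()))
  refine ⟨t, ht, fun a ha => ?_⟩
  have h1 : D a = (b.repr (KaehlerDifferential.D R A a) ()) • m.toCotangent ⟨t, ht⟩ := by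
    rw [htw, ← map_smul, ← Derivation.liftKaehlerDifferential_comp_D D a]
    congr 1
    conv_lhs => rw [← b.sum_repr (KaehlerDifferential.D R A a)]
    simp
  have h2 : D a = m.toCotangent ⟨a, ha⟩ := by
    change m.toCotangent _ = _
    congr 1; ext
    simp [(RingHom.mem_ker).1 ha]
  rw [h2, ← map_smul, Ideal.toCotangent_eq] at h1
  have := Ideal.add_mem (Ideal.span {t} ⊔ m ^ 2)
    (Ideal.mem_sup_right h1) (Ideal.mem_sup_left (Ideal.mem_span_singleton'.2
      ⟨b.repr (KaehlerDifferential.D R A a) (), rfl⟩))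
  simpa using this

lemma ker_ne_bot {R A : Type u} [CommRing R] [CommRing A] [Nontrivial A] [Algebra R A]
    [Algebra.IsStandardSmoothOfRelativeDimension 1 R A] (τ : A →ₐ[R] R) : RingHom.ker τ ≠ ⊥ := by
  intro h
  have hinj : Function.Injective τ := (RingHom.injective_iff_ker_eq_bot τ).2 h
  have hs : Function.Surjective (algebraMap R A) := fun a => ⟨τ a, hinj (by simp)⟩
  have h0 := KaehlerDifferential.subsingleton_of_surjective R A hs
  have h1 := Algebra.IsStandardSmoothOfRelativeDimension.rank_kaehlerDifferential (R := R) (S := A) 1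
  rw [rank_subsingleton'] at h1
  simp at h1

lemma isDiscreteValuationRing_of_le {A O : Type u} [CommRing A] [CommRing O] [IsDomain O]
    [IsLocalRing O] [IsNoetherianRing O] [Algebra A O] (m : Ideal A) [m.IsPrime]
    [IsLocalization.AtPrime O m] {t : A} (ht : m ≤ Ideal.span {t} ⊔ m ^ 2)
    (ht' : t ∈ m)
    (hm : m.map (algebraMap A O) ≠ ⊥) : IsDiscreteValuationRing O := by
  have hmax := IsLocalization.AtPrime.map_eq_maximalIdeal m O
  have h1 : IsLocalRing.maximalIdeal O ≤ Ideal.span {algebraMap A O t} := by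
    refine Submodule.le_of_le_smul_of_le_jacobson_bot (I := IsLocalRing.maximalIdeal O)
      (IsNoetherian.noetherian _) (IsLocalRing.maximalIdeal_le_jacobson _) ?_
    have := Ideal.map_mono (f := algebraMap A O) ht
    rw [Ideal.map_sup, Ideal.map_pow, hmax, Ideal.map_span, Set.image_singleton, sq] at this
    exact this
  have h2 : (IsLocalRing.maximalIdeal O).IsPrincipal := by
    refine ⟨⟨algebraMap A O t, le_antisymm h1 ?_⟩⟩
    rw [Ideal.submodule_span_eq, Ideal.span_le, Set.singleton_subset_iff, ← hmax]
    exact Ideal.mem_map_of_mem _ ht'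
  have : IsPrincipalIdealRing O :=
    ((tfae_of_isNoetherianRing_of_isLocalRing_of_isDomain O).out 4 0).1 h2
  exact { not_a_field' := hmax ▸ hm }

end Ring

section
variable {k : Type u} [Field k] {X : Scheme.{u}} (σ : Spec (CommRingCat.of k) ⟶ X)

lemma isUnit_germ_iff {V : X.Opens} (h : ⊤ ≤ σ ⁻¹ᵁ V) (a : Γ(X, V)) {x : X}
    {z : Spec (CommRingCat.of k)} (hz : σ z = x) (hx : x ∈ V) :
    IsUnit (X.presheaf.germ V x hx a) ↔ (evHom σ V h).hom a ≠ 0 := by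
  have h1 := Scheme.basicOpen_appLE σ ⊤ V h a
  have h2 : (evHom σ V h).hom a = (Scheme.ΓSpecIso (CommRingCat.of k)).hom (σ.appLE V ⊤ h a) := rfl
  rw [← Scheme.mem_basicOpen]
  have h3 : x ∈ X.basicOpen a ↔ z ∈ (Spec (CommRingCat.of k)).basicOpen (σ.appLE V ⊤ h a) := by
    rw [h1, ← hz]; exact ⟨fun hh => ⟨trivial, hh⟩, fun hh => hh.2⟩
  rw [h3]
  constructor
  · intro hx h0
    have h4 : σ.appLE V ⊤ h a = 0 := by
      have := congrArg (Scheme.ΓSpecIso (CommRingCat.of k)).inv.hom (h2.symm.trans h0)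
      simpa using this
    rw [h4, Scheme.basicOpen_zero] at hx
    exact hx
  · intro h0
    have h4 : IsUnit (σ.appLE V ⊤ h a) := by
      have := (isUnit_iff_ne_zero.2 h0).map (Scheme.ΓSpecIso (CommRingCat.of k)).inv.hom
      rw [h2] at this
      simpa using this
    rw [Scheme.basicOpen_of_isUnit _ h4]
    trivial

lemma primeIdealOf_eq_ker {V : X.Opens} (hV : IsAffineOpen V) (h : ⊤ ≤ σ ⁻¹ᵁ V) {x : X}
    {z : Spec (CommRingCat.of k)} (hz : σ z = x) (hx : x ∈ V) :
    (hV.primeIdealOf ⟨x, hx⟩).asIdeal = RingHom.ker (evHom σ V h).hom := by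
  algebraize [(X.presheaf.germ V x hx).hom]
  have := hV.isLocalization_stalk ⟨x, hx⟩
  ext a
  rw [RingHom.mem_ker, ← not_iff_not, ← Ne, ← isUnit_germ_iff σ h a hz hx]
  exact (IsLocalization.AtPrime.isUnit_to_map_iff (X.presheaf.stalk x)
    (hV.primeIdealOf ⟨x, hx⟩).asIdeal a).symm

instance ker_evHom_isPrime {V : X.Opens} (h : ⊤ ≤ σ ⁻¹ᵁ V) :
    (RingHom.ker (evHom σ V h).hom).IsPrime :=
  have : IsDomain (CommRingCat.of k) := inferInstanceAs (IsDomain k)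
  RingHom.ker_isPrime _

lemma isLocalization_stalk_ker {V : X.Opens} (hV : IsAffineOpen V) (h : ⊤ ≤ σ ⁻¹ᵁ V) {x : X}
    {z : Spec (CommRingCat.of k)} (hz : σ z = x) (hx : x ∈ V) :
    letI := (X.presheaf.germ V x hx).hom.toAlgebra
    IsLocalization.AtPrime (X.presheaf.stalk x) (RingHom.ker (evHom σ V h).hom) := by
  have := hV.isLocalization_stalk ⟨x, hx⟩
  convert! this using 2
  exact (primeIdealOf_eq_ker σ hV h hz hx).symm

end

section
variable {k : Type u} [Field k] {X : Scheme.{u}} (g : X ⟶ Spec (CommRingCat.of k))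
  [SmoothOfRelativeDimension 1 g] [IsIntegral X] [IsLocallyNoetherian X]

/-- The local ring at a rational point of a smooth curve is a discrete valuation ring. -/
lemma isDiscreteValuationRing_stalk (σ : Spec (CommRingCat.of k) ⟶ X) (hσ : σ ≫ g = 𝟙 _)
    {x : X} {z : Spec (CommRingCat.of k)} (hz : σ z = x) :
    IsDiscreteValuationRing (X.presheaf.stalk x) := by
  obtain ⟨U, hU, V, hV, hx, e, hs⟩ :=
    SmoothOfRelativeDimension.exists_isStandardSmoothOfRelativeDimension (n := 1) (f := g) x
  obtain rfl : U = ⊤ := by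
    ext w
    simp only [TopologicalSpace.Opens.coe_top, Set.mem_univ, iff_true]
    have : Subsingleton (Spec (CommRingCat.of k)) :=
      inferInstanceAs (Subsingleton (PrimeSpectrum k))
    rw [Subsingleton.elim w (g x)]
    exact e hx
  have h : ⊤ ≤ σ ⁻¹ᵁ V := by
    intro w _
    have : Subsingleton (Spec (CommRingCat.of k)) :=
      inferInstanceAs (Subsingleton (PrimeSpectrum k))
    rw [Subsingleton.elim w z]
    change σ z ∈ V
    rwa [hz]
  have : Nonempty V := ⟨⟨x, hx⟩⟩
  have hτ : g.appLE ⊤ V e ≫ evHom σ V h ≫ (Scheme.ΓSpecIso (CommRingCat.of k)).inv = 𝟙 _ := by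
    rw [← Category.assoc]
    refine (congrArg (· ≫ _) (appLE_evHom σ g e h)).trans ?_
    rw [evHom_congr hσ]
    have := ΓSpecIso_inv_evHom (𝟙 (CommRingCat.of k))
    rw [Iso.inv_comp_eq, Category.comp_id] at this
    refine (congrArg (· ≫ _) ((evHom_congr (Spec.map_id _).symm ⊤ _).trans this)).trans ?_
    exact Iso.hom_inv_id _
  algebraize [(g.appLE ⊤ V e).hom]
  let τ : Γ(X, V) →ₐ[Γ(Spec (CommRingCat.of k), ⊤)] Γ(Spec (CommRingCat.of k), ⊤) :=
    { (evHom σ V h ≫ (Scheme.ΓSpecIso (CommRingCat.of k)).inv).hom with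
      commutes' := fun r => congrArg (fun q => q.hom r) hτ }
  have hker : RingHom.ker τ = RingHom.ker (evHom σ V h).hom := by
    ext a
    have h0 : τ a = (Scheme.ΓSpecIso (CommRingCat.of k)).inv.hom ((evHom σ V h).hom a) := rfl
    rw [RingHom.mem_ker, RingHom.mem_ker, h0, map_eq_zero_iff]
    exact (Scheme.ΓSpecIso (CommRingCat.of k)).commRingCatIsoToRingEquiv.symm.injective
  have : Algebra.IsStandardSmoothOfRelativeDimension 1 Γ(Spec (CommRingCat.of k), ⊤) Γ(X, V) := hs
  obtain ⟨t, ht, htm⟩ := exists_ker_le_span_sup_sq τ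
  have hne := ker_ne_bot τ
  rw [hker] at ht htm hne
  algebraize [(X.presheaf.germ V x hx).hom]
  have := isLocalization_stalk_ker σ hV h hz hx
  refine isDiscreteValuationRing_of_le (RingHom.ker (evHom σ V h).hom) htm ht ?_
  intro h0
  apply hne
  rw [eq_bot_iff]
  intro a ha
  have : X.presheaf.germ V x hx a = 0 := by
    have := Ideal.mem_map_of_mem (algebraMap Γ(X, V) (X.presheaf.stalk x)) ha
    rw [h0] at this
    exact this
  exact (map_eq_zero_iff _ (germ_injective_of_isIntegral X x hx)).1 this

end

lemma exists_uniformizer {A O : Type u} {ι : Type*} [CommRing A] [CommRing O] [IsDomain O]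
    [IsDiscreteValuationRing O] [Algebra A O] (hinj : Function.Injective (algebraMap A O))
    (m : Ideal A) [m.IsPrime] [IsLocalization.AtPrime O m] (t : ι → A)
    (hm : m = Ideal.span (Set.range t)) :
    ∃ j, Irreducible (algebraMap A O (t j)) ∧
      ∀ b ≠ 0, ∃ (n : ℕ) (s u : A), s ∉ m ∧ u ∉ m ∧ s * b = u * t j ^ n := by
  have hmax := IsLocalization.AtPrime.map_eq_maximalIdeal m O
  have hj : ∃ j, Irreducible (algebraMap A O (t j)) := by
    obtain ⟨ϖ, hϖ⟩ := IsDiscreteValuationRing.exists_irreducible O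
    have hmϖ := hϖ.maximalIdeal_eq
    by_contra! hne
    have h1 : ϖ ∈ Ideal.span {ϖ ^ 2} := by
      have : ϖ ∈ m.map (algebraMap A O) := by
        rw [hmax, hmϖ]; exact Ideal.mem_span_singleton_self ϖ
      rw [hm, Ideal.map_span] at this
      refine (Ideal.span_le.2 ?_) this
      rintro _ ⟨_, ⟨j, rfl⟩, rfl⟩
      have h2 : algebraMap A O (t j) ∈ IsLocalRing.maximalIdeal O := by
        rw [← hmax, hm]; exact Ideal.mem_map_of_mem _ (Ideal.subset_span ⟨j, rfl⟩)
      rw [hmϖ, Ideal.mem_span_singleton] at h2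
      obtain ⟨c, hc⟩ := h2
      have h3 : ¬ IsUnit c := fun h => hne j (hc ▸ (irreducible_mul_isUnit h).2 hϖ)
      have h4 : c ∈ IsLocalRing.maximalIdeal O := h3
      rw [hmϖ, Ideal.mem_span_singleton] at h4
      obtain ⟨d, rfl⟩ := h4
      rw [SetLike.mem_coe, Ideal.mem_span_singleton, hc]
      exact ⟨d, by ring⟩
    rw [Ideal.mem_span_singleton] at h1
    obtain ⟨d, hd⟩ := h1
    have : ϖ * (1 - ϖ * d) = 0 := by linear_combination hd
    rcases mul_eq_zero.1 this with h | h
    · exact hϖ.ne_zero h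
    · exact hϖ.not_isUnit (IsUnit.of_mul_eq_one d (by linear_combination -h))
  obtain ⟨j, hj⟩ := hj
  refine ⟨j, hj, fun b hb => ?_⟩
  have hb' : algebraMap A O b ≠ 0 := by rwa [Ne, map_eq_zero_iff _ hinj]
  obtain ⟨n, hn⟩ := IsDiscreteValuationRing.associated_pow_irreducible hb' hj
  obtain ⟨w, hw⟩ := hn.symm
  obtain ⟨⟨u, s⟩, hus⟩ := IsLocalization.surj m.primeCompl (w : O)
  refine ⟨n, s, u, s.2, ?_, ?_⟩
  · change u ∈ m.primeCompl
    rw [← IsLocalization.AtPrime.isUnit_to_map_iff O m, ← hus]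
    exact w.isUnit.mul (IsLocalization.map_units O s)
  · apply hinj
    rw [map_mul, map_mul, map_pow, ← hw, ← hus]
    ring

section Point

variable {f : Type u} [Field f] {C : Scheme.{u}} {p : C ⟶ Spec (CommRingCat.of f)}
  {𝒰 : Atlas p} {k : Type u} [Field k] [Algebra f k]

/-- Evaluation of functions on a chart at a rational point. -/
def evAt {x : Point p (algebraMap f k)} {i : Fin 𝒰.size} (h : InChart 𝒰 x i) :
    BRing 𝒰 k i →+* k :=
  bEval (ι := RingHom.id k) (y := ⟨x.1, x.2⟩) h

lemma evAt_const {x : Point p (algebraMap f k)} {i : Fin 𝒰.size} (h : InChart 𝒰 x i) (a : k) :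
    evAt h (bConst 𝒰 k i a) = a :=
  bEval_const (ι := RingHom.id k) (y := ⟨x.1, x.2⟩) h a

lemma evAt_coord {x : Point p (algebraMap f k)} {i : Fin 𝒰.size} (h : InChart 𝒰 x i) (j) :
    evAt h (bCoord 𝒰 k i j) = coordAt 𝒰 x i j :=
  bEval_coord (ι := RingHom.id k) (y := ⟨x.1, x.2⟩) h j

lemma evAt_eval₂ {x : Point p (algebraMap f k)} {i : Fin 𝒰.size} (h : InChart 𝒰 x i)
    (P : MvPolynomial (Fin (𝒰.dim i)) k) :
    evAt h (MvPolynomial.eval₂ (bConst 𝒰 k i) (bCoord 𝒰 k i) P) =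
      MvPolynomial.eval (coordAt 𝒰 x i) P :=
  bEval_eval₂ (ι := RingHom.id k) (y := ⟨x.1, x.2⟩) h P

/-- The function `z j - z j (x)` on a chart. -/
def localCoord (x : Point p (algebraMap f k)) (i : Fin 𝒰.size) (j : Fin (𝒰.dim i)) :
    BRing 𝒰 k i :=
  bCoord 𝒰 k i j - bConst 𝒰 k i (coordAt 𝒰 x i j)

lemma ker_evAt {x : Point p (algebraMap f k)} {i : Fin 𝒰.size} (h : InChart 𝒰 x i) :
    RingHom.ker (evAt h) = Ideal.span (Set.range (localCoord x i)) := by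
  apply le_antisymm
  · intro b hb
    obtain ⟨P, rfl⟩ := exists_eval₂_eq 𝒰 k i b
    rw [RingHom.mem_ker, evAt_eval₂] at hb
    rw [← Ideal.Quotient.eq_zero_iff_mem, MvPolynomial.hom_eval₂]
    have h1 : (fun j => Ideal.Quotient.mk (Ideal.span (Set.range (localCoord x i)))
        (bCoord 𝒰 k i j)) = fun j => Ideal.Quotient.mk (Ideal.span (Set.range (localCoord x i)))
        (bConst 𝒰 k i (coordAt 𝒰 x i j)) := by
      funext j
      rw [Ideal.Quotient.eq]
      exact Ideal.subset_span ⟨j, rfl⟩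
    have h2 := MvPolynomial.hom_eval₂ P (RingHom.id k)
      ((Ideal.Quotient.mk (Ideal.span (Set.range (localCoord x i)))).comp (bConst 𝒰 k i))
      (coordAt 𝒰 x i)
    rw [MvPolynomial.eval₂_id, hb, map_zero, RingHom.comp_id] at h2
    refine Eq.trans ?_ h2.symm
    exact congrArg (fun g => MvPolynomial.eval₂ _ g P) h1
  · rw [Ideal.span_le]
    rintro _ ⟨j, rfl⟩
    rw [SetLike.mem_coe, RingHom.mem_ker, localCoord, map_sub, evAt_const, evAt_coord, sub_self]

variable [SmoothOfRelativeDimension 1 p] [GeometricallyIntegral p]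

/-- At a rational point of a chart, some coordinate yields a local parameter. -/
theorem exists_localCoord_uniformizer {x : Point p (algebraMap f k)} {i : Fin 𝒰.size}
    (h : InChart 𝒰 x i) :
    ∃ j, ordAt p x (bFun k i (localCoord x i j)) = 1 ∧ ∀ b : BRing 𝒰 k i, b ≠ 0 →
      ∃ (n : ℕ) (s u : BRing 𝒰 k i), evAt h s ≠ 0 ∧ evAt h u ≠ 0 ∧
        s * b = u * localCoord x i j ^ n ∧ ordAt p x (bFun k i b) = n := by
  let σ : Spec (CommRingCat.of k) ⟶ baseChange p k := liftPoint (ι := RingHom.id k) ⟨x.1, x.2⟩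
  let z : Spec (CommRingCat.of k) := IsLocalRing.closedPoint k
  have hid : specMap (RingHom.id k) = 𝟙 _ := Spec.map_id _
  have hz : σ z = x.closedPoint := by
    have : σ = pullback.lift x.1 (𝟙 _) (by simpa using x.2) := by
      apply pullback.hom_ext
      · rw [pullback.lift_fst]; exact pullback.lift_fst _ _ _
      · rw [pullback.lift_snd, ← hid]; exact pullback.lift_snd _ _ _
    rw [this]; rfl
  have hσ : σ ≫ pullback.snd p (specMap (algebraMap f k)) = 𝟙 _ := by
    rw [← hid]; exact pullback.lift_snd _ _ _
  have hV := isAffineOpen_chartBC 𝒰 k i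
  have hσV : ⊤ ≤ σ ⁻¹ᵁ chartBC 𝒰 k i := top_le_chartBC (ι := RingHom.id k) (y := ⟨x.1, x.2⟩) h
  have hx : x.closedPoint ∈ chartBC 𝒰 k i := by rw [← hz]; exact hσV trivial
  have : SmoothOfRelativeDimension 1 (pullback.snd p (specMap (algebraMap f k))) :=
    (smoothOfRelativeDimension_isStableUnderBaseChange 1).of_isPullback
      (IsPullback.of_hasPullback p _) inferInstance
  have hdvr := isDiscreteValuationRing_stalk _ σ hσ hz
  algebraize [((baseChange p k).presheaf.germ (chartBC 𝒰 k i) x.closedPoint hx).hom]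
  have hloc := isLocalization_stalk_ker σ hV hσV hz hx
  have hinj : Function.Injective (algebraMap (BRing 𝒰 k i)
      ((baseChange p k).presheaf.stalk x.closedPoint)) :=
    germ_injective_of_isIntegral (baseChange p k) x.closedPoint hx
  obtain ⟨j, hj, hb⟩ := exists_uniformizer (O := (baseChange p k).presheaf.stalk x.closedPoint)
    hinj (RingHom.ker (evHom σ _ hσV).hom) (localCoord x i) (ker_evAt h)
  have hfun (b : BRing 𝒰 k i) : bFun k i b =
      algebraMap ((baseChange p k).presheaf.stalk x.closedPoint) (functionField p k)
        (algebraMap (BRing 𝒰 k i) _ b) :=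
    (Scheme.algebraMap_germ_eq_germToFunctionField _ hx b).symm
  have hcoh : Order.coheight x.closedPoint = 1 := by
    have h1 := ringKrullDim_stalk_eq_coheight x.closedPoint
    rw [IsPrincipalIdealRing.ringKrullDim_eq_one _ hdvr.not_isField] at h1
    exact_mod_cast h1.symm
  have hbinj : Function.Injective (bFun (𝒰 := 𝒰) (p := p) k i) :=
    (baseChange p k).germToFunctionField_injective _
  have hunit (b : BRing 𝒰 k i) (hb : evAt h b ≠ 0) : ordAt p x (bFun k i b) = 0 := by
    have hb0 : b ≠ 0 := fun h0 => hb (by rw [h0, map_zero])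
    have hu : IsUnit (algebraMap (BRing 𝒰 k i) ((baseChange p k).presheaf.stalk x.closedPoint) b) :=
      (IsLocalization.AtPrime.isUnit_to_map_iff _ (RingHom.ker (evHom σ _ hσV).hom) b).2 hb
    rw [ordAt, Scheme.ord_eq_iff hcoh ((map_ne_zero_iff _ hbinj).2 hb0), hfun]
    exact Ring.ordFrac_of_isUnit hu
  have h1 : ordAt p x (bFun k i (localCoord x i j)) = 1 := by
    have hj0 : localCoord x i j ≠ 0 := fun h0 => hj.ne_zero (by rw [h0, map_zero])
    rw [ordAt, Scheme.ord_eq_iff hcoh ((map_ne_zero_iff _ hbinj).2 hj0), hfun]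
    exact Ring.ordFrac_irreducible hj
  refine ⟨j, h1, fun b hb0 => ?_⟩
  obtain ⟨n, s, u, hs, hu, hsu⟩ := hb b hb0
  refine ⟨n, s, u, hs, hu, hsu, ?_⟩
  have hj0 : localCoord x i j ≠ 0 := fun h0 => hj.ne_zero (by rw [h0, map_zero])
  have hne (a : BRing 𝒰 k i) (ha : a ≠ 0) : bFun k i a ≠ 0 := (map_ne_zero_iff _ hbinj).2 ha
  have hs0 : s ≠ 0 := fun h0 => hs (by rw [h0]; exact map_zero _)
  have hu0 : u ≠ 0 := fun h0 => hu (by rw [h0]; exact map_zero _)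
  have hpow (n : ℕ) : ordAt p x (bFun k i (localCoord x i j) ^ n) = n := by
    induction n with
    | zero =>
      have := hunit 1 (by rw [map_one]; exact one_ne_zero)
      rw [map_one] at this
      simpa using this
    | succ n ih =>
      rw [pow_succ]
      refine (Scheme.ord_mul (pow_ne_zero _ (hne _ hj0)) (hne _ hj0)).trans ?_
      exact (congrArg₂ (· + ·) ih h1).trans (by push_cast; rfl)
  have h2 := congrArg (fun a => ordAt p x (bFun k i a)) hsu
  simp only [map_mul, map_pow] at h2
  have h3 : ordAt p x (bFun k i s * bFun k i b) = _ := Scheme.ord_mul (hne _ hs0) (hne _ hb0)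
  have h4 : ordAt p x (bFun k i u * bFun k i (localCoord x i j) ^ n) = _ :=
    Scheme.ord_mul (hne _ hu0) (pow_ne_zero _ (hne _ hj0))
  have h5 := hunit s hs
  have h6 := hunit u hu
  have h7 := hpow n
  unfold ordAt at *
  omega

end Point
end CurveACVF
end

noncomputable section
namespace CurveACVF

section Val

variable {f : Type u} [Field f] {C : Scheme.{u}} {p : C ⟶ Spec (CommRingCat.of f)}
  {𝒰 : Atlas p} {k : Type u} [Field k] [Algebra f k]
  {K Γ : Type u} [Field K] [AddCommGroup Γ] [LinearOrder Γ] [IsOrderedAddMonoid Γ]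
  {ι : k →+* K} {v : AddValuation K (WithTop Γ)} {one : Γ}

lemma bEval_localCoord {y : Point p (ι.comp (algebraMap f k))} {i : Fin 𝒰.size}
    (h : InChart 𝒰 y i) (x : Point p (algebraMap f k)) (j) :
    bEval h (localCoord x i j) = coordAt 𝒰 y i j - ι (coordAt 𝒰 x i j) := by
  rw [localCoord, map_sub, bEval_coord, bEval_const]

section
variable (hι : ∀ a : k, a ≠ 0 → v (ι a) = 0) (h1 : 0 < one)
  {y : Point p (ι.comp (algebraMap f k))} {x : Point p (algebraMap f k)} {i : Fin 𝒰.size}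
  (hy : InChart 𝒰 y i) (hx : InChart 𝒰 x i)
  (hle : ∀ j, (one : WithTop Γ) ≤ v (coordAt 𝒰 y i j - ι (coordAt 𝒰 x i j)))
include hι h1 hle

lemma zero_le_val_bEval (b : BRing 𝒰 k i) : 0 ≤ v (bEval hy b) := by
  have hι' (a : k) : 0 ≤ v (ι a) := by
    by_cases ha : a = 0
    · simp [ha]
    · rw [hι a ha]
  have hone : (0 : WithTop Γ) ≤ one := by exact_mod_cast h1.le
  obtain ⟨P, rfl⟩ := exists_eval₂_eq 𝒰 k i b
  rw [bEval_eval₂]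
  change MvPolynomial.eval₂ ι (coordAt 𝒰 y i) P ∈ valuationRing v
  rw [MvPolynomial.eval₂_eq]
  refine sum_mem fun d _ => mul_mem (hι' _) (prod_mem fun j _ => pow_mem ?_ _)
  have h2 := v.map_le_add (hone.trans (hle j)) (hι' (coordAt 𝒰 x i j))
  rwa [sub_add_cancel] at h2

lemma one_le_val_bEval {b : BRing 𝒰 k i} (hb : evAt hx b = 0) : (one : WithTop Γ) ≤ v (bEval hy b) := by
  have hb' : b ∈ Ideal.span (Set.range (localCoord x i)) := by rw [← ker_evAt hx]; exact hb
  induction hb' using Submodule.span_induction with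
  | mem b h =>
    obtain ⟨j, rfl⟩ := h
    rw [bEval_localCoord]; exact hle j
  | zero => simp
  | add a b ha' hb' h2 h3 =>
    rw [map_add]
    exact v.map_le_add (h2 (RingHom.mem_ker.1 ((ker_evAt hx).ge ha')))
      (h3 (RingHom.mem_ker.1 ((ker_evAt hx).ge hb')))
  | smul a b hb' h2 =>
    rw [smul_eq_mul, map_mul, v.map_mul]
    have := add_le_add (zero_le_val_bEval hι h1 hy hle a) 
      (h2 (RingHom.mem_ker.1 ((ker_evAt hx).ge hb')))
    rwa [zero_add] at this

lemma val_bEval_eq_zero {b : BRing 𝒰 k i} (hb : evAt hx b ≠ 0) : v (bEval hy b) = 0 := by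
  have h2 : evAt hx (b - bConst 𝒰 k i (evAt hx b)) = 0 := by rw [map_sub, evAt_const, sub_self]
  have h3 := one_le_val_bEval hι h1 hy hx hle h2
  rw [map_sub, bEval_const] at h3
  have hone : (0 : WithTop Γ) < one := by exact_mod_cast h1
  have h4 : v (ι (evAt hx b)) < v (bEval hy b - ι (evAt hx b)) := by
    rw [hι _ hb]; exact hone.trans_le h3
  have := v.map_add_eq_of_lt_left h4
  rw [add_sub_cancel] at this
  rw [this, hι _ hb]

end

lemma localCoord_ord_pos [SmoothOfRelativeDimension 1 p] [GeometricallyIntegral p]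
    {x : Point p (algebraMap f k)} {i : Fin 𝒰.size} (hx : InChart 𝒰 x i) {n : ℕ} {j}
    {s u t : BRing 𝒰 k i} (hu : evAt hx u ≠ 0) (h : s * localCoord x i j = u * t ^ n) : 1 ≤ n := by
  rcases Nat.eq_zero_or_pos n with rfl | h'
  · have h2 := congrArg (evAt hx) h
    have h3 : evAt hx (localCoord x i j) = 0 := by
      rw [localCoord, map_sub, evAt_coord, evAt_const, sub_self]
    rw [map_mul, h3, mul_zero, pow_zero, mul_one] at h2
    exact absurd h2.symm hu
  · exact h'

variable [SmoothOfRelativeDimension 1 p] [GeometricallyIntegral p]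

/-- The valuation of the values of rational functions at a generic point close to `x`, in terms of
coordinates. -/
theorem exists_isEvaluationAt_iff (hι : ∀ a : k, a ≠ 0 → v (ι a) = 0) (h1 : 0 < one)
    (y : Point p (ι.comp (algebraMap f k))) {x : Point p (algebraMap f k)} {i : Fin 𝒰.size}
    (hx : InChart 𝒰 x i) :
    (∃ φ : functionField p k →+* K, IsEvaluationAt p ι y φ ∧
      ∀ h, h ≠ 0 → v (φ h) = ((ordAt p x h • one : Γ) : WithTop Γ)) ↔
    InChart 𝒰 y i ∧ (∀ j, (one : WithTop Γ) ≤ v (coordAt 𝒰 y i j - ι (coordAt 𝒰 x i j))) ∧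
      ∃ j, v (coordAt 𝒰 y i j - ι (coordAt 𝒰 x i j)) = one := by
  have hbinj : Function.Injective (bFun (𝒰 := 𝒰) (p := p) k i) :=
    (baseChange p k).germToFunctionField_injective _
  obtain ⟨j₀, hj₀, hb⟩ := exists_localCoord_uniformizer hx
  constructor
  · rintro ⟨φ, hφ, hv⟩
    have hy : InChart 𝒰 y i := hφ.inChart i
    have he := (isEvaluationAt_iff hy φ).1 hφ
    have key (j) : coordAt 𝒰 y i j - ι (coordAt 𝒰 x i j) = φ (bFun k i (localCoord x i j)) := by
      rw [← bEval_localCoord hy, ← he]; rfl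
    refine ⟨hy, fun j => ?_, j₀, ?_⟩
    · rw [key]
      by_cases hj : localCoord x i j = 0
      · rw [hj, map_zero, map_zero]; simp
      · obtain ⟨n, s, u, hs, hu, hsu, hn⟩ := hb _ hj
        rw [hv _ ((map_ne_zero_iff _ hbinj).2 hj), hn]
        have := localCoord_ord_pos hx hu hsu
        norm_cast
        calc one = 1 • one := (one_smul _ _).symm
          _ ≤ n • one := nsmul_le_nsmul_left h1.le this
    · rw [key, hv, hj₀, one_smul]
      intro h0
      rw [h0] at hj₀
      exact zero_ne_one ((congrFun Scheme.ord_zero _).symm.trans hj₀)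
  · rintro ⟨hy, hle, j₁, hj₁⟩
    have hone : (0 : WithTop Γ) < one := by exact_mod_cast h1
    have hval {b : BRing 𝒰 k i} {n : ℕ} {s u : BRing 𝒰 k i} (hs : evAt hx s ≠ 0)
        (hu : evAt hx u ≠ 0) (hsu : s * b = u * localCoord x i j₀ ^ n) :
        v (bEval hy b) = n • v (bEval hy (localCoord x i j₀)) := by
      have := congrArg (fun a => v (bEval hy a)) hsu
      simp only [map_mul, map_pow, v.map_mul, v.map_pow] at this
      rwa [val_bEval_eq_zero hι h1 hy hx hle hs, val_bEval_eq_zero hι h1 hy hx hle hu, zero_add,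
        zero_add] at this
    have hj : v (bEval hy (localCoord x i j₀)) = one := by
      have hne : localCoord x i j₁ ≠ 0 := by
        intro h0
        have := bEval_localCoord hy x j₁
        rw [h0, map_zero] at this
        rw [← this, v.map_zero] at hj₁
        exact WithTop.top_ne_coe hj₁
      obtain ⟨n, s, u, hs, hu, hsu, hn⟩ := hb _ hne
      have h2 := hval hs hu hsu
      rw [bEval_localCoord, hj₁] at h2
      have h3 := localCoord_ord_pos hx hu hsu
      have h4 : (one : WithTop Γ) ≤ v (bEval hy (localCoord x i j₀)) := by
        rw [bEval_localCoord]; exact hle j₀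
      refine le_antisymm ?_ h4
      rw [h2]
      calc v (bEval hy (localCoord x i j₀)) = 1 • v (bEval hy (localCoord x i j₀)) :=
            (one_smul _ _).symm
        _ ≤ _ := nsmul_le_nsmul_left (hone.le.trans h4) h3
    have hvb (b : BRing 𝒰 k i) (hb0 : b ≠ 0) :
        v (bEval hy b) = ((ordAt p x (bFun k i b) • one : Γ) : WithTop Γ) := by
      obtain ⟨n, s, u, hs, hu, hsu, hn⟩ := hb _ hb0
      rw [hval hs hu hsu, hj, hn]
      norm_cast
    have hinj : Function.Injective (bEval hy) := by
      rw [injective_iff_map_eq_zero]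
      intro b hb0
      by_contra hne
      have := hvb b hne
      rw [hb0, v.map_zero] at this
      exact WithTop.top_ne_coe this
    have hfrac : IsFractionRing (BRing 𝒰 k i) (functionField p k) :=
      functionField_isFractionRing_of_isAffineOpen _ _ (isAffineOpen_chartBC 𝒰 k i)
    have hlift (b : BRing 𝒰 k i) :
        (IsFractionRing.lift hinj : functionField p k →+* K) (bFun k i b) = bEval hy b :=
      IsFractionRing.lift_algebraMap hinj b
    refine ⟨IsFractionRing.lift hinj, (isEvaluationAt_iff hy _).2 (RingHom.ext hlift), ?_⟩
    intro h hne
    obtain ⟨a, b, hb0, rfl⟩ := IsFractionRing.div_surjective (A := BRing 𝒰 k i) h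
    change v (IsFractionRing.lift hinj (bFun k i a / bFun k i b)) = _
    change bFun k i a / bFun k i b ≠ 0 at hne
    have hb1 : b ≠ 0 := nonZeroDivisors.ne_zero hb0
    have ha1 : a ≠ 0 := by rintro rfl; rw [map_zero, zero_div] at hne; exact hne rfl
    have hb2 : bFun k i b ≠ 0 := (map_ne_zero_iff _ hbinj).2 hb1
    have h2 : ordAt p x (bFun k i a / bFun k i b * bFun k i b) = _ := Scheme.ord_mul hne hb2
    rw [div_mul_cancel₀ _ hb2] at h2
    have h3 := congrArg v (congrArg (IsFractionRing.lift hinj : functionField p k →+* K)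
      (div_mul_cancel₀ (bFun k i a) hb2))
    rw [map_mul, v.map_mul, hlift, hlift, hvb a ha1, hvb b hb1, h2, add_smul, WithTop.coe_add] at h3
    exact WithTop.add_right_cancel WithTop.coe_ne_top h3

end Val
end CurveACVF
end

noncomputable section
namespace CurveACVF

section Functoriality

variable {f : Type u} [Field f] {C : Scheme.{u}} {p : C ⟶ Spec (CommRingCat.of f)}
  (𝒰 : Atlas p) {K K' : Type u} [Field K] [Field K'] {s : f →+* K} {s' : f →+* K'}

lemma inChart_of_mem {y : Point p s} {i : Fin 𝒰.size} {z : Spec (CommRingCat.of K)}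
    (h : y.1 z ∈ 𝒰.U i) : InChart 𝒰 y i := by
  intro w _
  have : Subsingleton (Spec (CommRingCat.of K)) := inferInstanceAs (Subsingleton (PrimeSpectrum K))
  rw [Subsingleton.elim w z]
  exact h

lemma exists_inChart (y : Point p s) : ∃ i, InChart 𝒰 y i := by
  let z : Spec (CommRingCat.of K) := IsLocalRing.closedPoint K
  have h : y.1 z ∈ ⨆ i, 𝒰.U i := by rw [𝒰.cover]; trivial
  obtain ⟨i, hi⟩ := TopologicalSpace.Opens.mem_iSup.1 h
  exact ⟨i, inChart_of_mem 𝒰 hi⟩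

/-- The map `C(K) → C(K')` given by an embedding of `K` in `K'`. -/
def Point.map (T : K →+* K') (hT : T.comp s = s') (y : Point p s) : Point p s' :=
  ⟨specMap T ≫ y.1, by rw [Category.assoc, y.2, ← hT, ← Spec.map_comp, ← CommRingCat.ofHom_comp]⟩

variable {𝒰}

lemma inChart_map {T : K →+* K'} {hT : T.comp s = s'} {y : Point p s} {i : Fin 𝒰.size} :
    InChart 𝒰 (y.map T hT) i ↔ InChart 𝒰 y i := by
  refine ⟨fun h => ?_, fun h => top_le_comp_preimage (U := 𝒰.U i) (specMap T) h⟩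
  let z : Spec (CommRingCat.of K') := IsLocalRing.closedPoint K'
  have h1 : (specMap T ≫ y.1) z ∈ 𝒰.U i := h (Set.mem_univ z)
  rw [Scheme.Hom.comp_apply] at h1
  exact inChart_of_mem 𝒰 h1

lemma coordAt_of_not_inChart {y : Point p s} {i : Fin 𝒰.size} (h : ¬ InChart 𝒰 y i) (j) :
    coordAt 𝒰 y i j = 0 := dif_neg h

lemma coordAt_map {T : K →+* K'} {hT : T.comp s = s'} {y : Point p s} (i : Fin 𝒰.size) (j) :
    coordAt 𝒰 (y.map T hT) i j = T (coordAt 𝒰 y i j) := by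
  by_cases h : InChart 𝒰 y i
  · rw [← chartEval_coord h, ← chartEval_coord (inChart_map.2 h)]
    have := evHom_specMap_comp y.1 (CommRingCat.ofHom T) h (inChart_map (hT := hT).2 h)
    exact congrArg (fun g => g.hom (𝒰.coord i j)) this
  · rw [coordAt_of_not_inChart h, coordAt_of_not_inChart (fun h' => h (inChart_map.1 h')), map_zero]

variable (𝒰)

lemma exists_chart [GeometricallyIntegral p] : ∃ _ : Fin 𝒰.size, True := by
  have : Nonempty (baseChange p f) := inferInstance
  obtain ⟨x⟩ := this
  have h : pullback.fst p (specMap (algebraMap f f)) x ∈ ⨆ i, 𝒰.U i := by rw [𝒰.cover]; trivial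
  obtain ⟨i, -⟩ := TopologicalSpace.Opens.mem_iSup.1 h
  exact ⟨i, trivial⟩

/-- Every chart has a rational point over an algebraically closed field. -/
lemma exists_point_inChart [IsAlgClosed K] (s : f →+* K) (i : Fin 𝒰.size) :
    ∃ y : Point p s, InChart 𝒰 y i := by
  let R : Type u := Γ(C, 𝒰.U i)
  have hnt : Nontrivial R := by
    obtain ⟨x, hx⟩ := 𝒰.nonempty i
    have : Nonempty (𝒰.U i) := ⟨⟨x, hx⟩⟩
    infer_instance
  obtain ⟨m, hm⟩ := Ideal.exists_maximal R
  let g : f →+* R := chartConst 𝒰 i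
  algebraize [g, s]
  have hft : Algebra.FiniteType f R := by
    refine Algebra.FiniteType.of_surjective (R := f) (A := MvPolynomial (Fin (𝒰.dim i)) f)
      (MvPolynomial.aeval (𝒰.coord i)) (𝒰.generate i)
  let _ : Field (R ⧸ m) := Ideal.Quotient.field m
  have hft' : Algebra.FiniteType f (R ⧸ m) :=
    hft.of_surjective (Ideal.Quotient.mkₐ f m) (Ideal.Quotient.mkₐ_surjective f m)
  have hfin : Module.Finite f (R ⧸ m) := finite_of_finite_type_of_isJacobsonRing f (R ⧸ m)
  let φ : (R ⧸ m) →ₐ[f] K := IsAlgClosed.lift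
  obtain ⟨y, hy, -⟩ := exists_point_of_hom (𝒰 := 𝒰) (s := s) i
    (φ.toRingHom.comp (Ideal.Quotient.mk m)) (by
      ext r
      exact φ.commutes r)
  exact ⟨y, hy⟩

end Functoriality
end CurveACVF
end

noncomputable section
namespace CurveACVF

open FirstOrder FirstOrder.Language FirstOrder.Language.Structure

section FO

variable {L : FirstOrder.Language.{u, u}}

/-- A family of predicates on the structures is given by a formula. -/
class FO {α : Type*} (P : ∀ (M : Type u) [L.Structure M], (α → M) → Prop) : Prop where
  exists_formula : ∃ φ : L.Formula α, ∀ (M : Type u) [L.Structure M] (v : α → M),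
    φ.Realize v ↔ P M v

/-- A family of functions on the structures is given by a term. -/
class TFO {α : Type*} (t : ∀ (M : Type u) [L.Structure M], (α → M) → M) : Prop where
  exists_term : ∃ τ : L.Term α, ∀ (M : Type u) [L.Structure M] (v : α → M), τ.realize v = t M v

section Instances

variable {α : Type*}

instance TFO.var (a : α) : TFO (L := L) (fun _ _ v => v a) := ⟨Term.var a, fun _ _ _ => rfl⟩

instance TFO.func₀ (g : L.Functions 0) : TFO (L := L) (α := α) (fun _ _ _ => funMap g ![]) :=
  ⟨Term.func g ![], fun M _ v => by
    rw [Term.realize]; congr 1; ext i; exact i.elim0⟩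

instance TFO.func₁ (g : L.Functions 1) (s : ∀ (M : Type u) [L.Structure M], (α → M) → M) [hs : TFO s] :
    TFO (L := L) (fun M _ v => funMap g ![s M v]) := by
  obtain ⟨σ, hσ⟩ := hs.exists_term
  refine ⟨Term.func g ![σ], fun M _ v => ?_⟩
  rw [Term.realize]; congr 1; ext i; fin_cases i; exact hσ M v

instance TFO.func₂ (g : L.Functions 2) (s t : ∀ (M : Type u) [L.Structure M], (α → M) → M)
    [hs : TFO s] [ht : TFO t] :
    TFO (L := L) (fun M _ v => funMap g ![s M v, t M v]) := by
  obtain ⟨σ, hσ⟩ := hs.exists_term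
  obtain ⟨τ, hτ⟩ := ht.exists_term
  refine ⟨Term.func g ![σ, τ], fun M _ v => ?_⟩
  rw [Term.realize]; congr 1; ext i; fin_cases i
  exacts [hσ M v, hτ M v]

instance TFO.realize {β : Type*} (τ : L.Term β) (s : β → ∀ (M : Type u) [L.Structure M], (α → M) → M)
    [hs : ∀ b, TFO (s b)] : TFO (L := L) (fun M _ v => τ.realize (fun b => s b M v)) := by
  choose σ hσ using fun b => (hs b).exists_term
  refine ⟨τ.subst σ, fun M _ v => ?_⟩
  rw [Term.realize_subst]; congr 1; ext b; exact hσ b M v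

instance FO.rel₁ (R : L.Relations 1) (s : ∀ (M : Type u) [L.Structure M], (α → M) → M) [hs : TFO s] :
    FO (L := L) (fun M _ v => RelMap R ![s M v]) := by
  obtain ⟨σ, hσ⟩ := hs.exists_term
  refine ⟨R.formula₁ σ, fun M _ v => ?_⟩
  rw [Formula.realize_rel₁, hσ]

instance FO.rel₂ (R : L.Relations 2) (s t : ∀ (M : Type u) [L.Structure M], (α → M) → M)
    [hs : TFO s] [ht : TFO t] :
    FO (L := L) (fun M _ v => RelMap R ![s M v, t M v]) := by
  obtain ⟨σ, hσ⟩ := hs.exists_term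
  obtain ⟨τ, hτ⟩ := ht.exists_term
  refine ⟨R.formula₂ σ τ, fun M _ v => ?_⟩
  rw [Formula.realize_rel₂, hσ, hτ]

instance FO.eq (s t : ∀ (M : Type u) [L.Structure M], (α → M) → M) [hs : TFO s] [ht : TFO t] :
    FO (L := L) (fun M _ v => s M v = t M v) := by
  obtain ⟨σ, hσ⟩ := hs.exists_term
  obtain ⟨τ, hτ⟩ := ht.exists_term
  refine ⟨σ.equal τ, fun M _ v => ?_⟩
  rw [Formula.realize_equal, hσ, hτ]

variable (P Q : ∀ (M : Type u) [L.Structure M], (α → M) → Prop)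

instance FO.not [hP : FO P] : FO (L := L) (fun M _ v => ¬ P M v) := by
  obtain ⟨φ, hφ⟩ := hP.exists_formula
  exact ⟨φ.not, fun M _ v => by rw [Formula.realize_not, hφ]⟩

instance FO.imp [hP : FO P] [hQ : FO Q] : FO (L := L) (fun M _ v => P M v → Q M v) := by
  obtain ⟨φ, hφ⟩ := hP.exists_formula
  obtain ⟨ψ, hψ⟩ := hQ.exists_formula
  exact ⟨φ.imp ψ, fun M _ v => by rw [Formula.realize_imp, hφ, hψ]⟩

instance FO.and [hP : FO P] [hQ : FO Q] : FO (L := L) (fun M _ v => P M v ∧ Q M v) := by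
  obtain ⟨φ, hφ⟩ := hP.exists_formula
  obtain ⟨ψ, hψ⟩ := hQ.exists_formula
  exact ⟨φ ⊓ ψ, fun M _ v => by rw [Formula.realize_inf, hφ, hψ]⟩

instance FO.or [hP : FO P] [hQ : FO Q] : FO (L := L) (fun M _ v => P M v ∨ Q M v) := by
  obtain ⟨φ, hφ⟩ := hP.exists_formula
  obtain ⟨ψ, hψ⟩ := hQ.exists_formula
  exact ⟨φ ⊔ ψ, fun M _ v => by rw [Formula.realize_sup, hφ, hψ]⟩

instance FO.iff [hP : FO P] [hQ : FO Q] : FO (L := L) (fun M _ v => P M v ↔ Q M v) := by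
  obtain ⟨φ, hφ⟩ := hP.exists_formula
  obtain ⟨ψ, hψ⟩ := hQ.exists_formula
  exact ⟨φ.iff ψ, fun M _ v => by rw [Formula.realize_iff, hφ, hψ]⟩

instance FO.allFin (n : ℕ) (R : ∀ (M : Type u) [L.Structure M], (α → M) → (Fin n → M) → Prop)
    [hR : FO (L := L) (fun M _ (w : α ⊕ Fin n → M) => R M (fun a => w (.inl a)) (fun j => w (.inr j)))] :
    FO (L := L) (fun M _ v => ∀ x : Fin n → M, R M v x) := by
  obtain ⟨φ, hφ⟩ := hR.exists_formula
  exact ⟨φ.iAlls (Fin n), fun M _ v => by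
    simp only [Formula.realize_iAlls, hφ]; rfl⟩

instance FO.exFin (n : ℕ) (R : ∀ (M : Type u) [L.Structure M], (α → M) → (Fin n → M) → Prop)
    [hR : FO (L := L) (fun M _ (w : α ⊕ Fin n → M) => R M (fun a => w (.inl a)) (fun j => w (.inr j)))] :
    FO (L := L) (fun M _ v => ∃ x : Fin n → M, R M v x) := by
  obtain ⟨φ, hφ⟩ := hR.exists_formula
  exact ⟨φ.iExs (Fin n), fun M _ v => by
    simp only [Formula.realize_iExs, hφ]; rfl⟩

instance FO.all (R : ∀ (M : Type u) [L.Structure M], (α → M) → M → Prop)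
    [hR : FO (L := L) (fun M _ (w : Option α → M) => R M (fun a => w (some a)) (w none))] :
    FO (L := L) (fun M _ v => ∀ x : M, R M v x) := by
  obtain ⟨φ, hφ⟩ := hR.exists_formula
  let g : Option α → α ⊕ Fin 1 := fun o => o.elim (.inr 0) .inl
  refine ⟨(φ.relabel g).iAlls (Fin 1), fun M _ v => ?_⟩
  simp only [Formula.realize_iAlls, Formula.realize_relabel, hφ]
  exact ⟨fun h x => h fun _ => x, fun h x => h (x 0)⟩

instance FO.ex (R : ∀ (M : Type u) [L.Structure M], (α → M) → M → Prop)
    [hR : FO (L := L) (fun M _ (w : Option α → M) => R M (fun a => w (some a)) (w none))] :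
    FO (L := L) (fun M _ v => ∃ x : M, R M v x) := by
  obtain ⟨φ, hφ⟩ := hR.exists_formula
  let g : Option α → α ⊕ Fin 1 := fun o => o.elim (.inr 0) .inl
  refine ⟨(φ.relabel g).iExs (Fin 1), fun M _ v => ?_⟩
  simp only [Formula.realize_iExs, Formula.realize_relabel, hφ]
  exact ⟨fun ⟨x, h⟩ => ⟨x 0, h⟩, fun ⟨x, h⟩ => ⟨fun _ => x, h⟩⟩

instance FO.allExt {ι : Type*} [Finite ι] (R : ι → ∀ (M : Type u) [L.Structure M], (α → M) → Prop)
    [hR : ∀ i, FO (R i)] : FO (L := L) (fun M _ v => ∀ i, R i M v) := by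
  choose φ hφ using fun i => (hR i).exists_formula
  exact ⟨BoundedFormula.iInf φ, fun M _ v => by
    simp only [Formula.Realize, BoundedFormula.realize_iInf]
    exact forall_congr' fun i => hφ i M v⟩

instance FO.exExt {ι : Type*} [Finite ι] (R : ι → ∀ (M : Type u) [L.Structure M], (α → M) → Prop)
    [hR : ∀ i, FO (R i)] : FO (L := L) (fun M _ v => ∃ i, R i M v) := by
  choose φ hφ using fun i => (hR i).exists_formula
  exact ⟨BoundedFormula.iSup φ, fun M _ v => by
    simp only [Formula.Realize, BoundedFormula.realize_iSup]
    exact exists_congr fun i => hφ i M v⟩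

end Instances

end FO

section Compactness

/-- A set outside of a Boolean algebra of sets is not determined by the trace of ultrafilters on
the Boolean algebra. -/
lemma exists_ultrafilter_of_notMem {α : Type*} (B : Set (Set α)) (huniv : Set.univ ∈ B)
    (hinter : ∀ s ∈ B, ∀ t ∈ B, s ∩ t ∈ B) (hcompl : ∀ s ∈ B, sᶜ ∈ B) {X : Set α} (hX : X ∉ B) :
    ∃ U₁ U₂ : Ultrafilter α, X ∈ U₁ ∧ X ∉ U₂ ∧ ∀ s ∈ B, s ∈ U₁ ↔ s ∈ U₂ := by
  let G : Set (Set α) := {s | ∃ s₁ ∈ B, ∃ s₂ ∈ B, X ⊆ s₁ ∧ Xᶜ ⊆ s₂ ∧ s₁ ∩ s₂ ⊆ s}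
  let F : Filter α :=
    { sets := G
      univ_sets := ⟨_, huniv, _, huniv, Set.subset_univ _, Set.subset_univ _, Set.subset_univ _⟩
      sets_of_superset := by
        rintro s t ⟨s₁, h₁, s₂, h₂, h₃, h₄, h₅⟩ hst
        exact ⟨s₁, h₁, s₂, h₂, h₃, h₄, h₅.trans hst⟩
      inter_sets := by
        rintro s t ⟨s₁, h₁, s₂, h₂, h₃, h₄, h₅⟩ ⟨t₁, g₁, t₂, g₂, g₃, g₄, g₅⟩
        refine ⟨_, hinter _ h₁ _ g₁, _, hinter _ h₂ _ g₂, Set.subset_inter h₃ g₃,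
          Set.subset_inter h₄ g₄, ?_⟩
        rintro x ⟨⟨a, b⟩, c, d⟩
        exact ⟨h₅ ⟨a, c⟩, g₅ ⟨b, d⟩⟩ }
  have hF : F.NeBot := by
    rw [Filter.neBot_iff, Ne, ← Filter.empty_mem_iff_bot]
    rintro ⟨s₁, h₁, s₂, h₂, h₃, h₄, h₅⟩
    apply hX
    convert! h₁ using 1
    refine h₃.antisymm fun x hx => ?_
    by_contra hx'
    exact h₅ ⟨hx, h₄ hx'⟩
  let W : Ultrafilter α := Ultrafilter.of F
  have hW : ∀ s ∈ G, s ∈ W := fun s hs => Ultrafilter.of_le F hs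
  have key : ∀ Y : Set α, (Y = X ∨ Y = Xᶜ) → ∃ U : Ultrafilter α, Y ∈ U ∧ ∀ s ∈ B, s ∈ U ↔ s ∈ W := by
    intro Y hY
    let H : Filter α :=
      { sets := {s | ∃ t ∈ B, t ∈ W ∧ t ∩ Y ⊆ s}
        univ_sets := ⟨_, huniv, Filter.univ_mem, Set.subset_univ _⟩
        sets_of_superset := by
          rintro s t ⟨s₁, h₁, h₂, h₃⟩ hst
          exact ⟨s₁, h₁, h₂, h₃.trans hst⟩
        inter_sets := by
          rintro s t ⟨s₁, h₁, h₂, h₃⟩ ⟨t₁, g₁, g₂, g₃⟩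
          refine ⟨_, hinter _ h₁ _ g₁, Filter.inter_mem h₂ g₂, ?_⟩
          rintro x ⟨⟨a, b⟩, c⟩
          exact ⟨h₃ ⟨a, c⟩, g₃ ⟨b, c⟩⟩ }
    have hH : H.NeBot := by
      rw [Filter.neBot_iff, Ne, ← Filter.empty_mem_iff_bot]
      rintro ⟨t, h₁, h₂, h₃⟩
      have h4 : tᶜ ∈ W := by
        apply hW
        have h5 : Y ⊆ tᶜ := fun x hx hxt => h₃ ⟨hxt, hx⟩
        rcases hY with rfl | rfl
        · exact ⟨_, hcompl _ h₁, _, huniv, h5, Set.subset_univ _, Set.inter_subset_left⟩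
        · exact ⟨_, huniv, _, hcompl _ h₁, Set.subset_univ _, h5, Set.inter_subset_right⟩
      exact Ultrafilter.compl_notMem_iff.2 h₂ h4
    let U : Ultrafilter α := Ultrafilter.of H
    have hU : ∀ s ∈ B, s ∈ W → s ∈ U := fun s h₁ h₂ =>
      Ultrafilter.of_le H ⟨s, h₁, h₂, Set.inter_subset_left⟩
    refine ⟨U, Ultrafilter.of_le H ⟨_, huniv, Filter.univ_mem, Set.inter_subset_right⟩,
      fun s hs => ⟨fun h => ?_, hU s hs⟩⟩
    by_contra h'
    exact Ultrafilter.compl_notMem_iff.2 h (hU _ (hcompl _ hs) (Ultrafilter.compl_mem_iff_notMem.2 h'))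
  obtain ⟨U₁, h₁, h₂⟩ := key X (.inl rfl)
  obtain ⟨U₂, h₃, h₄⟩ := key Xᶜ (.inr rfl)
  exact ⟨U₁, U₂, h₁, Ultrafilter.compl_mem_iff_notMem.1 h₃, fun s hs => (h₂ s hs).trans (h₄ s hs).symm⟩

variable {L : FirstOrder.Language.{u, u}}

/-- A finitely satisfiable set of formulas over a structure is realized in an elementary
extension. -/
theorem exists_elementaryEmbedding_realize {M : Type u} [L.Structure M] [Nonempty M] {ι I : Type u}
    (φ : I → L.Formula (M ⊕ ι))
    (hφ : ∀ s : Finset I, ∃ w : ι → M, ∀ i ∈ s, (φ i).Realize (Sum.elim id w)) :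
    ∃ (N : Type u) (_ : L.Structure N) (j : M ↪ₑ[L] N) (w : ι → N),
      ∀ i, (φ i).Realize (Sum.elim j w) := by
  classical
  choose w hw using hφ
  let F : Filter (Finset I) := Filter.atTop
  let U : Ultrafilter (Finset I) := Ultrafilter.of F
  let N := (U : Filter (Finset I)).Product (fun _ => M)
  let j : M ↪ₑ[L] N :=
    ⟨fun m => ((fun _ => m : ∀ _ : Finset I, M) : N), fun n ψ x => by
      refine (Ultraproduct.realize_formula_cast (u := U) ψ (fun i _ => x i)).trans ?_
      exact Filter.eventually_const⟩
  refine ⟨N, inferInstance, j, fun x => ((fun s => w s x : ∀ _ : Finset I, M) : N), fun i => ?_⟩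
  have h1 := (Ultraproduct.realize_formula_cast (u := U) (M := fun _ => M) (φ i)
    (Sum.elim (fun m _ => m) (fun x s => w s x))).2 (by
      refine Ultrafilter.of_le F ((Filter.eventually_ge_atTop {i}).mono fun s hs => ?_)
      have := hw s i (hs (Finset.mem_singleton_self i))
      convert! this using 1
      funext x; cases x <;> rfl)
  convert! h1 using 1
  funext x; cases x <;> rfl

end Compactness

section Transfer

variable {f : Type u} [Field f] {C : Scheme.{u}} {p : C ⟶ Spec (CommRingCat.of f)}
  [SmoothOfRelativeDimension 1 p] [GeometricallyIntegral p] {𝒰 : Atlas p}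

instance (D : Model p) : (lang 𝒰).Structure D.Carrier := D.toStructure 𝒰

lemma models_theory (D : Model p) : D.Carrier ⊨ theory 𝒰 :=
  Theory.model_iff _ |>.2 fun _ h => h D

/-- First-order properties of the described structures hold in all models of their theory. -/
theorem transfer {P : ∀ (M : Type u) [(lang 𝒰).Structure M], Prop}
    [hP : FO (L := lang 𝒰) (α := Empty) (fun M _ _ => P M)] (hD : ∀ D : Model p, P D.Carrier) :
    ∀ {M : Type u} [(lang 𝒰).Structure M], M ⊨ theory 𝒰 → P M := by
  intro M _ hM
  obtain ⟨φ, hφ⟩ := hP.exists_formula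
  have h : φ ∈ theory 𝒰 := fun D => (hφ D.Carrier _).2 (hD D)
  exact (hφ M _).1 (Theory.realize_sentence_of_mem (theory 𝒰) h)

end Transfer
end CurveACVF
end

noncomputable section
namespace CurveACVF

open FirstOrder FirstOrder.Language FirstOrder.Language.Structure

section Symbols

variable {f : Type u} [Field f] {C : Scheme.{u}} {p : C ⟶ Spec (CommRingCat.of f)}
  (𝒰 : Atlas p)

/-- A function symbol of the language. -/
abbrev sym {n : ℕ} (g : Func 𝒰 n) : (lang 𝒰).Functions n := g

/-- A relation symbol of the language. -/
abbrev rsym {n : ℕ} (R : Rel 𝒰 n) : (lang 𝒰).Relations n := R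

variable {M : Type u} [(lang 𝒰).Structure M]

abbrev isK (a : M) : Prop := RelMap (rsym 𝒰 .isK) ![a]
abbrev isC (a : M) : Prop := RelMap (rsym 𝒰 .isC) ![a]
abbrev isG (a : M) : Prop := RelMap (rsym 𝒰 .isG) ![a]
abbrev isV (a : M) : Prop := RelMap (rsym 𝒰 .isV) ![a]
abbrev inCh (i : Fin 𝒰.size) (a : M) : Prop := RelMap (rsym 𝒰 (.chart i)) ![a]
abbrev gLe (a b : M) : Prop := RelMap (rsym 𝒰 .le) ![a, b]
abbrev isInt (a : M) : Prop := RelMap (rsym 𝒰 .integral) ![a]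
abbrev cst (r : f) : M := funMap (sym 𝒰 (.const r)) ![]
abbrev kAdd (a b : M) : M := funMap (sym 𝒰 .addK) ![a, b]
abbrev kMul (a b : M) : M := funMap (sym 𝒰 .mulK) ![a, b]
abbrev kNeg (a : M) : M := funMap (sym 𝒰 .negK) ![a]
abbrev crd (i : Fin 𝒰.size) (j : Fin (𝒰.dim i)) (a : M) : M := funMap (sym 𝒰 (.coord i j)) ![a]
abbrev gZero : M := funMap (sym 𝒰 .zeroG) ![]
abbrev gOne : M := funMap (sym 𝒰 .oneG) ![]
abbrev gAdd (a b : M) : M := funMap (sym 𝒰 .addG) ![a, b]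
abbrev gNeg (a : M) : M := funMap (sym 𝒰 .negG) ![a]
abbrev bas (a : M) : M := funMap (sym 𝒰 .base) ![a]
abbrev vAdd (a b : M) : M := funMap (sym 𝒰 .addV) ![a, b]
abbrev vMul (a b : M) : M := funMap (sym 𝒰 .mulV) ![a, b]
abbrev vNeg (a : M) : M := funMap (sym 𝒰 .negV) ![a]
abbrev vl (a : M) : M := funMap (sym 𝒰 .val) ![a]
abbrev rs (a b : M) : M := funMap (sym 𝒰 .res) ![a, b]
abbrev sc (x a : M) : M := funMap (sym 𝒰 .sec) ![x, a]
abbrev gn (i : Fin 𝒰.size) (j : Fin (𝒰.dim i)) (a : M) : M := funMap (sym 𝒰 (.gen i j)) ![a]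
/-- The fiber over `x`. -/
abbrev isVx (x a : M) : Prop := isV 𝒰 a ∧ bas 𝒰 a = x

end Symbols

section Eval

variable {f : Type u} [Field f] {C : Scheme.{u}} {p : C ⟶ Spec (CommRingCat.of f)}
  [SmoothOfRelativeDimension 1 p] [GeometricallyIntegral p]
  (𝒰 : Atlas p) {D : Model p}

namespace Model.Carrier

variable {x : Point p (algebraMap f D.k)} {m : D.Carrier}

lemma isK_iff : isK 𝒰 m ↔ ∃ a, m = ofK a := Iff.rfl
lemma isC_iff : isC 𝒰 m ↔ ∃ a, m = ofC a := Iff.rfl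
lemma isG_iff : isG 𝒰 m ↔ ∃ a, m = ofG a := Iff.rfl
lemma isV_iff : isV 𝒰 m ↔ ∃ x a, m = ofV x a := Iff.rfl
lemma inCh_iff {i : Fin 𝒰.size} : inCh 𝒰 i m ↔ ∃ x, m = ofC x ∧ InChart 𝒰 x i := Iff.rfl
lemma isInt_iff : isInt 𝒰 m ↔ ∃ x a, m = ofV x a ∧ 0 ≤ D.v x a := Iff.rfl
lemma gLe_iff {m' : D.Carrier} :
  gLe 𝒰 m m' ↔ ∃ γ δ, m = ofG γ ∧ m' = ofG δ ∧ γ ≤ δ := Iff.rfl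
@[simp] lemma gLe_ofG {γ δ : D.Γ} : gLe 𝒰 (ofG γ : D.Carrier) (ofG δ) ↔ γ ≤ δ := by
  rw [gLe_iff]
  refine ⟨?_, fun h => ⟨_, _, rfl, rfl, h⟩⟩
  rintro ⟨γ, δ, h₁, h₂, h⟩
  cases h₁; cases h₂; exact h
@[simp] lemma isInt_ofV {a : D.VF x} : isInt 𝒰 (ofV x a : D.Carrier) ↔ 0 ≤ D.v x a := by
  rw [isInt_iff]
  refine ⟨?_, fun h => ⟨_, _, rfl, h⟩⟩
  rintro ⟨x, a, h₁, h₂⟩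
  cases h₁; exact h₂
@[simp] lemma inCh_ofC {i : Fin 𝒰.size} : inCh 𝒰 i (ofC x : D.Carrier) ↔ InChart 𝒰 x i := by
  rw [inCh_iff]
  refine ⟨?_, fun h => ⟨_, rfl, h⟩⟩
  rintro ⟨x, h₁, h₂⟩
  cases h₁; exact h₂
@[simp] lemma isK_ofK {a : D.k} : isK 𝒰 (ofK a : D.Carrier) := ⟨_, rfl⟩
@[simp] lemma isC_ofC : isC 𝒰 (ofC x : D.Carrier) := ⟨_, rfl⟩
@[simp] lemma isG_ofG {a : D.Γ} : isG 𝒰 (ofG a : D.Carrier) := ⟨_, rfl⟩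
@[simp] lemma isV_ofV {a : D.VF x} : isV 𝒰 (ofV x a : D.Carrier) := ⟨_, _, rfl⟩

lemma cst_eq (r : f) : (cst 𝒰 r : D.Carrier) = ofK (algebraMap f D.k r) := rfl
@[simp] lemma kAdd_ofK (a b : D.k) : kAdd 𝒰 (ofK a : D.Carrier) (ofK b) = ofK (a + b) := rfl
@[simp] lemma kMul_ofK (a b : D.k) : kMul 𝒰 (ofK a : D.Carrier) (ofK b) = ofK (a * b) := rfl
@[simp] lemma kNeg_ofK (a : D.k) : kNeg 𝒰 (ofK a : D.Carrier) = ofK (-a) := rfl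
@[simp] lemma crd_ofC (i j) : crd 𝒰 i j (ofC x : D.Carrier) = ofK (coordAt 𝒰 x i j) := rfl
lemma gZero_eq : (gZero 𝒰 : D.Carrier) = ofG 0 := rfl
lemma gOne_eq : (gOne 𝒰 : D.Carrier) = ofG D.one := rfl
@[simp] lemma gAdd_ofG (a b : D.Γ) : gAdd 𝒰 (ofG a : D.Carrier) (ofG b) = ofG (a + b) := rfl
@[simp] lemma gNeg_ofG (a : D.Γ) : gNeg 𝒰 (ofG a : D.Carrier) = ofG (-a) := rfl
@[simp] lemma bas_ofV (a : D.VF x) : bas 𝒰 (ofV x a : D.Carrier) = ofC x := rfl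
@[simp] lemma vAdd_ofV (a b : D.VF x) : vAdd 𝒰 (ofV x a : D.Carrier) (ofV x b) = ofV x (a + b) :=
  dif_pos rfl
@[simp] lemma vMul_ofV (a b : D.VF x) : vMul 𝒰 (ofV x a : D.Carrier) (ofV x b) = ofV x (a * b) :=
  dif_pos rfl
@[simp] lemma vNeg_ofV (a : D.VF x) : vNeg 𝒰 (ofV x a : D.Carrier) = ofV x (-a) := rfl
lemma vl_ofV (a : D.VF x) : vl 𝒰 (ofV x a : D.Carrier) = D.valElem x a := rfl
@[simp] lemma rs_ofV (a b : D.VF x) : rs 𝒰 (ofV x a : D.Carrier) (ofV x b) = ofK (D.resDiv x a b) :=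
  dif_pos rfl
@[simp] lemma sc_ofC (a : D.k) : sc 𝒰 (ofC x : D.Carrier) (ofK a) = ofV x (D.sec x a : D.VF x) := rfl
@[simp] lemma gn_ofC (i j) : gn 𝒰 i j (ofC x : D.Carrier) = ofV x (coordAt 𝒰 (D.c x) i j) := rfl

lemma isVx_iff : isVx 𝒰 (ofC x : D.Carrier) m ↔ ∃ a, m = ofV x a := by
  constructor
  · rintro ⟨⟨y, a, rfl⟩, h⟩
    rw [bas_ofV] at h
    cases h; exact ⟨a, rfl⟩
  · rintro ⟨a, rfl⟩
    exact ⟨isV_ofV 𝒰, rfl⟩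

lemma vl_ofV_eq {a : D.VF x} {γ : D.Γ} (h : D.v x a = γ) : vl 𝒰 (ofV x a : D.Carrier) = ofG γ := by
  rw [vl_ofV, valElem, h]

lemma vl_ofV_zero : vl 𝒰 (ofV x 0 : D.Carrier) = ofK 0 := by
  rw [vl_ofV, valElem, AddValuation.map_zero]; rfl

end Model.Carrier

lemma Model.exists_val_eq {x : Point p (algebraMap f D.k)} {a : D.VF x} (ha : a ≠ 0) :
    ∃ γ : D.Γ, D.v x a = γ :=
  (WithTop.ne_top_iff_exists.1 (mt (D.v x).top_iff.1 ha)).imp fun _ h => h.symm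

end Eval

/-! ### Fields and polynomials in first-order structures -/

section FieldAx

variable {M : Type u}

/-- The operations make the elements that satisfy `S` a field. -/
abbrev FieldAx (S : M → Prop) (add mul : M → M → M) (neg : M → M) (zero one : M) : Prop :=
  S zero ∧ S one ∧ zero ≠ one ∧ (∀ a, S a → S (neg a) ∧ add zero a = a ∧ add (neg a) a = zero ∧
    mul one a = a ∧ (a ≠ zero → ∃ b, S b ∧ mul a b = one)) ∧
  (∀ a b, S a → S b → S (add a b) ∧ S (mul a b) ∧ add a b = add b a ∧ mul a b = mul b a) ∧
  ∀ a b c, S a → S b → S c → add (add a b) c = add a (add b c) ∧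
    mul (mul a b) c = mul a (mul b c) ∧ mul a (add b c) = add (mul a b) (mul a c)

variable {S : M → Prop} {add mul : M → M → M} {neg : M → M} {zero one : M}

lemma FieldAx.of_field {F : Type u} [Field F] (e : F → M) (he : Function.Injective e)
    (hS : ∀ m, S m ↔ ∃ a, m = e a) (hadd : ∀ a b, add (e a) (e b) = e (a + b))
    (hmul : ∀ a b, mul (e a) (e b) = e (a * b)) (hneg : ∀ a, neg (e a) = e (-a))
    (h0 : zero = e 0) (h1 : one = e 1) : FieldAx S add mul neg zero one := by
  subst h0 h1
  simp only [FieldAx, hS]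
  refine ⟨⟨_, rfl⟩, ⟨_, rfl⟩, fun h => zero_ne_one (he h), ?_, ?_, ?_⟩
  · rintro _ ⟨a, rfl⟩
    rw [hneg, hadd, hadd, hmul, zero_add, neg_add_cancel, one_mul]
    refine ⟨⟨_, rfl⟩, rfl, rfl, rfl, fun h => ⟨_, ⟨a⁻¹, rfl⟩, ?_⟩⟩
    rw [hmul, mul_inv_cancel₀ fun h' => h (congrArg e h')]
  · rintro _ _ ⟨a, rfl⟩ ⟨b, rfl⟩
    rw [hadd, hadd, hmul, hmul]
    exact ⟨⟨_, rfl⟩, ⟨_, rfl⟩, congrArg e (add_comm _ _), congrArg e (mul_comm _ _)⟩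
  · rintro _ _ _ ⟨a, rfl⟩ ⟨b, rfl⟩ ⟨c, rfl⟩
    simp only [hadd, hmul]
    exact ⟨congrArg e (add_assoc _ _ _), congrArg e (mul_assoc _ _ _), congrArg e (mul_add _ _ _)⟩

open Classical in
/-- The field given by operations on a first-order structure. -/
abbrev FieldAx.field (h : FieldAx S add mul neg zero one) : Field {m : M // S m} :=
  letI : Add {m : M // S m} := ⟨fun a b => ⟨add a.1 b.1, (h.2.2.2.2.1 _ _ a.2 b.2).1⟩⟩
  letI : Mul {m : M // S m} := ⟨fun a b => ⟨mul a.1 b.1, (h.2.2.2.2.1 _ _ a.2 b.2).2.1⟩⟩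
  letI : Neg {m : M // S m} := ⟨fun a => ⟨neg a.1, (h.2.2.2.1 _ a.2).1⟩⟩
  letI : Zero {m : M // S m} := ⟨⟨zero, h.1⟩⟩
  letI : One {m : M // S m} := ⟨⟨one, h.2.1⟩⟩
  letI : Inv {m : M // S m} := ⟨fun a => if ha : a.1 ≠ zero then
    ⟨((h.2.2.2.1 _ a.2).2.2.2.2 ha).choose, ((h.2.2.2.1 _ a.2).2.2.2.2 ha).choose_spec.1⟩ else 0⟩
  Field.ofMinimalAxioms {m : M // S m}
    (fun a b c => Subtype.ext (h.2.2.2.2.2 _ _ _ a.2 b.2 c.2).1)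
    (fun a => Subtype.ext (h.2.2.2.1 _ a.2).2.1)
    (fun a => Subtype.ext (h.2.2.2.1 _ a.2).2.2.1)
    (fun a b c => Subtype.ext (h.2.2.2.2.2 _ _ _ a.2 b.2 c.2).2.1)
    (fun a b => Subtype.ext (h.2.2.2.2.1 _ _ a.2 b.2).2.2.2)
    (fun a => Subtype.ext (h.2.2.2.1 _ a.2).2.2.2.1)
    (fun a ha => by
      have ha' : a.1 ≠ zero := fun h' => ha (Subtype.ext h')
      have : a⁻¹ = ⟨((h.2.2.2.1 _ a.2).2.2.2.2 ha').choose, _⟩ := dif_pos ha'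
      rw [this]
      exact Subtype.ext ((h.2.2.2.1 _ a.2).2.2.2.2 ha').choose_spec.2)
    (dif_neg fun h' => h' rfl)
    (fun a b c => Subtype.ext (h.2.2.2.2.2 _ _ _ a.2 b.2 c.2).2.2)
    ⟨0, 1, fun h' => h.2.2.1 (congrArg Subtype.val h')⟩

end FieldAx

section PolyTerm

variable {L : FirstOrder.Language.{u, u}} {f : Type u} [CommRing f]

lemma exists_polyTerm {σ β : Type*} (add mul : L.Functions 2) (c : f → L.Term β) (var : σ → β)
    (F : MvPolynomial σ f) :
    ∃ τ : L.Term β, ∀ (N : Type u) [L.Structure N] (R : Type u) [CommRing R] (s : f →+* R)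
      (e : R → N) (w : β → N) (a : σ → R), (∀ a b, funMap add ![e a, e b] = e (a + b)) →
      (∀ a b, funMap mul ![e a, e b] = e (a * b)) → (∀ r, (c r).realize w = e (s r)) →
      (∀ j, w (var j) = e (a j)) → τ.realize w = e (MvPolynomial.eval₂ s a F) := by
  induction F using MvPolynomial.induction_on with
  | C r => exact ⟨c r, fun N _ R _ s e w a _ _ h _ => by rw [h, MvPolynomial.eval₂_C]⟩
  | add F G hF hG =>
    obtain ⟨τ, hτ⟩ := hF
    obtain ⟨τ', hτ'⟩ := hG
    refine ⟨Term.func add ![τ, τ'], fun N _ R _ s e w a h₁ h₂ h₃ h₄ => ?_⟩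
    rw [MvPolynomial.eval₂_add, ← h₁, ← hτ N R s e w a h₁ h₂ h₃ h₄, ← hτ' N R s e w a h₁ h₂ h₃ h₄,
      Term.realize]
    congr 1; ext i; fin_cases i <;> rfl
  | mul_X F j hF =>
    obtain ⟨τ, hτ⟩ := hF
    refine ⟨Term.func mul ![τ, Term.var (var j)], fun N _ R _ s e w a h₁ h₂ h₃ h₄ => ?_⟩
    rw [MvPolynomial.eval₂_mul, MvPolynomial.eval₂_X, ← h₂, ← hτ N R s e w a h₁ h₂ h₃ h₄, ← h₄,
      Term.realize]
    congr 1; ext i; fin_cases i <;> rfl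

end PolyTerm

end CurveACVF
end

noncomputable section
namespace CurveACVF

open FirstOrder FirstOrder.Language FirstOrder.Language.Structure

section

variable {L : FirstOrder.Language.{u, u}} {α : Type*}

instance TFO.optionElim {β : Type*} (s : ∀ (M : Type u) [L.Structure M], (α → M) → M)
    (t : β → ∀ (M : Type u) [L.Structure M], (α → M) → M) [hs : TFO s] [ht : ∀ b, TFO (t b)]
    (o : Option β) : TFO (L := L) (fun M _ v => o.elim (s M v) (fun b => t b M v)) := by
  cases o with
  | none => exact hs
  | some b => exact ht b

instance TFO.sumElim {β γ : Type*} (s : γ → ∀ (M : Type u) [L.Structure M], (α → M) → M)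
    (t : β → ∀ (M : Type u) [L.Structure M], (α → M) → M) [hs : ∀ c, TFO (s c)] [ht : ∀ b, TFO (t b)]
    (o : γ ⊕ β) : TFO (L := L) (fun M _ v => Sum.elim (fun c => s c M v) (fun b => t b M v) o) := by
  cases o with
  | inl c => exact hs c
  | inr b => exact ht b

end

section Polynomials

variable {f : Type u} [Field f] {C : Scheme.{u}} {p : C ⟶ Spec (CommRingCat.of f)}
  (𝒰 : Atlas p)

/-- A term for a polynomial function on `k`. -/
def polyK {σ : Type} (F : MvPolynomial σ f) : (lang 𝒰).Term σ :=
  (exists_polyTerm (sym 𝒰 .addK) (sym 𝒰 .mulK) (fun r => Term.func (sym 𝒰 (.const r)) ![]) id F).choose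

/-- A term for a polynomial function on the fibers of `VF`. -/
def polyV {σ : Type} (F : MvPolynomial σ f) : (lang 𝒰).Term (Option σ) :=
  (exists_polyTerm (sym 𝒰 .addV) (sym 𝒰 .mulV)
    (fun r => Term.func (sym 𝒰 .sec) ![Term.var none, Term.func (sym 𝒰 (.const r)) ![] ]) some F).choose

variable {𝒰} {N : Type u} [(lang 𝒰).Structure N] {R : Type u} [CommRing R] {s : f →+* R}

lemma realize_polyK {σ : Type} (F : MvPolynomial σ f) (e : R → N) (a : σ → R)
    (h₁ : ∀ a b, kAdd 𝒰 (e a) (e b) = e (a + b)) (h₂ : ∀ a b, kMul 𝒰 (e a) (e b) = e (a * b))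
    (h₃ : ∀ r, cst 𝒰 r = e (s r)) :
    (polyK 𝒰 F).realize (fun j => e (a j)) = e (MvPolynomial.eval₂ s a F) := by
  refine (exists_polyTerm (sym 𝒰 .addK) (sym 𝒰 .mulK) _ id F).choose_spec N R s e _ a h₁ h₂
    (fun r => ?_) fun _ => rfl
  rw [← h₃]
  simp only [Term.realize, cst]
  congr 1; ext i; exact i.elim0

lemma realize_polyV {σ : Type} (F : MvPolynomial σ f) (e : R → N) (a : σ → R) (x : N)
    (h₁ : ∀ a b, vAdd 𝒰 (e a) (e b) = e (a + b)) (h₂ : ∀ a b, vMul 𝒰 (e a) (e b) = e (a * b))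
    (h₃ : ∀ r, sc 𝒰 x (cst 𝒰 r) = e (s r)) :
    (polyV 𝒰 F).realize (fun o => o.elim x fun j => e (a j)) = e (MvPolynomial.eval₂ s a F) := by
  refine (exists_polyTerm (sym 𝒰 .addV) (sym 𝒰 .mulV) _ some F).choose_spec N R s e _ a h₁ h₂
    (fun r => ?_) fun _ => rfl
  rw [← h₃]
  simp only [Term.realize, cst, sc]
  congr 1; ext i; fin_cases i
  · rfl
  · change funMap _ _ = funMap _ _
    congr 1; funext i; exact i.elim0

section

variable [SmoothOfRelativeDimension 1 p] [GeometricallyIntegral p] {D : Model p}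
open Model.Carrier

lemma realize_polyK_ofK {σ : Type} (F : MvPolynomial σ f) (a : σ → D.k) :
    (polyK 𝒰 F).realize (fun j => (ofK (a j) : D.Carrier)) =
      ofK (MvPolynomial.eval₂ (algebraMap f D.k) a F) :=
  realize_polyK F _ a (fun _ _ => rfl) (fun _ _ => rfl) fun _ => rfl

/-- The constants of the fiber over `x`. -/
def Model.constV (D : Model p) (x : Point p (algebraMap f D.k)) : D.k →+* D.VF x :=
  (valuationRing (D.v x)).subtype.comp (D.sec x)

lemma realize_polyV_ofV {σ : Type} (F : MvPolynomial σ f) (x : Point p (algebraMap f D.k))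
    (a : σ → D.VF x) :
    (polyV 𝒰 F).realize (fun o => o.elim (ofC x : D.Carrier) fun j => ofV x (a j)) =
      ofV x (MvPolynomial.eval₂ ((D.constV x).comp (algebraMap f D.k)) a F) :=
  realize_polyV F _ a _ (fun _ _ => vAdd_ofV 𝒰 _ _) (fun _ _ => vMul_ofV 𝒰 _ _) fun _ => rfl

end

/-- The monic polynomial of degree `n + 1` in the variable `0`, with the other variables as
coefficients. -/
def genericMonic (f : Type u) [Field f] (n : ℕ) : MvPolynomial (Fin (n + 2)) f :=
  MvPolynomial.X 0 ^ (n + 1) + ∑ i : Fin (n + 1), MvPolynomial.X i.succ * MvPolynomial.X 0 ^ (i : ℕ)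

lemma exists_eval₂_genericMonic {K : Type u} [Field K] [IsAlgClosed K] (s : f →+* K) (n : ℕ)
    (a : Fin (n + 1) → K) : ∃ y, MvPolynomial.eval₂ s (Fin.cons y a) (genericMonic f n) = 0 := by
  let P : Polynomial K := Polynomial.X ^ (n + 1) +
    ∑ i : Fin (n + 1), Polynomial.C (a i) * Polynomial.X ^ (i : ℕ)
  have hP : P.degree = ((n + 1 : ℕ) : WithBot ℕ) := by
    have h1 : (∑ i : Fin (n + 1), Polynomial.C (a i) * Polynomial.X ^ (i : ℕ)).degree <
        ((n + 1 : ℕ) : WithBot ℕ) :=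
      Polynomial.degree_sum_fin_lt a
    rw [Polynomial.degree_add_eq_left_of_degree_lt (by rwa [Polynomial.degree_X_pow]),
      Polynomial.degree_X_pow]
  obtain ⟨y, hy⟩ := IsAlgClosed.exists_root P (by rw [hP]; norm_cast)
  refine ⟨y, ?_⟩
  simpa [genericMonic, P, Polynomial.IsRoot, MvPolynomial.eval₂_add, MvPolynomial.eval₂_mul, MvPolynomial.eval₂_sum, Polynomial.eval_finsetSum] using hy

lemma isAlgClosed_of_genericMonic {K : Type u} [Field K] (s : f →+* K)
    (h : ∀ (n : ℕ) (a : Fin (n + 1) → K),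
      ∃ y, MvPolynomial.eval₂ s (Fin.cons y a) (genericMonic f n) = 0) : IsAlgClosed K := by
  refine IsAlgClosed.of_exists_root K fun P hP hirr => ?_
  obtain ⟨n, hn⟩ : ∃ n, P.natDegree = n + 1 :=
    Nat.exists_eq_succ_of_ne_zero hirr.natDegree_pos.ne'
  obtain ⟨y, hy⟩ := h n (fun i => P.coeff i)
  refine ⟨y, ?_⟩
  rw [Polynomial.eval_eq_sum_range, hn, Finset.sum_range_succ, Finset.sum_range]
  have : P.coeff (n + 1) = 1 := by rw [← hn]; exact hP
  rw [this, one_mul, add_comm]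
  simpa [genericMonic, MvPolynomial.eval₂_add, MvPolynomial.eval₂_mul, MvPolynomial.eval₂_sum] using hy

end Polynomials

end CurveACVF
end

noncomputable section
namespace CurveACVF

open FirstOrder FirstOrder.Language FirstOrder.Language.Structure

/-- Generators of an ideal. -/
lemma exists_finset_eval₂ {f : Type u} [Field f] {σ : Type} [Finite σ] (I : Ideal (MvPolynomial σ f)) :
    ∃ s : Finset (MvPolynomial σ f), ↑s ⊆ (I : Set (MvPolynomial σ f)) ∧
      ∀ {R : Type u} [CommRing R] (g : f →+* R) (a : σ → R),
      (∀ F ∈ s, MvPolynomial.eval₂ g a F = 0) → ∀ F ∈ I, MvPolynomial.eval₂ g a F = 0 := by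
  obtain ⟨s, hs⟩ := (isNoetherianRing_iff_ideal_fg _).1 inferInstance I
  refine ⟨s, by rw [← hs]; exact Ideal.subset_span, fun {R} _ g a h F hF => ?_⟩
  have : I ≤ RingHom.ker (MvPolynomial.eval₂Hom g a) := by
    rw [← hs, Ideal.span_le]
    exact fun F hF => h F hF
  exact this hF

section Models

variable {f : Type u} [Field f] {C : Scheme.{u}} {p : C ⟶ Spec (CommRingCat.of f)}
  [SmoothOfRelativeDimension 1 p] [GeometricallyIntegral p] {𝒰 : Atlas p}

lemma Model.val_sec (D : Model p) (x : Point p (algebraMap f D.k)) {a : D.k} (ha : a ≠ 0) :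
    D.v x (D.constV x a) = 0 := by
  have h1 : 0 ≤ D.v x (D.constV x a) := (D.sec x a).2
  have h2 : 0 ≤ D.v x (D.constV x a⁻¹) := (D.sec x a⁻¹).2
  have h3 : D.v x (D.constV x a) + D.v x (D.constV x a⁻¹) = 0 := by
    rw [← (D.v x).map_mul, ← map_mul, mul_inv_cancel₀ ha, map_one, (D.v x).map_one]
  refine le_antisymm ?_ h1
  calc D.v x (D.constV x a) ≤ D.v x (D.constV x a) + D.v x (D.constV x a⁻¹) := le_add_of_nonneg_right h2
    _ = 0 := h3

/-- The condition on the coordinates of the generic point near `x`. -/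
lemma Model.gen_coord (D : Model p) {x : Point p (algebraMap f D.k)} {i : Fin 𝒰.size}
    (hx : InChart 𝒰 x i) :
    (∀ j, (D.one : WithTop D.Γ) ≤ D.v x (coordAt 𝒰 (D.c x) i j - D.constV x (coordAt 𝒰 x i j))) ∧
      ∃ j, D.v x (coordAt 𝒰 (D.c x) i j - D.constV x (coordAt 𝒰 x i j)) = D.one :=
  ((exists_isEvaluationAt_iff (fun _ => D.val_sec x) D.one_pos (D.c x) hx).1 (D.val_c x)).2

end Models

section Axioms

variable {f : Type u} [Field f] {C : Scheme.{u}} {p : C ⟶ Spec (CommRingCat.of f)}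
  [SmoothOfRelativeDimension 1 p] [GeometricallyIntegral p]
  {𝒰 : Atlas p} {M : Type u} [(lang 𝒰).Structure M] (hM : M ⊨ theory 𝒰)
include hM

open Model.Carrier

lemma ax_sorts : ∀ m : M, (isK 𝒰 m ∨ isC 𝒰 m ∨ isG 𝒰 m ∨ isV 𝒰 m) ∧
    (isK 𝒰 m → ¬ isC 𝒰 m ∧ ¬ isG 𝒰 m ∧ ¬ isV 𝒰 m) ∧ (isC 𝒰 m → ¬ isG 𝒰 m ∧ ¬ isV 𝒰 m) ∧
    (isG 𝒰 m → ¬ isV 𝒰 m) := by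
  revert M; apply transfer
  exact (fun D m => by
    simp only [isK_iff, isC_iff, isG_iff, isV_iff]
    cases m <;> simp)

set_option synthInstance.maxHeartbeats 400000 in
set_option synthInstance.maxSize 2000 in
lemma ax_fieldK : FieldAx (M := M) (isK 𝒰) (kAdd 𝒰) (kMul 𝒰) (kNeg 𝒰) (cst 𝒰 0) (cst 𝒰 1) := by
  revert M; apply transfer
  exact (fun D => FieldAx.of_field (F := D.k) ofK (fun _ _ h => by cases h; rfl)
    (fun _ => Iff.rfl) (fun _ _ => rfl) (fun _ _ => rfl) (fun _ => rfl)
    (by rw [cst_eq, map_zero]) (by rw [cst_eq, map_one]))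

lemma ax_cst (r s : f) : isK 𝒰 (cst 𝒰 r : M) ∧ (cst 𝒰 (r + s) : M) = kAdd 𝒰 (cst 𝒰 r) (cst 𝒰 s) ∧
    (cst 𝒰 (r * s) : M) = kMul 𝒰 (cst 𝒰 r) (cst 𝒰 s) := by
  revert M; apply transfer
  exact (fun D => by simp [cst_eq])

lemma ax_rootK (n : ℕ) : ∀ a : Fin (n + 1) → M, (∀ i, isK 𝒰 (a i)) → ∃ b : Fin (n + 2) → M,
    isK 𝒰 (b 0) ∧ (∀ i : Fin (n + 1), b i.succ = a i) ∧
      (polyK 𝒰 (genericMonic f n)).realize (fun j => b j) = cst 𝒰 0 := by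
  revert M; apply transfer
  exact (fun D a ha => by
    choose a' ha' using ha
    obtain ⟨y, hy⟩ := exists_eval₂_genericMonic (algebraMap f D.k) n a'
    refine ⟨fun j => ofK (Fin.cons (α := fun _ => D.k) y a' j), ⟨_, rfl⟩, fun i => (ha' i).symm, ?_⟩
    rw [realize_polyK_ofK, hy, cst_eq, map_zero])

set_option synthInstance.maxHeartbeats 400000 in
set_option synthInstance.maxSize 2000 in
lemma ax_group : isG 𝒰 (gZero 𝒰 : M) ∧ isG 𝒰 (gOne 𝒰 : M) ∧ gLe 𝒰 (gZero 𝒰 : M) (gOne 𝒰) ∧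
    (gZero 𝒰 : M) ≠ gOne 𝒰 ∧
    (∀ a : M, isG 𝒰 a → isG 𝒰 (gNeg 𝒰 a) ∧ gAdd 𝒰 (gZero 𝒰) a = a ∧
      gAdd 𝒰 (gNeg 𝒰 a) a = gZero 𝒰 ∧ gLe 𝒰 a a) ∧
    (∀ a b : M, gLe 𝒰 a b → isG 𝒰 a ∧ isG 𝒰 b ∧ (gLe 𝒰 b a → a = b)) ∧
    (∀ a b : M, isG 𝒰 a → isG 𝒰 b → isG 𝒰 (gAdd 𝒰 a b) ∧ gAdd 𝒰 a b = gAdd 𝒰 b a ∧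
      (gLe 𝒰 a b ∨ gLe 𝒰 b a)) ∧
    (∀ a b c : M, isG 𝒰 a → isG 𝒰 b → isG 𝒰 c → gAdd 𝒰 (gAdd 𝒰 a b) c = gAdd 𝒰 a (gAdd 𝒰 b c) ∧
      (gLe 𝒰 a b → gLe 𝒰 b c → gLe 𝒰 a c) ∧ (gLe 𝒰 a b → gLe 𝒰 (gAdd 𝒰 c a) (gAdd 𝒰 c b))) := by
  revert M; apply transfer
  exact (fun D => by
    refine ⟨⟨_, rfl⟩, ⟨_, rfl⟩, ?_, ?_, ?_, ?_, ?_, ?_⟩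
    · rw [gZero_eq, gOne_eq, gLe_ofG]; exact D.one_pos.le
    · rw [gZero_eq, gOne_eq, Ne, ofG.injEq]; exact D.one_pos.ne
    · rintro _ ⟨a, rfl⟩
      rw [gNeg_ofG, gZero_eq, gAdd_ofG, gAdd_ofG, gLe_ofG, zero_add, neg_add_cancel]
      exact ⟨⟨_, rfl⟩, rfl, rfl, le_rfl⟩
    · rintro _ _ ⟨a, b, rfl, rfl, h⟩
      refine ⟨⟨_, rfl⟩, ⟨_, rfl⟩, fun h' => ?_⟩
      rw [gLe_ofG] at h'
      rw [le_antisymm h h']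
    · rintro _ _ ⟨a, rfl⟩ ⟨b, rfl⟩
      rw [gAdd_ofG, gAdd_ofG, gLe_ofG, gLe_ofG, add_comm]
      exact ⟨⟨_, rfl⟩, rfl, le_total _ _⟩
    · rintro _ _ _ ⟨a, rfl⟩ ⟨b, rfl⟩ ⟨c, rfl⟩
      simp only [gAdd_ofG, gLe_ofG]
      exact ⟨congrArg _ (add_assoc _ _ _), le_trans, fun h => add_le_add_right h _⟩)

set_option synthInstance.maxHeartbeats 400000 in
set_option synthInstance.maxSize 2000 in
lemma ax_fieldV : ∀ x : M, isC 𝒰 x → FieldAx (M := M) (isVx 𝒰 x) (vAdd 𝒰) (vMul 𝒰) (vNeg 𝒰)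
    (sc 𝒰 x (cst 𝒰 0)) (sc 𝒰 x (cst 𝒰 1)) := by
  revert M; apply transfer
  exact (fun D => by
    rintro _ ⟨x, rfl⟩
    refine FieldAx.of_field (F := D.VF x) (ofV x) (fun _ _ h => by cases h; rfl)
      (fun _ => isVx_iff 𝒰) (fun _ _ => vAdd_ofV 𝒰 _ _) (fun _ _ => vMul_ofV 𝒰 _ _) (fun _ => rfl) ?_ ?_
    · rw [cst_eq, sc_ofC, map_zero, map_zero]; rfl
    · rw [cst_eq, sc_ofC, map_one, map_one]; rfl)

lemma ax_base : ∀ m : M, isV 𝒰 m → isC 𝒰 (bas 𝒰 m) := by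
  revert M; apply transfer
  exact (fun D => by
    rintro _ ⟨x, a, rfl⟩
    exact ⟨_, rfl⟩)

lemma ax_rootV (n : ℕ) : ∀ x : M, isC 𝒰 x → ∀ a : Fin (n + 1) → M, (∀ i, isVx 𝒰 x (a i)) →
    ∃ b : Fin (n + 2) → M, isVx 𝒰 x (b 0) ∧ (∀ i : Fin (n + 1), b i.succ = a i) ∧
      (polyV 𝒰 (genericMonic f n)).realize (fun o => o.elim x fun j => b j) = sc 𝒰 x (cst 𝒰 0) := by
  revert M; apply transfer
  exact (fun D => by
    rintro _ ⟨x, rfl⟩ a ha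
    simp only [isVx_iff] at ha
    choose a' ha' using ha
    obtain ⟨y, hy⟩ := exists_eval₂_genericMonic ((D.constV x).comp (algebraMap f D.k)) n a'
    refine ⟨fun j => ofV x (Fin.cons (α := fun _ => D.VF x) y a' j), (isVx_iff 𝒰).2 ⟨_, rfl⟩,
      fun i => (ha' i).symm, ?_⟩
    rw [realize_polyV_ofV, hy, cst_eq, sc_ofC, map_zero, map_zero]
    rfl)

lemma ax_sec : ∀ x a b : M, isC 𝒰 x → isK 𝒰 a → isK 𝒰 b → isVx 𝒰 x (sc 𝒰 x a) ∧
    sc 𝒰 x (kAdd 𝒰 a b) = vAdd 𝒰 (sc 𝒰 x a) (sc 𝒰 x b) ∧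
    sc 𝒰 x (kMul 𝒰 a b) = vMul 𝒰 (sc 𝒰 x a) (sc 𝒰 x b) ∧
    isInt 𝒰 (sc 𝒰 x a) ∧ rs 𝒰 (sc 𝒰 x a) (sc 𝒰 x (cst 𝒰 1)) = a := by
  revert M; apply transfer
  exact (fun D => by
    rintro _ _ _ ⟨x, rfl⟩ ⟨a, rfl⟩ ⟨b, rfl⟩
    rw [cst_eq, map_one]
    simp only [sc_ofC, kAdd_ofK, kMul_ofK, vAdd_ofV, vMul_ofV, isInt_ofV, rs_ofV, map_add, map_mul,
      map_one]
    refine ⟨(isVx_iff 𝒰).2 ⟨_, rfl⟩, rfl, rfl, (D.sec x a).2, ?_⟩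
    have h1 : (((1 : valuationRing (D.v x)) : D.VF x)) ≠ 0 := one_ne_zero
    have h2 : ((D.sec x a : D.VF x) / ((1 : valuationRing (D.v x)) : D.VF x)) = D.sec x a := div_one _
    rw [Model.resDiv, dif_pos ⟨h1, by rw [h2]; exact (D.sec x a).2⟩]
    have h3 := RingHom.congr_fun (D.res_comp_sec x) a
    simp only [h2]
    exact congrArg ofK h3)

set_option synthInstance.maxHeartbeats 400000 in
set_option synthInstance.maxSize 2000 in
lemma ax_val : ∀ x : M, isC 𝒰 x → vl 𝒰 (sc 𝒰 x (cst 𝒰 0)) = cst 𝒰 0 ∧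
    vl 𝒰 (sc 𝒰 x (cst 𝒰 1)) = gZero 𝒰 ∧
    (∀ γ : M, isG 𝒰 γ → ∃ a : M, isVx 𝒰 x a ∧ a ≠ sc 𝒰 x (cst 𝒰 0) ∧ vl 𝒰 a = γ) ∧
    (∀ a : M, isVx 𝒰 x a → (a ≠ sc 𝒰 x (cst 𝒰 0) → isG 𝒰 (vl 𝒰 a)) ∧
      (isInt 𝒰 a ↔ a = sc 𝒰 x (cst 𝒰 0) ∨ gLe 𝒰 (gZero 𝒰) (vl 𝒰 a))) ∧
    (∀ a b : M, isVx 𝒰 x a → isVx 𝒰 x b → a ≠ sc 𝒰 x (cst 𝒰 0) → b ≠ sc 𝒰 x (cst 𝒰 0) →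
      vl 𝒰 (vMul 𝒰 a b) = gAdd 𝒰 (vl 𝒰 a) (vl 𝒰 b) ∧ (vAdd 𝒰 a b ≠ sc 𝒰 x (cst 𝒰 0) →
        gLe 𝒰 (vl 𝒰 a) (vl 𝒰 (vAdd 𝒰 a b)) ∨ gLe 𝒰 (vl 𝒰 b) (vl 𝒰 (vAdd 𝒰 a b)))) := by
  revert M; apply transfer
  exact (fun D => by
    rintro _ ⟨x, rfl⟩
    have h0 : sc 𝒰 (ofC x : D.Carrier) (cst 𝒰 0) = ofV x 0 := by
      rw [cst_eq, sc_ofC, map_zero, map_zero]; rfl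
    have h1 : sc 𝒰 (ofC x : D.Carrier) (cst 𝒰 1) = ofV x 1 := by
      rw [cst_eq, sc_ofC, map_one, map_one]; rfl
    have hne {a : D.VF x} : (ofV x a : D.Carrier) ≠ ofV x 0 ↔ a ≠ 0 := by
      refine not_congr ⟨fun h => by cases h; rfl, fun h => by rw [h]⟩
    rw [h0, h1]
    simp only [isVx_iff]
    refine ⟨?_, ?_, ?_, ?_, ?_⟩
    · rw [vl_ofV_zero, cst_eq, map_zero]
    · rw [vl_ofV_eq (γ := 0) 𝒰 (by simp)]; rfl
    · rintro _ ⟨γ, rfl⟩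
      obtain ⟨a, ha⟩ := D.v_surjective x γ
      refine ⟨_, ⟨a, rfl⟩, hne.2 ?_, vl_ofV_eq 𝒰 ha⟩
      rintro rfl
      simp at ha
    · rintro _ ⟨a, rfl⟩
      rw [hne, isInt_ofV]
      constructor
      · intro ha
        obtain ⟨γ, hγ⟩ := D.exists_val_eq ha
        exact ⟨γ, vl_ofV_eq 𝒰 hγ⟩
      · by_cases ha : a = 0
        · simp [ha]
        · obtain ⟨γ, hγ⟩ := D.exists_val_eq ha
          rw [vl_ofV_eq 𝒰 hγ, gZero_eq, gLe_ofG, hγ, or_iff_right (hne.2 ha)]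
          exact_mod_cast Iff.rfl
    · rintro _ _ ⟨a, rfl⟩ ⟨b, rfl⟩ ha hb
      rw [hne] at ha hb
      obtain ⟨γ, hγ⟩ := D.exists_val_eq ha
      obtain ⟨δ, hδ⟩ := D.exists_val_eq hb
      rw [vMul_ofV, vAdd_ofV, hne, vl_ofV_eq 𝒰 hγ, vl_ofV_eq 𝒰 hδ, gAdd_ofG]
      refine ⟨vl_ofV_eq 𝒰 (by rw [(D.v x).map_mul, hγ, hδ]; rfl), fun hab => ?_⟩
      obtain ⟨ε, hε⟩ := D.exists_val_eq hab
      have := (D.v x).map_add a b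
      rw [hε, hγ, hδ, min_le_iff] at this
      rw [vl_ofV_eq 𝒰 hε, gLe_ofG, gLe_ofG]
      exact_mod_cast this)

set_option synthInstance.maxHeartbeats 400000 in
set_option synthInstance.maxSize 2000 in
lemma ax_res : ∀ x : M, isC 𝒰 x →
    (∀ a b : M, isVx 𝒰 x a → isVx 𝒰 x b → isK 𝒰 (rs 𝒰 a b) ∧
      (isInt 𝒰 a → isInt 𝒰 b → 
        rs 𝒰 (vAdd 𝒰 a b) (sc 𝒰 x (cst 𝒰 1)) =
          kAdd 𝒰 (rs 𝒰 a (sc 𝒰 x (cst 𝒰 1))) (rs 𝒰 b (sc 𝒰 x (cst 𝒰 1))) ∧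
        rs 𝒰 (vMul 𝒰 a b) (sc 𝒰 x (cst 𝒰 1)) =
          kMul 𝒰 (rs 𝒰 a (sc 𝒰 x (cst 𝒰 1))) (rs 𝒰 b (sc 𝒰 x (cst 𝒰 1)))) ∧
      rs 𝒰 a (sc 𝒰 x (cst 𝒰 0)) = cst 𝒰 0 ∧
      (b ≠ sc 𝒰 x (cst 𝒰 0) → rs 𝒰 (vMul 𝒰 a b) b = rs 𝒰 a (sc 𝒰 x (cst 𝒰 1)))) ∧
    (∀ a : M, isVx 𝒰 x a → ¬ isInt 𝒰 a → rs 𝒰 a (sc 𝒰 x (cst 𝒰 1)) = cst 𝒰 0) := by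
  revert M; apply transfer
  exact (fun D => by
    rintro _ ⟨x, rfl⟩
    have h0 : sc 𝒰 (ofC x : D.Carrier) (cst 𝒰 0) = ofV x 0 := by
      rw [cst_eq, sc_ofC, map_zero, map_zero]; rfl
    have h1 : sc 𝒰 (ofC x : D.Carrier) (cst 𝒰 1) = ofV x 1 := by
      rw [cst_eq, sc_ofC, map_one, map_one]; rfl
    have hne {a : D.VF x} : (ofV x a : D.Carrier) ≠ ofV x 0 ↔ a ≠ 0 := by
      refine not_congr ⟨fun h => by cases h; rfl, fun h => by rw [h]⟩
    have hr (a : D.VF x) (ha : 0 ≤ D.v x a) : D.resDiv x a 1 = D.res x ⟨a, ha⟩ := by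
      rw [Model.resDiv, dif_pos ⟨one_ne_zero, by rwa [div_one]⟩]
      congr 2
      exact div_one a
    rw [h0, h1]
    simp only [isVx_iff]
    refine ⟨?_, ?_⟩
    · rintro _ _ ⟨a, rfl⟩ ⟨b, rfl⟩
      simp only [hne, isInt_ofV, vAdd_ofV, vMul_ofV, rs_ofV, kAdd_ofK, kMul_ofK]
      refine ⟨⟨_, rfl⟩, fun ha hb => ?_, ?_, fun hb => ?_⟩
      · rw [hr a ha, hr b hb, hr (a + b) ((D.v x).map_le_add ha hb),
          hr (a * b) (by rw [(D.v x).map_mul]; exact add_nonneg ha hb), ← map_add, ← map_mul]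
        exact ⟨rfl, rfl⟩
      · rw [Model.resDiv, dif_neg (by simp), cst_eq, map_zero]
      · simp only [Model.resDiv, mul_div_cancel_right₀ a hb, div_one]
        simp [hb]
    · rintro _ ⟨a, rfl⟩ ha
      rw [isInt_ofV] at ha
      rw [rs_ofV, Model.resDiv, dif_neg (by simpa using ha), cst_eq, map_zero])

lemma ax_chart (i : Fin 𝒰.size) (j : Fin (𝒰.dim i)) : ∀ x : M, (inCh 𝒰 i x → isC 𝒰 x) ∧
    (isC 𝒰 x → isK 𝒰 (crd 𝒰 i j x) ∧ isVx 𝒰 x (gn 𝒰 i j x) ∧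
      (¬ inCh 𝒰 i x → crd 𝒰 i j x = cst 𝒰 0)) := by
  revert M; apply transfer
  exact (fun D x => by
    constructor
    · rintro ⟨x, rfl, h⟩; exact ⟨_, rfl⟩
    · rintro ⟨x, rfl⟩
      rw [inCh_ofC, crd_ofC, gn_ofC, cst_eq, map_zero]
      exact ⟨⟨_, rfl⟩, (isVx_iff 𝒰).2 ⟨_, rfl⟩, fun h => by rw [coordAt_of_not_inChart h]⟩)

lemma ax_inCh_isC (i : Fin 𝒰.size) : ∀ x : M, inCh 𝒰 i x → isC 𝒰 x := by
  revert M; apply transfer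
  exact (fun D x => by
    rintro ⟨x, rfl, h⟩; exact ⟨_, rfl⟩)

lemma ax_cover : ∀ x : M, isC 𝒰 x → ∃ i, inCh 𝒰 i x := by
  revert M; apply transfer
  exact (fun D => by
    rintro _ ⟨x, rfl⟩
    obtain ⟨i, hi⟩ := exists_inChart 𝒰 x
    exact ⟨i, (inCh_ofC 𝒰).2 hi⟩)

lemma ax_default_K : ∀ a b : M, (¬ isK 𝒰 a → kNeg 𝒰 a = cst 𝒰 0) ∧
    (¬ (isK 𝒰 a ∧ isK 𝒰 b) → kAdd 𝒰 a b = cst 𝒰 0 ∧ kMul 𝒰 a b = cst 𝒰 0) := by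
  revert M; apply transfer
  intro D a b
  rw [cst_eq, map_zero]
  exact ⟨fun h => by cases a <;> first | exact absurd (isK_ofK 𝒰) h | rfl,
    fun h => by cases a <;> cases b <;>
      first | exact absurd ⟨isK_ofK 𝒰, isK_ofK 𝒰⟩ h | exact ⟨rfl, rfl⟩⟩

lemma ax_default_G : ∀ a b : M, (¬ isG 𝒰 a → gNeg 𝒰 a = cst 𝒰 0) ∧
    (¬ (isG 𝒰 a ∧ isG 𝒰 b) → gAdd 𝒰 a b = cst 𝒰 0) := by
  revert M; apply transfer
  intro D a b
  rw [cst_eq, map_zero]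
  exact ⟨fun h => by cases a <;> first | exact absurd (isG_ofG 𝒰) h | rfl,
    fun h => by cases a <;> cases b <;>
      first | exact absurd ⟨isG_ofG 𝒰, isG_ofG 𝒰⟩ h | rfl⟩

lemma ax_default_C (i : Fin 𝒰.size) (j : Fin (𝒰.dim i)) : ∀ a : M,
    (¬ isC 𝒰 a → crd 𝒰 i j a = cst 𝒰 0 ∧ gn 𝒰 i j a = cst 𝒰 0) := by
  revert M; apply transfer
  intro D a
  rw [cst_eq, map_zero]
  exact fun h => by cases a <;> first | exact absurd (isC_ofC 𝒰) h | exact ⟨rfl, rfl⟩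

lemma ax_default_sec : ∀ a b : M, ¬ (isC 𝒰 a ∧ isK 𝒰 b) → sc 𝒰 a b = cst 𝒰 0 := by
  revert M; apply transfer
  intro D a b
  rw [cst_eq, map_zero]
  exact fun h => by cases a <;> cases b <;>
      first | exact absurd ⟨isC_ofC 𝒰, isK_ofK 𝒰⟩ h | rfl

lemma ax_default_V : ∀ a b : M,
    (¬ isV 𝒰 a → bas 𝒰 a = cst 𝒰 0 ∧ vNeg 𝒰 a = cst 𝒰 0 ∧ vl 𝒰 a = cst 𝒰 0 ∧ ¬ isInt 𝒰 a) ∧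
    (¬ (isV 𝒰 a ∧ isV 𝒰 b ∧ bas 𝒰 b = bas 𝒰 a) →
      vAdd 𝒰 a b = cst 𝒰 0 ∧ vMul 𝒰 a b = cst 𝒰 0 ∧ rs 𝒰 a b = cst 𝒰 0) := by
  revert M; apply transfer
  intro D a b
  rw [cst_eq, map_zero]
  refine ⟨fun h => ?_, fun h => ?_⟩
  · have : ¬ isInt 𝒰 a := fun ⟨x, a, h₁, _⟩ => h ⟨x, a, h₁⟩
    cases a <;> first | exact absurd (isV_ofV 𝒰) h | exact ⟨rfl, rfl, rfl, this⟩
  · cases a <;> cases b <;> first | exact ⟨rfl, rfl, rfl⟩ | skip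
    rename_i x a y b
    have hxy : ¬ y = x := by
      rintro rfl; exact h ⟨isV_ofV 𝒰, isV_ofV 𝒰, rfl⟩
    exact ⟨dif_neg hxy, dif_neg hxy, dif_neg hxy⟩

lemma ax_chart_mem (i : Fin 𝒰.size) (F) (hF : F ∈ chartIdeal 𝒰 i) : ∀ x : M, inCh 𝒰 i x →
    (polyK 𝒰 F).realize (fun j => crd 𝒰 i j x) = cst 𝒰 0 := by
  revert M; apply transfer
  rintro D _ ⟨x, rfl, hx⟩
  rw [cst_eq, map_zero]
  exact (realize_polyK_ofK F _).trans (congrArg ofK (eval₂_coordAt_eq_zero hx hF))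

lemma ax_chart_exists (i : Fin 𝒰.size) (s : Finset (MvPolynomial (Fin (𝒰.dim i)) f))
    (hs : ∀ {R : Type u} [CommRing R] (g : f →+* R) (a : Fin (𝒰.dim i) → R),
      (∀ F ∈ s, MvPolynomial.eval₂ g a F = 0) → ∀ F ∈ chartIdeal 𝒰 i, MvPolynomial.eval₂ g a F = 0) :
    ∀ a : Fin (𝒰.dim i) → M, (∀ j, isK 𝒰 (a j)) →
      (∀ F : s, (polyK 𝒰 F.1).realize (fun j => a j) = cst 𝒰 0) →
      ∃ x : M, inCh 𝒰 i x ∧ ∀ j, crd 𝒰 i j x = a j := by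
  revert M; apply transfer
  intro D a ha h
  choose a' ha' using ha
  obtain rfl : a = fun j => ofK (a' j) := funext ha'
  simp only [realize_polyK_ofK, cst_eq, map_zero, ofK.injEq] at h
  obtain ⟨x, hx, hx'⟩ := exists_point_of_coords (s := algebraMap f D.k) i a'
    (hs _ _ fun F hF => h ⟨F, hF⟩)
  exact ⟨ofC x, (inCh_ofC 𝒰).2 hx, fun j => congrArg ofK (congrFun hx' j)⟩

lemma ax_diagonal (i j : Fin 𝒰.size)
    (J : Ideal (MvPolynomial (Fin (𝒰.dim i) ⊕ Fin (𝒰.dim j)) f))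
    (hJ : ∀ {K : Type u} [Field K] {s : f →+* K} {y z : Point p s},
      InChart 𝒰 y i → InChart 𝒰 z j →
      (y = z ↔ ∀ F ∈ J, MvPolynomial.eval₂ s (Sum.elim (coordAt 𝒰 y i) (coordAt 𝒰 z j)) F = 0))
    (s : Finset (MvPolynomial (Fin (𝒰.dim i) ⊕ Fin (𝒰.dim j)) f)) (hsJ : ∀ F ∈ s, F ∈ J)
    (hs : ∀ {R : Type u} [CommRing R] (g : f →+* R) (a : Fin (𝒰.dim i) ⊕ Fin (𝒰.dim j) → R),
      (∀ F ∈ s, MvPolynomial.eval₂ g a F = 0) → ∀ F ∈ J, MvPolynomial.eval₂ g a F = 0) :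
    ∀ x y : M, inCh 𝒰 i x → inCh 𝒰 j y → (x = y ↔
      ∀ F : s, (polyK 𝒰 F.1).realize
        (fun l => Sum.elim (fun l => crd 𝒰 i l x) (fun l => crd 𝒰 j l y) l) = cst 𝒰 0) := by
  revert M; apply transfer
  rintro D _ _ ⟨x, rfl, hx⟩ ⟨y, rfl, hy⟩
  have h1 : (fun l => Sum.elim (fun l => crd 𝒰 i l (ofC x : D.Carrier))
      (fun l => crd 𝒰 j l (ofC y)) l) =
      fun l => ofK (Sum.elim (coordAt 𝒰 x i) (coordAt 𝒰 y j) l) := by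
    funext l; cases l <;> rfl
  simp only [h1, realize_polyK_ofK, cst_eq, map_zero, ofK.injEq, ofC.injEq]
  rw [hJ hx hy]
  exact ⟨fun h F => h _ (hsJ _ F.2), fun h => hs _ _ fun F hF => h ⟨F, hF⟩⟩

lemma ax_gen_mem (i : Fin 𝒰.size) (F) (hF : F ∈ chartIdeal 𝒰 i) : ∀ x : M, isC 𝒰 x →
    (polyV 𝒰 F).realize (fun o => o.elim x fun j => gn 𝒰 i j x) = sc 𝒰 x (cst 𝒰 0) := by
  revert M; apply transfer
  rintro D _ ⟨x, rfl⟩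
  obtain ⟨φ, hφ, -⟩ := D.val_c x
  refine (realize_polyV_ofV F x _).trans ?_
  rw [cst_eq, sc_ofC, map_zero, map_zero]
  exact congrArg (ofV x) (eval₂_coordAt_eq_zero (hφ.inChart i) hF)

lemma ax_gen_diagonal (i j : Fin 𝒰.size)
    (J : Ideal (MvPolynomial (Fin (𝒰.dim i) ⊕ Fin (𝒰.dim j)) f))
    (hJ : ∀ {K : Type u} [Field K] {s : f →+* K} {y z : Point p s},
      InChart 𝒰 y i → InChart 𝒰 z j →
      (y = z ↔ ∀ F ∈ J, MvPolynomial.eval₂ s (Sum.elim (coordAt 𝒰 y i) (coordAt 𝒰 z j)) F = 0))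
    (F) (hF : F ∈ J) : ∀ x : M, isC 𝒰 x →
    (polyV 𝒰 F).realize (fun o => o.elim x fun l => Sum.elim (fun l => gn 𝒰 i l x)
      (fun l => gn 𝒰 j l x) l) = sc 𝒰 x (cst 𝒰 0) := by
  revert M; apply transfer
  rintro D _ ⟨x, rfl⟩
  obtain ⟨φ, hφ, -⟩ := D.val_c x
  have h1 : (fun l => Sum.elim (fun l => gn 𝒰 i l (ofC x : D.Carrier))
      (fun l => gn 𝒰 j l (ofC x)) l) =
      fun l => ofV x (Sum.elim (coordAt 𝒰 (D.c x) i) (coordAt 𝒰 (D.c x) j) l) := by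
    funext l; cases l <;> rfl
  simp only [h1]
  refine (realize_polyV_ofV F x _).trans ?_
  rw [cst_eq, sc_ofC, map_zero, map_zero]
  exact congrArg (ofV x) ((hJ (hφ.inChart i) (hφ.inChart j)).1 rfl F hF)

lemma ax_gen_val (i : Fin 𝒰.size) : ∀ x : M, inCh 𝒰 i x →
    (∀ j, vAdd 𝒰 (gn 𝒰 i j x) (vNeg 𝒰 (sc 𝒰 x (crd 𝒰 i j x))) = sc 𝒰 x (cst 𝒰 0) ∨
      gLe 𝒰 (gOne 𝒰) (vl 𝒰 (vAdd 𝒰 (gn 𝒰 i j x) (vNeg 𝒰 (sc 𝒰 x (crd 𝒰 i j x)))))) ∧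
    (∃ j, vl 𝒰 (vAdd 𝒰 (gn 𝒰 i j x) (vNeg 𝒰 (sc 𝒰 x (crd 𝒰 i j x)))) = gOne 𝒰) := by
  revert M; apply transfer
  rintro D _ ⟨x, rfl, hx⟩
  obtain ⟨h1, j₀, h2⟩ := D.gen_coord hx
  have h0 (j) : vAdd 𝒰 (gn 𝒰 i j (ofC x : D.Carrier)) (vNeg 𝒰 (sc 𝒰 (ofC x) (crd 𝒰 i j (ofC x)))) =
      ofV x (coordAt 𝒰 (D.c x) i j - D.constV x (coordAt 𝒰 x i j)) := by
    rw [gn_ofC, crd_ofC, sc_ofC, vNeg_ofV, vAdd_ofV, sub_eq_add_neg]; rfl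
  simp only [h0]
  refine ⟨fun j => ?_, j₀, vl_ofV_eq 𝒰 h2⟩
  by_cases h : coordAt 𝒰 (D.c x) i j - D.constV x (coordAt 𝒰 x i j) = 0
  · left
    rw [h, cst_eq, sc_ofC, map_zero, map_zero]; rfl
  · right
    obtain ⟨γ, hγ⟩ := D.exists_val_eq h
    rw [vl_ofV_eq 𝒰 hγ, gOne_eq, gLe_ofG]
    have := h1 j
    rw [hγ] at this
    exact_mod_cast this

end Axioms

end CurveACVF
end

noncomputable section
namespace CurveACVF

open FirstOrder FirstOrder.Language FirstOrder.Language.Structure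

section OfModel

variable {f : Type u} [Field f] {C : Scheme.{u}} {p : C ⟶ Spec (CommRingCat.of f)}
  [SmoothOfRelativeDimension 1 p] [GeometricallyIntegral p]
  {𝒰 : Atlas p} {M : Type u} [(lang 𝒰).Structure M] (hM : M ⊨ theory 𝒰)

/-- The sort `k` of a model of the theory. -/
def SortK (_ : M ⊨ theory 𝒰) : Type u := {m : M // isK 𝒰 m}

instance : Field (SortK hM) := (ax_fieldK hM).field

/-- The constants of a model of the theory. -/
def constK : f →+* SortK hM where
  toFun r := ⟨cst 𝒰 r, (ax_cst hM r r).1⟩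
  map_zero' := rfl
  map_one' := rfl
  map_add' r s := Subtype.ext (ax_cst hM r s).2.1
  map_mul' r s := Subtype.ext (ax_cst hM r s).2.2

instance : Algebra f (SortK hM) := (constK hM).toAlgebra

lemma realize_polyK_sortK {σ : Type} (F : MvPolynomial σ f) (a : σ → SortK hM) :
    (polyK 𝒰 F).realize (fun j => (a j).1) =
      (MvPolynomial.eval₂ (algebraMap f (SortK hM)) a F).1 :=
  realize_polyK F (fun a : SortK hM => a.1) a (fun _ _ => rfl) (fun _ _ => rfl) fun _ => rfl

instance : IsAlgClosed (SortK hM) :=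
  isAlgClosed_of_genericMonic (algebraMap f (SortK hM)) fun n a => by
    obtain ⟨b, hb, hba, h⟩ := ax_rootK hM n (fun i => (a i).1) fun i => (a i).2
    refine ⟨⟨b 0, hb⟩, Subtype.ext ?_⟩
    rw [← realize_polyK_sortK]
    refine Eq.trans (congrArg (fun w => (polyK 𝒰 (genericMonic f n)).realize w) ?_) h
    funext j
    refine Fin.cases rfl (fun i => (hba i).symm) j

/-- The sort `Γ` of a model of the theory. -/
def SortG (_ : M ⊨ theory 𝒰) : Type u := {m : M // isG 𝒰 m}

instance : Add (SortG hM) :=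
  ⟨fun a b => ⟨gAdd 𝒰 a.1 b.1, ((ax_group hM).2.2.2.2.2.2.1 _ _ a.2 b.2).1⟩⟩
instance : Zero (SortG hM) := ⟨⟨gZero 𝒰, (ax_group hM).1⟩⟩
instance : Neg (SortG hM) := ⟨fun a => ⟨gNeg 𝒰 a.1, ((ax_group hM).2.2.2.2.1 _ a.2).1⟩⟩

instance : AddCommGroup (SortG hM) :=
  have hz (a : SortG hM) : 0 + a = a := Subtype.ext ((ax_group hM).2.2.2.2.1 _ a.2).2.1
  have hc (a b : SortG hM) : a + b = b + a :=
    Subtype.ext ((ax_group hM).2.2.2.2.2.2.1 _ _ a.2 b.2).2.1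
  { add_assoc := fun a b c => Subtype.ext ((ax_group hM).2.2.2.2.2.2.2 _ _ _ a.2 b.2 c.2).1
    zero_add := hz
    add_zero := fun a => by rw [hc, hz]
    add_comm := hc
    neg_add_cancel := fun a => Subtype.ext ((ax_group hM).2.2.2.2.1 _ a.2).2.2.1
    nsmul := nsmulRec
    zsmul := zsmulRec }

open Classical in
instance : LinearOrder (SortG hM) where
  le a b := gLe 𝒰 a.1 b.1
  le_refl a := ((ax_group hM).2.2.2.2.1 _ a.2).2.2.2
  le_trans a b c := ((ax_group hM).2.2.2.2.2.2.2 _ _ _ a.2 b.2 c.2).2.1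
  le_antisymm a b h h' := Subtype.ext (((ax_group hM).2.2.2.2.2.1 _ _ h).2.2 h')
  le_total a b := ((ax_group hM).2.2.2.2.2.2.1 _ _ a.2 b.2).2.2
  toDecidableLE := Classical.decRel _

instance : IsOrderedAddMonoid (SortG hM) where
  add_le_add_left a b h c := by
    rw [add_comm a, add_comm b]
    exact ((ax_group hM).2.2.2.2.2.2.2 _ _ _ a.2 b.2 c.2).2.2 h

/-- The distinguished element of the sort `Γ`. -/
def oneG : SortG hM := ⟨gOne 𝒰, (ax_group hM).2.1⟩

lemma oneG_pos : 0 < oneG hM :=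
  lt_of_le_of_ne (ax_group hM).2.2.1 fun h => (ax_group hM).2.2.2.1 (congrArg Subtype.val h)

section Points

include hM in
lemma crd_isK {x : M} (hx : isC 𝒰 x) (i j) : isK 𝒰 (crd 𝒰 i j x) := ((ax_chart hM i j x).2 hx).1

/-- The coordinates of an element of the sort of points. -/
def crdK {x : M} (hx : isC 𝒰 x) (i : Fin 𝒰.size) (j : Fin (𝒰.dim i)) : SortK hM :=
  ⟨crd 𝒰 i j x, crd_isK hM hx i j⟩

lemma exists_toPoint {x : M} {i : Fin 𝒰.size} (hx : inCh 𝒰 i x) :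
    ∃ x' : Point p (algebraMap f (SortK hM)), InChart 𝒰 x' i ∧
      coordAt 𝒰 x' i = crdK hM (ax_inCh_isC hM i x hx) i := by
  refine exists_point_of_coords (s := algebraMap f (SortK hM)) i _ fun F hF => Subtype.ext ?_
  rw [← realize_polyK_sortK]
  exact ax_chart_mem hM i F hF x hx

lemma exists_ofPoint {x' : Point p (algebraMap f (SortK hM))} {i : Fin 𝒰.size}
    (hx' : InChart 𝒰 x' i) :
    ∃ (x : M) (hx : inCh 𝒰 i x), coordAt 𝒰 x' i = crdK hM (ax_inCh_isC hM i x hx) i := by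
  obtain ⟨s, hsJ, hs⟩ := exists_finset_eval₂ (chartIdeal 𝒰 i)
  obtain ⟨x, hx, h⟩ := ax_chart_exists hM i s hs (fun j => (coordAt 𝒰 x' i j).1)
    (fun j => (coordAt 𝒰 x' i j).2) (fun F => by
      rw [realize_polyK_sortK, eval₂_coordAt_eq_zero hx' (hsJ F.2)]; rfl)
  exact ⟨x, hx, funext fun j => Subtype.ext (h j).symm⟩

variable [IsSeparated p]

lemma sort_diagonal {i j : Fin 𝒰.size} {x y : M} (hx : inCh 𝒰 i x) (hy : inCh 𝒰 j y)
    {x' y' : Point p (algebraMap f (SortK hM))} (hx' : InChart 𝒰 x' i) (hy' : InChart 𝒰 y' j)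
    (hxx : coordAt 𝒰 x' i = crdK hM (ax_inCh_isC hM i x hx) i)
    (hyy : coordAt 𝒰 y' j = crdK hM (ax_inCh_isC hM j y hy) j) : x = y ↔ x' = y' := by
  obtain ⟨J, hJ⟩ := exists_diagonal_ideal (𝒰 := 𝒰) i j
  obtain ⟨s, hsJ, hs⟩ := exists_finset_eval₂ J
  rw [ax_diagonal hM i j J hJ s hsJ hs x y hx hy, hJ hx' hy', hxx, hyy]
  have h1 : (fun l => Sum.elim (fun l => crd 𝒰 i l x) (fun l => crd 𝒰 j l y) l) =
      fun l => (Sum.elim (crdK hM (ax_inCh_isC hM i x hx) i)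
        (crdK hM (ax_inCh_isC hM j y hy) j) l).1 := by
    funext l; cases l <;> rfl
  simp only [h1, realize_polyK_sortK]
  exact ⟨fun h => hs _ _ fun F hF => Subtype.ext (h ⟨F, hF⟩),
    fun h F => congrArg Subtype.val (h _ (hsJ F.2))⟩

lemma exists_point_ofSort (x' : Point p (algebraMap f (SortK hM))) :
    ∃ (x : M) (hx : isC 𝒰 x), ∀ i, (inCh 𝒰 i x ↔ InChart 𝒰 x' i) ∧
      coordAt 𝒰 x' i = crdK hM hx i := by
  obtain ⟨i₀, h₀⟩ := exists_inChart 𝒰 x'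
  obtain ⟨x, hx, hxx⟩ := exists_ofPoint hM h₀
  have key (i : Fin 𝒰.size) (hi : inCh 𝒰 i x) : InChart 𝒰 x' i ∧
      coordAt 𝒰 x' i = crdK hM (ax_inCh_isC hM _ x hx) i := by
    obtain ⟨y', hy', hyy⟩ := exists_toPoint hM hi
    obtain rfl := (sort_diagonal hM hx hi h₀ hy' hxx hyy).1 rfl
    exact ⟨hy', hyy⟩
  have key' (i : Fin 𝒰.size) (hi : InChart 𝒰 x' i) : inCh 𝒰 i x := by
    obtain ⟨y, hy, hyy⟩ := exists_ofPoint hM hi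
    obtain rfl := (sort_diagonal hM hx hy h₀ hi hxx hyy).2 rfl
    exact hy
  refine ⟨x, ax_inCh_isC hM _ x hx, fun i => ⟨⟨fun h => (key i h).1, key' i⟩, ?_⟩⟩
  by_cases hi : inCh 𝒰 i x
  · exact (key i hi).2
  · funext j
    rw [coordAt_of_not_inChart fun h => hi (key' i h)]
    exact Subtype.ext (((ax_chart hM i j x).2 (ax_inCh_isC hM _ x hx)).2.2 hi).symm

/-- The element of the sort of points given by a point. -/
def ofPoint (x : Point p (algebraMap f (SortK hM))) : M := (exists_point_ofSort hM x).choose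

lemma isC_ofPoint (x : Point p (algebraMap f (SortK hM))) : isC 𝒰 (ofPoint hM x) :=
  (exists_point_ofSort hM x).choose_spec.choose

lemma inCh_ofPoint (x : Point p (algebraMap f (SortK hM))) (i) :
    inCh 𝒰 i (ofPoint hM x) ↔ InChart 𝒰 x i :=
  ((exists_point_ofSort hM x).choose_spec.choose_spec i).1

lemma crd_ofPoint (x : Point p (algebraMap f (SortK hM))) (i j) :
    crd 𝒰 i j (ofPoint hM x) = (coordAt 𝒰 x i j).1 :=
  congrArg Subtype.val (congrFun ((exists_point_ofSort hM x).choose_spec.choose_spec i).2 j).symm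

lemma ofPoint_injective : Function.Injective (ofPoint hM) := by
  intro x y h
  obtain ⟨i, hi⟩ := exists_inChart 𝒰 x
  have hi' : InChart 𝒰 y i := by rwa [← inCh_ofPoint hM, ← h, inCh_ofPoint]
  refine point_ext hi hi' fun j => Subtype.ext ?_
  rw [← crd_ofPoint, ← crd_ofPoint, h]

lemma exists_ofPoint_eq {x : M} (hx : isC 𝒰 x) : ∃ x', ofPoint hM x' = x := by
  obtain ⟨i, hi⟩ := ax_cover hM x hx
  obtain ⟨x', hx', hxx⟩ := exists_toPoint hM hi
  refine ⟨x', (sort_diagonal hM ((inCh_ofPoint hM x' i).2 hx') hi hx' hx' ?_ hxx).2 rfl⟩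
  funext j
  exact Subtype.ext (crd_ofPoint hM x' i j).symm

end Points

section Fibers

variable [IsSeparated p] (x : Point p (algebraMap f (SortK hM)))

/-- The fibers of the sort `VF`. -/
def SortV : Type u := {m : M // isVx 𝒰 (ofPoint hM x) m}

instance : Field (SortV hM x) := (ax_fieldV hM _ (isC_ofPoint hM x)).field

/-- The embedding of the sort `k` in the fibers of the sort `VF`. -/
def secV : SortK hM →+* SortV hM x where
  toFun a := ⟨sc 𝒰 (ofPoint hM x) a.1, (ax_sec hM _ _ _ (isC_ofPoint hM x) a.2 a.2).1⟩
  map_zero' := rfl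
  map_one' := rfl
  map_add' a b := Subtype.ext (ax_sec hM _ _ _ (isC_ofPoint hM x) a.2 b.2).2.1
  map_mul' a b := Subtype.ext (ax_sec hM _ _ _ (isC_ofPoint hM x) a.2 b.2).2.2.1

lemma realize_polyV_sortV {σ : Type} (F : MvPolynomial σ f) (a : σ → SortV hM x) :
    (polyV 𝒰 F).realize (fun o => o.elim (ofPoint hM x) fun j => (a j).1) =
      (MvPolynomial.eval₂ ((secV hM x).comp (algebraMap f (SortK hM))) a F).1 :=
  realize_polyV F (fun a : SortV hM x => a.1) a _ (fun _ _ => rfl) (fun _ _ => rfl) fun _ => rfl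

instance : IsAlgClosed (SortV hM x) :=
  isAlgClosed_of_genericMonic ((secV hM x).comp (algebraMap f (SortK hM))) fun n a => by
    obtain ⟨b, hb, hba, h⟩ := ax_rootV hM n _ (isC_ofPoint hM x) (fun i => (a i).1) fun i => (a i).2
    refine ⟨⟨b 0, hb⟩, Subtype.ext ?_⟩
    rw [← realize_polyV_sortV]
    refine Eq.trans (congrArg (fun w => (polyV 𝒰 (genericMonic f n)).realize w) ?_) h
    funext o
    cases o with
    | none => rfl
    | some j => exact Fin.cases rfl (fun i => (hba i).symm) j

lemma sortV_ne_zero {a : SortV hM x} (ha : a ≠ 0) : a.1 ≠ sc 𝒰 (ofPoint hM x) (cst 𝒰 0) :=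
  fun h => ha (Subtype.ext h)

/-- The value of a nonzero element. -/
def vlG {a : SortV hM x} (ha : a ≠ 0) : SortG hM :=
  ⟨vl 𝒰 a.1, ((ax_val hM _ (isC_ofPoint hM x)).2.2.2.1 a.1 a.2).1 (sortV_ne_zero hM x ha)⟩

open Classical in
/-- The valuation of the fibers of the sort `VF`. -/
def valFun (a : SortV hM x) : WithTop (SortG hM) := if ha : a ≠ 0 then (vlG hM x ha : SortG hM) else ⊤

lemma valFun_of_ne {a : SortV hM x} (ha : a ≠ 0) : valFun hM x a = (vlG hM x ha : SortG hM) :=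
  dif_pos ha

lemma valFun_zero : valFun hM x 0 = ⊤ := dif_neg fun h => h rfl

/-- The valuation of the fibers of the sort `VF`. -/
def valV : AddValuation (SortV hM x) (WithTop (SortG hM)) :=
  AddValuation.of (valFun hM x) (valFun_zero hM x)
    (by
      rw [valFun_of_ne hM x one_ne_zero]
      exact congrArg _ (Subtype.ext (ax_val hM _ (isC_ofPoint hM x)).2.1))
    (fun a b => by
      by_cases ha : a = 0
      · simp [ha]
      by_cases hb : b = 0
      · simp [hb]
      by_cases hab : a + b = 0
      · rw [hab, valFun_zero]; exact le_top
      rw [valFun_of_ne hM x ha, valFun_of_ne hM x hb, valFun_of_ne hM x hab, min_le_iff,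
        WithTop.coe_le_coe, WithTop.coe_le_coe]
      exact ((ax_val hM _ (isC_ofPoint hM x)).2.2.2.2 a.1 b.1 a.2 b.2 (sortV_ne_zero hM x ha)
        (sortV_ne_zero hM x hb)).2 (sortV_ne_zero hM x hab))
    (fun a b => by
      by_cases ha : a = 0
      · simp [ha, valFun_zero]
      by_cases hb : b = 0
      · simp [hb, valFun_zero]
      rw [valFun_of_ne hM x ha, valFun_of_ne hM x hb, valFun_of_ne hM x (mul_ne_zero ha hb),
        ← WithTop.coe_add]
      exact congrArg _ (Subtype.ext ((ax_val hM _ (isC_ofPoint hM x)).2.2.2.2 a.1 b.1 a.2 b.2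
        (sortV_ne_zero hM x ha) (sortV_ne_zero hM x hb)).1))

lemma valV_of_ne {a : SortV hM x} (ha : a ≠ 0) : valV hM x a = (vlG hM x ha : SortG hM) :=
  valFun_of_ne hM x ha

lemma zero_le_valV {a : SortV hM x} : 0 ≤ valV hM x a ↔ isInt 𝒰 a.1 := by
  rw [((ax_val hM _ (isC_ofPoint hM x)).2.2.2.1 a.1 a.2).2]
  by_cases ha : a = 0
  · subst ha
    rw [AddValuation.map_zero]
    exact iff_of_true le_top (.inl rfl)
  · rw [valV_of_ne hM x ha, or_iff_right (sortV_ne_zero hM x ha)]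
    exact WithTop.coe_le_coe (b := (0 : SortG hM))

/-- The residue of an element of the fibers of the sort `VF`. -/
def rsK (a : SortV hM x) : SortK hM :=
  ⟨rs 𝒰 a.1 (1 : SortV hM x).1,
    (((ax_res hM _ (isC_ofPoint hM x)).1 a.1 (1 : SortV hM x).1) a.2 (1 : SortV hM x).2).1⟩

/-- The residue map of the fibers of the sort `VF`. -/
def resV : valuationRing (valV hM x) →+* SortK hM where
  toFun a := rsK hM x a.1
  map_zero' := Subtype.ext
    (ax_sec hM _ _ _ (isC_ofPoint hM x) (0 : SortK hM).2 (0 : SortK hM).2).2.2.2.2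
  map_one' := Subtype.ext
    (ax_sec hM _ _ _ (isC_ofPoint hM x) (1 : SortK hM).2 (1 : SortK hM).2).2.2.2.2
  map_add' a b := Subtype.ext
    (((ax_res hM _ (isC_ofPoint hM x)).1 a.1.1 b.1.1 a.1.2 b.1.2).2.1
      ((zero_le_valV hM x).1 a.2) ((zero_le_valV hM x).1 b.2)).1
  map_mul' a b := Subtype.ext
    (((ax_res hM _ (isC_ofPoint hM x)).1 a.1.1 b.1.1 a.1.2 b.1.2).2.1
      ((zero_le_valV hM x).1 a.2) ((zero_le_valV hM x).1 b.2)).2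

/-- The section of the residue map of the fibers of the sort `VF`. -/
def secRing : SortK hM →+* valuationRing (valV hM x) :=
  (secV hM x).codRestrict _ fun a => (zero_le_valV hM x).2
    (ax_sec hM _ _ _ (isC_ofPoint hM x) a.2 a.2).2.2.2.1

/-- The coordinates of the generic point in the fibers of the sort `VF`. -/
def gnV (i : Fin 𝒰.size) (j : Fin (𝒰.dim i)) : SortV hM x :=
  ⟨gn 𝒰 i j (ofPoint hM x), ((ax_chart hM i j _).2 (isC_ofPoint hM x)).2.1⟩

lemma exists_genPoint :
    ∃ c : Point p ((((valuationRing (valV hM x)).subtype).comp (secRing hM x)).comp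
      (algebraMap f (SortK hM))), ∀ i, InChart 𝒰 c i ∧ coordAt 𝒰 c i = gnV hM x i := by
  obtain ⟨i₀, -⟩ := exists_chart 𝒰
  have key (i) : ∃ c : Point p ((((valuationRing (valV hM x)).subtype).comp (secRing hM x)).comp
      (algebraMap f (SortK hM))), InChart 𝒰 c i ∧ coordAt 𝒰 c i = gnV hM x i := by
    refine exists_point_of_coords i (gnV hM x i) fun F hF => Subtype.ext ?_
    exact (realize_polyV_sortV hM x F _).symm.trans (ax_gen_mem hM i F hF _ (isC_ofPoint hM x))
  obtain ⟨c, hc, hcc⟩ := key i₀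
  refine ⟨c, fun i => ?_⟩
  obtain ⟨c', hc', hcc'⟩ := key i
  obtain ⟨J, hJ⟩ := exists_diagonal_ideal (𝒰 := 𝒰) i₀ i
  have : c = c' := by
    rw [hJ hc hc', hcc, hcc']
    intro F hF
    refine Subtype.ext ((realize_polyV_sortV hM x F _).symm.trans
      (Eq.trans ?_ (ax_gen_diagonal hM i₀ i J hJ F hF _ (isC_ofPoint hM x))))
    congr 1
    funext o
    rcases o with _ | _ | _ <;> rfl
  rw [this]; exact ⟨hc', hcc'⟩

/-- The generic point near `x`. -/
def genPoint := (exists_genPoint hM x).choose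

lemma inChart_genPoint (i) : InChart 𝒰 (genPoint hM x) i := ((exists_genPoint hM x).choose_spec i).1
lemma coordAt_genPoint (i) : coordAt 𝒰 (genPoint hM x) i = gnV hM x i :=
  ((exists_genPoint hM x).choose_spec i).2

lemma valV_secV {a : SortK hM} (ha : a ≠ 0) : valV hM x (secV hM x a) = 0 := by
  have h1 (a) : 0 ≤ valV hM x (secV hM x a) := (secRing hM x a).2
  have h3 : valV hM x (secV hM x a) + valV hM x (secV hM x a⁻¹) = 0 := by
    rw [← (valV hM x).map_mul, ← map_mul, mul_inv_cancel₀ ha, map_one, (valV hM x).map_one]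
  exact le_antisymm (by rw [← h3]; exact le_add_of_nonneg_right (h1 _)) (h1 a)

end Fibers

variable [IsSeparated p]

/-- The structure given by a model of the theory. -/
def toModel : Model p where
  k := SortK hM
  Γ := SortG hM
  one := oneG hM
  one_pos := oneG_pos hM
  VF := SortV hM
  v := valV hM
  v_surjective x γ := by
    obtain ⟨a, ha, ha0, h⟩ := (ax_val hM _ (isC_ofPoint hM x)).2.2.1 γ.1 γ.2
    have h0 : (⟨a, ha⟩ : SortV hM x) ≠ (0 : SortV hM x) :=
      fun h' => ha0 (congrArg (fun b : SortV hM x => b.1) h')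
    exact ⟨⟨a, ha⟩, (valV_of_ne hM x h0).trans (congrArg _ (Subtype.ext h))⟩
  res := resV hM
  sec := secRing hM
  res_comp_sec x := RingHom.ext fun a => Subtype.ext
    (ax_sec hM _ _ _ (isC_ofPoint hM x) a.2 a.2).2.2.2.2
  c := genPoint hM
  val_c x := by
    obtain ⟨i, hi⟩ := exists_inChart 𝒰 x
    refine (exists_isEvaluationAt_iff (fun a ha => valV_secV hM x ha) (oneG_pos hM) _ hi).2
      ⟨inChart_genPoint hM x i, ?_⟩
    have h0 (j) : (gnV hM x i j - secV hM x (coordAt 𝒰 x i j)).1 =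
        vAdd 𝒰 (gn 𝒰 i j (ofPoint hM x)) (vNeg 𝒰 (sc 𝒰 (ofPoint hM x)
          (crd 𝒰 i j (ofPoint hM x)))) := by
      rw [sub_eq_add_neg, crd_ofPoint]; rfl
    obtain ⟨h1, j₀, h2⟩ := ax_gen_val hM i (ofPoint hM x) ((inCh_ofPoint hM x i).2 hi)
    have hc (j) : valV hM x (gnV hM x i j - secV hM x (coordAt 𝒰 x i j)) =
        valV hM x (coordAt 𝒰 (genPoint hM x) i j - secV hM x (coordAt 𝒰 x i j)) :=
      congrArg (fun z => valV hM x (z - secV hM x (coordAt 𝒰 x i j)))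
        (congrFun (coordAt_genPoint hM x i) j).symm
    refine ⟨fun j => le_of_le_of_eq ?_ (hc j), j₀, (hc j₀).symm.trans ?_⟩
    · by_cases h : gnV hM x i j - secV hM x (coordAt 𝒰 x i j) = 0
      · rw [h, AddValuation.map_zero]; exact le_top
      · rw [valV_of_ne hM x h, WithTop.coe_le_coe]
        have := (h1 j).resolve_left (by rw [← h0]; exact sortV_ne_zero hM x h)
        rw [← h0] at this
        exact this
    · rw [← h0] at h2
      by_cases h : gnV hM x i j₀ - secV hM x (coordAt 𝒰 x i j₀) = 0
      · exfalso
        have h3 : vl 𝒰 (gnV hM x i j₀ - secV hM x (coordAt 𝒰 x i j₀)).1 = cst 𝒰 0 := by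
          rw [h]; exact (ax_val hM _ (isC_ofPoint hM x)).1
        rw [h2] at h3
        have h4 := (ax_sorts hM (gOne 𝒰)).2.1 (by rw [h3]; exact (0 : SortK hM).2)
        exact h4.2.1 (oneG hM).2
      · rw [valV_of_ne hM x h]
        exact congrArg _ (Subtype.ext h2)

end OfModel

end CurveACVF
end

noncomputable section
namespace CurveACVF

open FirstOrder FirstOrder.Language FirstOrder.Language.Structure

section OfModel

variable {f : Type u} [Field f] {C : Scheme.{u}} {p : C ⟶ Spec (CommRingCat.of f)}
  [SmoothOfRelativeDimension 1 p] [GeometricallyIntegral p] [IsSeparated p]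
  {𝒰 : Atlas p} {M : Type u} [(lang 𝒰).Structure M] (hM : M ⊨ theory 𝒰)

open Model.Carrier

/-- The comparison of a model of the theory and the structure that it defines. -/
def fromCarrier : (toModel hM).Carrier → M
  | ofK a => a.1
  | ofC x => ofPoint hM x
  | ofG γ => γ.1
  | ofV _ a => a.1

lemma absurd_of_eq {α : Type*} {P : α → Prop} {a b : α} {q : Prop} (h : a = b) (h₁ : ¬ P a)
    (h₂ : P b) : q := absurd (h ▸ h₂) h₁

lemma fromCarrier_bijective : Function.Bijective (fromCarrier hM) := by
  have hs := ax_sorts hM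
  constructor
  · intro a b h
    cases a with
    | ofK a =>
      have h1 := (hs _).2.1 a.2
      cases b with
      | ofK b => exact congrArg ofK (Subtype.ext h)
      | ofC b => exact absurd_of_eq h h1.1 (isC_ofPoint hM b)
      | ofG b => exact absurd_of_eq h h1.2.1 b.2
      | ofV x b => exact absurd_of_eq h h1.2.2 b.2.1
    | ofC a =>
      have h1 := (hs _).2.2.1 (isC_ofPoint hM a)
      cases b with
      | ofK b => exact absurd_of_eq h.symm ((hs _).2.1 b.2).1 (isC_ofPoint hM a)
      | ofC b => exact congrArg ofC (ofPoint_injective hM h)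
      | ofG b => exact absurd_of_eq h h1.1 b.2
      | ofV x b => exact absurd_of_eq h h1.2 b.2.1
    | ofG a =>
      have h1 := (hs _).2.2.2 a.2
      cases b with
      | ofK b => exact absurd_of_eq h.symm ((hs _).2.1 b.2).2.1 a.2
      | ofC b => exact absurd_of_eq h.symm ((hs _).2.2.1 (isC_ofPoint hM b)).1 a.2
      | ofG b => exact congrArg ofG (Subtype.ext h)
      | ofV x b => exact absurd_of_eq h h1 b.2.1
    | ofV x a =>
      cases b with
      | ofK b => exact absurd_of_eq h.symm ((hs _).2.1 b.2).2.2 a.2.1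
      | ofC b => exact absurd_of_eq h.symm ((hs _).2.2.1 (isC_ofPoint hM b)).2 a.2.1
      | ofG b => exact absurd_of_eq h.symm ((hs _).2.2.2 b.2) a.2.1
      | ofV y b =>
        have h1 : a.1 = b.1 := h
        have h2 : ofPoint hM x = ofPoint hM y := by rw [← a.2.2, ← b.2.2, h1]
        obtain rfl := ofPoint_injective hM h2
        exact congrArg (ofV x) (Subtype.ext h1)
  · intro m
    rcases (hs m).1 with h | h | h | h
    · exact ⟨ofK ⟨m, h⟩, rfl⟩
    · obtain ⟨x, hx⟩ := exists_ofPoint_eq hM h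
      exact ⟨ofC x, hx⟩
    · exact ⟨ofG ⟨m, h⟩, rfl⟩
    · obtain ⟨x, hx⟩ := exists_ofPoint_eq hM (ax_base hM m h)
      exact ⟨ofV x ⟨m, h, hx.symm⟩, rfl⟩

lemma isK_fromCarrier (a : (toModel hM).Carrier) : isK 𝒰 (fromCarrier hM a) ↔ isK 𝒰 a := by
  rw [isK_iff]
  refine ⟨fun h => ⟨⟨_, h⟩, (fromCarrier_bijective hM).1 rfl⟩, ?_⟩
  rintro ⟨a, rfl⟩; exact a.2

lemma isC_fromCarrier (a : (toModel hM).Carrier) : isC 𝒰 (fromCarrier hM a) ↔ isC 𝒰 a := by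
  rw [isC_iff]
  refine ⟨fun h => ?_, ?_⟩
  · obtain ⟨x, hx⟩ := exists_ofPoint_eq hM h
    exact ⟨x, (fromCarrier_bijective hM).1 hx.symm⟩
  · rintro ⟨a, rfl⟩; exact isC_ofPoint hM a

lemma isG_fromCarrier (a : (toModel hM).Carrier) : isG 𝒰 (fromCarrier hM a) ↔ isG 𝒰 a := by
  rw [isG_iff]
  refine ⟨fun h => ⟨⟨_, h⟩, (fromCarrier_bijective hM).1 rfl⟩, ?_⟩
  rintro ⟨a, rfl⟩; exact a.2

lemma isV_fromCarrier (a : (toModel hM).Carrier) : isV 𝒰 (fromCarrier hM a) ↔ isV 𝒰 a := by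
  rw [isV_iff]
  refine ⟨fun h => ?_, ?_⟩
  · obtain ⟨x, hx⟩ := exists_ofPoint_eq hM (ax_base hM _ h)
    exact ⟨x, ⟨_, h, hx.symm⟩, (fromCarrier_bijective hM).1 rfl⟩
  · rintro ⟨x, a, rfl⟩; exact a.2.1

lemma sortV_rs (x : Point p (algebraMap f (SortK hM))) (a b : SortV hM x) :
    ((toModel hM).resDiv x a b).1 = rs 𝒰 a.1 b.1 := by
  by_cases hb : b = 0
  · subst hb
    refine (congrArg Subtype.val
      (dif_neg fun h => h.1 rfl : (toModel hM).resDiv x a (0 : SortV hM x) = 0)).trans ?_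
    exact (((ax_res hM _ (isC_ofPoint hM x)).1 _ _ a.2 a.2).2.2.1).symm
  have h1 : rs 𝒰 a.1 b.1 = rs 𝒰 (a / b).1 (1 : SortV hM x).1 := by
    have := ((ax_res hM _ (isC_ofPoint hM x)).1 (a / b).1 b.1 (a / b).2 b.2).2.2.2
      (sortV_ne_zero hM x hb)
    refine Eq.trans ?_ this
    change _ = rs 𝒰 (a / b * b).1 b.1
    rw [div_mul_cancel₀ a hb]
  rw [h1]
  by_cases h2 : 0 ≤ valV hM x (a / b)
  · exact congrArg Subtype.val
      (dif_pos ⟨hb, h2⟩ : (toModel hM).resDiv x a b = resV hM x ⟨a / b, h2⟩)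
  · refine (congrArg Subtype.val
      (dif_neg fun h => h2 h.2 : (toModel hM).resDiv x a b = 0)).trans ?_
    rw [zero_le_valV] at h2
    exact ((ax_res hM _ (isC_ofPoint hM x)).2 _ (a / b).2 h2).symm

lemma sortV_vl (x : Point p (algebraMap f (SortK hM))) (a : SortV hM x) :
    fromCarrier hM ((toModel hM).valElem x a) = vl 𝒰 a.1 := by
  by_cases ha : a = 0
  · subst ha
    refine Eq.trans ?_ (ax_val hM _ (isC_ofPoint hM x)).1.symm
    exact congrArg (fromCarrier hM) (vl_ofV_zero (𝒰 := 𝒰) (D := toModel hM) (x := x))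
  · exact congrArg (fromCarrier hM) (vl_ofV_eq (𝒰 := 𝒰) (D := toModel hM) (x := x)
      (valV_of_ne hM x ha))

lemma vec_one {α β : Type*} (h : α → β) (t : Fin 1 → α) : h ∘ t = ![h (t 0)] := by
  funext i; fin_cases i; rfl

lemma vec_two {α β : Type*} (h : α → β) (t : Fin 2 → α) : h ∘ t = ![h (t 0), h (t 1)] := by
  funext i; fin_cases i <;> rfl

lemma vec_zero {α β : Type*} (h : α → β) (t : Fin 0 → α) : h ∘ t = ![] := by
  funext i; exact i.elim0

set_option linter.unusedSimpArgs false in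
lemma fromCarrier_funMap {n : ℕ} (g : Func 𝒰 n) (t : Fin n → (toModel hM).Carrier) :
    fromCarrier hM (funMap (sym 𝒰 g) t) = funMap (sym 𝒰 g) (fromCarrier hM ∘ t) := by
  cases g with
  | const r => rw [vec_zero]; rfl
  | zeroG => rw [vec_zero]; rfl
  | oneG => rw [vec_zero]; rfl
  | addK =>
    rw [vec_two]
    change fromCarrier hM ((t 0).mapK₂ _ (t 1)) = _
    have h := (ax_default_K hM (fromCarrier hM (t 0)) (fromCarrier hM (t 1))).2
    rw [isK_fromCarrier, isK_fromCarrier] at h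
    revert h
    cases t 0 <;> cases t 1 <;> intro h <;>
      first | rfl | exact (h fun ⟨⟨_, h₁⟩, ⟨_, h₂⟩⟩ => by first | (cases h₁; done) | cases h₂).1.symm
  | mulK =>
    rw [vec_two]
    change fromCarrier hM ((t 0).mapK₂ _ (t 1)) = _
    have h := (ax_default_K hM (fromCarrier hM (t 0)) (fromCarrier hM (t 1))).2
    rw [isK_fromCarrier, isK_fromCarrier] at h
    revert h
    cases t 0 <;> cases t 1 <;> intro h <;>
      first | rfl | exact (h fun ⟨⟨_, h₁⟩, ⟨_, h₂⟩⟩ => by first | (cases h₁; done) | cases h₂).2.symm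
  | negK =>
    rw [vec_one]
    change fromCarrier hM ((t 0).mapK _) = _
    have h := (ax_default_K hM (fromCarrier hM (t 0)) (fromCarrier hM (t 0))).1
    rw [isK_fromCarrier] at h
    revert h
    cases t 0 <;> intro h <;> first | rfl | exact (h fun ⟨_, h₁⟩ => by cases h₁).symm
  | coord i j =>
    rw [vec_one]
    change fromCarrier hM ((t 0).mapC _) = _
    have h := ax_default_C hM i j (fromCarrier hM (t 0))
    rw [isC_fromCarrier] at h
    revert h
    cases t 0 <;> intro h <;>
      first | exact (crd_ofPoint hM _ i j).symm | exact (h fun ⟨_, h₁⟩ => by cases h₁).1.symm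
  | gen i j =>
    rw [vec_one]
    change fromCarrier hM ((t 0).mapC _) = _
    have h := ax_default_C hM i j (fromCarrier hM (t 0))
    rw [isC_fromCarrier] at h
    revert h
    cases t 0 <;> intro h <;>
      first
      | exact congrArg Subtype.val (congrFun (coordAt_genPoint hM _ i) j)
      | exact (h fun ⟨_, h₁⟩ => by cases h₁).2.symm
  | addG =>
    rw [vec_two]
    change fromCarrier hM ((t 0).mapG₂ _ (t 1)) = _
    have h := (ax_default_G hM (fromCarrier hM (t 0)) (fromCarrier hM (t 1))).2
    rw [isG_fromCarrier, isG_fromCarrier] at h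
    revert h
    cases t 0 <;> cases t 1 <;> intro h <;>
      first | rfl | exact (h fun ⟨⟨_, h₁⟩, ⟨_, h₂⟩⟩ => by first | (cases h₁; done) | cases h₂).symm
  | negG =>
    rw [vec_one]
    change fromCarrier hM ((t 0).mapG _) = _
    have h := (ax_default_G hM (fromCarrier hM (t 0)) (fromCarrier hM (t 0))).1
    rw [isG_fromCarrier] at h
    revert h
    cases t 0 <;> intro h <;> first | rfl | exact (h fun ⟨_, h₁⟩ => by cases h₁).symm
  | sec =>
    rw [vec_two]
    change fromCarrier hM ((t 0).secMap (t 1)) = _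
    have h := ax_default_sec hM (fromCarrier hM (t 0)) (fromCarrier hM (t 1))
    rw [isC_fromCarrier, isK_fromCarrier] at h
    revert h
    cases t 0 <;> cases t 1 <;> intro h <;>
      first | rfl | exact (h fun ⟨⟨_, h₁⟩, ⟨_, h₂⟩⟩ => by first | (cases h₁; done) | cases h₂).symm
  | base =>
    rw [vec_one]
    change fromCarrier hM ((t 0).mapV _) = _
    have h := (ax_default_V hM (fromCarrier hM (t 0)) (fromCarrier hM (t 0))).1
    rw [isV_fromCarrier] at h
    revert h
    cases t 0 with
    | ofV x a => exact fun _ => a.2.2.symm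
    | _ => exact fun h => (h fun ⟨_, _, h₁⟩ => by cases h₁).1.symm
  | negV =>
    rw [vec_one]
    change fromCarrier hM ((t 0).mapV _) = _
    have h := (ax_default_V hM (fromCarrier hM (t 0)) (fromCarrier hM (t 0))).1
    rw [isV_fromCarrier] at h
    revert h
    cases t 0 with
    | ofV x a => exact fun _ => rfl
    | _ => exact fun h => (h fun ⟨_, _, h₁⟩ => by cases h₁).2.1.symm
  | val =>
    rw [vec_one]
    change fromCarrier hM ((t 0).mapV _) = _
    have h := (ax_default_V hM (fromCarrier hM (t 0)) (fromCarrier hM (t 0))).1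
    rw [isV_fromCarrier] at h
    revert h
    cases t 0 with
    | ofV x a => exact fun _ => sortV_vl hM x a
    | _ => exact fun h => (h fun ⟨_, _, h₁⟩ => by cases h₁).2.2.1.symm
  | addV =>
    rw [vec_two]
    change fromCarrier hM ((t 0).mapV₂ (fun x a b => .ofV x (a + b)) (t 1)) = _
    have h := (ax_default_V hM (fromCarrier hM (t 0)) (fromCarrier hM (t 1))).2
    rw [isV_fromCarrier, isV_fromCarrier] at h
    revert h
    cases t 0 <;> cases t 1 <;> intro h <;>
      first | exact (h fun ⟨⟨_, _, h₁⟩, ⟨_, _, h₂⟩, _⟩ => by first | (cases h₁; done) | cases h₂).1.symm | skip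
    rename_i x a y b
    by_cases hxy : y = x
    · subst hxy
      exact congrArg (fromCarrier hM) (vAdd_ofV (D := toModel hM) 𝒰 a b)
    · refine Eq.trans (congrArg (fromCarrier hM) (dif_neg hxy)) (h fun h' => hxy ?_).1.symm
      exact ofPoint_injective hM (b.2.2.symm.trans (h'.2.2.trans a.2.2))
  | mulV =>
    rw [vec_two]
    change fromCarrier hM ((t 0).mapV₂ (fun x a b => .ofV x (a * b)) (t 1)) = _
    have h := (ax_default_V hM (fromCarrier hM (t 0)) (fromCarrier hM (t 1))).2
    rw [isV_fromCarrier, isV_fromCarrier] at h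
    revert h
    cases t 0 <;> cases t 1 <;> intro h <;>
      first | exact (h fun ⟨⟨_, _, h₁⟩, ⟨_, _, h₂⟩, _⟩ => by first | (cases h₁; done) | cases h₂).2.1.symm | skip
    rename_i x a y b
    by_cases hxy : y = x
    · subst hxy
      exact congrArg (fromCarrier hM) (vMul_ofV (D := toModel hM) 𝒰 a b)
    · refine Eq.trans (congrArg (fromCarrier hM) (dif_neg hxy)) (h fun h' => hxy ?_).2.1.symm
      exact ofPoint_injective hM (b.2.2.symm.trans (h'.2.2.trans a.2.2))
  | res =>
    rw [vec_two]
    change fromCarrier hM ((t 0).mapV₂ (fun x a b => .ofK ((toModel hM).resDiv x a b)) (t 1)) = _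
    have h := (ax_default_V hM (fromCarrier hM (t 0)) (fromCarrier hM (t 1))).2
    rw [isV_fromCarrier, isV_fromCarrier] at h
    revert h
    cases t 0 <;> cases t 1 <;> intro h <;>
      first | exact (h fun ⟨⟨_, _, h₁⟩, ⟨_, _, h₂⟩, _⟩ => by first | (cases h₁; done) | cases h₂).2.2.symm | skip
    rename_i x a y b
    by_cases hxy : y = x
    · subst hxy
      exact (congrArg (fromCarrier hM) (rs_ofV (D := toModel hM) 𝒰 a b)).trans (sortV_rs hM _ a b)
    · refine Eq.trans (congrArg (fromCarrier hM) (dif_neg hxy)) (h fun h' => hxy ?_).2.2.symm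
      exact ofPoint_injective hM (b.2.2.symm.trans (h'.2.2.trans a.2.2))

lemma fromCarrier_relMap {n : ℕ} (R : Rel 𝒰 n) (t : Fin n → (toModel hM).Carrier) :
    RelMap (rsym 𝒰 R) (fromCarrier hM ∘ t) ↔ RelMap (rsym 𝒰 R) t := by
  have h1 (t : Fin 1 → (toModel hM).Carrier) : ∃ a, t = ![a] :=
    ⟨t 0, by funext i; fin_cases i; rfl⟩
  have h2 (t : Fin 2 → (toModel hM).Carrier) : ∃ a b, t = ![a, b] :=
    ⟨t 0, t 1, by funext i; fin_cases i <;> rfl⟩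
  cases R with
  | isK =>
    obtain ⟨a, rfl⟩ := h1 t
    rw [vec_one]
    exact isK_fromCarrier hM _
  | isC =>
    obtain ⟨a, rfl⟩ := h1 t
    rw [vec_one]
    exact isC_fromCarrier hM _
  | isG =>
    obtain ⟨a, rfl⟩ := h1 t
    rw [vec_one]
    exact isG_fromCarrier hM _
  | isV =>
    obtain ⟨a, rfl⟩ := h1 t
    rw [vec_one]
    exact isV_fromCarrier hM _
  | chart i =>
    obtain ⟨a, rfl⟩ := h1 t
    rw [vec_one]
    constructor
    · intro h
      obtain ⟨x, hx⟩ := (isC_fromCarrier hM _).1 (ax_inCh_isC hM i _ h)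
      refine ⟨x, hx, ?_⟩
      subst hx
      exact (inCh_ofPoint hM x i).1 h
    · rintro ⟨x, hx, h⟩
      subst hx
      exact (inCh_ofPoint hM x i).2 h
  | le =>
    obtain ⟨a, b, rfl⟩ := h2 t
    rw [vec_two]
    constructor
    · intro h
      obtain ⟨h₁, h₂, -⟩ := (ax_group hM).2.2.2.2.2.1 _ _ h
      obtain ⟨γ, hγ⟩ := (isG_fromCarrier hM _).1 h₁
      obtain ⟨δ, hδ⟩ := (isG_fromCarrier hM _).1 h₂
      refine ⟨γ, δ, hγ, hδ, ?_⟩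
      subst hγ hδ
      exact h
    · rintro ⟨γ, δ, hγ, hδ, h⟩
      subst hγ hδ
      exact h
  | integral =>
    obtain ⟨a, rfl⟩ := h1 t
    rw [vec_one]
    constructor
    · intro h
      have h' : isV 𝒰 a := by
        by_contra h'
        rw [← isV_fromCarrier] at h'
        exact ((ax_default_V hM _ (fromCarrier hM a)).1 h').2.2.2 h
      obtain ⟨x, b, ha⟩ := h'
      refine ⟨x, b, ha, ?_⟩
      subst ha
      exact (zero_le_valV hM x).2 h
    · rintro ⟨x, b, ha, h⟩
      subst ha
      exact (zero_le_valV hM x).1 h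

/-- A model of the theory is isomorphic to one of the described structures. -/
theorem exists_equiv_model (hM : M ⊨ theory 𝒰) :
    ∃ D : Model p, Nonempty ((lang 𝒰).Equiv M D.Carrier) :=
  ⟨toModel hM, ⟨(Language.Equiv.symm
    { toEquiv := Equiv.ofBijective _ (fromCarrier_bijective hM)
      map_fun' := fun g t => fromCarrier_funMap hM g t
      map_rel' := fun R t => fromCarrier_relMap hM R t } : (lang 𝒰).Equiv M (toModel hM).Carrier)⟩⟩

end OfModel

/-- The models of the theory are the described structures. -/
theorem models_iff {f : Type u} [Field f] {C : Scheme.{u}} {p : C ⟶ Spec (CommRingCat.of f)}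
    [SmoothOfRelativeDimension 1 p] [GeometricallyIntegral p] [IsSeparated p]
    {𝒰 : Atlas p} (M : Type u) [(lang 𝒰).Structure M] :
    M ⊨ theory 𝒰 ↔ ∃ D : Model p, Nonempty ((lang 𝒰).Equiv M D.Carrier) := by
  refine ⟨fun hM => exists_equiv_model hM, ?_⟩
  rintro ⟨D, ⟨e⟩⟩
  have := models_theory (𝒰 := 𝒰) D
  exact StrongHomClass.theory_model e.symm

end CurveACVF
end

noncomputable section
namespace CurveACVF

/-! ### Extensions of valuations -/

section ValuationExtension

open Polynomial

/-- If `y ∈ V` is a root of a nonzero polynomial over a subfield, then `y` is a fraction `w / u` of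
elements which are integral over the trace of `V`, where `u` is a unit of `V`. -/
lemma exists_fraction_of_root {F L : Type*} [Field F] [Field L] (i : F →+* L)
    (V : ValuationSubring L) {y : L} (hy : y ∈ V) {P : F[X]} (hP : P ≠ 0)
    (hPy : P.eval₂ i y = 0) :
    ∃ u w : L, u * y = w ∧ V.valuation u = 1 ∧ ∀ V' : ValuationSubring L,
      (∀ a, i a ∈ V → i a ∈ V') → u ∈ V' ∧ w ∈ V' := by
  classical
  by_cases hy0 : y = 0
  · exact ⟨1, 0, by simp [hy0], map_one _, fun V' _ => ⟨one_mem _, zero_mem _⟩⟩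
  obtain ⟨j₀, hj₀, hmax⟩ := P.support.exists_max_image (fun n => V.valuation (i (P.coeff n)))
    (support_nonempty.2 hP)
  set T := P.support.filter fun n => V.valuation (i (P.coeff n)) = V.valuation (i (P.coeff j₀))
  obtain ⟨j, hj, hjmax⟩ := T.exists_max_image id ⟨j₀, by simp [T, Polynomial.mem_support_iff.1 hj₀]⟩
  have hj' : P.coeff j ≠ 0 ∧ V.valuation (i (P.coeff j)) = V.valuation (i (P.coeff j₀)) := by
    simpa [T] using hj
  have hle (n) : V.valuation (i (P.coeff n)) ≤ V.valuation (i (P.coeff j)) := by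
    rw [hj'.2]
    by_cases hn : P.coeff n = 0
    · simp [hn]
    · exact hmax n (by simpa using hn)
  have hlt (n) (hn : j < n) : V.valuation (i (P.coeff n)) < V.valuation (i (P.coeff j)) := by
    refine lt_of_le_of_ne (hle n) fun h => ?_
    by_cases hn0 : P.coeff n = 0
    · rw [hn0, map_zero, map_zero, eq_comm, map_eq_zero, map_eq_zero] at h
      exact hj'.1 h
    · exact absurd (hjmax n (by simp [T, hn0, h, hj'.2])) (not_le.2 hn)
  have hij : i (P.coeff j) ≠ 0 := (_root_.map_ne_zero i).2 hj'.1
  let b (n : ℕ) : F := P.coeff n / P.coeff j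
  have hvj : V.valuation (i (P.coeff j)) ≠ 0 := (_root_.map_ne_zero _).2 hij
  have hb (n) : i (b n) ∈ V := by
    rw [← V.valuation_le_one_iff, map_div₀ i, map_div₀]
    exact div_le_one_of_le₀ (hle n) zero_le
  have hb1 (n) (hn : j < n) : V.valuation (i (b n)) < 1 := by
    rw [map_div₀ i, map_div₀]
    exact (div_lt_one₀ (zero_lt_iff.2 hvj)).2 (hlt n hn)
  have hbj : b j = 1 := div_self hj'.1
  set N := P.natDegree + 1
  have hjN : j < N := Nat.lt_succ_of_le (le_natDegree_of_ne_zero hj'.1)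
  let u := ∑ n ∈ Finset.Ico j N, i (b n) * y ^ (n - j)
  let w := - ∑ n ∈ Finset.range j, i (b n) * y⁻¹ ^ (j - 1 - n)
  have hsum : ∑ n ∈ Finset.range N, i (b n) * y ^ n = 0 := by
    rw [eval₂_eq_sum_range] at hPy
    calc _ = (i (P.coeff j))⁻¹ * ∑ n ∈ Finset.range N, i (P.coeff n) * y ^ n := by
          rw [Finset.mul_sum]
          refine Finset.sum_congr rfl fun n _ => ?_
          simp only [b, map_div₀ i]; ring
      _ = 0 := by rw [hPy, mul_zero]
  have huw : u * y = w := by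
    rw [← Finset.sum_range_add_sum_Ico _ hjN.le] at hsum
    have h1 : u * y ^ j = ∑ n ∈ Finset.Ico j N, i (b n) * y ^ n := by
      rw [Finset.sum_mul]
      refine Finset.sum_congr rfl fun n hn => ?_
      rw [mul_assoc, ← pow_add, Nat.sub_add_cancel (Finset.mem_Ico.1 hn).1]
    have h2 : w * y ^ j = -(∑ n ∈ Finset.range j, i (b n) * y ^ n) * y := by
      rw [neg_mul, neg_mul, Finset.sum_mul, Finset.sum_mul]
      refine congrArg _ (Finset.sum_congr rfl fun n hn => ?_)
      have hn' := Finset.mem_range.1 hn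
      have : y ^ j = y ^ (j - 1 - n) * (y ^ n * y) := by
        rw [← pow_succ, ← pow_add]; congr 1; omega
      rw [this, inv_pow]
      field_simp
    refine mul_right_cancel₀ (pow_ne_zero j hy0) ?_
    rw [h2, mul_right_comm, h1, eq_neg_of_add_eq_zero_right hsum]
  refine ⟨u, w, huw, ?_, fun V' hV' => ?_⟩
  · have h1 : V.valuation (∑ n ∈ Finset.Ico (j + 1) N, i (b n) * y ^ (n - j)) < 1 := by
      refine Valuation.map_sum_lt _ one_ne_zero fun n hn => ?_
      rw [map_mul, map_pow]
      exact mul_lt_one_of_lt_of_le (hb1 n (Finset.mem_Ico.1 hn).1)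
        (pow_le_one₀ zero_le ((V.valuation_le_one_iff y).2 hy))
    have h2 : u = 1 + ∑ n ∈ Finset.Ico (j + 1) N, i (b n) * y ^ (n - j) := by
      simp only [u]
      rw [Finset.sum_eq_sum_Ico_succ_bot hjN, hbj, map_one, Nat.sub_self, pow_zero, one_mul]
    rw [h2]
    rw [V.valuation.map_add_eq_of_lt_left (by rwa [map_one]), map_one]
  · by_cases hyV : y ∈ V'
    · have : u ∈ V' := sum_mem fun n _ => mul_mem (hV' _ (hb n)) (pow_mem hyV _)
      exact ⟨this, huw ▸ mul_mem this hyV⟩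
    · have hyV' : y⁻¹ ∈ V' := (V'.mem_or_inv_mem y).resolve_left hyV
      have : w ∈ V' := neg_mem (sum_mem fun n _ => mul_mem (hV' _ (hb n)) (pow_mem hyV' _))
      refine ⟨?_, this⟩
      rw [(eq_mul_inv_iff_mul_eq₀ hy0).2 huw]
      exact mul_mem this hyV'

/-- Over a subfield, the values of algebraic elements are torsion. -/
lemma exists_valuation_pow_eq {F L : Type*} [Field F] [Field L] (i : F →+* L)
    (V : ValuationSubring L) {y : L} (hy : y ≠ 0) {P : F[X]} (hP : P ≠ 0)
    (hPy : P.eval₂ i y = 0) :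
    ∃ (m : ℕ) (c : F), 0 < m ∧ c ≠ 0 ∧ V.valuation (y ^ m) = V.valuation (i c) := by
  obtain ⟨n₀, hn₀, hmax⟩ := P.support.exists_max_image
    (fun n => V.valuation (i (P.coeff n) * y ^ n)) (support_nonempty.2 hP)
  have h0 (n) (hn : n ∈ P.support) : V.valuation (i (P.coeff n) * y ^ n) ≠ 0 :=
    (_root_.map_ne_zero _).2 (mul_ne_zero ((_root_.map_ne_zero i).2 (mem_support_iff.1 hn))
      (pow_ne_zero n hy))
  obtain ⟨n, hn, hne, heq⟩ : ∃ n ∈ P.support, n ≠ n₀ ∧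
      V.valuation (i (P.coeff n) * y ^ n) = V.valuation (i (P.coeff n₀) * y ^ n₀) := by
    by_contra! h
    have h1 : V.valuation (∑ n ∈ P.support.erase n₀, i (P.coeff n) * y ^ n) <
        V.valuation (i (P.coeff n₀) * y ^ n₀) :=
      Valuation.map_sum_lt _ (h0 n₀ hn₀) fun n hn =>
        lt_of_le_of_ne (hmax n (Finset.mem_of_mem_erase hn))
          (h n (Finset.mem_of_mem_erase hn) (Finset.ne_of_mem_erase hn))
    rw [eval₂_eq_sum, Polynomial.sum, ← Finset.add_sum_erase _ _ hn₀] at hPy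
    rw [eq_neg_of_add_eq_zero_right hPy, Valuation.map_neg] at h1
    exact h1.false
  have key (n m : ℕ) (hn : n ∈ P.support) (hm : m ∈ P.support) (hnm : n < m)
      (h : V.valuation (i (P.coeff n) * y ^ n) = V.valuation (i (P.coeff m) * y ^ m)) :
      ∃ (m : ℕ) (c : F), 0 < m ∧ c ≠ 0 ∧ V.valuation (y ^ m) = V.valuation (i c) := by
    have hm0 := mem_support_iff.1 hm
    refine ⟨m - n, P.coeff n / P.coeff m, Nat.sub_pos_of_lt hnm,
      div_ne_zero (mem_support_iff.1 hn) hm0, ?_⟩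
    have h1 : y ^ m = y ^ (m - n) * y ^ n := by rw [← pow_add, Nat.sub_add_cancel hnm.le]
    have h2 : V.valuation (y ^ n) ≠ 0 := (_root_.map_ne_zero _).2 (pow_ne_zero n hy)
    have h3 : V.valuation (i (P.coeff m)) ≠ 0 :=
      (_root_.map_ne_zero _).2 ((_root_.map_ne_zero i).2 hm0)
    rw [h1, map_mul, map_mul, map_mul, ← mul_assoc] at h
    have h4 := mul_right_cancel₀ h2 h
    rw [map_div₀ i, map_div₀, eq_div_iff h3, h4, mul_comm]
  rcases lt_or_gt_of_ne hne with hlt | hlt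
  · exact key n n₀ hn hn₀ hlt heq
  · exact key n₀ n hn₀ hn hlt heq.symm

/-- Comparable valuation subrings of an algebraic extension with the same trace are equal. -/
lemma valuationSubring_eq_of_le {F L : Type*} [Field F] [Field L] [Algebra F L]
    [Algebra.IsAlgebraic F L] {V₁ V₂ : ValuationSubring L} (hle : V₁ ≤ V₂)
    (h : ∀ a, algebraMap F L a ∈ V₂ → algebraMap F L a ∈ V₁) : V₁ = V₂ := by
  refine le_antisymm hle fun y hy => ?_
  by_cases hy0 : y = 0
  · rw [hy0]; exact zero_mem _
  obtain ⟨P, hP, hPy⟩ := Algebra.IsAlgebraic.isAlgebraic (R := F) y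
  obtain ⟨m, c, hm, hc, hmc⟩ := exists_valuation_pow_eq (algebraMap F L) V₁ hy0 hP hPy
  have hv : V₁.valuation (algebraMap F L c) ≠ 0 :=
    (_root_.map_ne_zero _).2 ((_root_.map_ne_zero _).2 hc)
  have h1 : algebraMap F L c / y ^ m ∈ V₁ := by
    rw [← V₁.valuation_le_one_iff, map_div₀, hmc, div_self hv]
  have h2 : algebraMap F L c ∈ V₁ := by
    refine h c ?_
    rw [← div_mul_cancel₀ (algebraMap F L c) (pow_ne_zero m hy0)]
    exact mul_mem (hle h1) (pow_mem hy m)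
  rw [← V₁.valuation_le_one_iff, ← hmc, map_pow] at h2
  rw [← V₁.valuation_le_one_iff]
  exact (pow_le_one_iff hm.ne').1 h2

/-- The centre of a valuation subring on a smaller subring. -/
def centre {L : Type*} [Field L] (B : Subring L) (V : ValuationSubring L) (h : B ≤ V.toSubring) :
    Ideal B :=
  (IsLocalRing.maximalIdeal V).comap (Subring.inclusion h : B →+* V.toSubring)

instance {L : Type*} [Field L] (B : Subring L) (V : ValuationSubring L) (h : B ≤ V.toSubring) :
    (centre B V h).IsPrime := Ideal.comap_isPrime _ _

lemma mem_centre {L : Type*} [Field L] {B : Subring L} {V : ValuationSubring L}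
    {h : B ≤ V.toSubring} {b : B} : b ∈ centre B V h ↔ V.valuation b < 1 :=
  V.valuation_lt_one_iff ⟨b.1, h b.2⟩

/-- **Conjugacy of valuations**: every extension of a valuation to a finite extension is induced by
a homomorphism to a given algebraically closed valued field. -/
theorem exists_algHom_comap_eq {F L Ω : Type*} [Field F] [Field L] [Field Ω] [Algebra F L]
    [Algebra F Ω] [FiniteDimensional F L] [IsAlgClosed Ω] (V : ValuationSubring L)
    (W : ValuationSubring Ω) (h : V.comap (algebraMap F L) = W.comap (algebraMap F Ω)) :
    ∃ σ : L →ₐ[F] Ω, W.comap (σ : L →+* Ω) = V := by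
  classical
  have hA (a : F) : algebraMap F L a ∈ V ↔ algebraMap F Ω a ∈ W := SetLike.ext_iff.1 h a
  have hσ (σ : L →ₐ[F] Ω) (a : F) :
      algebraMap F L a ∈ W.comap (σ : L →+* Ω) ↔ algebraMap F L a ∈ V := by
    rw [hA, ValuationSubring.mem_comap]
    change σ (algebraMap F L a) ∈ W ↔ _
    rw [σ.commutes]
  let S : Set (ValuationSubring L) := {V' | ∀ a, algebraMap F L a ∈ V → algebraMap F L a ∈ V'}
  let B : Subring L := ⨅ V' : S, V'.1.toSubring
  have hBS (V' : S) : B ≤ V'.1.toSubring := iInf_le _ V'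
  have hVS : V ∈ S := fun a ha => ha
  have hWS (σ : L →ₐ[F] Ω) : W.comap (σ : L →+* Ω) ∈ S := fun a => (hσ σ a).2
  let Q (σ : L →ₐ[F] Ω) : Ideal B := centre B _ (hBS ⟨_, hWS σ⟩)
  have hQ (σ : L →ₐ[F] Ω) (b : B) : b ∈ Q σ ↔ W.valuation (σ b) < 1 := by
    have hb : σ b ∈ W := hBS ⟨_, hWS σ⟩ b.2
    rw [mem_centre, ← ValuationSubring.mem_nonunits_iff, ← ValuationSubring.mem_nonunits_iff,
      ← inv_inv b.1, ValuationSubring.inv_mem_nonunits_iff, map_inv₀,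
      ValuationSubring.inv_mem_nonunits_iff, ValuationSubring.mem_comap]
    simp
  have hcover : ((centre B V (hBS ⟨V, hVS⟩) : Ideal B) : Set B) ⊆
      ⋃ σ ∈ ((Finset.univ : Finset (L →ₐ[F] Ω)) : Set (L →ₐ[F] Ω)), (Q σ : Set B) := by
    intro b hb
    rw [SetLike.mem_coe, mem_centre] at hb
    simp only [Finset.coe_univ, Set.mem_univ, Set.iUnion_true, Set.mem_iUnion, SetLike.mem_coe, hQ]
    by_contra! hne
    have hbF : IsIntegral F b.1 := Algebra.IsIntegral.isIntegral _
    set P := minpoly F b.1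
    have hPm : P.Monic := minpoly.monic hbF
    have hroot (r) (hr : r ∈ (P.map (algebraMap F Ω)).roots) : W.valuation r = 1 := by
      have hr' : r ∈ P.rootSet Ω := by
        rw [mem_rootSet]
        refine ⟨hPm.ne_zero, ?_⟩
        rw [mem_roots (hPm.map _).ne_zero, IsRoot, Polynomial.eval_map] at hr
        exact hr
      rw [← Algebra.IsAlgebraic.range_eval_eq_rootSet_minpoly] at hr'
      obtain ⟨σ, rfl⟩ := hr'
      exact le_antisymm ((W.valuation_le_one_iff _).2 (hBS ⟨_, hWS σ⟩ b.2)) (hne σ)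
    have hs : (P.map (algebraMap F Ω)).Splits := IsAlgClosed.splits _
    have hc (n : ℕ) : algebraMap F L (P.coeff n) ∈ V := by
      rw [hA, ← coeff_map, hs.eq_prod_roots_of_monic (hPm.map _)]
      have hl : ((P.map (algebraMap F Ω)).roots.map fun r => X - C r).prod ∈ lifts W.subtype := by
        refine Submonoid.multiset_prod_mem (lifts W.subtype).toSubmonoid _ fun q hq => ?_
        obtain ⟨r, hr, rfl⟩ := Multiset.mem_map.1 hq
        have hrW : r ∈ W := (W.valuation_le_one_iff _).1 (hroot r hr).le
        exact (mem_lifts _).2 ⟨X - C ⟨r, hrW⟩, by simp⟩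
      obtain ⟨c, hc⟩ := (lifts_iff_coeff_lifts _).1 hl n
      rw [← hc]; exact c.2
    have hc0 : V.valuation (algebraMap F L (P.coeff 0)) < 1 := by
      have h1 : P.eval₂ (algebraMap F L) b.1 = 0 := minpoly.aeval F b.1
      rw [← P.divX_mul_X_add, eval₂_add, eval₂_C, eval₂_mul, eval₂_X] at h1
      rw [eq_neg_of_add_eq_zero_right h1, Valuation.map_neg, map_mul]
      refine (mul_le_of_le_one_left zero_le ?_).trans_lt hb
      rw [V.valuation_le_one_iff, eval₂_eq_sum]
      refine sum_mem fun n _ => mul_mem ?_ (pow_mem (hBS ⟨V, hVS⟩ b.2) _)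
      rw [coeff_divX]; exact hc _
    have hc1 : W.valuation (algebraMap F Ω (P.coeff 0)) = 1 := by
      rw [← coeff_map, hs.coeff_zero_eq_prod_roots_of_monic (hPm.map _), map_mul, map_pow,
        Valuation.map_neg, map_one, one_pow, one_mul, map_multiset_prod]
      refine Multiset.prod_eq_one fun r hr => ?_
      obtain ⟨r', hr', rfl⟩ := Multiset.mem_map.1 hr
      exact hroot r' hr'
    have hne0 : P.coeff 0 ≠ 0 := fun h0 => by simp [h0] at hc1
    rw [← ValuationSubring.mem_nonunits_iff, ← inv_inv (algebraMap F L _),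
      ValuationSubring.inv_mem_nonunits_iff, ← map_inv₀, hA, map_inv₀] at hc0
    refine hc0.elim (fun h0 => hne0 (by simpa using h0)) fun h0 => h0 ?_
    rw [← W.valuation_le_one_iff, map_inv₀, map_inv₀, hc1, inv_one]
  obtain ⟨σ, -, hle⟩ := (Ideal.subset_union_prime (s := Finset.univ) (f := Q)
    (IsAlgClosed.lift : L →ₐ[F] Ω) (IsAlgClosed.lift : L →ₐ[F] Ω)
    fun _ _ _ _ => inferInstance).1 hcover
  refine ⟨σ, valuationSubring_eq_of_le (F := F) (fun y hy => ?_) fun a ha => (hσ σ a).2 ha⟩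
  obtain ⟨P, hP, hPy⟩ := Algebra.IsAlgebraic.isAlgebraic (R := F) y
  obtain ⟨u, w, huw, hu, huwB⟩ := exists_fraction_of_root (algebraMap F L) _ hy hP hPy
  have hmem (z : L) (hz : ∀ V' ∈ S, z ∈ V') : z ∈ B := by
    simp only [B, Subring.mem_iInf]
    exact fun V' => hz V'.1 V'.2
  have huB : u ∈ B := hmem u fun V' hV' => (huwB V' fun a ha => hV' a ((hσ σ a).1 ha)).1
  have hwB : w ∈ B := hmem w fun V' hV' => (huwB V' fun a ha => hV' a ((hσ σ a).1 ha)).2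
  have hu1 : V.valuation u = 1 := by
    refine le_antisymm ((V.valuation_le_one_iff u).2 (hBS ⟨V, hVS⟩ huB)) (not_lt.1 fun hlt => ?_)
    have := hle (show (⟨u, huB⟩ : B) ∈ centre B V (hBS ⟨V, hVS⟩) from mem_centre.2 hlt)
    exact (mem_centre.1 this).ne hu
  rw [← V.valuation_le_one_iff]
  have h1 : V.valuation w ≤ 1 := (V.valuation_le_one_iff w).2 (hBS ⟨V, hVS⟩ hwB)
  rwa [← huw, map_mul, hu1, one_mul] at h1

end ValuationExtension

end CurveACVF
end

noncomputable section
namespace CurveACVF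

open FirstOrder FirstOrder.Language FirstOrder.Language.Structure

/-! ### Partial isomorphisms -/

/-- A relation between two structures which is a (possibly infinite) partial isomorphism with a
domain that is closed under the operations. -/
structure IsPartialIso {L : FirstOrder.Language.{u, u}} {M N : Type u} [L.Structure M]
    [L.Structure N] (R : M → N → Prop) : Prop where
  func : ∀ {n : ℕ} (g : L.Functions n) (t : Fin n → M) (t' : Fin n → N),
    (∀ i, R (t i) (t' i)) → R (funMap g t) (funMap g t')
  rel : ∀ {n : ℕ} (r : L.Relations n) (t : Fin n → M) (t' : Fin n → N),
    (∀ i, R (t i) (t' i)) → (RelMap r t ↔ RelMap r t')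
  eq : ∀ {a b : M} {a' b' : N}, R a a' → R b b' → (a = b ↔ a' = b')

section ValRel

set_option linter.unusedSectionVars false

variable {Γ Γ' : Type u} [AddCommGroup Γ] [LinearOrder Γ] [IsOrderedAddMonoid Γ]
  [AddCommGroup Γ'] [LinearOrder Γ'] [IsOrderedAddMonoid Γ']

/-- A partial isomorphism of ordered groups. -/
def IsOrderCompat (G : AddSubgroup (Γ × Γ')) : Prop := ∀ q ∈ G, 0 ≤ q.1 ↔ 0 ≤ q.2

/-- The relation between values that is induced by a relation between value groups. -/
def ValRel (G : AddSubgroup (Γ × Γ')) (a : WithTop Γ) (b : WithTop Γ') : Prop :=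
  (a = ⊤ ∧ b = ⊤) ∨ ∃ q ∈ G, a = (q.1 : Γ) ∧ b = (q.2 : Γ')

variable {G : AddSubgroup (Γ × Γ')}

lemma IsOrderCompat.le_iff (hG : IsOrderCompat G) {q r : Γ × Γ'} (hq : q ∈ G) (hr : r ∈ G) :
    q.1 ≤ r.1 ↔ q.2 ≤ r.2 := by
  rw [← sub_nonneg, ← sub_nonneg (a := r.2)]
  exact hG _ (G.sub_mem hr hq)

lemma IsOrderCompat.eq_iff (hG : IsOrderCompat G) {q r : Γ × Γ'} (hq : q ∈ G) (hr : r ∈ G) :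
    q.1 = r.1 ↔ q.2 = r.2 := by
  rw [le_antisymm_iff, le_antisymm_iff, hG.le_iff hq hr, hG.le_iff hr hq]

lemma valRel_coe {γ : Γ} {γ' : Γ'} (hG : (γ, γ') ∈ G) :
    ValRel G (γ : WithTop Γ) (γ' : WithTop Γ') := .inr ⟨_, hG, rfl, rfl⟩

lemma valRel_zero : ValRel G 0 0 := valRel_coe G.zero_mem

lemma valRel_top : ValRel G ⊤ ⊤ := .inl ⟨rfl, rfl⟩

lemma ValRel.mono {G' : AddSubgroup (Γ × Γ')} (h : G ≤ G') {a : WithTop Γ} {b : WithTop Γ'}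
    (hab : ValRel G a b) : ValRel G' a b :=
  hab.imp_right fun ⟨q, hq, hab⟩ => ⟨q, h hq, hab⟩

lemma ValRel.le_iff (hG : IsOrderCompat G) {a b : WithTop Γ} {a' b' : WithTop Γ'}
    (ha : ValRel G a a') (hb : ValRel G b b') : a ≤ b ↔ a' ≤ b' := by
  rcases hb with ⟨rfl, rfl⟩ | ⟨r, hr, rfl, rfl⟩
  · simp
  rcases ha with ⟨rfl, rfl⟩ | ⟨q, hq, rfl, rfl⟩
  · simp
  · rw [WithTop.coe_le_coe, WithTop.coe_le_coe, hG.le_iff hq hr]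

lemma ValRel.lt_iff (hG : IsOrderCompat G) {a b : WithTop Γ} {a' b' : WithTop Γ'}
    (ha : ValRel G a a') (hb : ValRel G b b') : a < b ↔ a' < b' := by
  rw [← not_le, ← not_le, hb.le_iff hG ha]

lemma ValRel.eq_iff (hG : IsOrderCompat G) {a b : WithTop Γ} {a' b' : WithTop Γ'}
    (ha : ValRel G a a') (hb : ValRel G b b') : a = b ↔ a' = b' := by
  rw [le_antisymm_iff, le_antisymm_iff, ha.le_iff hG hb, hb.le_iff hG ha]

lemma ValRel.top_iff {a : WithTop Γ} {a' : WithTop Γ'} (ha : ValRel G a a') : a = ⊤ ↔ a' = ⊤ := by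
  rcases ha with ⟨rfl, rfl⟩ | ⟨q, hq, rfl, rfl⟩ <;> simp

lemma ValRel.add {a b : WithTop Γ} {a' b' : WithTop Γ'} (ha : ValRel G a a')
    (hb : ValRel G b b') : ValRel G (a + b) (a' + b') := by
  rcases ha with ⟨rfl, rfl⟩ | ⟨q, hq, rfl, rfl⟩
  · exact .inl (by simp)
  rcases hb with ⟨rfl, rfl⟩ | ⟨r, hr, rfl, rfl⟩
  · exact .inl (by simp)
  · exact .inr ⟨q + r, G.add_mem hq hr, rfl, rfl⟩

end ValRel

section

variable {f : Type u} [Field f] {C : Scheme.{u}} {p : C ⟶ Spec (CommRingCat.of f)}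
  [SmoothOfRelativeDimension 1 p] [GeometricallyIntegral p] {𝒰 : Atlas p}

namespace Model

variable (D : Model p) {x : Point p (algebraMap f D.k)}

lemma v_eq_top {a : D.VF x} : D.v x a = ⊤ ↔ a = 0 := AddValuation.top_iff _

lemma res_sec (c : D.k) : D.res x (D.sec x c) = c := DFunLike.congr_fun (D.res_comp_sec x) c

lemma res_eq_zero_iff (z : valuationRing (D.v x)) : D.res x z = 0 ↔ 0 < D.v x z := by
  have key (z : valuationRing (D.v x)) (h : D.res x z = 0) : 0 < D.v x z := by
    refine lt_of_le_of_ne z.2 fun h0 => ?_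
    have hz : z.1 ≠ 0 := fun hz => by
      rw [hz, AddValuation.map_zero] at h0
      exact WithTop.zero_ne_top h0
    have hz' : D.v x z.1⁻¹ = 0 := by
      have := (D.v x).map_mul z.1 z.1⁻¹
      rw [mul_inv_cancel₀ hz, ← h0, zero_add, AddValuation.map_one] at this
      exact this.symm
    have h1 : z * ⟨z.1⁻¹, hz'.ge⟩ = 1 := Subtype.ext (mul_inv_cancel₀ hz)
    have := congrArg (D.res x) h1
    rw [map_mul, h, zero_mul, map_one] at this
    exact zero_ne_one this
  refine ⟨key z, fun h => ?_⟩
  by_contra hc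
  have h1 := key (z - D.sec x (D.res x z)) (by rw [map_sub, res_sec, sub_self])
  have h2 : D.v x (D.constV x (D.res x z)) = 0 := D.val_sec x hc
  have h3 : D.v x (z.1 - (z - D.sec x (D.res x z)).1) = D.v x (D.constV x (D.res x z)) :=
    congrArg (D.v x) (sub_sub_cancel _ _)
  have := (D.v x).map_le_sub (g := min (D.v x z.1) (D.v x (z - D.sec x (D.res x z)).1))
    (min_le_left _ _) (min_le_right _ _)
  rw [h3, h2] at this
  exact absurd (lt_min h h1) (not_lt.2 this)

/-- The residue of a quotient, in terms of the valuation. -/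
lemma resDiv_eq_iff {a b : D.VF x} (hb : b ≠ 0) (hab : D.v x b ≤ D.v x a) (c : D.k) :
    D.resDiv x a b = c ↔ D.v x b < D.v x (a - D.constV x c * b) := by
  have hvb : D.v x b ≠ ⊤ := fun h => hb (D.v_eq_top.1 h)
  have h0 (z : D.VF x) : D.v x (z * b) = D.v x z + D.v x b := (D.v x).map_mul z b
  have h1 : 0 ≤ D.v x (a / b) := by
    rw [← div_mul_cancel₀ a hb, h0] at hab
    exact (WithTop.add_le_add_iff_right hvb).1 (by rwa [zero_add])
  have h2 : D.resDiv x a b = D.res x ⟨a / b, h1⟩ := dif_pos ⟨hb, h1⟩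
  have h3 : a - D.constV x c * b = (a / b - D.constV x c) * b := by
    rw [sub_mul, div_mul_cancel₀ a hb]
  have h4 : D.res x ⟨a / b, h1⟩ = c ↔ D.res x (⟨a / b, h1⟩ - D.sec x c) = 0 := by
    rw [map_sub, res_sec, sub_eq_zero]
  rw [h2, h4, res_eq_zero_iff, h3, h0]
  have h5 := WithTop.add_lt_add_iff_right (x := 0) (y := D.v x (a / b - D.constV x c)) hvb
  rw [zero_add] at h5
  exact h5.symm

lemma resDiv_eq_zero {a b : D.VF x} (h : b = 0 ∨ D.v x a < D.v x b) : D.resDiv x a b = 0 := by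
  refine dif_neg fun ⟨hb, h1⟩ => ?_
  have h := h.resolve_left hb
  rw [← div_mul_cancel₀ a hb, (D.v x).map_mul] at h
  exact absurd (le_add_of_nonneg_left h1) (not_le.2 h)

end Model

/-- A partial embedding of a model in another one. It is defined everywhere on `k` and on the
points, on a subgroup of the value group, and on subrings of the fibers. -/
structure PartialEmb (𝒰 : Atlas p) (D E : Model p) where
  T : D.k →+* E.k
  T_const : T.comp (algebraMap f D.k) = algebraMap f E.k
  pt : Point p (algebraMap f D.k) → Point p (algebraMap f E.k)
  inChart_pt : ∀ {x i}, InChart 𝒰 (pt x) i ↔ InChart 𝒰 x i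
  coordAt_pt : ∀ x i j, coordAt 𝒰 (pt x) i j = T (coordAt 𝒰 x i j)
  G : AddSubgroup (D.Γ × E.Γ)
  one_mem : (D.one, E.one) ∈ G
  compat : IsOrderCompat G
  V : ∀ x, Subring (D.VF x × E.VF (pt x))
  sec_mem : ∀ x c, (D.constV x c, E.constV (pt x) (T c)) ∈ V x
  gen_mem : ∀ x i j, (coordAt 𝒰 (D.c x) i j, coordAt 𝒰 (E.c (pt x)) i j) ∈ V x
  val : ∀ x, ∀ q ∈ V x, ValRel G (D.v x q.1) (E.v _ q.2)

namespace PartialEmb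

open Model Model.Carrier

variable {D E : Model p} (P : PartialEmb 𝒰 D E)

/-- The relation between all the elements that is given by a partial embedding. -/
inductive Rel : D.Carrier → E.Carrier → Prop
  | ofK (a : D.k) : Rel (ofK a) (ofK (P.T a))
  | ofC (x) : Rel (ofC x) (ofC (P.pt x))
  | ofG {γ γ'} (h : (γ, γ') ∈ P.G) : Rel (ofG γ) (ofG γ')
  | ofV {x a a'} (h : (a, a') ∈ P.V x) : Rel (ofV x a) (ofV (P.pt x) a')

lemma rel_undef : P.Rel undef undef := by
  have := Rel.ofK (P := P) 0
  rwa [map_zero] at this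

lemma eq_iff {x} {a b : D.VF x} {a' b' : E.VF (P.pt x)} (ha : (a, a') ∈ P.V x)
    (hb : (b, b') ∈ P.V x) : a = b ↔ a' = b' := by
  have := (P.val x _ (sub_mem ha hb)).top_iff
  rwa [v_eq_top, v_eq_top, Prod.fst_sub, Prod.snd_sub, sub_eq_zero, sub_eq_zero] at this

lemma resDiv_eq {x} {a b : D.VF x} {a' b' : E.VF (P.pt x)} (ha : (a, a') ∈ P.V x)
    (hb : (b, b') ∈ P.V x) : E.resDiv (P.pt x) a' b' = P.T (D.resDiv x a b) := by
  have hab := (P.val x _ hb).le_iff P.compat (P.val x _ ha)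
  have hb0 := P.eq_iff hb (P.V x).zero_mem
  by_cases h : b ≠ 0 ∧ D.v x b ≤ D.v x a
  · rw [E.resDiv_eq_iff (fun h' => h.1 (hb0.2 h')) (hab.1 h.2)]
    have h1 := (D.resDiv_eq_iff h.1 h.2 _).1 rfl
    exact ((P.val x _ hb).lt_iff P.compat (P.val x _ (sub_mem ha
      (mul_mem (P.sec_mem x (D.resDiv x a b)) hb)))).1 h1
  · rw [not_and_or, not_not, not_le] at h
    rw [D.resDiv_eq_zero h, map_zero]
    refine E.resDiv_eq_zero (h.imp hb0.1 ?_)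
    exact ((P.val x _ ha).lt_iff P.compat (P.val x _ hb)).1

lemma rel_valElem {x} {a : D.VF x} {a' : E.VF (P.pt x)} (ha : (a, a') ∈ P.V x) :
    P.Rel (D.valElem x a) (E.valElem (P.pt x) a') := by
  rcases P.val x _ ha with ⟨h, h'⟩ | ⟨q, hq, h, h'⟩
  · rw [valElem, valElem]
    change D.v x a = _ at h
    change E.v _ a' = _ at h'
    rw [h, h']; exact P.rel_undef
  · rw [valElem, valElem]
    change D.v x a = _ at h
    change E.v _ a' = _ at h'
    rw [h, h']; exact .ofG hq

lemma pt_injective : Function.Injective P.pt := by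
  intro x y h
  obtain ⟨i, hi⟩ := exists_inChart 𝒰 x
  have hi' : InChart 𝒰 y i := by rwa [← P.inChart_pt, ← h, P.inChart_pt]
  refine point_ext hi hi' fun j => P.T.injective ?_
  rw [← P.coordAt_pt, ← P.coordAt_pt, h]

lemma rel_mapV₂ {op : ∀ x, D.VF x → D.VF x → D.Carrier} {op' : ∀ x, E.VF x → E.VF x → E.Carrier}
    (h : ∀ {x a b a' b'}, (a, a') ∈ P.V x → (b, b') ∈ P.V x →
      P.Rel (op x a b) (op' (P.pt x) a' b')) {m n : D.Carrier} {m' n' : E.Carrier}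
    (hm : P.Rel m m') (hn : P.Rel n n') : P.Rel (m.mapV₂ op n) (m'.mapV₂ op' n') := by
  cases hm <;> cases hn <;> try exact P.rel_undef
  rename_i x a a' ha y b b' hb
  by_cases hxy : y = x
  · subst hxy
    have h1 : (Carrier.ofV y a).mapV₂ op (.ofV y b) = op y a b := dif_pos rfl
    have h2 : (Carrier.ofV (P.pt y) a').mapV₂ op' (.ofV (P.pt y) b') = op' _ a' b' := dif_pos rfl
    rw [h1, h2]
    exact h ha hb
  · have h1 : (Carrier.ofV x a).mapV₂ op (.ofV y b) = undef := dif_neg hxy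
    have h2 : (Carrier.ofV (P.pt x) a').mapV₂ op' (.ofV (P.pt y) b') = undef :=
      dif_neg fun h => hxy (P.pt_injective h)
    rw [h1, h2]
    exact P.rel_undef

theorem isPartialIso : IsPartialIso (L := lang 𝒰) P.Rel where
  func {n} g t t' h := by
    change Func 𝒰 n at g
    cases g with
    | const r =>
      change P.Rel (Carrier.ofK _) (Carrier.ofK _)
      rw [← DFunLike.congr_fun P.T_const r]
      exact .ofK _
    | zeroG => exact .ofG P.G.zero_mem
    | oneG => exact .ofG P.one_mem
    | addK =>
      change P.Rel ((t 0).mapK₂ _ (t 1)) ((t' 0).mapK₂ _ (t' 1))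
      have h0 := h 0; have h1 := h 1
      revert h0 h1
      generalize t 0 = a, t' 0 = a', t 1 = b, t' 1 = b'
      rintro ⟨a⟩ ⟨b⟩ <;> try exact P.rel_undef
      rename_i a b
      change P.Rel (Carrier.ofK (a + b)) (Carrier.ofK (P.T a + P.T b))
      rw [← map_add]; exact .ofK _
    | mulK =>
      change P.Rel ((t 0).mapK₂ _ (t 1)) ((t' 0).mapK₂ _ (t' 1))
      have h0 := h 0; have h1 := h 1
      revert h0 h1
      generalize t 0 = a, t' 0 = a', t 1 = b, t' 1 = b'
      rintro ⟨a⟩ ⟨b⟩ <;> try exact P.rel_undef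
      rename_i a b
      change P.Rel (Carrier.ofK (a * b)) (Carrier.ofK (P.T a * P.T b))
      rw [← map_mul]; exact .ofK _
    | negK =>
      change P.Rel ((t 0).mapK _) ((t' 0).mapK _)
      have h0 := h 0
      revert h0
      generalize t 0 = a, t' 0 = a'
      rintro ⟨a⟩ <;> try exact P.rel_undef
      rename_i a
      change P.Rel (Carrier.ofK (-a)) (Carrier.ofK (-P.T a))
      rw [← map_neg]; exact .ofK _
    | coord i j =>
      change P.Rel ((t 0).mapC _) ((t' 0).mapC _)
      have h0 := h 0
      revert h0
      generalize t 0 = a, t' 0 = a'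
      rintro ⟨a⟩ <;> try exact P.rel_undef
      rename_i a
      change P.Rel (Carrier.ofK _) (Carrier.ofK (coordAt 𝒰 (P.pt a) i j))
      rw [P.coordAt_pt]; exact .ofK _
    | gen i j =>
      change P.Rel ((t 0).mapC _) ((t' 0).mapC _)
      have h0 := h 0
      revert h0
      generalize t 0 = a, t' 0 = a'
      rintro ⟨a⟩ <;> try exact P.rel_undef
      exact .ofV (P.gen_mem _ i j)
    | addG =>
      change P.Rel ((t 0).mapG₂ _ (t 1)) ((t' 0).mapG₂ _ (t' 1))
      have h0 := h 0; have h1 := h 1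
      revert h0 h1
      generalize t 0 = a, t' 0 = a', t 1 = b, t' 1 = b'
      rintro (⟨a⟩ | ⟨a⟩ | ⟨a⟩ | ⟨a⟩) (⟨b⟩ | ⟨b⟩ | ⟨b⟩ | ⟨b⟩) <;> try exact P.rel_undef
      exact .ofG (P.G.add_mem a b)
    | negG =>
      change P.Rel ((t 0).mapG _) ((t' 0).mapG _)
      have h0 := h 0
      revert h0
      generalize t 0 = a, t' 0 = a'
      rintro (⟨a⟩ | ⟨a⟩ | ⟨a⟩ | ⟨a⟩) <;> try exact P.rel_undef
      exact .ofG (P.G.neg_mem a)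
    | sec =>
      change P.Rel ((t 0).secMap (t 1)) ((t' 0).secMap (t' 1))
      have h0 := h 0; have h1 := h 1
      revert h0 h1
      generalize t 0 = a, t' 0 = a', t 1 = b, t' 1 = b'
      rintro ⟨a⟩ ⟨b⟩ <;> try exact P.rel_undef
      exact .ofV (P.sec_mem _ _)
    | base =>
      change P.Rel ((t 0).mapV _) ((t' 0).mapV _)
      have h0 := h 0
      revert h0
      generalize t 0 = a, t' 0 = a'
      rintro (⟨a⟩ | ⟨a⟩ | ⟨a⟩ | ⟨a⟩) <;> try exact P.rel_undef
      exact .ofC _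
    | negV =>
      change P.Rel ((t 0).mapV _) ((t' 0).mapV _)
      have h0 := h 0
      revert h0
      generalize t 0 = a, t' 0 = a'
      rintro (⟨a⟩ | ⟨a⟩ | ⟨a⟩ | ⟨a⟩) <;> try exact P.rel_undef
      exact .ofV ((P.V _).neg_mem a)
    | val =>
      change P.Rel ((t 0).mapV _) ((t' 0).mapV _)
      have h0 := h 0
      revert h0
      generalize t 0 = a, t' 0 = a'
      rintro (⟨a⟩ | ⟨a⟩ | ⟨a⟩ | ⟨a⟩) <;> try exact P.rel_undef
      exact P.rel_valElem a
    | addV =>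
      exact P.rel_mapV₂ (op := fun x a b => .ofV x (a + b)) (op' := fun x a b => .ofV x (a + b))
        (fun ha hb => .ofV ((P.V _).add_mem ha hb)) (h 0) (h 1)
    | mulV =>
      exact P.rel_mapV₂ (op := fun x a b => .ofV x (a * b)) (op' := fun x a b => .ofV x (a * b))
        (fun ha hb => .ofV ((P.V _).mul_mem ha hb)) (h 0) (h 1)
    | res =>
      refine P.rel_mapV₂ (op := fun x a b => .ofK (D.resDiv x a b))
        (op' := fun x a b => .ofK (E.resDiv x a b)) (fun ha hb => ?_) (h 0) (h 1)
      rw [P.resDiv_eq ha hb]; exact .ofK _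
  rel {n} r t t' h := by
    change CurveACVF.Rel 𝒰 n at r
    cases r with
    | isK =>
      change isK 𝒰 (t 0) ↔ isK 𝒰 (t' 0)
      have h0 := h 0
      revert h0
      generalize t 0 = a, t' 0 = a'
      rintro (⟨a⟩ | ⟨a⟩ | ⟨a⟩ | ⟨a⟩) <;> simp [isK_iff]
    | isC =>
      change isC 𝒰 (t 0) ↔ isC 𝒰 (t' 0)
      have h0 := h 0
      revert h0
      generalize t 0 = a, t' 0 = a'
      rintro (⟨a⟩ | ⟨a⟩ | ⟨a⟩ | ⟨a⟩) <;> simp [isC_iff]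
    | isG =>
      change isG 𝒰 (t 0) ↔ isG 𝒰 (t' 0)
      have h0 := h 0
      revert h0
      generalize t 0 = a, t' 0 = a'
      rintro (⟨a⟩ | ⟨a⟩ | ⟨a⟩ | ⟨a⟩) <;> simp [isG_iff]
    | isV =>
      change isV 𝒰 (t 0) ↔ isV 𝒰 (t' 0)
      have h0 := h 0
      revert h0
      generalize t 0 = a, t' 0 = a'
      rintro (⟨a⟩ | ⟨a⟩ | ⟨a⟩ | ⟨a⟩) <;> simp [isV_iff]
    | chart i =>
      change inCh 𝒰 i (t 0) ↔ inCh 𝒰 i (t' 0)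
      have h0 := h 0
      revert h0
      generalize t 0 = a, t' 0 = a'
      rintro (⟨a⟩ | ⟨a⟩ | ⟨a⟩ | ⟨a⟩) <;> simp [inCh_iff, P.inChart_pt]
    | le =>
      change gLe 𝒰 (t 0) (t 1) ↔ gLe 𝒰 (t' 0) (t' 1)
      have h0 := h 0; have h1 := h 1
      revert h0 h1
      generalize t 0 = a, t' 0 = a', t 1 = b, t' 1 = b'
      rintro (⟨a⟩ | ⟨a⟩ | ⟨a⟩ | ⟨a⟩) (⟨b⟩ | ⟨b⟩ | ⟨b⟩ | ⟨b⟩) <;> try (simp [gLe_iff]; done)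
      rw [gLe_ofG, gLe_ofG]
      exact P.compat.le_iff a b
    | integral =>
      change isInt 𝒰 (t 0) ↔ isInt 𝒰 (t' 0)
      have h0 := h 0
      revert h0
      generalize t 0 = a, t' 0 = a'
      rintro (⟨a⟩ | ⟨a⟩ | ⟨a⟩ | ⟨a⟩) <;> try (simp [isInt_iff]; done)
      rw [isInt_ofV, isInt_ofV]
      exact valRel_zero.le_iff P.compat (P.val _ _ a)
  eq {a b a' b'} h h' := by
    rcases h with _ | _ | h | h <;> rcases h' with _ | _ | h' | h' <;> try (simp; done)
    · simp [P.T.injective.eq_iff]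
    · simp [P.pt_injective.eq_iff]
    · simp only [Carrier.ofG.injEq]
      exact P.compat.eq_iff h h'
    · rename_i x a a' y b b'
      by_cases hxy : x = y
      · subst hxy
        simp only [Carrier.ofV.injEq, heq_eq_eq, true_and]
        exact P.eq_iff h h'
      · simp [P.pt_injective.eq_iff, hxy]

end PartialEmb

end

end CurveACVF
end

noncomputable section
namespace CurveACVF

open FirstOrder FirstOrder.Language FirstOrder.Language.Structure

section

variable {f : Type u} [Field f] {C : Scheme.{u}} {p : C ⟶ Spec (CommRingCat.of f)}
  [SmoothOfRelativeDimension 1 p] [GeometricallyIntegral p] {𝒰 : Atlas p} {D E : Model p}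

open Model Model.Carrier

/-! ### Fibers over new points -/

/-- Corresponding points: `x'` has the coordinates of the image of `x`. -/
def Corr (𝒰 : Atlas p) {D E : Model p} (T : D.k → E.k) (x : Point p (algebraMap f D.k))
    (x' : Point p (algebraMap f E.k)) : Prop :=
  (∀ i, InChart 𝒰 x' i ↔ InChart 𝒰 x i) ∧ ∀ i j, coordAt 𝒰 x' i j = T (coordAt 𝒰 x i j)

/-- Over corresponding points, the fields generated by the constants and the generic points are
isomorphic valued fields. -/
lemma exists_generic_subring {T : D.k →+* E.k}
    (hT : T.comp (algebraMap f D.k) = algebraMap f E.k) {x : Point p (algebraMap f D.k)}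
    {x' : Point p (algebraMap f E.k)} (hx : Corr 𝒰 T x x') {G : AddSubgroup (D.Γ × E.Γ)}
    (hone : (D.one, E.one) ∈ G) :
    ∃ V : Subring (D.VF x × E.VF x'), (∀ c, (D.constV x c, E.constV x' (T c)) ∈ V) ∧
      (∀ i j, (coordAt 𝒰 (D.c x) i j, coordAt 𝒰 (E.c x') i j) ∈ V) ∧
      ∀ q ∈ V, ValRel G (D.v x q.1) (E.v x' q.2) := by
  obtain ⟨φ, hφ, hv⟩ := D.val_c x
  let ι : D.k →+* E.VF x' := (E.constV x').comp T
  let y : Point p (ι.comp (algebraMap f D.k)) :=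
    Point.map (RingHom.id _) (by
      rw [RingHom.id_comp]
      change (E.constV x').comp (algebraMap f E.k) = ((E.constV x').comp T).comp _
      rw [RingHom.comp_assoc, hT]) (E.c x')
  have hyc (i j) : coordAt 𝒰 y i j = coordAt 𝒰 (E.c x') i j := coordAt_map i j
  have hι (a : D.k) (ha : a ≠ 0) : E.v x' (ι a) = 0 := E.val_sec x' ((map_ne_zero T).2 ha)
  obtain ⟨i, hi⟩ := exists_inChart 𝒰 x
  obtain ⟨h1, j, h2⟩ := E.gen_coord ((hx.1 i).2 hi)
  have hιc (j) : ι (coordAt 𝒰 x i j) = E.constV x' (coordAt 𝒰 x' i j) :=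
    congrArg (E.constV x') (hx.2 i j).symm
  have hE : InChart 𝒰 (E.c x') i := by
    obtain ⟨φ', hφ', -⟩ := E.val_c x'
    exact hφ'.inChart i
  obtain ⟨φ', hφ', hv'⟩ := (exists_isEvaluationAt_iff hι E.one_pos y hi).2
    ⟨inChart_map.2 hE, fun j => by rw [hyc, hιc]; exact h1 j, j, by rw [hyc, hιc]; exact h2⟩
  have hb (i) := (isEvaluationAt_iff (hφ.inChart (𝒰 := 𝒰) i) φ).1 hφ
  have hb' (i) := (isEvaluationAt_iff (hφ'.inChart (𝒰 := 𝒰) i) φ').1 hφ'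
  refine ⟨(φ.prod φ').range, fun c => ?_, fun i j => ?_, ?_⟩
  · refine ⟨bFun D.k i (bConst 𝒰 D.k i c), Prod.ext ?_ ?_⟩
    · exact (DFunLike.congr_fun (hb i) _).trans (bEval_const _ c)
    · exact (DFunLike.congr_fun (hb' i) _).trans (bEval_const _ c)
  · refine ⟨bFun D.k i (bCoord 𝒰 D.k i j), Prod.ext ?_ ?_⟩
    · exact (DFunLike.congr_fun (hb i) _).trans (bEval_coord _ j)
    · exact ((DFunLike.congr_fun (hb' i) _).trans (bEval_coord _ j)).trans (hyc i j)
  · rintro _ ⟨h, rfl⟩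
    by_cases h0 : h = 0
    · subst h0
      rw [map_zero, Prod.fst_zero, Prod.snd_zero, AddValuation.map_zero, AddValuation.map_zero]
      exact valRel_top
    · have e1 : D.v x (φ.prod φ' h).1 = _ := hv h h0
      have e2 : E.v x' (φ.prod φ' h).2 = _ := hv' h h0
      rw [e1, e2]
      exact valRel_coe (G.zsmul_mem hone (ordAt p x h))

/-! ### The sorts of a partial isomorphism -/

namespace IsPartialIso

variable {R : D.Carrier → E.Carrier → Prop} (hR : IsPartialIso (L := lang 𝒰) R)

include hR in
lemma func₀ (g : Func 𝒰 0) : R (funMap (sym 𝒰 g) ![]) (funMap (sym 𝒰 g) ![]) :=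
  hR.func _ _ _ fun i => i.elim0

include hR in
lemma func₁ (g : Func 𝒰 1) {a a'} (h : R a a') :
    R (funMap (sym 𝒰 g) ![a]) (funMap (sym 𝒰 g) ![a']) :=
  hR.func _ _ _ fun i => by fin_cases i; exact h

include hR in
lemma func₂ (g : Func 𝒰 2) {a a' b b'} (h : R a a') (h' : R b b') :
    R (funMap (sym 𝒰 g) ![a, b]) (funMap (sym 𝒰 g) ![a', b']) :=
  hR.func _ _ _ fun i => by fin_cases i; exacts [h, h']

include hR in
lemma rel₁ (r : Rel 𝒰 1) {a a'} (h : R a a') :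
    RelMap (rsym 𝒰 r) ![a] ↔ RelMap (rsym 𝒰 r) ![a'] :=
  hR.rel _ _ _ fun i => by fin_cases i; exact h

include hR in
lemma rel₂ (r : Rel 𝒰 2) {a a' b b'} (h : R a a') (h' : R b b') :
    RelMap (rsym 𝒰 r) ![a, b] ↔ RelMap (rsym 𝒰 r) ![a', b'] :=
  hR.rel _ _ _ fun i => by fin_cases i; exacts [h, h']

include hR in
lemma const_mem (r : f) : R (ofK (algebraMap f D.k r)) (ofK (algebraMap f E.k r)) :=
  hR.func₀ (.const r)

/-- The part of a partial isomorphism on the sort `k`. -/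
def kPart : Subring (D.k × E.k) where
  carrier := {q | R (ofK q.1) (ofK q.2)}
  mul_mem' ha hb := hR.func₂ .mulK ha hb
  add_mem' ha hb := hR.func₂ .addK ha hb
  neg_mem' ha := hR.func₁ .negK ha
  one_mem' := by have := hR.const_mem 1; rwa [map_one, map_one] at this
  zero_mem' := by have := hR.const_mem 0; rwa [map_zero, map_zero] at this

lemma kPart_eq_zero {q : D.k × E.k} (hq : q ∈ hR.kPart) : q.1 = 0 ↔ q.2 = 0 := by
  have := hR.eq hq hR.kPart.zero_mem
  simpa using this

/-- The part of a partial isomorphism on the sort `Γ`. -/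
def gPart : AddSubgroup (D.Γ × E.Γ) where
  carrier := {q | R (ofG q.1) (ofG q.2)}
  add_mem' ha hb := hR.func₂ .addG ha hb
  neg_mem' ha := hR.func₁ .negG ha
  zero_mem' := hR.func₀ .zeroG

lemma gPart_one : (D.one, E.one) ∈ hR.gPart := hR.func₀ .oneG

lemma gPart_compat : IsOrderCompat hR.gPart := fun q hq => by
  have := hR.rel₂ .le hR.gPart.zero_mem hq
  exact (gLe_ofG 𝒰).symm.trans (this.trans (gLe_ofG 𝒰))

variable {x : Point p (algebraMap f D.k)} {x' : Point p (algebraMap f E.k)}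
  (hx : R (ofC x) (ofC x'))

include hR hx in
lemma sec_mem {q : D.k × E.k} (hq : q ∈ hR.kPart) :
    R (ofV x (D.constV x q.1)) (ofV x' (E.constV x' q.2)) := hR.func₂ .sec hx hq

/-- The part of a partial isomorphism on a fiber. -/
def vPart : Subring (D.VF x × E.VF x') where
  carrier := {q | R (ofV x q.1) (ofV x' q.2)}
  mul_mem' {a b} ha hb := by
    have h : R (vMul 𝒰 (ofV x a.1) (ofV x b.1)) (vMul 𝒰 (ofV x' a.2) (ofV x' b.2)) :=
      hR.func₂ .mulV ha hb
    rwa [vMul_ofV, vMul_ofV] at h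
  add_mem' {a b} ha hb := by
    have h : R (vAdd 𝒰 (ofV x a.1) (ofV x b.1)) (vAdd 𝒰 (ofV x' a.2) (ofV x' b.2)) :=
      hR.func₂ .addV ha hb
    rwa [vAdd_ofV, vAdd_ofV] at h
  neg_mem' ha := hR.func₁ .negV ha
  one_mem' := by
    have := hR.sec_mem hx hR.kPart.one_mem
    rwa [Prod.fst_one, Prod.snd_one, map_one, map_one] at this
  zero_mem' := by
    have := hR.sec_mem hx hR.kPart.zero_mem
    rwa [Prod.fst_zero, Prod.snd_zero, map_zero, map_zero] at this

lemma vPart_gen (i j) : (coordAt 𝒰 (D.c x) i j, coordAt 𝒰 (E.c x') i j) ∈ hR.vPart hx :=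
  hR.func₁ (.gen i j) hx

lemma vPart_eq_zero {q : D.VF x × E.VF x'} (hq : q ∈ hR.vPart hx) : q.1 = 0 ↔ q.2 = 0 := by
  have := hR.eq hq (hR.vPart hx).zero_mem
  simpa using this

lemma vPart_val {q : D.VF x × E.VF x'} (hq : q ∈ hR.vPart hx) :
    ValRel hR.gPart (D.v x q.1) (E.v x' q.2) := by
  by_cases h0 : q.1 = 0
  · rw [h0, (hR.vPart_eq_zero hx hq).1 h0, AddValuation.map_zero, AddValuation.map_zero]
    exact valRel_top
  · obtain ⟨γ, hγ⟩ := WithTop.ne_top_iff_exists.1 fun h => h0 (D.v_eq_top.1 h)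
    obtain ⟨γ', hγ'⟩ := WithTop.ne_top_iff_exists.1 fun h =>
      h0 ((hR.vPart_eq_zero hx hq).2 (E.v_eq_top.1 h))
    have h1 : R (vl 𝒰 (ofV x q.1)) (vl 𝒰 (ofV x' q.2)) := hR.func₁ .val hq
    rw [vl_ofV_eq 𝒰 hγ.symm, vl_ofV_eq 𝒰 hγ'.symm] at h1
    rw [← hγ, ← hγ']
    exact valRel_coe h1

lemma resDiv_mem {q r : D.VF x × E.VF x'} (hq : q ∈ hR.vPart hx) (hr : r ∈ hR.vPart hx) :
    (D.resDiv x q.1 r.1, E.resDiv x' q.2 r.2) ∈ hR.kPart := by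
  have h : R (rs 𝒰 (ofV x q.1) (ofV x r.1)) (rs 𝒰 (ofV x' q.2) (ofV x' r.2)) :=
    hR.func₂ .res hq hr
  rwa [rs_ofV, rs_ofV] at h

include hR hx in
lemma corr {T : D.k → E.k} (hT : ∀ q ∈ hR.kPart, q.2 = T q.1) : Corr 𝒰 T x x' := by
  refine ⟨fun i => ?_, fun i j => hT (_, _) (hR.func₁ (.coord i j) hx)⟩
  have := hR.rel₁ (.chart i) hx
  exact ((inCh_ofC 𝒰).symm.trans (this.trans (inCh_ofC 𝒰))).symm

/-- The values of linear combinations with arbitrary coefficients in `k`. -/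
lemma valRel_sum {T : D.k →+* E.k} (hT : ∀ q ∈ hR.kPart, q.2 = T q.1) {ι : Type*} (s : Finset ι)
    (a : ι → D.VF x) (a' : ι → E.VF x') (c : ι → D.k) (ha : ∀ i, (a i, a' i) ∈ hR.vPart hx) :
    ValRel hR.gPart (D.v x (∑ i ∈ s, D.constV x (c i) * a i))
      (E.v x' (∑ i ∈ s, E.constV x' (T (c i)) * a' i)) := by
  classical
  induction hn : s.card generalizing s a a' c with
  | zero =>
    rw [Finset.card_eq_zero.1 hn]
    simp only [Finset.sum_empty, AddValuation.map_zero]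
    exact valRel_top
  | succ n ih =>
  have hne : s.Nonempty := Finset.card_pos.1 (by omega)
  obtain ⟨j, hj, hmin⟩ := s.exists_min_image (fun i => D.v x (a i)) hne
  by_cases h0 : a j = 0
  · have h1 (i) (hi : i ∈ s) : a i = 0 := by
      have := hmin i hi
      rw [h0, AddValuation.map_zero, top_le_iff] at this
      exact D.v_eq_top.1 this
    have h2 (i) (hi : i ∈ s) : a' i = 0 := (hR.vPart_eq_zero hx (ha i)).1 (h1 i hi)
    rw [Finset.sum_eq_zero fun i hi => by rw [h1 i hi, mul_zero],
      Finset.sum_eq_zero fun i hi => by rw [h2 i hi, mul_zero], AddValuation.map_zero,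
      AddValuation.map_zero]
    exact valRel_top
  have h0' : a' j ≠ 0 := fun h => h0 ((hR.vPart_eq_zero hx (ha j)).2 h)
  have hmin' (i) (hi : i ∈ s) : E.v x' (a' j) ≤ E.v x' (a' i) :=
    ((hR.vPart_val hx (ha j)).le_iff hR.gPart_compat (hR.vPart_val hx (ha i))).1 (hmin i hi)
  let r (i : ι) : D.k := D.resDiv x (a i) (a j)
  have hr (i) : E.resDiv x' (a' i) (a' j) = T (r i) := hT _ (hR.resDiv_mem hx (ha i) (ha j))
  have hrk (i) : (r i, T (r i)) ∈ hR.kPart := by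
    rw [← hr]; exact hR.resDiv_mem hx (ha i) (ha j)
  have hrj : r j = 1 := by
    refine (D.resDiv_eq_iff h0 le_rfl 1).2 ?_
    rw [map_one, one_mul, sub_self, AddValuation.map_zero]
    exact lt_top_iff_ne_top.2 fun h => h0 (D.v_eq_top.1 h)
  let b (i : ι) : D.VF x := a i - D.constV x (r i) * a j
  let b' (i : ι) : E.VF x' := a' i - E.constV x' (T (r i)) * a' j
  have hb (i) : (b i, b' i) ∈ hR.vPart hx :=
    (hR.vPart hx).sub_mem (x := (a i, a' i))
      (y := (D.constV x (r i), E.constV x' (T (r i))) * (a j, a' j)) (ha i)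
      ((hR.vPart hx).mul_mem (hR.sec_mem hx (hrk i)) (ha j))
  have hbv (i) (hi : i ∈ s) : D.v x (a j) < D.v x (b i) :=
    (D.resDiv_eq_iff h0 (hmin i hi) _).1 rfl
  have hbv' (i) (hi : i ∈ s) : E.v x' (a' j) < E.v x' (b' i) :=
    (E.resDiv_eq_iff h0' (hmin' i hi) _).1 (hr i)
  have hbj : b j = 0 := by simp only [b, hrj, map_one, one_mul, sub_self]
  have hbj' : b' j = 0 := by simp only [b', hrj, map_one, one_mul, sub_self]
  let d : D.k := ∑ i ∈ s, c i * r i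
  have hsum : ∑ i ∈ s, D.constV x (c i) * a i = D.constV x d * a j +
      ∑ i ∈ s.erase j, D.constV x (c i) * b i := by
    rw [Finset.sum_erase _ (by rw [hbj, mul_zero]), map_sum, Finset.sum_mul,
      ← Finset.sum_add_distrib]
    refine Finset.sum_congr rfl fun i _ => ?_
    rw [map_mul]; ring
  have hsum' : ∑ i ∈ s, E.constV x' (T (c i)) * a' i = E.constV x' (T d) * a' j +
      ∑ i ∈ s.erase j, E.constV x' (T (c i)) * b' i := by
    rw [Finset.sum_erase _ (by rw [hbj', mul_zero]), map_sum, map_sum, Finset.sum_mul,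
      ← Finset.sum_add_distrib]
    refine Finset.sum_congr rfl fun i _ => ?_
    rw [map_mul, map_mul]; ring
  rw [hsum, hsum']
  by_cases hd : d = 0
  · rw [hd, map_zero, map_zero, map_zero, zero_mul, zero_mul, zero_add, zero_add]
    exact ih _ b b' c hb (by rw [Finset.card_erase_of_mem hj, hn]; rfl)
  · have key (F : Model p) {z : Point p (algebraMap f F.k)} {d : F.k} (hd : d ≠ 0) {α : F.VF z}
        (hα : α ≠ 0) (e : ι → F.k) {β : ι → F.VF z} (hβ : ∀ i ∈ s, F.v z α < F.v z (β i)) :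
        F.v z (F.constV z d * α + ∑ i ∈ s.erase j, F.constV z (e i) * β i) = F.v z α := by
      have h1 : F.v z (F.constV z d * α) = F.v z α := by
        rw [(F.v z).map_mul, F.val_sec z hd, zero_add]
      rw [← h1]
      refine (F.v z).map_add_eq_of_lt_left ?_
      rw [h1]
      refine (F.v z).map_lt_sum (fun h => hα (F.v_eq_top.1 h)) fun i hi => ?_
      rw [(F.v z).map_mul]
      exact (hβ i (Finset.mem_of_mem_erase hi)).trans_le
        (le_add_of_nonneg_left (F.sec z (e i)).2)
    rw [key D hd h0 c hbv, key E ((map_ne_zero T).2 hd) h0' _ hbv']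
    exact hR.vPart_val hx (ha j)

lemma exists_span_subring {T : D.k →+* E.k} (hT : ∀ q ∈ hR.kPart, q.2 = T q.1) :
    ∃ V : Subring (D.VF x × E.VF x'), (∀ c, (D.constV x c, E.constV x' (T c)) ∈ V) ∧
      hR.vPart hx ≤ V ∧ ∀ q ∈ V, ValRel hR.gPart (D.v x q.1) (E.v x' q.2) := by
  let ψ : D.k →+* D.VF x × E.VF x' := (D.constV x).prod ((E.constV x').comp T)
  let _ : Algebra D.k (D.VF x × E.VF x') := ψ.toAlgebra
  refine ⟨(Algebra.adjoin D.k (hR.vPart hx : Set (D.VF x × E.VF x'))).toSubring, fun c => ?_,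
    fun q hq => Algebra.subset_adjoin hq, fun q hq => ?_⟩
  · exact Subalgebra.algebraMap_mem _ c
  · have hq' : q ∈ Submodule.span D.k (hR.vPart hx : Set (D.VF x × E.VF x')) := by
      have h1 : q ∈ Subalgebra.toSubmodule (Algebra.adjoin D.k
        (hR.vPart hx : Set (D.VF x × E.VF x'))) := hq
      rw [Algebra.adjoin_eq_span] at h1
      have h2 : Submonoid.closure (hR.vPart hx : Set (D.VF x × E.VF x')) =
        (hR.vPart hx).toSubmonoid := Submonoid.closure_eq (hR.vPart hx).toSubmonoid
      rw [h2] at h1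
      exact h1
    obtain ⟨n, c, g, rfl⟩ := Submodule.mem_span_set'.1 hq'
    have := hR.valRel_sum hx hT Finset.univ (fun i => (g i).1.1) (fun i => (g i).1.2) c
      fun i => (g i).2
    rw [Prod.fst_sum, Prod.snd_sum]
    exact this

end IsPartialIso

/-! ### Construction of partial embeddings -/

lemma Corr.eq {T : D.k → E.k} {x : Point p (algebraMap f D.k)} {y z : Point p (algebraMap f E.k)}
    (hy : Corr 𝒰 T x y) (hz : Corr 𝒰 T x z) : y = z := by
  obtain ⟨i, hi⟩ := exists_inChart 𝒰 y
  exact point_ext hi ((hz.1 i).2 ((hy.1 i).1 hi)) fun j => (hy.2 i j).trans (hz.2 i j).symm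

/-- The partial embedding given by embeddings of subrings of the fibers. -/
def PartialEmb.ofFibers (T : D.k →+* E.k) (hT : T.comp (algebraMap f D.k) = algebraMap f E.k)
    (G : AddSubgroup (D.Γ × E.Γ)) (hone : (D.one, E.one) ∈ G) (hG : IsOrderCompat G)
    (V : ∀ x, Subring (D.VF x × E.VF (x.map T hT)))
    (hs : ∀ x c, (D.constV x c, E.constV (x.map T hT) (T c)) ∈ V x)
    (hg : ∀ x i j, (coordAt 𝒰 (D.c x) i j, coordAt 𝒰 (E.c (x.map T hT)) i j) ∈ V x)
    (hv : ∀ x, ∀ q ∈ V x, ValRel G (D.v x q.1) (E.v _ q.2)) : PartialEmb 𝒰 D E where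
  T := T
  T_const := hT
  pt := Point.map T hT
  inChart_pt := inChart_map
  coordAt_pt _ := coordAt_map
  G := G
  one_mem := hone
  compat := hG
  V := V
  sec_mem := hs
  gen_mem := hg
  val := hv

/-- Every embedding of the field `k` is part of a partial embedding. -/
theorem exists_partialEmb (𝒰 : Atlas p) (T : D.k →+* E.k)
    (hT : T.comp (algebraMap f D.k) = algebraMap f E.k)
    {G : AddSubgroup (D.Γ × E.Γ)} (hone : (D.one, E.one) ∈ G) (hG : IsOrderCompat G) :
    ∃ P : PartialEmb 𝒰 D E, P.T = T ∧ P.G = G := by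
  choose V h1 h2 h3 using fun x : Point p (algebraMap f D.k) =>
    exists_generic_subring (𝒰 := 𝒰) (x := x) (x' := x.map T hT) hT
      ⟨fun _ => inChart_map, coordAt_map⟩ hone
  exact ⟨PartialEmb.ofFibers T hT G hone hG V h1 h2 h3, rfl, rfl⟩

/-- A partial isomorphism extends to a partial embedding, if it has been extended to `k`. The value
group can be prescribed. -/
theorem IsPartialIso.exists_partialEmb {R : D.Carrier → E.Carrier → Prop}
    (hR : IsPartialIso (L := lang 𝒰) R) (T : D.k →+* E.k) (hT : ∀ q ∈ hR.kPart, q.2 = T q.1)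
    {G : AddSubgroup (D.Γ × E.Γ)} (hG : IsOrderCompat G) (hle : hR.gPart ≤ G) :
    ∃ P : PartialEmb 𝒰 D E, P.T = T ∧ P.G = G ∧ ∀ a b, R a b → P.Rel a b := by
  have hT' : T.comp (algebraMap f D.k) = algebraMap f E.k :=
    RingHom.ext fun r => (hT (_, _) (hR.const_mem r)).symm
  have hone := hle hR.gPart_one
  have hc (x) : Corr 𝒰 T x (x.map T hT') := ⟨fun _ => inChart_map, coordAt_map⟩
  have key (x : Point p (algebraMap f D.k)) : ∃ V : Subring (D.VF x × E.VF (x.map T hT')),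
      (∀ c, (D.constV x c, E.constV (x.map T hT') (T c)) ∈ V) ∧
      (∀ i j, (coordAt 𝒰 (D.c x) i j, coordAt 𝒰 (E.c (x.map T hT')) i j) ∈ V) ∧
      (∀ q ∈ V, ValRel G (D.v x q.1) (E.v (x.map T hT') q.2)) ∧
      (R (ofC x) (ofC (x.map T hT')) →
        ∀ a a', R (ofV x a) (ofV (x.map T hT') a') → (a, a') ∈ V) := by
    by_cases hx : R (ofC x) (ofC (x.map T hT'))
    · obtain ⟨V, h1, h2, h3⟩ := hR.exists_span_subring hx hT
      exact ⟨V, h1, fun i j => h2 (hR.vPart_gen hx i j), fun q hq => (h3 q hq).mono hle,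
        fun _ a a' h => h2 h⟩
    · obtain ⟨V, h1, h2, h3⟩ := exists_generic_subring (𝒰 := 𝒰) hT' (hc x) hone
      exact ⟨V, h1, h2, h3, fun h => absurd h hx⟩
  choose V h1 h2 h3 h4 using key
  refine ⟨PartialEmb.ofFibers T hT' G hone hG V h1 h2 h3, rfl, rfl, fun a b hab => ?_⟩
  cases a with
  | ofK a =>
    obtain ⟨b, rfl⟩ := (hR.rel₁ .isK hab).1 (isK_ofK 𝒰)
    obtain rfl : b = T a := hT (a, b) hab
    exact .ofK a
  | ofC x =>
    obtain ⟨x', rfl⟩ := (hR.rel₁ .isC hab).1 (isC_ofC 𝒰)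
    obtain rfl := (hR.corr hab hT).eq (hc x)
    exact .ofC x
  | ofG γ =>
    obtain ⟨γ', rfl⟩ := (hR.rel₁ .isG hab).1 (isG_ofG 𝒰)
    exact .ofG (hle hab)
  | ofV x a =>
    obtain ⟨x', a', rfl⟩ := (hR.rel₁ .isV hab).1 (isV_ofV 𝒰)
    have hx : R (ofC x) (ofC x') := hR.func₁ .base hab
    obtain rfl := (hR.corr hx hT).eq (hc x)
    exact .ofV (h4 x hx a a' hab)

end

end CurveACVF
end

noncomputable section
namespace CurveACVF

open FirstOrder FirstOrder.Language FirstOrder.Language.Structure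

/-! ### Extension of partial embeddings -/

section General

variable {L : FirstOrder.Language.{u, u}} {M N N' : Type u} [L.Structure M] [L.Structure N]
  [L.Structure N']

lemma IsPartialIso.flip {R : M → N → Prop} (hR : IsPartialIso (L := L) R) :
    IsPartialIso (L := L) (fun b a => R a b) where
  func g t t' h := hR.func g t' t h
  rel r t t' h := (hR.rel r t' t h).symm
  eq h h' := (hR.eq h h').symm

lemma IsPartialIso.comp_embedding {R : M → N → Prop} (hR : IsPartialIso (L := L) R)
    (j : N ↪ₑ[L] N') : IsPartialIso (L := L) (fun a b => ∃ c, R a c ∧ j c = b) where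
  func g t t' h := by
    choose c hc hcj using h
    obtain rfl : j ∘ c = t' := funext hcj
    exact ⟨_, hR.func g t c hc, j.map_fun g c⟩
  rel r t t' h := by
    choose c hc hcj using h
    obtain rfl : j ∘ c = t' := funext hcj
    exact (hR.rel r t c hc).trans (j.map_rel r c).symm
  eq := by
    rintro a b _ _ ⟨c, hc, rfl⟩ ⟨d, hd, rfl⟩
    rw [hR.eq hc hd, j.injective.eq_iff]

end General

section

variable {f : Type u} [Field f] {C : Scheme.{u}} {p : C ⟶ Spec (CommRingCat.of f)}
  [SmoothOfRelativeDimension 1 p] [GeometricallyIntegral p] {𝒰 : Atlas p} {D E : Model p}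

open Model Model.Carrier

instance (D : Model p) : Nonempty D.Carrier := ⟨.ofK 0⟩

lemma Model.exists_point (𝒰 : Atlas p) (D : Model p) : ∃ _ : Point p (algebraMap f D.k), True := by
  obtain ⟨i, -⟩ := exists_chart 𝒰
  obtain ⟨x, -⟩ := exists_point_inChart 𝒰 (algebraMap f D.k) i
  exact ⟨x, trivial⟩

/-- The value group of a model is divisible. -/
lemma Model.exists_nsmul_eq (𝒰 : Atlas p) (D : Model p) {n : ℕ} (hn : 0 < n) (γ : D.Γ) :
    ∃ δ, n • δ = γ := by
  obtain ⟨x, -⟩ := D.exists_point 𝒰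
  obtain ⟨a, ha⟩ := D.v_surjective x γ
  obtain ⟨b, rfl⟩ := IsAlgClosed.exists_pow_nat_eq a hn
  rw [(D.v x).map_pow] at ha
  have hb : D.v x b ≠ ⊤ := fun h => by
    rw [h] at ha
    obtain ⟨m, rfl⟩ := Nat.exists_eq_succ_of_ne_zero hn.ne'
    rw [succ_nsmul, WithTop.add_top] at ha
    exact WithTop.top_ne_coe ha
  obtain ⟨δ, hδ⟩ := WithTop.ne_top_iff_exists.1 hb
  refine ⟨δ, ?_⟩
  rw [← hδ] at ha
  exact_mod_cast ha

variable [IsSeparated p]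

/-- Compactness, within the class of the described structures. -/
theorem exists_model_extension (E : Model p) {ι I : Type u}
    (P : I → ∀ (M : Type u) [(lang 𝒰).Structure M], (E.Carrier ⊕ ι → M) → Prop)
    (hP : ∀ i, FO (P i))
    (h : ∀ s : Finset I, ∃ w : ι → E.Carrier, ∀ i ∈ s, P i E.Carrier (Sum.elim id w)) :
    ∃ (E' : Model p) (j : E.Carrier ↪ₑ[lang 𝒰] E'.Carrier) (w : ι → E'.Carrier),
      ∀ i, P i E'.Carrier (Sum.elim j w) := by
  choose φ hφ using fun i => (hP i).exists_formula
  obtain ⟨N, _, j, w, hw⟩ := exists_elementaryEmbedding_realize φ fun s => by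
    obtain ⟨w, hw⟩ := h s
    exact ⟨w, fun i hi => (hφ i _ _).2 (hw i hi)⟩
  have hN : N ⊨ theory 𝒰 := by
    have := models_theory (𝒰 := 𝒰) E
    exact j.theory_model_iff (theory 𝒰) |>.1 this
  obtain ⟨E', ⟨e⟩⟩ := exists_equiv_model hN
  refine ⟨E', e.toElementaryEmbedding.comp j, e ∘ w, fun i => ?_⟩
  rw [← hφ]
  have h1 := (StrongHomClass.realize_formula e (φ i)).2 (hw i)
  convert! h1 using 1
  funext m; cases m <;> rfl

/-- A partial isomorphism that is defined on `k` and on the points is a partial embedding. -/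
theorem IsPartialIso.exists_partialEmb_rel {R : D.Carrier → E.Carrier → Prop}
    (hR : IsPartialIso (L := lang 𝒰) R) (hK : ∀ a, ∃ a', R (ofK a) a') (hC : ∀ x, ∃ x', R (ofC x) x') :
    ∃ P : PartialEmb 𝒰 D E, ∀ a b, P.Rel a b ↔ R a b := by
  have hK' (a) : ∃ a', R (ofK a) (ofK a') := by
    obtain ⟨m, hm⟩ := hK a
    obtain ⟨a', rfl⟩ := (hR.rel₁ .isK hm).1 (isK_ofK 𝒰)
    exact ⟨a', hm⟩
  have hC' (x) : ∃ x', R (ofC x) (ofC x') := by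
    obtain ⟨m, hm⟩ := hC x
    obtain ⟨x', rfl⟩ := (hR.rel₁ .isC hm).1 (isC_ofC 𝒰)
    exact ⟨x', hm⟩
  choose t ht using hK'
  choose pt hpt using hC'
  have hf (q) (hq : q ∈ hR.kPart) : q.2 = t q.1 := by
    simpa using hR.eq hq (ht q.1)
  let T : D.k →+* E.k :=
    { toFun := t
      map_zero' := (hf 0 hR.kPart.zero_mem).symm
      map_one' := (hf 1 hR.kPart.one_mem).symm
      map_add' := fun a b => (hf ((a, t a) + (b, t b)) (hR.kPart.add_mem (ht a) (ht b))).symm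
      map_mul' := fun a b => (hf ((a, t a) * (b, t b)) (hR.kPart.mul_mem (ht a) (ht b))).symm }
  have hcorr (x) : Corr 𝒰 T x (pt x) := hR.corr (hpt x) hf
  let P : PartialEmb 𝒰 D E :=
    { T := T
      T_const := RingHom.ext fun r => (hf (_, _) (hR.const_mem r)).symm
      pt := pt
      inChart_pt := fun {x i} => (hcorr x).1 i
      coordAt_pt := fun x => (hcorr x).2
      G := hR.gPart
      one_mem := hR.gPart_one
      compat := hR.gPart_compat
      V := fun x => hR.vPart (hpt x)
      sec_mem := fun x c => hR.sec_mem (hpt x) (q := (c, t c)) (ht c)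
      gen_mem := fun x => hR.vPart_gen (hpt x)
      val := fun x q hq => hR.vPart_val (hpt x) hq }
  refine ⟨P, fun a b => ⟨?_, fun hab => ?_⟩⟩
  · rintro (a | x | h | h)
    exacts [ht a, hpt x, h, h]
  · cases a with
    | ofK a =>
      obtain ⟨b, rfl⟩ := (hR.rel₁ .isK hab).1 (isK_ofK 𝒰)
      obtain rfl : b = t a := hf (a, b) hab
      exact .ofK (P := P) a
    | ofC x =>
      obtain ⟨x', rfl⟩ := (hR.rel₁ .isC hab).1 (isC_ofC 𝒰)
      obtain rfl := (hR.corr hab hf).eq (hcorr x)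
      exact .ofC (P := P) x
    | ofG γ =>
      obtain ⟨γ', rfl⟩ := (hR.rel₁ .isG hab).1 (isG_ofG 𝒰)
      exact .ofG (P := P) hab
    | ofV x a =>
      obtain ⟨x', a', rfl⟩ := (hR.rel₁ .isV hab).1 (isV_ofV 𝒰)
      have hx : R (ofC x) (ofC x') := hR.func₁ .base hab
      obtain rfl := (hR.corr hx hf).eq (hcorr x)
      exact .ofV (P := P) hab

namespace PartialEmb

set_option linter.unusedSectionVars false

variable (P : PartialEmb 𝒰 D E)

/-- The composite of a partial embedding and an elementary embedding. -/
theorem exists_comp {E' : Model p} (j : E.Carrier ↪ₑ[lang 𝒰] E'.Carrier) :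
    ∃ P' : PartialEmb 𝒰 D E', ∀ a b, P'.Rel a b ↔ ∃ c, P.Rel a c ∧ j c = b :=
  (P.isPartialIso.comp_embedding j).exists_partialEmb_rel (fun a => ⟨_, _, .ofK a, rfl⟩)
    (fun x => ⟨_, _, .ofC x, rfl⟩)

/-- Enlarges the value group of a partial embedding. -/
def withG (G' : AddSubgroup (D.Γ × E.Γ)) (hle : P.G ≤ G') (hG' : IsOrderCompat G') :
    PartialEmb 𝒰 D E :=
  { P with
    G := G'
    one_mem := hle P.one_mem
    compat := hG'
    val := fun x q hq => (P.val x q hq).mono hle }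

lemma rel_withG {G' : AddSubgroup (D.Γ × E.Γ)} {hle : P.G ≤ G'} {hG' : IsOrderCompat G'} {a b}
    (h : P.Rel a b) : (P.withG G' hle hG').Rel a b := by
  rcases h with a | x | h | h
  exacts [.ofK (P := P.withG G' hle hG') a, .ofC (P := P.withG G' hle hG') x,
    .ofG (P := P.withG G' hle hG') (hle h), .ofV (P := P.withG G' hle hG') h]

lemma rel_ofG {γ γ'} : P.Rel (ofG γ) (ofG γ') ↔ (γ, γ') ∈ P.G := by
  refine ⟨fun h => ?_, .ofG⟩
  cases h with | ofG h => exact h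

/-- The domain of a partial embedding on a fiber. -/
def dom (x) : Subring (D.VF x) := (P.V x).map (RingHom.fst _ _)

lemma mem_dom {x} {a : D.VF x} : a ∈ P.dom x ↔ ∃ a', (a, a') ∈ P.V x := by
  simp [dom]

lemma mem_dom_iff_rel {x} {a : D.VF x} : a ∈ P.dom x ↔ ∃ m, P.Rel (ofV x a) m := by
  rw [mem_dom]
  refine ⟨fun ⟨a', h⟩ => ⟨_, .ofV h⟩, fun ⟨m, h⟩ => ?_⟩
  cases h with | ofV h => exact ⟨_, h⟩

/-- The value group of the partial embedding is pure. -/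
def IsPure : Prop := ∀ n : ℕ, 0 < n → ∀ q, n • q ∈ P.G → q ∈ P.G

/-- Extends a partial embedding to the pure hull of the value group. -/
lemma exists_isPure : ∃ P' : PartialEmb 𝒰 D E, P'.IsPure ∧ (∀ a b, P.Rel a b → P'.Rel a b) ∧
    ∀ x, P'.dom x = P.dom x := by
  let G' : AddSubgroup (D.Γ × E.Γ) :=
    { carrier := {q | ∃ n : ℕ, 0 < n ∧ n • q ∈ P.G}
      zero_mem' := ⟨1, one_pos, by rw [smul_zero]; exact P.G.zero_mem⟩
      neg_mem' := by
        rintro q ⟨n, hn, h⟩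
        exact ⟨n, hn, by rw [smul_neg]; exact P.G.neg_mem h⟩
      add_mem' := by
        rintro q r ⟨n, hn, h⟩ ⟨m, hm, h'⟩
        refine ⟨n * m, Nat.mul_pos hn hm, ?_⟩
        rw [smul_add]
        refine P.G.add_mem ?_ ?_
        · rw [mul_comm, mul_smul]; exact P.G.nsmul_mem h m
        · rw [mul_smul]; exact P.G.nsmul_mem h' n }
  have hG' : IsOrderCompat G' := by
    rintro q ⟨n, hn, h⟩
    have := P.compat _ h
    rwa [Prod.smul_fst, Prod.smul_snd, nsmul_nonneg_iff hn.ne', nsmul_nonneg_iff hn.ne'] at this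
  have hle : P.G ≤ G' := fun q hq => ⟨1, one_pos, by rwa [one_smul]⟩
  refine ⟨P.withG G' hle hG', ?_, fun a b => P.rel_withG, fun x => rfl⟩
  rintro n hn q ⟨m, hm, h⟩
  exact ⟨m * n, Nat.mul_pos hm hn, by rwa [mul_smul]⟩

/-- Extends a partial embedding to a given element of the value group. -/
theorem exists_extension_G (γ : D.Γ) :
    ∃ (E' : Model p) (j : E.Carrier ↪ₑ[lang 𝒰] E'.Carrier) (P' : PartialEmb 𝒰 D E'),
      (∀ a b, P.Rel a b → P'.Rel a (j b)) ∧ (∀ x, P'.dom x = P.dom x) ∧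
      ∃ γ', (γ, γ') ∈ P'.G := by
  obtain ⟨P₁, hpure, hP₁, hdom₁⟩ := P.exists_isPure
  by_cases hγ : ∃ γ', (γ, γ') ∈ P₁.G
  · exact ⟨E, ElementaryEmbedding.refl _ _, P₁, hP₁, hdom₁, hγ⟩
  have hne (q) (hq : q ∈ P₁.G) : q.1 ≠ γ := fun h => hγ ⟨q.2, h ▸ hq⟩
  have hd : DenselyOrdered E.Γ := ⟨fun a b hab => by
    obtain ⟨c, hc⟩ := E.exists_nsmul_eq 𝒰 two_pos (a + b)
    rw [two_smul] at hc
    refine ⟨c, ?_, ?_⟩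
    · by_contra! h
      exact absurd hc (ne_of_lt (add_lt_add_of_le_of_lt h (h.trans_lt hab)))
    · by_contra! h
      exact absurd hc (ne_of_gt (add_lt_add_of_lt_of_le (hab.trans_le h) h))⟩
  have hmax : NoMaxOrder E.Γ := ⟨fun a => ⟨a + E.one, lt_add_of_pos_right a E.one_pos⟩⟩
  have hmin : NoMinOrder E.Γ := ⟨fun a => ⟨a - E.one, sub_lt_self a E.one_pos⟩⟩
  obtain ⟨E', j, w, hw⟩ := exists_model_extension (𝒰 := 𝒰) E (ι := PUnit) (I := P₁.G)
    (fun q M _ v => (q.1.1 < γ → gLe 𝒰 (v (.inl (ofG q.1.2))) (v (.inr ⟨⟩)) ∧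
      v (.inl (ofG q.1.2)) ≠ v (.inr ⟨⟩)) ∧
      (γ < q.1.1 → gLe 𝒰 (v (.inr ⟨⟩)) (v (.inl (ofG q.1.2))) ∧
        v (.inl (ofG q.1.2)) ≠ v (.inr ⟨⟩)))
    (fun q => by
      by_cases h1 : q.1.1 < γ <;> by_cases h2 : γ < q.1.1 <;>
        simp only [h1, h2, true_imp_iff, false_imp_iff, true_and, and_true]
      all_goals first | infer_instance | skip
      · exact ⟨⊤, fun _ _ _ => by simp⟩)
    (fun s => by
      classical
      obtain ⟨γ', h1, h2⟩ := Order.exists_between_finsets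
        ((s.filter fun q => q.1.1 < γ).image fun q => q.1.2)
        ((s.filter fun q => γ < q.1.1).image fun q => q.1.2) (by
          intro a ha b hb
          simp only [Finset.mem_image, Finset.mem_filter] at ha hb
          obtain ⟨q, ⟨-, hq⟩, rfl⟩ := ha
          obtain ⟨r, ⟨-, hr⟩, rfl⟩ := hb
          rw [← not_le, ← P₁.compat.le_iff r.2 q.2, not_le]
          exact hq.trans hr)
      refine ⟨fun _ => ofG γ', fun q hq => ⟨fun hlt => ?_, fun hlt => ?_⟩⟩
      · have := h1 q.1.2 (Finset.mem_image_of_mem _ (Finset.mem_filter.2 ⟨hq, hlt⟩))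
        exact ⟨(gLe_ofG 𝒰).2 this.le, fun h => this.ne (ofG.inj h)⟩
      · have := h2 q.1.2 (Finset.mem_image_of_mem _ (Finset.mem_filter.2 ⟨hq, hlt⟩))
        exact ⟨(gLe_ofG 𝒰).2 this.le, fun h => this.ne' (ofG.inj h)⟩)
  obtain ⟨P₂, hP₂⟩ := P₁.exists_comp j
  obtain ⟨γ', hγ'⟩ : ∃ γ', w ⟨⟩ = ofG γ' := by
    rcases lt_or_gt_of_ne (hne 0 P₁.G.zero_mem) with h | h
    · obtain ⟨_, δ, -, h', -⟩ := ((hw 0).1 h).1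
      exact ⟨δ, h'⟩
    · obtain ⟨δ, _, h', -, -⟩ := ((hw 0).2 h).1
      exact ⟨δ, h'⟩
  have hcut (q) (hq : q ∈ P₂.G) : (q.1 < γ ∧ q.2 < γ') ∨ (γ < q.1 ∧ γ' < q.2) := by
    obtain ⟨c, hc, hj⟩ := (hP₂ _ _).1 (.ofG (P := P₂) hq)
    obtain ⟨α', rfl⟩ := (P₁.isPartialIso.rel₁ .isG hc).1 (isG_ofG 𝒰)
    rw [P₁.rel_ofG] at hc
    have h1 := hw ⟨_, hc⟩
    simp only [Sum.elim_inl, Sum.elim_inr, hγ', hj, gLe_ofG, ne_eq, ofG.injEq] at h1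
    exact (lt_or_gt_of_ne (hne _ hc)).imp (fun h => ⟨h, lt_of_le_of_ne (h1.1 h).1 (h1.1 h).2⟩)
      fun h => ⟨h, lt_of_le_of_ne (h1.2 h).1 (Ne.symm (h1.2 h).2)⟩
  have hpure₂ : P₂.IsPure := by
    intro n hn q hq
    obtain ⟨c, hc, hj⟩ := (hP₂ _ _).1 (.ofG (P := P₂) hq)
    obtain ⟨δ, rfl⟩ := (P₁.isPartialIso.rel₁ .isG hc).1 (isG_ofG 𝒰)
    rw [P₁.rel_ofG] at hc
    obtain ⟨ε, rfl⟩ := E.exists_nsmul_eq 𝒰 hn δ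
    have h1 : P₂.Rel (ofG q.1) (j (ofG ε)) :=
      (hP₂ _ _).2 ⟨_, .ofG (hpure n hn (q.1, ε) hc), rfl⟩
    obtain ⟨ε', hε'⟩ := (P₂.isPartialIso.rel₁ .isG h1).1 (isG_ofG 𝒰)
    have hε₁ : j (ofG ε) = ofG ε' := hε'
    rw [hε₁, P₂.rel_ofG] at h1
    have h2 := (P₂.compat.eq_iff (P₂.G.nsmul_mem h1 n) hq).1 rfl
    have h3 : ε' = q.2 := nsmul_right_injective hn.ne' h2
    rwa [h3] at h1
  refine ⟨E', j, P₂.withG (P₂.G ⊔ AddSubgroup.zmultiples (γ, γ')) le_sup_left ?_,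
    fun a b hab => P₂.rel_withG ((hP₂ _ _).2 ⟨b, hP₁ a b hab, rfl⟩), fun x => ?_, γ',
    AddSubgroup.mem_sup_right (AddSubgroup.mem_zmultiples _)⟩
  · intro q hq
    obtain ⟨g, hg, z, hz, rfl⟩ := AddSubgroup.mem_sup.1 hq
    obtain ⟨n, rfl⟩ := AddSubgroup.mem_zmultiples_iff.1 hz
    have hdiv (m : ℕ) (hm : 0 < m) (g) (hg : g ∈ P₂.G) : ∃ b ∈ P₂.G, g = m • b := by
      obtain ⟨β, hβ⟩ := D.exists_nsmul_eq 𝒰 hm g.1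
      obtain ⟨β', hβ'⟩ := E'.exists_nsmul_eq 𝒰 hm g.2
      have h : g = m • (β, β') := Prod.ext hβ.symm hβ'.symm
      exact ⟨_, hpure₂ m hm _ (h ▸ hg), h⟩
    obtain ⟨m, rfl | rfl⟩ := n.eq_nat_or_neg
    all_goals
      rcases Nat.eq_zero_or_pos m with rfl | hm
      · simpa using P₂.compat g hg
      obtain ⟨b, hb, rfl⟩ := hdiv m hm g hg
    · have h1 := hcut (-b) (P₂.G.neg_mem hb)
      simp only [Prod.fst_add, Prod.snd_add, Prod.smul_fst, Prod.smul_snd, natCast_zsmul,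
        ← smul_add, nsmul_nonneg_iff hm.ne', Prod.fst_neg, Prod.snd_neg, ← neg_le_iff_add_nonneg'] at h1 ⊢
      rcases h1 with h | h
      · exact iff_of_true h.1.le h.2.le
      · exact iff_of_false (not_le.2 h.1) (not_le.2 h.2)
    · have h1 := hcut b hb
      simp only [Prod.fst_add, Prod.snd_add, Prod.smul_fst, Prod.smul_snd, natCast_zsmul, neg_smul,
        ← sub_eq_add_neg, ← smul_sub, nsmul_nonneg_iff hm.ne', Prod.fst_sub, Prod.snd_sub,
        sub_nonneg]
      rcases h1 with h | h
      · exact iff_of_false (not_le.2 h.1) (not_le.2 h.2)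
      · exact iff_of_true h.1.le h.2.le
  · rw [← hdom₁]
    ext b
    change b ∈ P₂.dom x ↔ _
    rw [mem_dom_iff_rel, mem_dom_iff_rel]
    constructor
    · rintro ⟨m, hm⟩
      obtain ⟨c, hc, -⟩ := (hP₂ _ _).1 hm
      exact ⟨c, hc⟩
    · rintro ⟨c, hc⟩
      exact ⟨j c, (hP₂ _ _).2 ⟨c, hc, rfl⟩⟩

end PartialEmb

end

end CurveACVF
end

noncomputable section
namespace CurveACVF

/-! ### Partial embeddings of valued fields -/

section ValuedFields

open Polynomial

/-- A subring of a field which is a relatively algebraically closed subfield. -/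
structure IsClosedFiber {K : Type u} [Field K] (S : Subring K) : Prop where
  inv_mem : ∀ a ∈ S, a⁻¹ ∈ S
  root_mem : ∀ (P : K[X]) (y : K), P ≠ 0 → (∀ n, P.coeff n ∈ S) → P.eval y = 0 → y ∈ S

variable {Γ Γ' : Type u} [AddCommGroup Γ] [LinearOrder Γ] [IsOrderedAddMonoid Γ]
  [AddCommGroup Γ'] [LinearOrder Γ'] [IsOrderedAddMonoid Γ']
  {K K' : Type u} [Field K] [Field K'] {v : AddValuation K (WithTop Γ)}
  {v' : AddValuation K' (WithTop Γ')} {G : AddSubgroup (Γ × Γ')}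

variable (v v' G) in
/-- A partial embedding of valued fields, with a given partial embedding of value groups. -/
def IsValCompat (V : Subring (K × K')) : Prop := ∀ q ∈ V, ValRel G (v q.1) (v' q.2)

lemma ValRel.of_add {a b : WithTop Γ} {a' b' : WithTop Γ'} (ha : ValRel G a a') (ha' : a ≠ ⊤)
    (h : ValRel G (a + b) (a' + b')) : ValRel G b b' := by
  obtain ⟨q, hq, rfl, rfl⟩ := ha.resolve_left fun h => ha' h.1
  rcases h with ⟨h, h'⟩ | ⟨r, hr, h, h'⟩
  · left
    rw [WithTop.add_eq_top] at h h'
    exact ⟨h.resolve_left WithTop.coe_ne_top, h'.resolve_left WithTop.coe_ne_top⟩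
  · right
    have hb : b ≠ ⊤ := by
      rintro rfl; rw [WithTop.add_top] at h; exact WithTop.top_ne_coe h
    have hb' : b' ≠ ⊤ := by
      rintro rfl; rw [WithTop.add_top] at h'; exact WithTop.top_ne_coe h'
    lift b to Γ using hb
    lift b' to Γ' using hb'
    rw [← WithTop.coe_add, WithTop.coe_inj] at h h'
    exact ⟨r - q, G.sub_mem hr hq, by simp [← h], by simp [← h']⟩

lemma IsValCompat.eq_zero_iff {V : Subring (K × K')} (hV : IsValCompat v v' G V) {q : K × K'}
    (hq : q ∈ V) : q.1 = 0 ↔ q.2 = 0 := by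
  have := (hV q hq).top_iff
  rwa [AddValuation.top_iff, AddValuation.top_iff] at this

lemma IsValCompat.eq_iff {V : Subring (K × K')} (hV : IsValCompat v v' G V) {q r : K × K'}
    (hq : q ∈ V) (hr : r ∈ V) : q.1 = r.1 ↔ q.2 = r.2 := by
  have := hV.eq_zero_iff (V.sub_mem hq hr)
  rwa [Prod.fst_sub, Prod.snd_sub, sub_eq_zero, sub_eq_zero] at this

/-- The localization of a partial embedding. -/
def locSubring (V : Subring (K × K')) : Subring (K × K') where
  carrier := {q | ∃ r ∈ V, r.1 ≠ 0 ∧ r * q ∈ V}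
  one_mem' := ⟨1, V.one_mem, one_ne_zero, by rw [mul_one]; exact V.one_mem⟩
  zero_mem' := ⟨1, V.one_mem, one_ne_zero, by rw [mul_zero]; exact V.zero_mem⟩
  neg_mem' := by
    rintro q ⟨r, hr, h0, h⟩
    exact ⟨r, hr, h0, by rw [mul_neg]; exact V.neg_mem h⟩
  mul_mem' := by
    rintro q q' ⟨r, hr, h0, h⟩ ⟨r', hr', h0', h'⟩
    refine ⟨r * r', V.mul_mem hr hr', mul_ne_zero h0 h0', ?_⟩
    rw [mul_mul_mul_comm]; exact V.mul_mem h h'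
  add_mem' := by
    rintro q q' ⟨r, hr, h0, h⟩ ⟨r', hr', h0', h'⟩
    refine ⟨r * r', V.mul_mem hr hr', mul_ne_zero h0 h0', ?_⟩
    have : r * r' * (q + q') = r' * (r * q) + r * (r' * q') := by ring
    rw [this]
    exact V.add_mem (V.mul_mem hr' h) (V.mul_mem hr h')

lemma le_locSubring (V : Subring (K × K')) : V ≤ locSubring V := fun q hq =>
  ⟨1, V.one_mem, one_ne_zero, by rwa [one_mul]⟩

lemma IsValCompat.locSubring {V : Subring (K × K')} (hV : IsValCompat v v' G V) :
    IsValCompat v v' G (locSubring V) := by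
  rintro q ⟨r, hr, h0, h⟩
  refine (hV r hr).of_add (fun h => h0 ((AddValuation.top_iff _).1 h)) ?_
  have := hV _ h
  rwa [Prod.fst_mul, Prod.snd_mul, AddValuation.map_mul, AddValuation.map_mul] at this

/-- The valuation subring of an additive valuation. -/
def valSubring (v : AddValuation K (WithTop Γ)) : ValuationSubring K where
  toSubring := valuationRing v
  mem_or_inv_mem' a := by
    rcases eq_or_ne a 0 with rfl | ha
    · exact .inl (valuationRing v).zero_mem
    refine or_iff_not_imp_left.2 fun h => ?_
    have h1 : v a < 0 := not_le.1 h
    have h2 : v a + v a⁻¹ = 0 := by rw [← v.map_mul, mul_inv_cancel₀ ha, v.map_one]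
    change 0 ≤ v a⁻¹
    by_contra! h3
    refine absurd h2 (ne_of_lt ?_)
    have := WithTop.add_lt_add_right (z := v a⁻¹) (fun h => by simp [h] at h3) h1
    exact this.trans (by rwa [zero_add])

lemma mem_valSubring {a : K} : a ∈ valSubring v ↔ 0 ≤ v a := Iff.rfl

lemma mem_comap_valSubring {L : Type*} [Field L] (i : L →+* K) {a b : L} (hb : b ≠ 0) :
    ((valSubring v).comap i).valuation a ≤ ((valSubring v).comap i).valuation b ↔
      v (i b) ≤ v (i a) := by
  set V := (valSubring v).comap i
  have hb' : V.valuation b ≠ 0 := (Valuation.ne_zero_iff _).2 hb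
  have hvb : v (i b) ≠ ⊤ := fun h => hb (i.injective (by
    rw [map_zero]; exact (AddValuation.top_iff _).1 h))
  have h1 : V.valuation a = V.valuation (a / b) * V.valuation b := by
    rw [← map_mul, div_mul_cancel₀ a hb]
  have h2 : v (i a) = v (i (a / b)) + v (i b) := by
    rw [← v.map_mul, ← map_mul, div_mul_cancel₀ a hb]
  rw [h1, h2, mul_le_iff_le_one_left (zero_lt_iff.2 hb'), V.valuation_le_one_iff,
    ValuationSubring.mem_comap, mem_valSubring]
  have := WithTop.add_le_add_iff_right (x := 0) (y := v (i (a / b))) hvb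
  rw [zero_add] at this
  exact this.symm

lemma mem_map_fst {V : Subring (K × K')} {a : K} :
    a ∈ V.map (RingHom.fst K K') ↔ ∃ a', (a, a') ∈ V := by simp

/-- A partial embedding into an algebraically closed valued field extends to a relatively
algebraically closed subfield. -/
theorem IsValCompat.exists_isClosedFiber [IsAlgClosed K'] (hG : IsOrderCompat G)
    (hpure : ∀ n : ℕ, 0 < n → ∀ q, n • q ∈ G → q ∈ G)
    {V : Subring (K × K')} (hV : IsValCompat v v' G V) :
    ∃ W, V ≤ W ∧ IsValCompat v v' G W ∧ IsClosedFiber (W.map (RingHom.fst K K')) := by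
  obtain ⟨W, hVW, hW, hmax⟩ := zorn_le_nonempty₀ {W | IsValCompat v v' G W} (by
    intro c hc hchain y hy
    refine ⟨sSup c, fun q hq => ?_, fun z hz => le_sSup hz⟩
    obtain ⟨s, hs, hq⟩ := (Subring.mem_sSup_of_directedOn ⟨y, hy⟩ hchain.directedOn).1 hq
    exact hc hs q hq) V hV
  change IsValCompat v v' G W at hW
  have hloc : CurveACVF.locSubring W ≤ W := hmax hW.locSubring (le_locSubring W)
  have hinv (a) (ha : a ∈ W.map (RingHom.fst K K')) : a⁻¹ ∈ W.map (RingHom.fst K K') := by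
    rcases eq_or_ne a 0 with rfl | h0
    · rwa [inv_zero]
    obtain ⟨a', ha'⟩ := mem_map_fst.1 ha
    have h0' : a' ≠ 0 := fun h => h0 ((hW.eq_zero_iff ha').2 h)
    refine mem_map_fst.2 ⟨a'⁻¹, hloc ⟨_, ha', h0, ?_⟩⟩
    have : (a, a') * (a⁻¹, a'⁻¹) = 1 := Prod.ext (mul_inv_cancel₀ h0) (mul_inv_cancel₀ h0')
    exact this ▸ W.one_mem
  refine ⟨W, hVW, hW, hinv, fun P y hP hc hy => ?_⟩
  let F : Subfield K := { W.map (RingHom.fst K K') with inv_mem' := hinv }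
  have hF (a : F) : ∃ a', ((a : K), a') ∈ W := mem_map_fst.1 a.2
  choose φ₀ hφ₀ using hF
  have huniq {a : F} {a'} (h : ((a : K), a') ∈ W) : φ₀ a = a' := (hW.eq_iff (hφ₀ a) h).1 rfl
  let φ : F →+* K' :=
    { toFun := φ₀
      map_one' := huniq W.one_mem
      map_zero' := huniq W.zero_mem
      map_add' := fun a b => huniq (W.add_mem (hφ₀ a) (hφ₀ b))
      map_mul' := fun a b => huniq (W.mul_mem (hφ₀ a) (hφ₀ b)) }
  let _ : Algebra F K' := φ.toAlgebra
  have hyF : IsIntegral F y := by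
    refine IsAlgebraic.isIntegral ?_
    obtain ⟨P', rfl⟩ : ∃ P' : F[X], P'.map F.subtype = P := by
      have := (Polynomial.mem_lifts (f := F.subtype) P).1 ((Polynomial.lifts_iff_coeff_lifts P).2
        fun n => ⟨⟨_, hc n⟩, rfl⟩)
      exact this
    refine ⟨P', fun h => hP (by rw [h, Polynomial.map_zero]), ?_⟩
    rw [Polynomial.eval_map] at hy
    exact hy
  let L := IntermediateField.adjoin F {y}
  have : FiniteDimensional F L := IntermediateField.adjoin.finiteDimensional hyF
  obtain ⟨σ, hσ⟩ := exists_algHom_comap_eq (F := F) (L := L) (Ω := K')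
    ((valSubring v).comap (algebraMap L K)) (valSubring v') (by
      ext a
      have := (valRel_zero (G := G)).le_iff hG (hW _ (hφ₀ a))
      exact this)
  let ψ : L →+* K × K' := (algebraMap L K).prod (σ : L →+* K')
  have hle : W ≤ ψ.range := fun q hq => by
    have hq1 : q.1 ∈ F := mem_map_fst.2 ⟨q.2, hq⟩
    refine ⟨algebraMap F L ⟨q.1, hq1⟩, Prod.ext rfl ?_⟩
    change σ (algebraMap F L ⟨q.1, hq1⟩) = q.2
    rw [σ.commutes]
    exact huniq hq
  have hψ : IsValCompat v v' G ψ.range := by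
    rintro _ ⟨l, rfl⟩
    change ValRel G (v (algebraMap L K l)) (v' (σ l))
    rcases eq_or_ne l 0 with rfl | hl
    · rw [_root_.map_zero (algebraMap L K), _root_.map_zero σ, AddValuation.map_zero,
        AddValuation.map_zero]
      exact valRel_top
    obtain ⟨m, c, hm, hc0, hval⟩ := exists_valuation_pow_eq (algebraMap F L)
      ((valSubring v).comap (algebraMap L K)) hl (minpoly.ne_zero (IsIntegral.of_finite F l))
      (minpoly.aeval F l)
    have hc1 : algebraMap F L c ≠ 0 := by rwa [_root_.map_ne_zero]
    have h1 : v (algebraMap L K (l ^ m)) = v (c : K) :=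
      le_antisymm ((mem_comap_valSubring (v := v) (algebraMap L K) (pow_ne_zero m hl)).1 hval.ge)
        ((mem_comap_valSubring (v := v) (algebraMap L K) hc1).1 hval.le)
    have hval' := hval
    rw [← hσ] at hval'
    have h2 : v' (σ (l ^ m)) = v' (σ (algebraMap F L c)) :=
      le_antisymm ((mem_comap_valSubring (v := v') (σ : L →+* K') (pow_ne_zero m hl)).1 hval'.ge)
        ((mem_comap_valSubring (v := v') (σ : L →+* K') hc1).1 hval'.le)
    rw [σ.commutes] at h2
    rw [map_pow, v.map_pow] at h1
    rw [map_pow, v'.map_pow] at h2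
    have hne : v (algebraMap L K l) ≠ ⊤ := fun h => hl ((algebraMap L K).injective (by
      rw [map_zero]; exact (AddValuation.top_iff _).1 h))
    have hne' : v' (σ l) ≠ ⊤ := fun h => hl (σ.toRingHom.injective (by
      rw [map_zero]; exact (AddValuation.top_iff _).1 h))
    obtain ⟨γ, hγ⟩ := WithTop.ne_top_iff_exists.1 hne
    obtain ⟨γ', hγ'⟩ := WithTop.ne_top_iff_exists.1 hne'
    rw [← hγ, ← hγ']
    refine valRel_coe (hpure m hm _ ?_)
    rw [← hγ] at h1
    rw [← hγ'] at h2
    rcases hW _ (hφ₀ c) with ⟨h3, -⟩ | ⟨q, hq, h3, h4⟩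
    · exact absurd ((AddValuation.top_iff _).1 h3) fun h => hc0 (Subtype.ext h)
    · have h5 : m • γ = q.1 := WithTop.coe_injective (h1.trans h3)
      have h6 : m • γ' = q.2 := WithTop.coe_injective (h2.trans h4)
      have h7 : m • (γ, γ') = q := Prod.ext h5 h6
      rwa [h7]
  have : ψ.range ≤ W := hmax hψ hle
  exact mem_map_fst.2 ⟨_, this ⟨⟨y, IntermediateField.mem_adjoin_simple_self F y⟩, rfl⟩⟩

/-- Extension of a partial embedding of valued fields by a transcendental element. -/
theorem IsValCompat.exists_extension [IsAlgClosed K] {W : Subring (K × K')}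
    (hW : IsValCompat v v' G W) (hF : IsClosedFiber (W.map (RingHom.fst K K'))) {y : K} {y' : K'}
    (h : ∀ q ∈ W, ValRel G (v (y - q.1)) (v' (y' - q.2))) :
    ∃ W', W ≤ W' ∧ IsValCompat v v' G W' ∧ (y, y') ∈ W' := by
  let ev : W[X] →+* K × K' := Polynomial.eval₂RingHom W.subtype (y, y')
  have hev (P : W[X]) : ev P = P.eval₂ W.subtype (y, y') := rfl
  have hinj : Function.Injective ((RingHom.fst K K').comp W.subtype) := fun a b hab =>
    Subtype.ext (Prod.ext hab ((hW.eq_iff a.2 b.2).1 hab))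
  have key (n : ℕ) : ∀ P : W[X], P.natDegree = n → ValRel G (v (ev P).1) (v' (ev P).2) := by
    induction n with
    | zero =>
      intro P hP
      rw [Polynomial.eq_C_of_natDegree_eq_zero hP, hev, Polynomial.eval₂_C]
      exact hW _ (P.coeff 0).2
    | succ n ih =>
      intro P hP
      set Q := P.map ((RingHom.fst K K').comp W.subtype) with hQ
      have hdeg : Q.natDegree = n + 1 := by
        rw [hQ, Polynomial.natDegree_map_eq_of_injective hinj, hP]
      obtain ⟨b, hb⟩ := IsAlgClosed.exists_root Q fun h => by
        have := Polynomial.natDegree_eq_zero_iff_degree_le_zero.2 h.le; omega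
      have hb1 : b ∈ W.map (RingHom.fst K K') := hF.root_mem Q b
        (fun h => by rw [h, Polynomial.natDegree_zero] at hdeg; omega) (fun m => by
          rw [hQ, Polynomial.coeff_map]
          exact ⟨_, (P.coeff m).2, rfl⟩) hb
      obtain ⟨b', hb'⟩ := mem_map_fst.1 hb1
      have hroot : P.IsRoot (⟨(b, b'), hb'⟩ : W) := hinj (by
        rw [map_zero, ← Polynomial.eval₂_at_apply, ← Polynomial.eval_map]
        exact hb)
      obtain ⟨R, hR⟩ := Polynomial.dvd_iff_isRoot.2 hroot
      have hR' : R.natDegree = n := by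
        have : Nontrivial W := ⟨0, 1, fun h => zero_ne_one (α := K) (congrArg (fun z : W => z.1.1) h)⟩
        have hR0 : R ≠ 0 := by
          rintro rfl; rw [mul_zero] at hR; rw [hR, Polynomial.natDegree_zero] at hP; omega
        have := (Polynomial.monic_X_sub_C (⟨(b, b'), hb'⟩ : W)).natDegree_mul' hR0
        rw [← hR, hP, Polynomial.natDegree_X_sub_C] at this
        omega
      rw [hR, map_mul, Prod.fst_mul, Prod.snd_mul, v.map_mul, v'.map_mul]
      refine ValRel.add ?_ (ih R hR')
      rw [hev, Polynomial.eval₂_sub, Polynomial.eval₂_X, Polynomial.eval₂_C]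
      exact h _ hb'
  refine ⟨ev.range, fun q hq => ⟨C ⟨q, hq⟩, Polynomial.eval₂_C _ _⟩, ?_,
    ⟨X, Polynomial.eval₂_X _ _⟩⟩
  rintro _ ⟨P, rfl⟩
  exact key _ P rfl

end ValuedFields

end CurveACVF
end

noncomputable section
namespace CurveACVF

open FirstOrder FirstOrder.Language FirstOrder.Language.Structure

/-! ### Extension of partial embeddings in the fibers -/

section

variable {f : Type u} [Field f] {C : Scheme.{u}} {p : C ⟶ Spec (CommRingCat.of f)}
  [SmoothOfRelativeDimension 1 p] [GeometricallyIntegral p] {𝒰 : Atlas p} {D E : Model p}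

open Model Model.Carrier

namespace PartialEmb

set_option linter.unusedSectionVars false

variable (P : PartialEmb 𝒰 D E)

open Classical in
/-- Enlarges a partial embedding on a fiber. -/
def withV (x) (W : Subring (D.VF x × E.VF (P.pt x))) (hle : P.V x ≤ W)
    (hW : IsValCompat (D.v x) (E.v (P.pt x)) P.G W) : PartialEmb 𝒰 D E :=
  have hle' (y) : P.V y ≤ Function.update P.V x W y := by
    rcases eq_or_ne y x with rfl | h
    · rwa [Function.update_self]
    · rw [Function.update_of_ne h]
  { P with
    V := Function.update P.V x W
    sec_mem := fun y c => hle' y (P.sec_mem y c)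
    gen_mem := fun y i j => hle' y (P.gen_mem y i j)
    val := fun y => by
      rcases eq_or_ne y x with rfl | h
      · rw [Function.update_self]; exact hW
      · rw [Function.update_of_ne h]; exact P.val y }

variable {P} {x} {W : Subring (D.VF x × E.VF (P.pt x))} {hle : P.V x ≤ W}
  {hW : IsValCompat (D.v x) (E.v (P.pt x)) P.G W}

open Classical in
lemma withV_self : (P.withV x W hle hW).V x = W := by
  change Function.update P.V x W x = W
  exact Function.update_self _ _ _

open Classical in
lemma le_withV (y) : P.V y ≤ (P.withV x W hle hW).V y := by
  change P.V y ≤ Function.update P.V x W y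
  rcases eq_or_ne y x with rfl | h
  · rwa [Function.update_self]
  · rw [Function.update_of_ne h]

lemma rel_withV {a b} (h : P.Rel a b) : (P.withV x W hle hW).Rel a b := by
  rcases h with a | y | h | h
  exacts [.ofK (P := P.withV x W hle hW) a, .ofC (P := P.withV x W hle hW) y,
    .ofG (P := P.withV x W hle hW) h, .ofV (P := P.withV x W hle hW) (le_withV _ h)]

variable [IsSeparated p] (P)

/-- Extension of a partial embedding by an element that is at a compatible distance from the
elements of a relatively algebraically closed domain. -/
lemma exists_extension_of_valRel {y : D.VF x} {y' : E.VF (P.pt x)} (hF : IsClosedFiber (P.dom x))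
    (h : ∀ q ∈ P.V x, ValRel P.G (D.v x (y - q.1)) (E.v _ (y' - q.2))) :
    ∃ P' : PartialEmb 𝒰 D E, (∀ a b, P.Rel a b → P'.Rel a b) ∧
      P'.Rel (ofV x y) (ofV (P.pt x) y') := by
  obtain ⟨W, hle, hW, hy⟩ := IsValCompat.exists_extension (v := D.v x) (v' := E.v (P.pt x))
    (G := P.G) (P.val x) hF h
  refine ⟨P.withV x W hle hW, fun a b => rel_withV, ?_⟩
  refine .ofV (P := P.withV x W hle hW) ?_
  rw [withV_self]
  exact hy

variable {y : D.VF x}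

/-- Extension by an element that gives rise to a new value. -/
lemma exists_extension_new_value (hF : IsClosedFiber (P.dom x)) {b₀ : D.VF x} (hb₀ : b₀ ∈ P.dom x)
    {γ : D.Γ} (hγ : D.v x (y - b₀) = γ) (hnew : ∀ q ∈ P.G, q.1 ≠ γ) :
    ∃ (E' : Model p) (j : E.Carrier ↪ₑ[lang 𝒰] E'.Carrier) (P' : PartialEmb 𝒰 D E'),
      (∀ a b, P.Rel a b → P'.Rel a (j b)) ∧ ∃ e, P'.Rel (ofV x y) e := by
  obtain ⟨E', j, P₂, hP₂, hdom, γ', hγ'⟩ := P.exists_extension_G γ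
  rw [← hdom] at hF
  obtain ⟨b₀', hb₀'⟩ := P₂.mem_dom.1 (by rwa [hdom])
  obtain ⟨e, he⟩ := E'.v_surjective (P₂.pt x) γ'
  obtain ⟨P', hP', hrel⟩ := P₂.exists_extension_of_valRel (y := y) (y' := b₀' + e) hF (by
    intro q hq
    have hmem := sub_mem hb₀' hq
    have h1 : ValRel P₂.G (D.v x (b₀ - q.1)) (E'.v _ (b₀' - q.2)) := P₂.val x _ hmem
    have h2 : y - q.1 = (y - b₀) + (b₀ - q.1) := by ring
    have h3 : b₀' + e - q.2 = e + (b₀' - q.2) := by ring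
    have h4 : ValRel P₂.G (D.v x (y - b₀)) (E'.v (P₂.pt x) e) := by
      rw [hγ, he]; exact valRel_coe hγ'
    have hne : D.v x (y - b₀) ≠ D.v x (b₀ - q.1) := by
      obtain ⟨r', hr'⟩ := (P.mem_dom (a := b₀ - q.1)).1 (by
        rw [← hdom]; exact P₂.mem_dom.2 ⟨_, hmem⟩)
      rw [hγ]
      rcases P.val x _ hr' with ⟨h, -⟩ | ⟨r, hr, h, -⟩
      · change D.v x (b₀ - q.1) = ⊤ at h
        rw [h]; exact WithTop.coe_ne_top
      · change D.v x (b₀ - q.1) = _ at h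
        rw [h]; exact fun h => hnew r hr (WithTop.coe_injective h).symm
    have hne' : E'.v (P₂.pt x) e ≠ E'.v (P₂.pt x) (b₀' - q.2) := fun h =>
      hne ((h4.eq_iff P₂.compat h1).2 h)
    rw [h2, h3, (D.v x).map_add_of_distinct_val hne, (E'.v _).map_add_of_distinct_val hne']
    have h5 := h4.le_iff P₂.compat h1
    rcases le_total (D.v x (y - b₀)) (D.v x (b₀ - q.1)) with h | h
    · rw [min_eq_left h, min_eq_left (h5.1 h)]; exact h4
    · rw [min_eq_right h, min_eq_right ((h1.le_iff P₂.compat h4).1 h)]; exact h1)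
  exact ⟨E', j, P', fun a b hab => hP' _ _ (hP₂ a b hab), _, hrel⟩

instance (E : Model p) : Infinite E.k := IsAlgClosed.instInfinite

/-- Finitely many conditions on the distances to the domain can be satisfied. -/
lemma exists_forall_valRel {ι : Type*} (s : Finset ι) (b : ι → D.VF x × E.VF (P.pt x))
    (g : ι → D.Γ × E.Γ) (hb : ∀ i, b i ∈ P.V x) (hg : ∀ i, g i ∈ P.G)
    (h : ∀ i, D.v x (y - (b i).1) = (g i).1) :
    ∃ e : E.VF (P.pt x), ∀ i ∈ s, E.v _ (e - (b i).2) = (g i).2 := by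
  classical
  rcases s.eq_empty_or_nonempty with rfl | hs
  · exact ⟨0, by simp⟩
  obtain ⟨m, hm, hmax⟩ := s.exists_max_image (fun i => (g i).1) hs
  obtain ⟨π, hπ⟩ := E.v_surjective (P.pt x) (g m).2
  have hπ0 : π ≠ 0 := fun h => by
    rw [h, AddValuation.map_zero] at hπ; exact WithTop.top_ne_coe hπ
  obtain ⟨c, hc⟩ := Infinite.exists_notMem_finset
    (insert 0 (s.image fun i => E.resDiv (P.pt x) ((b i).2 - (b m).2) π))
  rw [Finset.mem_insert, not_or] at hc
  refine ⟨(b m).2 + E.constV (P.pt x) c * π, fun i hi => ?_⟩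
  have hcπ : E.v _ (E.constV (P.pt x) c * π) = (g m).2 := by
    rw [AddValuation.map_mul, hπ, E.val_sec (P.pt x) hc.1, zero_add]
  have hd := P.val x _ (sub_mem (hb i) (hb m))
  have hgi : ValRel P.G ((g i).1 : WithTop D.Γ) ((g i).2 : WithTop E.Γ) := valRel_coe (hg i)
  have hgm : ValRel P.G ((g m).1 : WithTop D.Γ) ((g m).2 : WithTop E.Γ) := valRel_coe (hg m)
  have h1 : (b i).1 - (b m).1 = (y - (b m).1) - (y - (b i).1) := by ring
  rcases (hmax i hi).lt_or_eq with hlt | heq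
  · have h2 : D.v x ((b i).1 - (b m).1) = (g i).1 := by
      rw [h1, AddValuation.map_sub_swap, (D.v x).map_sub_eq_of_lt_left, h]
      rw [h, h]; exact WithTop.coe_lt_coe.2 hlt
    have h3 : E.v _ ((b i).2 - (b m).2) = (g i).2 := (hd.eq_iff P.compat hgi).1 h2
    have h4 : (b m).2 + E.constV (P.pt x) c * π - (b i).2 =
      E.constV (P.pt x) c * π - ((b i).2 - (b m).2) := by ring
    rw [h4, AddValuation.map_sub_swap, (E.v _).map_sub_eq_of_lt_left, h3]
    rw [h3, hcπ]
    exact (hgi.lt_iff P.compat hgm).1 (WithTop.coe_lt_coe.2 hlt)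
  · have h2 : ((g m).1 : WithTop D.Γ) ≤ D.v x ((b i).1 - (b m).1) := by
      rw [h1]
      exact (D.v x).map_le_sub (h m).ge (by rw [h i, heq])
    have h3 := (hgm.le_iff P.compat hd).1 h2
    have h4 : (b m).2 + E.constV (P.pt x) c * π - (b i).2 =
      -(((b i).2 - (b m).2) - E.constV (P.pt x) c * π) := by ring
    have h5 : (g i).2 = (g m).2 := (P.compat.eq_iff (hg i) (hg m)).1 heq
    rw [h4, AddValuation.map_neg, h5]
    refine le_antisymm (not_lt.1 fun h6 => ?_) ((E.v _).map_le_sub h3 hcπ.ge)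
    rw [← hπ] at h6 h3
    exact hc.2 (Finset.mem_image.2 ⟨i, hi, (E.resDiv_eq_iff hπ0 h3 c).2 h6⟩)

/-- Extension by an element that does not give rise to a new value. -/
lemma exists_extension_old_value (hF : IsClosedFiber (P.dom x))
    (hold : ∀ b ∈ P.dom x, ∃ q ∈ P.G, D.v x (y - b) = (q.1 : D.Γ)) :
    ∃ (E' : Model p) (j : E.Carrier ↪ₑ[lang 𝒰] E'.Carrier) (P' : PartialEmb 𝒰 D E'),
      (∀ a b, P.Rel a b → P'.Rel a (j b)) ∧ ∃ e, P'.Rel (ofV x y) e := by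
  choose g hg hv using fun b : P.V x => hold b.1.1 (P.mem_dom.2 ⟨_, b.2⟩)
  obtain ⟨E', j, w, hw⟩ := exists_model_extension (𝒰 := 𝒰) E (ι := PUnit) (I := P.V x)
    (fun b M _ v => vl 𝒰 (vAdd 𝒰 (v (.inr ⟨⟩)) (vNeg 𝒰 (v (.inl (ofV (P.pt x) b.1.2))))) =
      v (.inl (ofG (g b).2))) (fun b => inferInstance) (fun s => by
      obtain ⟨e, he⟩ := P.exists_forall_valRel s (fun b => b.1) g (fun b => b.2) hg hv
      refine ⟨fun _ => ofV (P.pt x) e, fun b hb => ?_⟩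
      change vl 𝒰 (vAdd 𝒰 (ofV (P.pt x) e : E.Carrier) (vNeg 𝒰 (ofV (P.pt x) b.1.2))) = _
      rw [vNeg_ofV, vAdd_ofV, ← sub_eq_add_neg]
      exact vl_ofV_eq 𝒰 (he b hb))
  obtain ⟨P₂, hP₂⟩ := P.exists_comp j
  have hdom : P₂.dom x = P.dom x := by
    ext b
    rw [mem_dom_iff_rel, mem_dom_iff_rel]
    constructor
    · rintro ⟨m, hm⟩
      obtain ⟨c, hc, -⟩ := (hP₂ _ _).1 hm
      exact ⟨c, hc⟩
    · rintro ⟨c, hc⟩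
      exact ⟨j c, (hP₂ _ _).2 ⟨c, hc, rfl⟩⟩
  have key (q) (hq : q ∈ P₂.V x) : ∃ γ γ', (γ, γ') ∈ P₂.G ∧ D.v x (y - q.1) = (γ : D.Γ) ∧
      vl 𝒰 (vAdd 𝒰 (w ⟨⟩) (vNeg 𝒰 (ofV (P₂.pt x) q.2))) = ofG γ' := by
    obtain ⟨c, hc, hj⟩ := (hP₂ _ _).1 (.ofV (P := P₂) hq)
    obtain ⟨c', hc', rfl⟩ : ∃ c', (q.1, c') ∈ P.V x ∧ c = ofV (P.pt x) c' := by
      cases hc with | ofV h => exact ⟨_, h, rfl⟩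
    have h1 := hw ⟨_, hc'⟩
    have h2 : P₂.Rel (ofG (g ⟨_, hc'⟩).1) (j (ofG (g ⟨_, hc'⟩).2)) :=
      (hP₂ _ _).2 ⟨_, .ofG (hg ⟨_, hc'⟩), rfl⟩
    obtain ⟨γ', hγ'⟩ := (P₂.isPartialIso.rel₁ .isG h2).1 (isG_ofG 𝒰)
    have hγ₁ : j (ofG (g ⟨_, hc'⟩).2) = ofG γ' := hγ'
    rw [hγ₁, P₂.rel_ofG] at h2
    refine ⟨_, γ', h2, hv ⟨_, hc'⟩, ?_⟩
    rw [← hj]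
    exact h1.trans hγ₁
  obtain ⟨e, he⟩ : ∃ e, w ⟨⟩ = ofV (P₂.pt x) e := by
    obtain ⟨γ, γ', -, -, h⟩ := key 0 (P₂.V x).zero_mem
    rw [vNeg_ofV] at h
    cases hw0 : w ⟨⟩ with
    | ofV z e =>
      rw [hw0] at h
      by_cases hz : P₂.pt x = z
      · subst hz; exact ⟨e, rfl⟩
      · have h1 : vAdd 𝒰 (ofV z e : E'.Carrier) (ofV (P₂.pt x) (-(0 : D.VF x × E'.VF (P₂.pt x)).2)) =
          undef := dif_neg hz
        rw [h1] at h
        cases h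
    | ofK a => rw [hw0] at h; cases h
    | ofC a => rw [hw0] at h; cases h
    | ofG a => rw [hw0] at h; cases h
  obtain ⟨P', hP', hrel⟩ := P₂.exists_extension_of_valRel (y := y) (y' := e) (hdom ▸ hF) (by
    intro q hq
    obtain ⟨γ, γ', hmem, h1, h2⟩ := key q hq
    rw [he, vNeg_ofV, vAdd_ofV, ← sub_eq_add_neg, vl_ofV, valElem] at h2
    rw [h1]
    cases hv' : E'.v (P₂.pt x) (e - q.2) with
    | top => rw [hv'] at h2; cases h2
    | coe δ =>
      rw [hv'] at h2
      cases h2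
      exact valRel_coe hmem)
  exact ⟨E', j, P', fun a b hab => hP' _ _ ((hP₂ _ _).2 ⟨b, hab, rfl⟩), _, hrel⟩

/-- A partial embedding extends to any given element. -/
theorem exists_extension (d : D.Carrier) :
    ∃ (E' : Model p) (j : E.Carrier ↪ₑ[lang 𝒰] E'.Carrier) (P' : PartialEmb 𝒰 D E'),
      (∀ a b, P.Rel a b → P'.Rel a (j b)) ∧ ∃ e, P'.Rel d e := by
  cases d with
  | ofK a => exact ⟨E, ElementaryEmbedding.refl _ _, P, fun _ _ h => h, _, .ofK a⟩
  | ofC x => exact ⟨E, ElementaryEmbedding.refl _ _, P, fun _ _ h => h, _, .ofC x⟩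
  | ofG γ =>
    obtain ⟨E', j, P', hP', -, γ', h⟩ := P.exists_extension_G γ
    exact ⟨E', j, P', hP', _, .ofG h⟩
  | ofV x y =>
    obtain ⟨P₁, hpure, hP₁, -⟩ := P.exists_isPure
    obtain ⟨W, hle, hW, hF⟩ := IsValCompat.exists_isClosedFiber (v := D.v x) (v' := E.v (P₁.pt x))
      P₁.compat hpure (P₁.val x)
    let P₂ := P₁.withV x W hle hW
    have hP₂ (a b) (hab : P.Rel a b) : P₂.Rel a b := rel_withV (hP₁ a b hab)
    have hF₂ : IsClosedFiber (P₂.dom x) := by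
      rw [dom, withV_self]; exact hF
    by_cases hy : y ∈ P₂.dom x
    · obtain ⟨m, hm⟩ := P₂.mem_dom_iff_rel.1 hy
      exact ⟨E, ElementaryEmbedding.refl _ _, P₂, hP₂, m, hm⟩
    have key : ∃ (E' : Model p) (j : E.Carrier ↪ₑ[lang 𝒰] E'.Carrier) (P' : PartialEmb 𝒰 D E'),
      (∀ a b, P₂.Rel a b → P'.Rel a (j b)) ∧ ∃ e, P'.Rel (ofV x y) e := by
      by_cases h : ∀ b ∈ P₂.dom x, ∃ q ∈ P₂.G, D.v x (y - b) = (q.1 : D.Γ)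
      · exact P₂.exists_extension_old_value hF₂ h
      push Not at h
      obtain ⟨b, hb, h⟩ := h
      have hne : D.v x (y - b) ≠ ⊤ := fun h' => hy (by
        rw [D.v_eq_top, sub_eq_zero] at h'; rwa [h'])
      obtain ⟨γ, hγ⟩ := WithTop.ne_top_iff_exists.1 hne
      exact P₂.exists_extension_new_value hF₂ hb hγ.symm fun q hq h' => h q hq (by rw [h', hγ])
    obtain ⟨E', j, P', hP', he⟩ := key
    exact ⟨E', j, P', fun a b hab => hP' _ _ (hP₂ a b hab), he⟩

end PartialEmb

end

end CurveACVF
end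

noncomputable section
namespace CurveACVF

open FirstOrder FirstOrder.Language FirstOrder.Language.Structure

/-! ### Extension of partial embeddings in the residue field -/

/-- A nonzero algebra of finite type over a field has points in every algebraically closed
extension. -/
theorem nonempty_algHom_of_finiteType (F A Ω : Type*) [Field F] [CommRing A] [Nontrivial A]
    [Algebra F A] [hft : Algebra.FiniteType F A] [Field Ω] [Algebra F Ω] [IsAlgClosed Ω] :
    Nonempty (A →ₐ[F] Ω) := by
  obtain ⟨m, hm⟩ := Ideal.exists_maximal A
  let _ : Field (A ⧸ m) := Ideal.Quotient.field m
  have hft : Algebra.FiniteType F (A ⧸ m) :=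
    hft.of_surjective (Ideal.Quotient.mkₐ F m) (Ideal.Quotient.mkₐ_surjective F m)
  have hfin : Module.Finite F (A ⧸ m) := finite_of_finite_type_of_isJacobsonRing F (A ⧸ m)
  exact ⟨(IsAlgClosed.lift : (A ⧸ m) →ₐ[F] Ω).comp (Ideal.Quotient.mkₐ F m)⟩

/-- A partial embedding of a field in an algebraically closed one extends to finitely many further
elements. -/
theorem exists_ringHom_of_finset {K K' : Type u} [Field K] [Field K'] [IsAlgClosed K']
    (S : Subring (K × K')) (hS : ∀ q ∈ S, q.1 = 0 ↔ q.2 = 0) (F : Finset K) :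
    ∃ (B : Subring K) (ψ : B →+* K'), (∀ a ∈ F, a ∈ B) ∧ ∀ q ∈ S, ∃ h : q.1 ∈ B, ψ ⟨q.1, h⟩ = q.2 := by
  have hW (q) (hq : q ∈ locSubring S) : q.1 = 0 ↔ q.2 = 0 := by
    obtain ⟨r, hr, h0, h⟩ := hq
    have := hS _ h
    rwa [Prod.fst_mul, Prod.snd_mul, mul_eq_zero_iff_left h0,
      mul_eq_zero_iff_left fun h => h0 ((hS r hr).2 h)] at this
  let K₀ : Subfield K :=
    { (locSubring S).map (RingHom.fst K K') with
      inv_mem' := by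
        rintro _ ⟨q, hq, rfl⟩
        rcases eq_or_ne q.1 0 with h0 | h0
        · exact ⟨0, (locSubring S).zero_mem, by simp [h0]⟩
        have h0' : q.2 ≠ 0 := fun h => h0 ((hW q hq).2 h)
        obtain ⟨r, hr, hr0, h⟩ := hq
        refine ⟨(q.1⁻¹, q.2⁻¹), ⟨r * q, h, mul_ne_zero hr0 h0, ?_⟩, rfl⟩
        have : r * q * (q.1⁻¹, q.2⁻¹) = r :=
          Prod.ext (mul_inv_cancel_right₀ h0 _) (mul_inv_cancel_right₀ h0' _)
        rwa [this] }
  have hF (a : K₀) : ∃ a', ((a : K), a') ∈ locSubring S := mem_map_fst.1 a.2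
  choose φ₀ hφ₀ using hF
  have huniq {a : K₀} {a'} (h : ((a : K), a') ∈ locSubring S) : φ₀ a = a' := by
    have := (hW _ (sub_mem (hφ₀ a) h)).1 (sub_self _)
    exact sub_eq_zero.1 this
  let φ : K₀ →+* K' :=
    { toFun := φ₀
      map_one' := huniq (locSubring S).one_mem
      map_zero' := huniq (locSubring S).zero_mem
      map_add' := fun a b => huniq ((locSubring S).add_mem (hφ₀ a) (hφ₀ b))
      map_mul' := fun a b => huniq ((locSubring S).mul_mem (hφ₀ a) (hφ₀ b)) }
  let _ : Algebra K₀ K' := φ.toAlgebra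
  let B := Algebra.adjoin K₀ (F : Set K)
  have hB : Algebra.FiniteType K₀ B := Algebra.FiniteType.adjoin_of_finite F.finite_toSet
  obtain ⟨ψ⟩ := nonempty_algHom_of_finiteType K₀ B K'
  refine ⟨B.toSubring, (ψ : B →+* K'), fun a ha =>
    Algebra.subset_adjoin ha, fun q hq => ?_⟩
  have hq' := le_locSubring S hq
  let a : K₀ := ⟨q.1, mem_map_fst.2 ⟨q.2, hq'⟩⟩
  refine ⟨B.algebraMap_mem a, ?_⟩
  exact (ψ.commutes a).trans (huniq (a := a) hq')

section

variable {f : Type u} [Field f] {C : Scheme.{u}} {p : C ⟶ Spec (CommRingCat.of f)}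
  [SmoothOfRelativeDimension 1 p] [GeometricallyIntegral p] {𝒰 : Atlas p} {D E : Model p}
  [IsSeparated p]

open Model Model.Carrier

/-- A partial embedding of residue fields extends to an embedding in an elementary extension. -/
theorem exists_residueField_extension (𝒰 : Atlas p) (S : Subring (D.k × E.k))
    (hS : ∀ q ∈ S, q.1 = 0 ↔ q.2 = 0) :
    ∃ (E' : Model p) (j : E.Carrier ↪ₑ[lang 𝒰] E'.Carrier) (T : D.k →+* E'.k),
      ∀ q ∈ S, j (ofK q.2) = ofK (T q.1) := by
  classical
  obtain ⟨E', j, w, hw⟩ := exists_model_extension (𝒰 := 𝒰) E (ι := D.k) (I := D.k × D.k × S)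
    (fun i M _ v => isK 𝒰 (v (.inr i.1)) ∧
      kAdd 𝒰 (v (.inr i.1)) (v (.inr i.2.1)) = v (.inr (i.1 + i.2.1)) ∧
      kMul 𝒰 (v (.inr i.1)) (v (.inr i.2.1)) = v (.inr (i.1 * i.2.1)) ∧
      v (.inr i.2.2.1.1) = v (.inl (ofK i.2.2.1.2))) (fun i => inferInstance) (fun s => by
      obtain ⟨B, ψ, hB, hψ⟩ := exists_ringHom_of_finset S hS
        (s.image (fun i => i.1) ∪ s.image fun i => i.2.1)
      let g (a : D.k) : E.k := if h : a ∈ B then ψ ⟨a, h⟩ else 0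
      have hg {a} (h : a ∈ B) : g a = ψ ⟨a, h⟩ := dif_pos h
      refine ⟨fun a => ofK (g a), fun i hi => ?_⟩
      have h1 : i.1 ∈ B := hB _ (Finset.mem_union_left _ (Finset.mem_image_of_mem _ hi))
      have h2 : i.2.1 ∈ B := hB _ (Finset.mem_union_right _
        (Finset.mem_image_of_mem (fun i : D.k × D.k × S => i.2.1) hi))
      obtain ⟨h3, h4⟩ := hψ _ i.2.2.2
      refine ⟨isK_ofK 𝒰, congrArg ofK ?_, congrArg ofK ?_, congrArg ofK ?_⟩
      · change g i.1 + g i.2.1 = g (i.1 + i.2.1)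
        rw [hg h1, hg h2, hg (B.add_mem h1 h2), ← map_add]; rfl
      · change g i.1 * g i.2.1 = g (i.1 * i.2.1)
        rw [hg h1, hg h2, hg (B.mul_mem h1 h2), ← map_mul]; rfl
      · rw [hg h3, h4])
  have hK (a) : ∃ b, w a = ofK b := (hw (a, 0, 0)).1
  choose t ht using hK
  have hj (a) : ∃ b : E'.k, j (ofK a) = ofK b :=
    (j.map_rel (rsym 𝒰 .isK) ![ofK a]).2 (isK_ofK 𝒰)
  have hadd (a b) : t (a + b) = t a + t b := by
    have := (hw (a, b, 0)).2.1
    simp only [Sum.elim_inr, ht] at this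
    exact (Carrier.ofK.inj this).symm
  have hmul (a b) : t (a * b) = t a * t b := by
    have := (hw (a, b, 0)).2.2.1
    simp only [Sum.elim_inr, ht] at this
    exact (Carrier.ofK.inj this).symm
  have hS' (q) (hq : q ∈ S) : j (ofK q.2) = ofK (t q.1) := by
    have := (hw (0, 0, ⟨q, hq⟩)).2.2.2
    simp only [Sum.elim_inr, Sum.elim_inl, ht] at this
    exact this.symm
  have h1 : t 1 = 1 := by
    have h2 : j (cst 𝒰 1) = cst 𝒰 1 := by
      rw [cst, cst, j.map_fun]; congr 1; ext i; exact i.elim0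
    have h3 := hS' 1 S.one_mem
    rw [cst_eq, cst_eq, map_one, map_one] at h2
    exact Carrier.ofK.inj (h3.symm.trans h2)
  exact ⟨E', j, { toFun := t, map_one' := h1, map_mul' := hmul, map_add' := hadd
                  map_zero' := by have := hadd 0 0; rwa [add_zero, left_eq_add] at this }, hS'⟩

/-- A partial isomorphism is contained in a partial embedding in an elementary extension. -/
theorem IsPartialIso.exists_partialEmb_extension {R : D.Carrier → E.Carrier → Prop}
    (hR : IsPartialIso (L := lang 𝒰) R) :
    ∃ (E' : Model p) (j : E.Carrier ↪ₑ[lang 𝒰] E'.Carrier) (P : PartialEmb 𝒰 D E'),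
      ∀ a b, R a b → P.Rel a (j b) := by
  obtain ⟨E', j, T, hT⟩ := exists_residueField_extension 𝒰 hR.kPart fun q hq =>
    hR.kPart_eq_zero hq
  have hR' := hR.comp_embedding j
  obtain ⟨P, -, -, hP⟩ := hR'.exists_partialEmb T (by
    rintro q ⟨c, hc, hj⟩
    obtain ⟨b, rfl⟩ := (hR.rel₁ .isK hc).1 (isK_ofK 𝒰)
    have := hT (q.1, b) hc
    exact Carrier.ofK.inj (hj.symm.trans this)) hR'.gPart_compat le_rfl
  exact ⟨E', j, P, fun a b hab => hP _ _ ⟨b, hab, rfl⟩⟩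

/-- A partial isomorphism extends to a given element, in an elementary extension. -/
theorem IsPartialIso.exists_extension {R : D.Carrier → E.Carrier → Prop}
    (hR : IsPartialIso (L := lang 𝒰) R) (d : D.Carrier) :
    ∃ (E' : Model p) (j : E.Carrier ↪ₑ[lang 𝒰] E'.Carrier) (R' : D.Carrier → E'.Carrier → Prop),
      IsPartialIso (L := lang 𝒰) R' ∧ (∀ a b, R a b → R' a (j b)) ∧ ∃ e, R' d e := by
  obtain ⟨E₁, j₁, P₁, hP₁⟩ := hR.exists_partialEmb_extension
  obtain ⟨E₂, j₂, P₂, hP₂, he⟩ := P₁.exists_extension d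
  exact ⟨E₂, j₂.comp j₁, P₂.Rel, P₂.isPartialIso, fun a b hab => hP₂ _ _ (hP₁ a b hab), he⟩

/-- Partial isomorphisms preserve all formulas. -/
theorem IsPartialIso.realize_iff {D E : Model p} {R : D.Carrier → E.Carrier → Prop}
    (hR : IsPartialIso (L := lang 𝒰) R) {α : Type*} {n : ℕ} (φ : (lang 𝒰).BoundedFormula α n)
    {v : α → D.Carrier} {v' : α → E.Carrier} {xs : Fin n → D.Carrier} {xs' : Fin n → E.Carrier}
    (hv : ∀ a, R (v a) (v' a)) (hxs : ∀ i, R (xs i) (xs' i)) :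
    φ.Realize v xs ↔ φ.Realize v' xs' := by
  have hterm {D E : Model p} {R : D.Carrier → E.Carrier → Prop}
      (hR : IsPartialIso (L := lang 𝒰) R) {n : ℕ} {v : α → D.Carrier} {v' : α → E.Carrier}
      {xs : Fin n → D.Carrier} {xs' : Fin n → E.Carrier} (hv : ∀ a, R (v a) (v' a))
      (hxs : ∀ i, R (xs i) (xs' i)) (t : (lang 𝒰).Term (α ⊕ Fin n)) :
      R (t.realize (Sum.elim v xs)) (t.realize (Sum.elim v' xs')) := by
    induction t with
    | var a => rcases a with a | i; exacts [hv a, hxs i]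
    | func g ts ih => exact hR.func g _ _ ih
  induction φ generalizing D E with
  | falsum => exact Iff.rfl
  | equal t₁ t₂ => exact hR.eq (hterm hR hv hxs t₁) (hterm hR hv hxs t₂)
  | rel r ts => exact hR.rel r _ _ fun i => hterm hR hv hxs (ts i)
  | imp φ ψ ih ih' =>
    rw [BoundedFormula.realize_imp, BoundedFormula.realize_imp]
    exact imp_congr (ih hR hv hxs) (ih' hR hv hxs)
  | all φ ih =>
    have step {D E : Model p} {R : D.Carrier → E.Carrier → Prop}
        (hR : IsPartialIso (L := lang 𝒰) R) {v : α → D.Carrier} {v' : α → E.Carrier}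
        {xs : Fin _ → D.Carrier} {xs' : Fin _ → E.Carrier} (hv : ∀ a, R (v a) (v' a))
        (hxs : ∀ i, R (xs i) (xs' i)) (h : φ.all.Realize v' xs') : φ.all.Realize v xs := by
      rw [BoundedFormula.realize_all]
      intro d
      obtain ⟨E', j, R', hR', hle, e, he⟩ := hR.exists_extension d
      have h1 : φ.all.Realize (j ∘ v') (j ∘ xs') := (j.map_boundedFormula φ.all v' xs').2 h
      rw [BoundedFormula.realize_all] at h1
      refine (ih hR' (fun a => hle _ _ (hv a)) (fun i => ?_)).2 (h1 e)
      refine Fin.lastCases ?_ (fun i => ?_) i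
      · simpa using he
      · simpa using hle _ _ (hxs i)
    exact ⟨step hR.flip hv hxs, step hR hv hxs⟩

end

end CurveACVF
end

noncomputable section
namespace CurveACVF

open FirstOrder FirstOrder.Language FirstOrder.Language.Structure

/-! ### Quantifier elimination and completeness -/

/-- Tuples with the same quantifier-free type generate isomorphic substructures. -/
lemma isPartialIso_terms {L : FirstOrder.Language.{u, u}} {M N : Type u} [L.Structure M]
    [L.Structure N] {β : Type*} {v : β → M} {w : β → N}
    (h : ∀ ψ : L.Formula β, ψ.IsQF → (ψ.Realize v ↔ ψ.Realize w)) :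
    IsPartialIso (L := L) fun a b => ∃ t : L.Term β, t.realize v = a ∧ t.realize w = b where
  func g s s' hs := by
    choose t ht ht' using hs
    obtain rfl := funext ht
    obtain rfl := funext ht'
    exact ⟨Term.func g t, rfl, rfl⟩
  rel r s s' hs := by
    choose t ht ht' using hs
    obtain rfl := funext ht
    obtain rfl := funext ht'
    simpa only [Formula.realize_rel] using h (r.formula t) (BoundedFormula.IsAtomic.rel _ _).isQF
  eq := by
    rintro _ _ _ _ ⟨s, rfl, rfl⟩ ⟨t, rfl, rfl⟩
    simpa only [Formula.realize_equal] using h (s.equal t) (BoundedFormula.IsAtomic.equal _ _).isQF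

section

variable {f : Type u} [Field f] {C : Scheme.{u}} {p : C ⟶ Spec (CommRingCat.of f)}
  [SmoothOfRelativeDimension 1 p] [GeometricallyIntegral p] {𝒰 : Atlas p} {D E : Model p}
  [IsSeparated p]

open Model Model.Carrier

/-- Ultraproducts, within the class of the described structures. -/
theorem exists_ultraproduct {α : Type u} (U : Ultrafilter α) (M : α → Type u)
    [∀ a, (lang 𝒰).Structure (M a)] (hM : ∀ a, M a ⊨ theory 𝒰) :
    ∃ (E : Model p) (π : (∀ a, M a) → E.Carrier), ∀ {β : Type*} (φ : (lang 𝒰).Formula β)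
      (v : β → ∀ a, M a),
      φ.Realize (fun b => π (v b)) ↔ {a | φ.Realize fun b => v b a} ∈ U := by
  have hne (a) : Nonempty (M a) := by
    have := hM a
    obtain ⟨D, ⟨e⟩⟩ := exists_equiv_model (hM a)
    exact ⟨e.symm (ofK 0)⟩
  have hN : (U : Filter α).Product M ⊨ theory 𝒰 := by
    rw [Theory.model_iff]
    intro σ hσ
    rw [Ultraproduct.sentence_realize]
    exact Filter.Eventually.of_forall fun a => (hM a).realize_of_mem σ hσ
  obtain ⟨E, ⟨e⟩⟩ := exists_equiv_model hN
  refine ⟨E, fun x => e (x : (U : Filter α).Product M), fun φ v => ?_⟩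
  refine Iff.trans ?_ (Ultraproduct.realize_formula_cast (u := U) φ v)
  exact StrongHomClass.realize_formula e φ

/-- A quantifier-free type determines a complete type. -/
theorem realize_iff_of_isQF {β : Type*} {v : β → D.Carrier} {w : β → E.Carrier}
    (h : ∀ ψ : (lang 𝒰).Formula β, ψ.IsQF → (ψ.Realize v ↔ ψ.Realize w))
    (φ : (lang 𝒰).Formula β) : φ.Realize v ↔ φ.Realize w :=
  (isPartialIso_terms h).realize_iff φ (fun b => ⟨Term.var b, rfl, rfl⟩) fun i => i.elim0

theorem hasQuantifierElimination (𝒰 : Atlas p) : HasQuantifierElimination (theory 𝒰) := by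
  intro n φ
  let α := {s : Set ((lang 𝒰).Formula (Fin n)) //
    ∃ (D : Model p) (v : Fin n → D.Carrier), s = {φ | φ.Realize v}}
  choose D v hDv using fun s : α => s.2
  let X (φ : (lang 𝒰).Formula (Fin n)) : Set α := {s | φ.Realize (v s)}
  by_cases hφ : X φ ∈ X '' {ψ | ψ.IsQF}
  · obtain ⟨ψ, hψ, hX⟩ := hφ
    refine ⟨ψ, hψ, Theory.models_formula_iff.2 fun M w => ?_⟩
    obtain ⟨E, ⟨e⟩⟩ := exists_equiv_model (𝒰 := 𝒰) (M := M) M.is_model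
    let s : α := ⟨_, E, e ∘ w, rfl⟩
    have hs (χ : (lang 𝒰).Formula (Fin n)) : χ.Realize (v s) ↔ χ.Realize w := by
      rw [← StrongHomClass.realize_formula e χ]
      exact (Set.ext_iff.1 (hDv s) χ).symm
    rw [Formula.realize_iff, ← hs, ← hs]
    exact (Set.ext_iff.1 hX s).symm
  · exfalso
    obtain ⟨U₁, U₂, h₁, h₂, h⟩ := exists_ultrafilter_of_notMem (X '' {ψ | ψ.IsQF})
      ⟨⊤, BoundedFormula.IsQF.top, Set.eq_univ_of_forall fun s => Formula.realize_top.2 trivial⟩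
      (by
        rintro _ ⟨ψ, hψ, rfl⟩ _ ⟨χ, hχ, rfl⟩
        exact ⟨ψ ⊓ χ, hψ.inf hχ, Set.ext fun s => Formula.realize_inf⟩)
      (by
        rintro _ ⟨ψ, hψ, rfl⟩
        exact ⟨ψ.not, hψ.not, Set.ext fun s => Formula.realize_not⟩) hφ
    obtain ⟨E₁, π₁, hπ₁⟩ := exists_ultraproduct U₁ (fun s => (D s).Carrier)
      fun s => models_theory (𝒰 := 𝒰) (D s)
    obtain ⟨E₂, π₂, hπ₂⟩ := exists_ultraproduct U₂ (fun s => (D s).Carrier)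
      fun s => models_theory (𝒰 := 𝒰) (D s)
    have := realize_iff_of_isQF (𝒰 := 𝒰) (D := E₁) (E := E₂)
      (v := fun i => π₁ fun s => v s i) (w := fun i => π₂ fun s => v s i) (fun ψ hψ => by
        rw [hπ₁, hπ₂]
        exact h _ ⟨ψ, hψ, rfl⟩) φ
    rw [hπ₁, hπ₂] at this
    exact h₂ (this.1 h₁)

lemma isPartialIso_graph {M N : Type u} {L : FirstOrder.Language.{u, u}} [L.Structure M]
    [L.Structure N] (j : M ↪ₑ[L] N) : IsPartialIso (L := L) fun a b => j a = b where
  func g t t' h := by obtain rfl := funext h; exact j.map_fun g t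
  rel r t t' h := by obtain rfl := funext h; exact (j.map_rel r t).symm
  eq := by rintro _ _ _ _ rfl rfl; exact j.injective.eq_iff.symm

/-- The composite of two partial isomorphisms of groups. -/
def compSubgroup {A B C : Type*} [AddCommGroup A] [AddCommGroup B] [AddCommGroup C]
    (G : AddSubgroup (A × B)) (H : AddSubgroup (B × C)) : AddSubgroup (A × C) where
  carrier := {q | ∃ b, (q.1, b) ∈ G ∧ (b, q.2) ∈ H}
  zero_mem' := ⟨0, G.zero_mem, H.zero_mem⟩
  add_mem' := by
    rintro _ _ ⟨b, h, h'⟩ ⟨c, g, g'⟩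
    exact ⟨b + c, G.add_mem h g, H.add_mem h' g'⟩
  neg_mem' := by
    rintro _ ⟨b, h, h'⟩
    exact ⟨-b, G.neg_mem h, H.neg_mem h'⟩

lemma ElementaryEmbedding.exists_ofG (j : D.Carrier ↪ₑ[lang 𝒰] E.Carrier) (γ : D.Γ) :
    ∃ γ', j (ofG γ) = ofG γ' :=
  (j.map_rel (rsym 𝒰 .isG) ![ofG γ]).2 (isG_ofG 𝒰)

/-- A partial isomorphism extends to given partial embeddings of the residue fields and of the
value groups, in an elementary extension. -/
theorem IsPartialIso.exists_partialEmb_of_le {R : D.Carrier → E.Carrier → Prop}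
    (hR : IsPartialIso (L := lang 𝒰) R) {S : Subring (D.k × E.k)}
    (hS : ∀ q ∈ S, q.1 = 0 ↔ q.2 = 0) {G : AddSubgroup (D.Γ × E.Γ)} (hG : IsOrderCompat G)
    (hRS : hR.kPart ≤ S) (hRG : hR.gPart ≤ G) :
    ∃ (E' : Model p) (j : E.Carrier ↪ₑ[lang 𝒰] E'.Carrier) (P : PartialEmb 𝒰 D E'),
      (∀ a b, R a b → P.Rel a (j b)) ∧ (∀ q ∈ S, P.Rel (ofK q.1) (j (ofK q.2))) ∧
      ∀ q ∈ G, P.Rel (ofG q.1) (j (ofG q.2)) := by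
  obtain ⟨E', j, T, hT⟩ := exists_residueField_extension 𝒰 S hS
  have hj := isPartialIso_graph j
  have hR' := hR.comp_embedding j
  obtain ⟨P, hPT, hPG, hP⟩ := hR'.exists_partialEmb T (by
    rintro q ⟨c, hc, hjc⟩
    obtain ⟨b, rfl⟩ := (hR.rel₁ .isK hc).1 (isK_ofK 𝒰)
    have := hT (q.1, b) (hRS hc)
    exact Carrier.ofK.inj (hjc.symm.trans this)) (G := compSubgroup G hj.gPart) (by
    rintro q ⟨b, h, h'⟩
    exact (hG _ h).trans (hj.gPart_compat _ h')) (by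
    rintro q ⟨c, hc, hjc⟩
    obtain ⟨b, rfl⟩ := (hR.rel₁ .isG hc).1 (isG_ofG 𝒰)
    exact ⟨b, hRG (show (q.1, b) ∈ hR.gPart from hc), hjc⟩)
  refine ⟨E', j, P, fun a b hab => hP _ _ ⟨b, hab, rfl⟩, fun q hq => ?_, fun q hq => ?_⟩
  · rw [hT q hq, ← hPT]
    exact .ofK (P := P) _
  · obtain ⟨γ', hγ'⟩ := ElementaryEmbedding.exists_ofG j q.2
    rw [hγ']
    refine .ofG (P := P) ?_
    rw [hPG]
    exact ⟨q.2, hq, hγ'⟩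

/-- Partial embeddings of the residue fields and of the value groups are elementary. -/
theorem realize_iff_of_mem {S : Subring (D.k × E.k)} (hS : ∀ q ∈ S, q.1 = 0 ↔ q.2 = 0)
    (hc : ∀ r, (algebraMap f D.k r, algebraMap f E.k r) ∈ S) {G : AddSubgroup (D.Γ × E.Γ)}
    (hG : IsOrderCompat G) (hone : (D.one, E.one) ∈ G) {β : Type*} {v : β → D.Carrier}
    {w : β → E.Carrier} (h : ∀ b, (∃ q ∈ S, v b = ofK q.1 ∧ w b = ofK q.2) ∨
      ∃ q ∈ G, v b = ofG q.1 ∧ w b = ofG q.2) (φ : (lang 𝒰).Formula β) :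
    φ.Realize v ↔ φ.Realize w := by
  obtain ⟨E', j, T, hT⟩ := exists_residueField_extension 𝒰 S hS
  have hj := isPartialIso_graph j
  obtain ⟨P, hPT, hPG⟩ := exists_partialEmb 𝒰 T (RingHom.ext fun r => by
    have h1 := hT _ (hc r)
    rw [show j (ofK (algebraMap f E.k r)) = ofK (algebraMap f E'.k r) from hj.const_mem r] at h1
    exact (Carrier.ofK.inj h1).symm) (G := compSubgroup G hj.gPart)
    ⟨_, hone, hj.gPart_one⟩ (by
    rintro q ⟨b, h, h'⟩
    exact (hG _ h).trans (hj.gPart_compat _ h'))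
  have h1 : φ.Realize v ↔ φ.Realize (j ∘ w) := by
    refine P.isPartialIso.realize_iff φ (fun b => ?_) fun i => i.elim0
    rcases h b with ⟨q, hq, hv, hw⟩ | ⟨q, hq, hv, hw⟩
    · rw [hv, Function.comp, hw, hT q hq, ← hPT]
      exact .ofK (P := P) _
    · obtain ⟨γ', hγ'⟩ := ElementaryEmbedding.exists_ofG j q.2
      rw [hv, Function.comp, hw, hγ']
      refine .ofG (P := P) ?_
      rw [hPG]
      exact ⟨q.2, hq, hγ'⟩
  exact h1.trans (j.map_formula φ w)

/-- The prime partial embedding of the residue fields. -/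
def constSubring (D E : Model p) : Subring (D.k × E.k) :=
  ((algebraMap f D.k).prod (algebraMap f E.k)).range

lemma constSubring_eq_zero (q) (hq : q ∈ constSubring D E) : q.1 = 0 ↔ q.2 = 0 := by
  obtain ⟨r, rfl⟩ := hq
  change algebraMap f D.k r = 0 ↔ algebraMap f E.k r = 0
  rw [map_eq_zero, map_eq_zero]

/-- The prime partial embedding of the value groups. -/
def oneSubgroup (D E : Model p) : AddSubgroup (D.Γ × E.Γ) := AddSubgroup.zmultiples (D.one, E.one)

lemma oneSubgroup_compat : IsOrderCompat (oneSubgroup D E) := by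
  rintro q hq
  obtain ⟨n, rfl⟩ := AddSubgroup.mem_zmultiples_iff.1 hq
  change 0 ≤ n • D.one ↔ 0 ≤ n • E.one
  have key {Γ : Type u} [AddCommGroup Γ] [LinearOrder Γ] [IsOrderedAddMonoid Γ] {γ : Γ}
      (hγ : 0 < γ) : 0 ≤ n • γ ↔ 0 ≤ n := by
    have := (zsmul_left_strictMono hγ).le_iff_le (a := 0) (b := n)
    rwa [zero_smul] at this
  rw [key D.one_pos, key E.one_pos]

theorem realize_sentence_iff (D E : Model p) (σ : (lang 𝒰).Sentence) :
    D.Carrier ⊨ σ ↔ E.Carrier ⊨ σ :=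
  realize_iff_of_mem constSubring_eq_zero (fun r => ⟨r, rfl⟩) oneSubgroup_compat
    (AddSubgroup.mem_zmultiples _) (fun b => b.elim) σ

theorem isComplete_of_model (𝒰 : Atlas p) (D : Model p) : (theory 𝒰).IsComplete := by
  have hD := models_theory (𝒰 := 𝒰) D
  refine ⟨Theory.Model.isSatisfiable D.Carrier, fun σ => ?_⟩
  have key (M : (theory 𝒰).ModelType) : M ⊨ σ ↔ D.Carrier ⊨ σ := by
    obtain ⟨E, ⟨e⟩⟩ := exists_equiv_model (𝒰 := 𝒰) (M := M) M.is_model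
    rw [← realize_sentence_iff E D]
    exact StrongHomClass.realize_sentence e σ
  by_cases h : D.Carrier ⊨ σ
  · exact .inl (Theory.models_sentence_iff.2 fun M => (key M).2 h)
  · exact .inr (Theory.models_sentence_iff.2 fun M => (Sentence.realize_not M).2 fun h' => h ((key M).1 h'))

end

end CurveACVF
end

noncomputable section
namespace CurveACVF

/-! ### Existence of models -/

section RationalValuations

open Polynomial

variable {L : Type u} [Field L] (V : ValuationSubring L)

instance : IsOrderedAddMonoid (ULift.{u} ℚ) where
  add_le_add_left _ _ h c := add_le_add_left (α := ℚ) h c.down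

/-- A valuation with a value group that is commensurable to `ℤ` is a valuation in `ℚ`. -/
theorem exists_addValuation {π : L} (hπ : π ≠ 0) (hπ1 : V.valuation π < 1)
    (h : ∀ a : L, a ≠ 0 → ∃ (m : ℕ) (z : ℤ), 0 < m ∧ V.valuation a ^ m = V.valuation π ^ z) :
    ∃ w : AddValuation L (WithTop (ULift.{u} ℚ)),
      (∀ a b, w a ≤ w b ↔ V.valuation b ≤ V.valuation a) ∧
      ∀ (a : L) (m : ℕ) (z : ℤ), 0 < m → V.valuation a ^ m = V.valuation π ^ z →
        w a = ((⟨z / m⟩ : ULift.{u} ℚ) : WithTop (ULift.{u} ℚ)) := by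
  classical
  have hπ0 : 0 < V.valuation π := zero_lt_iff.2 ((Valuation.ne_zero_iff _).2 hπ)
  have key {a b : L} {m n : ℕ} {z y : ℤ} (hm : 0 < m) (hn : 0 < n)
      (ha : V.valuation a ^ m = V.valuation π ^ z) (hb : V.valuation b ^ n = V.valuation π ^ y) :
      (z / m : ℚ) ≤ y / n ↔ V.valuation b ≤ V.valuation a := by
    have h1 : V.valuation b ^ (m * n) = V.valuation π ^ (y * m) := by
      rw [mul_comm m n, pow_mul, hb, zpow_mul, zpow_natCast]
    have h2 : V.valuation a ^ (m * n) = V.valuation π ^ (z * n) := by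
      rw [pow_mul, ha, zpow_mul, zpow_natCast]
    rw [div_le_div_iff₀ (by exact_mod_cast hm) (by exact_mod_cast hn),
      ← pow_le_pow_iff_left₀ (a := V.valuation b) (b := V.valuation a) zero_le zero_le
        (Nat.mul_pos hm hn).ne', h1, h2,
      zpow_le_zpow_iff_right_of_lt_one₀ hπ0 hπ1]
    exact_mod_cast Iff.rfl
  choose m z hm hmz using h
  let q (a : L) : WithTop (ULift.{u} ℚ) :=
    if h : a = 0 then ⊤ else ((⟨z a h / m a h⟩ : ULift.{u} ℚ) : WithTop (ULift.{u} ℚ))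
  have hq0 : q 0 = ⊤ := dif_pos rfl
  have hq {a : L} (ha : a ≠ 0) :
      q a = ((⟨z a ha / m a ha⟩ : ULift.{u} ℚ) : WithTop (ULift.{u} ℚ)) := dif_neg ha
  have hqle (a b : L) : q a ≤ q b ↔ V.valuation b ≤ V.valuation a := by
    rcases eq_or_ne b 0 with rfl | hb
    · simp [hq0]
    rcases eq_or_ne a 0 with rfl | ha
    · simp [hq0, hq hb, hb]
    rw [hq ha, hq hb, WithTop.coe_le_coe]
    exact key (hm a ha) (hm b hb) (hmz a ha) (hmz b hb)
  have hqe (a : L) (n : ℕ) (y : ℤ) (hn : 0 < n) (hy : V.valuation a ^ n = V.valuation π ^ y) :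
      q a = ((⟨y / n⟩ : ULift.{u} ℚ) : WithTop (ULift.{u} ℚ)) := by
    have ha : a ≠ 0 := by
      rintro rfl
      rw [_root_.map_zero, zero_pow hn.ne'] at hy
      exact (zpow_ne_zero y hπ0.ne') hy.symm
    rw [hq ha]
    congr 2
    exact le_antisymm ((key (hm a ha) hn (hmz a ha) hy).2 le_rfl)
      ((key hn (hm a ha) hy (hmz a ha)).2 le_rfl)
  refine ⟨AddValuation.of q hq0 ?_ ?_ ?_, hqle, hqe⟩
  · rw [hqe 1 1 0 one_pos (by simp)]
    exact congrArg _ (congrArg ULift.up (by simp))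
  · intro a b
    rw [min_le_iff, hqle, hqle]
    exact le_max_iff.1 (V.valuation.map_add a b)
  · intro a b
    rcases eq_or_ne a 0 with rfl | ha
    · rw [zero_mul, hq0, top_add]
    rcases eq_or_ne b 0 with rfl | hb
    · rw [mul_zero, hq0, add_top]
    rw [hqe (a * b) (m a ha * m b hb) (z a ha * m b hb + z b hb * m a ha)
      (Nat.mul_pos (hm a ha) (hm b hb)), hq ha, hq hb, ← WithTop.coe_add]
    · congr 1
      refine congrArg ULift.up ?_
      have h1 : (m a ha : ℚ) ≠ 0 := by exact_mod_cast (hm a ha).ne'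
      have h2 : (m b hb : ℚ) ≠ 0 := by exact_mod_cast (hm b hb).ne'
      push_cast
      field_simp
    · rw [_root_.map_mul, mul_pow, pow_mul, hmz, mul_comm (m a ha), pow_mul, hmz,
        zpow_add₀ hπ0.ne', zpow_mul, zpow_mul, zpow_natCast, zpow_natCast]

variable {V}

lemma exists_residue_of_eval₂ {k : Type*} [Field k] [IsAlgClosed k] {κ : k →+* L}
    (hκ : ∀ r, r ≠ 0 → V.valuation (κ r) = 1) {a : L} (n : ℕ) : ∀ Q : k[X], Q ≠ 0 →
      Q.natDegree = n → V.valuation (Q.eval₂ κ a) < 1 → ∃ r, V.valuation (a - κ r) < 1 := by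
  induction n with
  | zero =>
    intro Q hQ hn h
    rw [Polynomial.eq_C_of_natDegree_eq_zero hn, Polynomial.eval₂_C, hκ] at h
    · exact absurd h (lt_irrefl 1)
    · intro h0
      exact hQ (by rw [Polynomial.eq_C_of_natDegree_eq_zero hn, h0, Polynomial.C_0])
  | succ n ih =>
    intro Q hQ hn h
    obtain ⟨r, hr⟩ := IsAlgClosed.exists_root Q fun h => by
      have := Polynomial.natDegree_eq_zero_iff_degree_le_zero.2 h.le; omega
    obtain ⟨R, rfl⟩ := Polynomial.dvd_iff_isRoot.2 hr
    by_cases har : V.valuation (a - κ r) < 1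
    · exact ⟨r, har⟩
    have hR0 : R ≠ 0 := right_ne_zero_of_mul hQ
    have hRn : R.natDegree = n := by
      rw [Polynomial.natDegree_mul (Polynomial.X_sub_C_ne_zero r) hR0,
        Polynomial.natDegree_X_sub_C] at hn
      omega
    refine ih R hR0 hRn ?_
    rw [Polynomial.eval₂_mul, Polynomial.eval₂_sub, Polynomial.eval₂_X, Polynomial.eval₂_C,
      _root_.map_mul] at h
    by_contra! h1
    exact absurd h (not_lt.2 (one_le_mul (not_lt.1 har) h1))

/-- The residue field of an algebraic extension of a valued field with an algebraically closed
residue field. -/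
lemma exists_residue {F k : Type*} [Field F] [Field k] [IsAlgClosed k] {i : F →+* L} {κ : k →+* L}
    (hκ : ∀ r, r ≠ 0 → V.valuation (κ r) = 1)
    (hres : ∀ c, i c ∈ V → ∃ r, V.valuation (i c - κ r) < 1) {a : L} (ha : a ∈ V) {P : F[X]}
    (hP : P ≠ 0) (hPa : P.eval₂ i a = 0) : ∃ r, V.valuation (a - κ r) < 1 := by
  obtain ⟨n₀, hn₀, hmax⟩ := P.support.exists_max_image (fun n => V.valuation (i (P.coeff n)))
    (support_nonempty.2 hP)
  rw [Polynomial.mem_support_iff] at hn₀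
  have hi0 : i (P.coeff n₀) ≠ 0 := by rwa [_root_.map_ne_zero]
  have hle (n : ℕ) : i (P.coeff n / P.coeff n₀) ∈ V := by
    rw [← V.valuation_le_one_iff, map_div₀, map_div₀]
    refine div_le_one_of_le₀ ?_ zero_le
    by_cases hn : n ∈ P.support
    · exact hmax n hn
    · rw [Polynomial.notMem_support_iff.1 hn]; simp
  choose r hr using fun n => hres _ (hle n)
  let Q : k[X] := ∑ n ∈ P.support, Polynomial.monomial n (r n)
  have hQn : Q.coeff n₀ = r n₀ := by
    simp [Q, Polynomial.finsetSum_coeff, Polynomial.coeff_monomial, hn₀]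
  have hr0 : r n₀ ≠ 0 := by
    intro h0
    have := hr n₀
    rw [div_self hn₀, h0, _root_.map_one, _root_.map_zero, sub_zero, _root_.map_one] at this
    exact lt_irrefl _ this
  have hQ0 : Q ≠ 0 := fun h => hr0 (by rw [← hQn, h, Polynomial.coeff_zero])
  refine exists_residue_of_eval₂ hκ _ Q hQ0 rfl ?_
  have h1 : ∑ n ∈ P.support, i (P.coeff n / P.coeff n₀) * a ^ n = 0 := by
    have h2 : P.eval₂ i a = ∑ n ∈ P.support, i (P.coeff n) * a ^ n :=
      Polynomial.eval₂_eq_sum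
    rw [hPa] at h2
    rw [← zero_div (i (P.coeff n₀)), h2, Finset.sum_div]
    refine Finset.sum_congr rfl fun n _ => ?_
    rw [map_div₀, div_mul_eq_mul_div]
  have h2 : Q.eval₂ κ a = -∑ n ∈ P.support, (i (P.coeff n / P.coeff n₀) - κ (r n)) * a ^ n := by
    simp only [Q, Polynomial.eval₂_finsetSum, Polynomial.eval₂_monomial, sub_mul,
      Finset.sum_sub_distrib, h1, zero_sub, neg_neg]
  rw [h2, Valuation.map_neg]
  refine V.valuation.map_sum_lt one_ne_zero fun n _ => ?_
  rw [_root_.map_mul, _root_.map_pow]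
  exact mul_lt_one_of_lt_of_le (hr n) (pow_le_one₀ zero_le ((V.valuation_le_one_iff a).2 ha))

end RationalValuations

end CurveACVF
end

noncomputable section
namespace CurveACVF

section Center

variable {B k L : Type u} [CommRing B] [Field k] [Field L] {ρ : B →+* L} {ev : B →+* k}
  {κ : k →+* B}

/-- A valuation ring with center at a rational point. -/
lemma exists_valuationSubring_of_section (hρ : Function.Injective ρ)
    (hκ : ∀ r, ev (κ r) = r) : ∃ V : ValuationSubring L,
      (∀ b, ev b = 0 → V.valuation (ρ b) < 1) ∧ ∀ b, ev b ≠ 0 → V.valuation (ρ b) = 1 := by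
  let e : B ≃+* ρ.range := RingEquiv.ofBijective ρ.rangeRestrict
    ⟨fun a b h => hρ (congrArg Subtype.val h), ρ.rangeRestrict_surjective⟩
  let I : Ideal ρ.range := RingHom.ker (ev.comp e.symm.toRingHom)
  have hI : I ≠ ⊤ := RingHom.ker_ne_top _
  obtain ⟨V, hV, hVI⟩ := Ideal.image_subset_nonunits_valuationSubring I hI
  have hle (b : B) : V.valuation (ρ b) ≤ 1 := (V.valuation_le_one_iff _).2 (hV ⟨b, rfl⟩)
  have hlt (b : B) (hb : ev b = 0) : V.valuation (ρ b) < 1 := by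
    rw [← ValuationSubring.mem_nonunits_iff]
    refine hVI ⟨e b, ?_, rfl⟩
    change ev (e.symm (e b)) = 0
    rw [e.symm_apply_apply, hb]
  refine ⟨V, hlt, fun b hb => le_antisymm (hle b) ?_⟩
  by_contra! h
  have h1 := hlt (b * κ (ev b)⁻¹ - 1) (by rw [map_sub, map_mul, hκ, map_one, mul_inv_cancel₀ hb,
    sub_self])
  have h2 : V.valuation (ρ (b * κ (ev b)⁻¹)) < 1 := by
    rw [map_mul, map_mul]
    exact mul_lt_one_of_lt_of_le h (hle _)
  have h3 := V.valuation.map_sub_lt h2 h1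
  rw [map_sub ρ, sub_sub_cancel, map_one, map_one] at h3
  exact lt_irrefl _ h3

end Center

section Fiber

variable {B F k L : Type u} [CommRing B] [Field k] [Field F] [Field L] [Algebra B F]
  [IsFractionRing B F] [Algebra F L] [Algebra.IsAlgebraic F L] [IsAlgClosed L] [IsAlgClosed k]
  {ev : B →+* k} {κ : k →+* B} {t : B}

/-- An extension, with values in `ℚ`, of the valuation at a smooth rational point of a curve to an
algebraic closure of the field of functions. -/
theorem exists_fiber (hκ : ∀ r, ev (κ r) = r) (ht : t ≠ 0) (ht0 : ev t = 0)
    (h : ∀ b : B, b ≠ 0 → ∃ (n : ℕ) (s u : B), ev s ≠ 0 ∧ ev u ≠ 0 ∧ s * b = u * t ^ n) :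
    ∃ (w : AddValuation L (WithTop (ULift.{u} ℚ))) (res : valuationRing w →+* k)
      (sec : k →+* valuationRing w), (∀ γ : ULift.{u} ℚ, ∃ a, w a = γ) ∧
      res.comp sec = RingHom.id k ∧
      (valuationRing w).subtype.comp sec = (algebraMap F L).comp ((algebraMap B F).comp κ) ∧
      w (algebraMap F L (algebraMap B F t)) = ((⟨1⟩ : ULift.{u} ℚ) : WithTop (ULift.{u} ℚ)) ∧
      ∀ b, ev b ≠ 0 → w (algebraMap F L (algebraMap B F b)) = 0 := by
  classical
  let ρ : B →+* L := (algebraMap F L).comp (algebraMap B F)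
  have hρ : Function.Injective ρ :=
    (algebraMap F L).injective.comp (IsFractionRing.injective B F)
  obtain ⟨V, hlt, hone⟩ := exists_valuationSubring_of_section hρ hκ
  have hπ : ρ t ≠ 0 := (map_ne_zero_iff _ hρ).2 ht
  have hπ0 : V.valuation (ρ t) ≠ 0 := (Valuation.ne_zero_iff _).2 hπ
  have hπ1 := hlt t ht0
  have hκ1 (r : k) (hr : r ≠ 0) : V.valuation (ρ (κ r)) = 1 := hone _ (by rwa [hκ])
  have hF (c : F) (hc : c ≠ 0) : ∃ (z : ℤ) (s u : B), ev s ≠ 0 ∧ ev u ≠ 0 ∧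
      ρ s * algebraMap F L c = ρ u * ρ t ^ z := by
    obtain ⟨a, b, hb, rfl⟩ := IsFractionRing.div_surjective (A := B) c
    have hb0 : b ≠ 0 := by rintro rfl; simp at hc
    have ha0 : a ≠ 0 := by rintro rfl; simp at hc
    obtain ⟨n, s, u, hs, hu, hsu⟩ := h a ha0
    obtain ⟨n', s', u', hs', hu', hsu'⟩ := h b hb0
    refine ⟨n - n', s * u', u * s', by simp [hs, hu'], by simp [hu, hs'], ?_⟩
    have h1 : ρ s * ρ a = ρ u * ρ t ^ n := by rw [← map_mul, hsu, map_mul, map_pow]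
    have h2 : ρ s' * ρ b = ρ u' * ρ t ^ n' := by rw [← map_mul, hsu', map_mul, map_pow]
    have hb1 : ρ b ≠ 0 := (map_ne_zero_iff _ hρ).2 hb0
    rw [map_div₀]
    change ρ (s * u') * (ρ a / ρ b) = _
    rw [map_mul, map_mul, zpow_sub₀ hπ, zpow_natCast, zpow_natCast]
    have h3 : ρ t ^ n' ≠ 0 := pow_ne_zero _ hπ
    field_simp
    linear_combination ρ t ^ n' * ρ u' * h1 - ρ u * ρ t ^ n * h2
  have hFv (c : F) (hc : c ≠ 0) : ∃ z : ℤ,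
      V.valuation (algebraMap F L c) = V.valuation (ρ t) ^ z := by
    obtain ⟨z, s, u, hs, hu, hsu⟩ := hF c hc
    refine ⟨z, ?_⟩
    have := congrArg V.valuation hsu
    rwa [map_mul, map_mul, hone s hs, hone u hu, one_mul, one_mul, map_zpow₀] at this
  have hpoly (a : L) : ∃ P : Polynomial F, P ≠ 0 ∧ P.eval₂ (algebraMap F L) a = 0 :=
    Algebra.IsAlgebraic.isAlgebraic (R := F) a
  obtain ⟨w, hw, hwq⟩ := exists_addValuation V hπ hπ1 fun a ha => by
    obtain ⟨P, hP, hPa⟩ := hpoly a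
    obtain ⟨m, c, hm, hc, hmc⟩ := exists_valuation_pow_eq (algebraMap F L) V ha hP hPa
    obtain ⟨z, hz⟩ := hFv c hc
    exact ⟨m, z, hm, (map_pow V.valuation a m).symm.trans (hmc.trans hz)⟩
  have hw0 (a : L) : 0 ≤ w a ↔ V.valuation a ≤ 1 := by
    rw [← w.map_one, hw, map_one]
  have hres (a : L) (ha : 0 ≤ w a) : ∃ r, V.valuation (a - ρ (κ r)) < 1 := by
    obtain ⟨P, hP, hPa⟩ := hpoly a
    refine exists_residue (κ := ρ.comp κ) hκ1 (fun c hc => ?_)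
      ((V.valuation_le_one_iff a).1 ((hw0 a).1 ha)) hP hPa
    rcases eq_or_ne c 0 with rfl | hc0
    · exact ⟨0, by simp⟩
    obtain ⟨z, s, u, hs, hu, hsu⟩ := hF c hc0
    have hv := congrArg V.valuation hsu
    rw [map_mul, map_mul, hone s hs, hone u hu, one_mul, one_mul, map_zpow₀] at hv
    rw [← V.valuation_le_one_iff, hv] at hc
    have hz : 0 ≤ z := by
      by_contra! hz
      exact absurd hc (not_le.2 (one_lt_zpow_of_neg₀ (zero_lt_iff.2 hπ0) hπ1 hz))
    rcases hz.eq_or_lt with rfl | hz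
    · refine ⟨ev u / ev s, ?_⟩
      have h1 := hlt (u - s * κ (ev u / ev s)) (by
        rw [map_sub, map_mul, hκ, mul_div_cancel₀ _ hs, sub_self])
      rw [zpow_zero, mul_one] at hsu
      rwa [map_sub, map_mul, ← hsu, ← mul_sub, map_mul, hone s hs, one_mul] at h1
    · refine ⟨0, ?_⟩
      rw [map_zero, sub_zero, hv]
      exact zpow_lt_one₀ (zero_lt_iff.2 hπ0) hπ1 hz
  have huniq {a : L} {r r' : k} (h1 : V.valuation (a - ρ (κ r)) < 1)
      (h2 : V.valuation (a - ρ (κ r')) < 1) : r = r' := by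
    by_contra hne
    have h3 := V.valuation.map_sub_lt h1 h2
    rw [sub_sub_sub_cancel_left, ← map_sub, ← map_sub, hκ1 _ (sub_ne_zero.2 (Ne.symm hne))] at h3
    exact lt_irrefl _ h3
  have hκle (r : k) : 0 ≤ w (ρ (κ r)) := by
    rw [hw0]
    rcases eq_or_ne r 0 with rfl | hr
    · simp
    · exact (hκ1 r hr).le
  choose r hr using fun a : valuationRing w => hres a.1 a.2
  let res : valuationRing w →+* k :=
    { toFun := r
      map_one' := huniq (hr 1) (by simp)
      map_zero' := huniq (hr 0) (by simp)
      map_mul' := fun a b => huniq (hr (a * b)) (by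
        have : (a * b : L) - ρ (κ (r a * r b)) =
            a * (b - ρ (κ (r b))) + (a - ρ (κ (r a))) * ρ (κ (r b)) := by
          rw [map_mul, map_mul]; ring
        change V.valuation ((a * b : L) - _) < 1
        rw [this]
        refine V.valuation.map_add_lt ?_ ?_
        · rw [map_mul, mul_comm]
          exact mul_lt_one_of_lt_of_le (hr b) ((hw0 _).1 a.2)
        · rw [map_mul]
          exact mul_lt_one_of_lt_of_le (hr a) ((hw0 _).1 (hκle _)))
      map_add' := fun a b => huniq (hr (a + b)) (by
        have : (a + b : L) - ρ (κ (r a + r b)) =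
            (a - ρ (κ (r a))) + (b - ρ (κ (r b))) := by
          rw [map_add, map_add]; ring
        change V.valuation ((a + b : L) - _) < 1
        rw [this]
        exact V.valuation.map_add_lt (hr a) (hr b)) }
  refine ⟨w, res, (ρ.comp κ).codRestrict _ hκle, fun γ => ?_, RingHom.ext fun c => ?_, rfl, ?_,
    fun b hb => ?_⟩
  · obtain ⟨a, ha⟩ := IsAlgClosed.exists_pow_nat_eq (ρ t ^ γ.down.num) γ.down.pos
    refine ⟨a, ?_⟩
    rw [hwq a γ.down.den γ.down.num γ.down.pos (by rw [← map_pow, ha, map_zpow₀])]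
    exact congrArg _ (congrArg ULift.up (Rat.num_div_den _))
  · exact huniq (hr _) (by
      change V.valuation (ρ (κ c) - ρ (κ c)) < 1
      simp)
  · exact (hwq (ρ t) 1 1 one_pos (by simp)).trans (congrArg _ (congrArg ULift.up (by simp)))
  · exact (hwq (ρ b) 1 0 one_pos (by simp [hone b hb])).trans
      (congrArg _ (congrArg ULift.up (by simp)))

end Fiber

section Existence

variable {f : Type u} [Field f] {C : Scheme.{u}} {p : C ⟶ Spec (CommRingCat.of f)}
  [IsSeparated p] [SmoothOfRelativeDimension 1 p] [GeometricallyIntegral p]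

theorem exists_model_fiber (𝒰 : Atlas p) (k : Type u) [Field k] [Algebra f k] [IsAlgClosed k]
    (x : Point p (algebraMap f k)) :
    ∃ (w : AddValuation (AlgebraicClosure (functionField p k)) (WithTop (ULift.{u} ℚ)))
      (res : valuationRing w →+* k) (sec : k →+* valuationRing w)
      (c : Point p (((valuationRing w).subtype.comp sec).comp (algebraMap f k))),
      (∀ γ : ULift.{u} ℚ, ∃ a, w a = γ) ∧ res.comp sec = RingHom.id k ∧
      ∃ φ : functionField p k →+* AlgebraicClosure (functionField p k),
        IsEvaluationAt p ((valuationRing w).subtype.comp sec) c φ ∧ ∀ h, h ≠ 0 →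
          w (φ h) = ((ordAt p x h • (⟨1⟩ : ULift.{u} ℚ) : ULift.{u} ℚ) :
            WithTop (ULift.{u} ℚ)) := by
  obtain ⟨i, hx⟩ := exists_inChart 𝒰 x
  obtain ⟨j₀, hj₀, hb⟩ := exists_localCoord_uniformizer hx
  have hbinj : Function.Injective (bFun (𝒰 := 𝒰) (p := p) k i) :=
    (baseChange p k).germToFunctionField_injective _
  have hfrac : IsFractionRing (BRing 𝒰 k i) (functionField p k) :=
    functionField_isFractionRing_of_isAffineOpen _ _ (isAffineOpen_chartBC 𝒰 k i)
  have hloc (j) : evAt hx (localCoord x i j) = 0 := by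
    rw [localCoord, map_sub, evAt_coord, evAt_const, sub_self]
  have ht : localCoord x i j₀ ≠ 0 := by
    intro h0
    rw [h0, map_zero] at hj₀
    exact zero_ne_one ((congrFun Scheme.ord_zero _).symm.trans hj₀)
  obtain ⟨w, res, sec, hsurj, hres, hsec, hwt, hw0⟩ :=
    exists_fiber (F := functionField p k) (L := AlgebraicClosure (functionField p k))
      (ev := evAt hx) (κ := bConst 𝒰 k i) (evAt_const hx) ht (hloc j₀)
      fun b hb0 => by
        obtain ⟨n, s, u, hs, hu, hsu, -⟩ := hb b hb0
        exact ⟨n, s, u, hs, hu, hsu⟩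
  let ρ : BRing 𝒰 k i →+* AlgebraicClosure (functionField p k) :=
    (algebraMap (functionField p k) (AlgebraicClosure (functionField p k))).comp
      (algebraMap (BRing 𝒰 k i) (functionField p k))
  obtain ⟨y, hy, hyρ⟩ := exists_point_of_hom (𝒰 := 𝒰)
    (s := ((valuationRing w).subtype.comp sec).comp (algebraMap f k)) i
    (ρ.comp (bPull 𝒰 k i)) (by
      rw [RingHom.comp_assoc, ← bConst_comp_algebraMap, hsec]; rfl)
  refine ⟨w, res, sec, y, hsurj, hres, ?_⟩
  have hsec' (r : k) : (valuationRing w).subtype.comp sec r = ρ (bConst 𝒰 k i r) :=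
    RingHom.congr_fun hsec r
  have hone : (0 : ULift.{u} ℚ) < ⟨1⟩ := zero_lt_one (α := ℚ)
  rw [exists_isEvaluationAt_iff (fun a ha => ?_) hone y hx]
  · have hval (j) : coordAt 𝒰 y i j - (valuationRing w).subtype.comp sec (coordAt 𝒰 x i j) =
        ρ (localCoord x i j) := by
      rw [hsec', ← chartEval_coord hy, hyρ, localCoord, map_sub]; rfl
    refine ⟨hy, fun j => ?_, j₀, ?_⟩
    · rw [hval]
      rcases eq_or_ne (localCoord x i j) 0 with h0 | h0
      · rw [h0, map_zero, w.map_zero]; exact le_top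
      obtain ⟨n, s, u, hs, hu, hsu, -⟩ := hb _ h0
      have hn := localCoord_ord_pos hx hu hsu
      have h1 := congrArg w (congrArg ρ hsu)
      rw [map_mul ρ, map_mul ρ, map_pow ρ, w.map_mul, w.map_mul, w.map_pow] at h1
      have h2 : w (ρ (localCoord x i j)) =
          n • ((⟨1⟩ : ULift.{u} ℚ) : WithTop (ULift.{u} ℚ)) := by
        have hs' : w (ρ s) = 0 := hw0 s hs
        have hu' : w (ρ u) = 0 := hw0 u hu
        have ht' : w (ρ (localCoord x i j₀)) = _ := hwt
        rwa [hs', hu', zero_add, zero_add, ht'] at h1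
      rw [h2]
      calc ((⟨1⟩ : ULift.{u} ℚ) : WithTop (ULift.{u} ℚ)) = 1 • _ := (one_smul _ _).symm
        _ ≤ _ := nsmul_le_nsmul_left (by exact_mod_cast hone.le) hn
    · rw [hval]; exact hwt
  · rw [hsec']
    exact hw0 _ (by rwa [evAt_const])

theorem nonempty_model (𝒰 : Atlas p) : Nonempty (Model p) := by
  choose w res sec c hsurj hres hval using
    exists_model_fiber 𝒰 (AlgebraicClosure f)
  exact ⟨{
    k := AlgebraicClosure f
    Γ := ULift.{u} ℚ
    one := ⟨1⟩
    one_pos := zero_lt_one (α := ℚ)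
    VF := fun _ => AlgebraicClosure (functionField p (AlgebraicClosure f))
    v := w
    v_surjective := hsurj
    res := res
    sec := sec
    res_comp_sec := hres
    c := c
    val_c := hval }⟩

end Existence
end CurveACVF
end

noncomputable section
namespace CurveACVF

open FirstOrder FirstOrder.Language FirstOrder.Language.Structure

/-! ### Stable embeddedness -/

section

variable {f : Type u} [Field f] {C : Scheme.{u}} {p : C ⟶ Spec (CommRingCat.of f)}
  [SmoothOfRelativeDimension 1 p] [GeometricallyIntegral p] {𝒰 : Atlas p} {D E : Model p}
  [IsSeparated p]

open Model Model.Carrier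

/-- The elements of a sort. -/
def sortSet (𝒰 : Atlas p) (r : Rel 𝒰 1) (M : Type u) [(lang 𝒰).Structure M] : Set M :=
  {a | RelMap (rsym 𝒰 r) ![a]}

lemma definable_sort_pow {r : Rel 𝒰 1} {M : Type u} [(lang 𝒰).Structure M] (A : Set M) (n : ℕ) :
    A.Definable (lang 𝒰) {t : Fin n → M | ∀ i, RelMap (rsym 𝒰 r) ![t i]} := by
  have h (i : Fin n) : A.Definable (lang 𝒰) {t : Fin n → M | RelMap (rsym 𝒰 r) ![t i]} := by
    refine Set.Definable.mono ((Set.empty_definable_iff (L := lang 𝒰) (M := M)).2 ⟨(rsym 𝒰 r).formula₁ (Term.var i), ?_⟩)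
      (Set.empty_subset A)
    ext t
    change _ ↔ ((rsym 𝒰 r).formula₁ (Term.var i)).Realize t
    rw [Formula.realize_rel₁]
    rfl
  have := Set.definable_iInter_of_finite h
  convert! this using 1
  ext t
  simp

/-- A criterion for stable embeddedness: if two elementary extensions have tuples in the sort with
the same type over the sort, then the tuples have the same type. -/
theorem isStablyEmbedded_of (r : Rel 𝒰 1)
    (key : ∀ (M : Type u) [(lang 𝒰).Structure M] (E₁ E₂ : Model p) (j₁ : M ↪ₑ[lang 𝒰] E₁.Carrier)
      (j₂ : M ↪ₑ[lang 𝒰] E₂.Carrier) (n : ℕ) (w₁ : Fin n → E₁.Carrier) (w₂ : Fin n → E₂.Carrier),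
      (∀ i, RelMap (rsym 𝒰 r) ![w₁ i]) →
      (∀ ψ : (lang 𝒰).Formula (sortSet 𝒰 r M ⊕ Fin n),
        ψ.Realize (Sum.elim (fun a => j₁ a) w₁) ↔ ψ.Realize (Sum.elim (fun a => j₂ a) w₂)) →
      ∀ φ : (lang 𝒰).Formula (M ⊕ Fin n),
        φ.Realize (Sum.elim j₁ w₁) ↔ φ.Realize (Sum.elim j₂ w₂)) :
    IsStablyEmbedded (theory 𝒰) r := by
  intro M _ hM n X hX hdef
  obtain ⟨φ, hφ⟩ := Set.definable_iff_exists_formula_sum.1 hdef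
  let α := {t : Fin n → M // ∀ i, RelMap (rsym 𝒰 r) ![t i]}
  let A := sortSet 𝒰 r M
  let B : Set (Set α) := {Y | ∃ Z, A.Definable (lang 𝒰) Z ∧ Y = {t | t.1 ∈ Z}}
  by_cases hXB : {t : α | t.1 ∈ X} ∈ B
  · obtain ⟨Z, hZ, hXZ⟩ := hXB
    have h1 : X = {t : Fin n → M | ∀ i, RelMap (rsym 𝒰 r) ![t i]} ∩ Z := by
      ext t
      refine ⟨fun ht => ⟨hX t ht, ?_⟩, fun ⟨ht, ht'⟩ => ?_⟩
      · exact (Set.ext_iff.1 hXZ ⟨t, hX t ht⟩).1 ht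
      · exact (Set.ext_iff.1 hXZ ⟨t, ht⟩).2 ht'
    rw [h1]
    exact (definable_sort_pow _ n).inter hZ
  exfalso
  obtain ⟨U₁, U₂, h₁, h₂, h⟩ := exists_ultrafilter_of_notMem B ⟨_, Set.definable_univ, rfl⟩
    (by rintro _ ⟨Z, hZ, rfl⟩ _ ⟨Z', hZ', rfl⟩; exact ⟨_, hZ.inter hZ', rfl⟩)
    (by rintro _ ⟨Z, hZ, rfl⟩; exact ⟨_, hZ.compl, rfl⟩) hXB
  obtain ⟨E₁, π₁, hπ₁⟩ := exists_ultraproduct.{u, u} U₁ (fun _ : α => M) fun _ => hM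
  obtain ⟨E₂, π₂, hπ₂⟩ := exists_ultraproduct.{u, u} U₂ (fun _ : α => M) fun _ => hM
  have elem {E : Model p} {U : Ultrafilter α} {π : (α → M) → E.Carrier}
      (hπ : ∀ {β : Type u} (φ : (lang 𝒰).Formula β) (v : β → α → M),
        φ.Realize (fun b => π (v b)) ↔ {a | φ.Realize fun b => v b a} ∈ U) :
      ∃ j : M ↪ₑ[lang 𝒰] E.Carrier, ∀ m, j m = π fun _ => m := by
    refine ⟨⟨fun m => π fun _ => m, fun n ψ x => ?_⟩, fun m => rfl⟩
    have h1 := hπ (ψ.relabel ULift.up.{u}) (fun i _ => x i.down)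
    simp only [Formula.realize_relabel] at h1
    exact h1.trans Filter.eventually_const
  obtain ⟨j₁, hj₁⟩ := elem hπ₁
  obtain ⟨j₂, hj₂⟩ := elem hπ₂
  have tuple {E : Model p} {U : Ultrafilter α} {π : (α → M) → E.Carrier}
      (hπ : ∀ {β : Type u} (φ : (lang 𝒰).Formula β) (v : β → α → M),
        φ.Realize (fun b => π (v b)) ↔ {a | φ.Realize fun b => v b a} ∈ U)
      {j : M ↪ₑ[lang 𝒰] E.Carrier} (hj : ∀ m, j m = π fun _ => m) {β : Type u} (c : β → M)
      (ψ : (lang 𝒰).Formula (β ⊕ Fin n)) :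
      ψ.Realize (Sum.elim (fun b => j (c b)) fun i => π fun t => t.1 i) ↔
        {t : α | ψ.Realize (Sum.elim c t.1)} ∈ U := by
    have h1 := hπ ψ (Sum.elim (fun b _ => c b) fun i t => t.1 i)
    convert! h1 using 2
    · funext b; rcases b with b | i
      · exact hj _
      · rfl
    · ext t
      refine iff_of_eq (congrArg ψ.Realize (funext fun b => ?_))
      rcases b with b | i <;> rfl
  have := key M E₁ E₂ j₁ j₂ n (fun i => π₁ fun t => t.1 i) (fun i => π₂ fun t => t.1 i) (fun i => by
      have h1 := hπ₁ ((rsym 𝒰 r).formula₁ (Term.var (ULift.up.{u} ()))) (fun _ t => t.1 i)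
      simp only [Formula.realize_rel₁, Term.realize_var] at h1
      exact h1.2 (Filter.Eventually.of_forall fun t => t.2 i)) (fun ψ => by
      rw [tuple hπ₁ hj₁ (fun a : sortSet 𝒰 r M => a.1), tuple hπ₂ hj₂ (fun a : sortSet 𝒰 r M => a.1)]
      refine h _ ⟨{t | ψ.Realize (Sum.elim (↑) t)}, ?_, rfl⟩
      exact Set.definable_iff_exists_formula_sum.2 ⟨ψ, rfl⟩)
    (φ.relabel (Sum.map (↑) id))
  have hrel (E : Model p) (j : M ↪ₑ[lang 𝒰] E.Carrier) (w : Fin n → E.Carrier) :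
      (φ.relabel (Sum.map (↑) id : (Set.univ : Set M) ⊕ Fin n → M ⊕ Fin n)).Realize (Sum.elim j w) ↔
        φ.Realize (Sum.elim (fun a => j a.1) w) := by
    rw [Formula.realize_relabel]
    refine iff_of_eq (congrArg φ.Realize (funext fun b => ?_))
    rcases b with b | i <;> rfl
  rw [hrel, hrel, tuple hπ₁ hj₁ (fun a : (Set.univ : Set M) => a.1),
    tuple hπ₂ hj₂ (fun a : (Set.univ : Set M) => a.1)] at this
  subst hφ
  exact h₂ (this.1 h₁)

/-- The graph of the correspondence between the images of two elementary embeddings. -/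
lemma isPartialIso_span {M : Type u} [(lang 𝒰).Structure M] (j₁ : M ↪ₑ[lang 𝒰] D.Carrier)
    (j₂ : M ↪ₑ[lang 𝒰] E.Carrier) :
    IsPartialIso (L := lang 𝒰) fun a b => ∃ m, j₁ m = a ∧ j₂ m = b where
  func g t t' h := by
    choose c hc hc' using h
    obtain rfl := funext hc
    obtain rfl := funext hc'
    exact ⟨_, j₁.map_fun g c, j₂.map_fun g c⟩
  rel r t t' h := by
    choose c hc hc' using h
    obtain rfl := funext hc
    obtain rfl := funext hc'
    exact (j₁.map_rel r c).trans (j₂.map_rel r c).symm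
  eq := by
    rintro _ _ _ _ ⟨a, rfl, rfl⟩ ⟨b, rfl, rfl⟩
    rw [j₁.injective.eq_iff, j₂.injective.eq_iff]

theorem isStablyEmbedded_isK (𝒰 : Atlas p) : IsStablyEmbedded (theory 𝒰) (Rel.isK (𝒰 := 𝒰)) := by
  refine isStablyEmbedded_of _ fun M _ E₁ E₂ j₁ j₂ n w₁ w₂ hw h φ => ?_
  have hR := isPartialIso_span j₁ j₂
  have hR' := isPartialIso_terms fun ψ _ => h ψ
  obtain ⟨E, j, P, hP, hPS, -⟩ := hR.exists_partialEmb_of_le (S := hR'.kPart)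
    (fun q hq => hR'.kPart_eq_zero hq) hR.gPart_compat (by
      rintro q ⟨m, hm, hm'⟩
      have h1 : isK 𝒰 m := (j₁.map_rel (rsym 𝒰 .isK) ![m]).1 (by
        have := isK_ofK 𝒰 (D := E₁) (a := q.1)
        rw [← hm] at this
        convert! this using 1
        ext i; fin_cases i; rfl)
      exact ⟨Term.var (.inl ⟨m, h1⟩), hm, hm'⟩) le_rfl
  have h1 : φ.Realize (Sum.elim j₁ w₁) ↔ φ.Realize (j ∘ Sum.elim j₂ w₂) := by
    refine P.isPartialIso.realize_iff φ (fun b => ?_) fun i => i.elim0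
    rcases b with m | i
    · exact hP _ _ ⟨m, rfl, rfl⟩
    · obtain ⟨a, ha⟩ := hw i
      have hmem : ∃ t : (lang 𝒰).Term (sortSet 𝒰 .isK M ⊕ Fin n),
          t.realize (Sum.elim (fun a => j₁ a.1) w₁) = w₁ i ∧
          t.realize (Sum.elim (fun a => j₂ a.1) w₂) = w₂ i := ⟨Term.var (.inr i), rfl, rfl⟩
      obtain ⟨b, hb⟩ := (hR'.rel₁ .isK hmem).1 (hw i)
      have ha' : w₁ i = ofK a := ha
      have hb' : w₂ i = ofK b := hb
      change P.Rel (w₁ i) (j (w₂ i))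
      rw [ha', hb'] at hmem ⊢
      exact hPS (a, b) hmem
  exact h1.trans (j.map_formula φ _)

theorem isStablyEmbedded_isG (𝒰 : Atlas p) : IsStablyEmbedded (theory 𝒰) (Rel.isG (𝒰 := 𝒰)) := by
  refine isStablyEmbedded_of _ fun M _ E₁ E₂ j₁ j₂ n w₁ w₂ hw h φ => ?_
  have hR := isPartialIso_span j₁ j₂
  have hR' := isPartialIso_terms fun ψ _ => h ψ
  obtain ⟨E, j, P, hP, -, hPG⟩ := hR.exists_partialEmb_of_le (S := hR.kPart)
    (fun q hq => hR.kPart_eq_zero hq) hR'.gPart_compat le_rfl (by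
      rintro q ⟨m, hm, hm'⟩
      have h1 : isG 𝒰 m := (j₁.map_rel (rsym 𝒰 .isG) ![m]).1 (by
        have := isG_ofG 𝒰 (D := E₁) (a := q.1)
        rw [← hm] at this
        convert! this using 1
        ext i; fin_cases i; rfl)
      exact ⟨Term.var (.inl ⟨m, h1⟩), hm, hm'⟩)
  have h1 : φ.Realize (Sum.elim j₁ w₁) ↔ φ.Realize (j ∘ Sum.elim j₂ w₂) := by
    refine P.isPartialIso.realize_iff φ (fun b => ?_) fun i => i.elim0
    rcases b with m | i
    · exact hP _ _ ⟨m, rfl, rfl⟩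
    · obtain ⟨a, ha⟩ := hw i
      have hmem : ∃ t : (lang 𝒰).Term (sortSet 𝒰 .isG M ⊕ Fin n),
          t.realize (Sum.elim (fun a => j₁ a.1) w₁) = w₁ i ∧
          t.realize (Sum.elim (fun a => j₂ a.1) w₂) = w₂ i := ⟨Term.var (.inr i), rfl, rfl⟩
      obtain ⟨b, hb⟩ := (hR'.rel₁ .isG hmem).1 (hw i)
      have ha' : w₁ i = ofG a := ha
      have hb' : w₂ i = ofG b := hb
      change P.Rel (w₁ i) (j (w₂ i))
      rw [ha', hb'] at hmem ⊢
      exact hPG (a, b) hmem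
  exact h1.trans (j.map_formula φ _)

end

end CurveACVF
end

noncomputable section
namespace CurveACVF

open FirstOrder FirstOrder.Language FirstOrder.Language.Structure

/-! ### The induced structure -/

section Translation

variable {L₀ L : FirstOrder.Language} {I : Type*} {N M : I → Type*} [∀ i, L₀.Structure (N i)]
  [∀ i, L.Structure (M i)] (e : ∀ i, N i → M i)

/-- The functions of `L₀` are given by terms of `L`. -/
def FuncTranslates : Prop := ∀ (n : ℕ) (g : L₀.Functions n), ∃ τ : L.Term (Fin n), ∀ i t,
  e i (funMap g t) = τ.realize (e i ∘ t)

/-- The relations of `L₀` are given by relations of `L`. -/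
def RelTranslates : Prop := ∀ (n : ℕ) (r : L₀.Relations n), ∃ r' : L.Relations n, ∀ i t,
  RelMap r t ↔ RelMap r' (e i ∘ t)

variable {e}

lemma FuncTranslates.exists_term (hF : FuncTranslates (L₀ := L₀) (L := L) e) {β : Type*}
    (t : L₀.Term β) : ∃ τ : L.Term β, ∀ i v, e i (t.realize v) = τ.realize (e i ∘ v) := by
  induction t with
  | var b => exact ⟨Term.var b, fun i v => rfl⟩
  | func g ts ih =>
    choose τ hτ using ih
    obtain ⟨σ, hσ⟩ := hF _ g
    refine ⟨σ.subst τ, fun i v => ?_⟩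
    rw [Term.realize_subst, Term.realize, hσ]
    exact congrArg σ.realize (funext fun j => hτ j i v)

/-- Formulas of `L₀` are equivalent to formulas of `L` that are relativized to a predicate. -/
lemma FuncTranslates.exists_formula (hF : FuncTranslates (L₀ := L₀) (L := L) e)
    (hR : RelTranslates (L₀ := L₀) (L := L) e) (he : ∀ i, Function.Injective (e i))
    (R : L.Relations 1) (hR₁ : ∀ i m, RelMap R ![m] ↔ ∃ a, m = e i a) {β : Type*} {n : ℕ}
    (φ : L₀.BoundedFormula β n) : ∃ ψ : L.BoundedFormula β n, ∀ i v xs,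
      φ.Realize v xs ↔ ψ.Realize (e i ∘ v) (e i ∘ xs) := by
  induction φ with
  | falsum => exact ⟨.falsum, fun _ _ _ => Iff.rfl⟩
  | equal t₁ t₂ =>
    obtain ⟨τ₁, h₁⟩ := hF.exists_term t₁
    obtain ⟨τ₂, h₂⟩ := hF.exists_term t₂
    refine ⟨.equal τ₁ τ₂, fun i v xs => ?_⟩
    change t₁.realize _ = t₂.realize _ ↔ τ₁.realize _ = τ₂.realize _
    rw [← (he i).eq_iff, h₁, h₂, Sum.comp_elim]
  | rel r ts =>
    choose τ hτ using fun j => hF.exists_term (ts j)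
    obtain ⟨r', hr⟩ := hR _ r
    refine ⟨.rel r' τ, fun i v xs => ?_⟩
    change RelMap r _ ↔ RelMap r' _
    rw [hr]
    refine iff_of_eq (congrArg (RelMap r') (funext fun j => ?_))
    rw [Function.comp, hτ, Sum.comp_elim]
  | imp φ ψ ih ih' =>
    obtain ⟨φ', h⟩ := ih
    obtain ⟨ψ', h'⟩ := ih'
    exact ⟨φ'.imp ψ', fun i v xs => imp_congr (h i v xs) (h' i v xs)⟩
  | @all n φ ih =>
    obtain ⟨φ', h⟩ := ih
    refine ⟨((R.boundedFormula₁ (Term.var (.inr (Fin.last n)))).imp φ').all, fun i v xs => ?_⟩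
    rw [BoundedFormula.realize_all, BoundedFormula.realize_all]
    have hx (a : N i) : e i ∘ Fin.snoc (α := fun _ => N i) xs a = Fin.snoc (e i ∘ xs) (e i a) :=
      Fin.comp_snoc _ _ _
    simp only [BoundedFormula.realize_imp, BoundedFormula.realize_rel₁, Term.realize_var,
      Sum.elim_inr, Fin.snoc_last, hR₁]
    refine ⟨?_, fun H a => ?_⟩
    · rintro H _ ⟨a, rfl⟩
      rw [← hx]
      exact (h i v _).1 (H a)
    · rw [h i, hx]
      exact H _ ⟨a, rfl⟩

end Translation

end CurveACVF
end

noncomputable section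
namespace CurveACVF

open FirstOrder FirstOrder.Language FirstOrder.Language.Structure

section

variable {f : Type u} [Field f] {C : Scheme.{u}} {p : C ⟶ Spec (CommRingCat.of f)}
  [SmoothOfRelativeDimension 1 p] [GeometricallyIntegral p] {𝒰 : Atlas p} {D E : Model p}
  [IsSeparated p]

open Model Model.Carrier

instance (D : Model p) : Ring.CompatibleRing D.k := Ring.compatibleRingOfRing D.k

instance (D : Model p) : groupLang.Structure D.Γ := groupStructure D.one

/-- A criterion for the definability of sets of tuples in a sort. -/
lemma mem_of_realize_iff {N : Type u} (ι : N → D.Carrier) {n : ℕ} (B : Set (Set (Fin n → N)))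
    (huniv : Set.univ ∈ B) (hinter : ∀ s ∈ B, ∀ t ∈ B, s ∩ t ∈ B) (hcompl : ∀ s ∈ B, sᶜ ∈ B)
    (φ : (lang 𝒰).Formula (Fin n))
    (key : ∀ (E₁ E₂ : Model p) (w₁ : Fin n → E₁.Carrier) (w₂ : Fin n → E₂.Carrier),
      (∀ ψ : (lang 𝒰).Formula (Fin n), {t | ψ.Realize (ι ∘ t)} ∈ B →
        (ψ.Realize w₁ ↔ ψ.Realize w₂)) →
      (∀ ψ : (lang 𝒰).Formula (Fin n), (∀ t, ψ.Realize (ι ∘ t)) →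
        ψ.Realize w₁ ∧ ψ.Realize w₂) → (φ.Realize w₁ ↔ φ.Realize w₂)) :
    {t | φ.Realize (ι ∘ t)} ∈ B := by
  by_contra hB
  obtain ⟨U₁, U₂, h₁, h₂, h⟩ := exists_ultrafilter_of_notMem B huniv hinter hcompl hB
  obtain ⟨E₁, π₁, hπ₁⟩ := exists_ultraproduct.{u, 0} U₁ (fun _ => D.Carrier)
    fun _ => models_theory (𝒰 := 𝒰) D
  obtain ⟨E₂, π₂, hπ₂⟩ := exists_ultraproduct.{u, 0} U₂ (fun _ => D.Carrier)
    fun _ => models_theory (𝒰 := 𝒰) D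
  have h3 (ψ : (lang 𝒰).Formula (Fin n)) := hπ₁ ψ (fun i t => ι (t i))
  have h4 (ψ : (lang 𝒰).Formula (Fin n)) := hπ₂ ψ (fun i t => ι (t i))
  have := key E₁ E₂ (fun i => π₁ fun t => ι (t i)) (fun i => π₂ fun t => ι (t i))
    (fun ψ hψ => by rw [h3, h4]; exact h _ hψ)
    (fun ψ hψ => ⟨(h3 ψ).2 (Filter.Eventually.of_forall hψ),
      (h4 ψ).2 (Filter.Eventually.of_forall hψ)⟩)
  rw [h3, h4] at this
  exact h₂ (this.1 h₁)

/-- The formula stating that a variable has a given sort. -/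
abbrev sortFormula (r : Rel 𝒰 1) {n : ℕ} (i : Fin n) : (lang 𝒰).Formula (Fin n) :=
  (rsym 𝒰 r).formula₁ (Term.var i)

lemma realize_sortFormula {r : Rel 𝒰 1} {n : ℕ} {i : Fin n} {M : Type u} [(lang 𝒰).Structure M]
    {w : Fin n → M} : (sortFormula r i).Realize w ↔ RelMap (rsym 𝒰 r) ![w i] :=
  Formula.realize_rel₁

lemma funcTranslates_ofK (𝒰 : Atlas p) : FuncTranslates (L₀ := Language.ring) (L := lang 𝒰)
    (N := fun D : Model p => D.k) (M := fun D => D.Carrier) fun _ => ofK := by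
  intro n g
  cases g with
  | add => exact ⟨Term.func (sym 𝒰 .addK) Term.var, fun D t => rfl⟩
  | mul => exact ⟨Term.func (sym 𝒰 .mulK) Term.var, fun D t => rfl⟩
  | neg => exact ⟨Term.func (sym 𝒰 .negK) Term.var, fun D t => rfl⟩
  | zero =>
    exact ⟨Term.func (sym 𝒰 (.const 0)) Term.var, fun D t =>
      congrArg ofK (map_zero (algebraMap f D.k)).symm⟩
  | one =>
    exact ⟨Term.func (sym 𝒰 (.const 1)) Term.var, fun D t =>
      congrArg ofK (map_one (algebraMap f D.k)).symm⟩

lemma relTranslates_ofK (𝒰 : Atlas p) : RelTranslates (L₀ := Language.ring) (L := lang 𝒰)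
    (N := fun D : Model p => D.k) (M := fun D => D.Carrier) fun _ => ofK :=
  fun _ r => r.elim

lemma funcTranslates_ofG (𝒰 : Atlas p) : FuncTranslates (L₀ := groupLang) (L := lang 𝒰)
    (N := fun D : Model p => D.Γ) (M := fun D => D.Carrier) fun _ => ofG := by
  intro n g
  cases g with
  | add => exact ⟨Term.func (sym 𝒰 .addG) Term.var, fun D t => rfl⟩
  | neg => exact ⟨Term.func (sym 𝒰 .negG) Term.var, fun D t => rfl⟩
  | zero => exact ⟨Term.func (sym 𝒰 .zeroG) Term.var, fun D t => rfl⟩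
  | one => exact ⟨Term.func (sym 𝒰 .oneG) Term.var, fun D t => rfl⟩

lemma relTranslates_ofG (𝒰 : Atlas p) : RelTranslates (L₀ := groupLang) (L := lang 𝒰)
    (N := fun D : Model p => D.Γ) (M := fun D => D.Carrier) fun _ => ofG := by
  intro n r
  cases r with
  | le =>
    refine ⟨rsym 𝒰 .le, fun D t => ⟨fun h => ⟨t 0, t 1, rfl, rfl, h⟩, ?_⟩⟩
    rintro ⟨γ, δ, h0, h1, h⟩
    rw [← Carrier.ofG.inj h0, ← Carrier.ofG.inj h1] at h
    exact h

/-- The terms for the constants and the variables. -/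
def constVarTerm (𝒰 : Atlas p) (n : ℕ) : f ⊕ Fin n → (lang 𝒰).Term (Fin n) :=
  Sum.elim (fun r => Term.func (sym 𝒰 (.const r)) Fin.elim0) Term.var

lemma realize_constVarTerm {n : ℕ} {w : Fin n → D.Carrier} (b : f ⊕ Fin n) :
    (constVarTerm 𝒰 n b).realize w = Sum.elim (fun r => ofK (algebraMap f D.k r)) w b := by
  rcases b with r | i <;> rfl

lemma definableInModel_of {N : Type u} {ι : N → D.Carrier} (r : Rel 𝒰 1)
    (hr : ∀ m : D.Carrier, RelMap (rsym 𝒰 r) ![m] ↔ ∃ a, m = ι a)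
    {n : ℕ} {X : Set (Fin n → N)} (ψ : (lang 𝒰).Formula (Fin n))
    (hψ : ∀ t, t ∈ X ↔ ψ.Realize (ι ∘ t)) :
    DefinableInModel 𝒰 D ((fun t j => ι (t j)) '' X) := by
  have h1 : (∅ : Set D.Carrier).Definable (lang 𝒰) {w : Fin n → D.Carrier | ψ.Realize w} :=
    Set.empty_definable_iff.2 ⟨ψ, rfl⟩
  have h2 := (definable_sort_pow (r := r) (∅ : Set D.Carrier) n).inter h1
  change (∅ : Set D.Carrier).Definable (lang 𝒰) _
  convert! h2 using 1
  ext w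
  constructor
  · rintro ⟨t, ht, rfl⟩
    exact ⟨fun i => (hr _).2 ⟨_, rfl⟩, (hψ t).1 ht⟩
  · rintro ⟨hw, hw'⟩
    choose t ht using fun i => (hr _).1 (hw i)
    obtain rfl : w = ι ∘ t := funext ht
    exact ⟨t, (hψ t).2 hw', rfl⟩

lemma DefinableInModel.exists_formula {N : Type u} {ι : N → D.Carrier}
    (hι : Function.Injective ι) {n : ℕ} {X : Set (Fin n → N)}
    (h : DefinableInModel 𝒰 D ((fun t j => ι (t j)) '' X)) :
    ∃ φ : (lang 𝒰).Formula (Fin n), X = {t | φ.Realize (ι ∘ t)} := by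
  obtain ⟨φ, hφ⟩ := Set.empty_definable_iff.1 h
  refine ⟨φ, Set.ext fun t => ?_⟩
  have hinj : Function.Injective fun (t : Fin n → N) j => ι (t j) := fun s t h =>
    funext fun j => hι (congrFun h j)
  exact hinj.mem_set_image.symm.trans (Set.ext_iff.1 hφ (ι ∘ t))

theorem definableInModel_ofK_iff (D : Model p) (n : ℕ) (X : Set (Fin n → D.k)) :
    DefinableInModel 𝒰 D ((fun (t : Fin n → D.k) j => ofK (D := D) (t j)) '' X) ↔
      DefinableInAlgebra D X := by
  have hinj (D : Model p) : Function.Injective (ofK (D := D)) := fun _ _ => Carrier.ofK.inj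
  have hterm (τ : Language.ring.Term (f ⊕ Fin n)) : ∃ σ : (lang 𝒰).Term (Fin n),
      ∀ (E : Model p) (a : Fin n → E.k),
        ofK (τ.realize (Sum.elim (algebraMap f E.k) a)) = σ.realize (ofK (D := E) ∘ a) := by
    obtain ⟨σ, hσ⟩ := (funcTranslates_ofK 𝒰).exists_term τ
    refine ⟨σ.subst (constVarTerm 𝒰 n), fun E a => ?_⟩
    rw [hσ, Term.realize_subst]
    refine congrArg σ.realize (funext fun b => ?_)
    rw [realize_constVarTerm]
    rcases b with b | b <;> rfl
  constructor
  · intro h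
    obtain ⟨φ, rfl⟩ := h.exists_formula (hinj D)
    refine mem_of_realize_iff (ofK (D := D)) {Y | DefinableInAlgebra D Y} Set.definable_univ
      (fun s hs t ht => Set.Definable.inter hs ht) (fun s hs => Set.Definable.compl hs) φ
      fun E₁ E₂ w₁ w₂ h₁ h₂ => ?_
    choose a₁ ha₁ using fun i => realize_sortFormula.1 (h₂ (sortFormula .isK i) fun t =>
      realize_sortFormula.2 (isK_ofK 𝒰)).1
    choose a₂ ha₂ using fun i => realize_sortFormula.1 (h₂ (sortFormula .isK i) fun t =>
      realize_sortFormula.2 (isK_ofK 𝒰)).2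
    obtain rfl : w₁ = ofK ∘ a₁ := funext ha₁
    obtain rfl : w₂ = ofK ∘ a₂ := funext ha₂
    let S : Subring (E₁.k × E₂.k) :=
      { carrier := {q | ∃ τ : Language.ring.Term (f ⊕ Fin n),
          τ.realize (Sum.elim (algebraMap f E₁.k) a₁) = q.1 ∧
          τ.realize (Sum.elim (algebraMap f E₂.k) a₂) = q.2}
        zero_mem' := ⟨0, by simp, by simp⟩
        one_mem' := ⟨1, by simp, by simp⟩
        add_mem' := by
          rintro q r ⟨τ, h, h'⟩ ⟨σ, g, g'⟩
          exact ⟨τ + σ, by simp [h, g], by simp [h', g']⟩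
        mul_mem' := by
          rintro q r ⟨τ, h, h'⟩ ⟨σ, g, g'⟩
          exact ⟨τ * σ, by simp [h, g], by simp [h', g']⟩
        neg_mem' := by
          rintro q ⟨τ, h, h'⟩
          exact ⟨-τ, by simp [h], by simp [h']⟩ }
    have hS (q) (hq : q ∈ S) : q.1 = 0 ↔ q.2 = 0 := by
      obtain ⟨τ, h, h'⟩ := hq
      obtain ⟨σ, hσ⟩ := hterm τ
      have h3 (E : Model p) (a : Fin n → E.k) :
          (σ.equal (Term.func (sym 𝒰 (.const 0)) Fin.elim0)).Realize (ofK (D := E) ∘ a) ↔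
            τ.realize (Sum.elim (algebraMap f E.k) a) = 0 := by
        rw [Formula.realize_equal, ← hσ, ← (hinj E).eq_iff]
        have h4 : Term.realize (ofK (D := E) ∘ a) (Term.func (sym 𝒰 (.const 0)) Fin.elim0) =
          ofK 0 := congrArg ofK (map_zero (algebraMap f E.k))
        rw [h4]
      rw [← h, ← h', ← h3, ← h3]
      refine h₁ _ ?_
      simp only [h3]
      refine Set.definable_iff_exists_formula_sum.2 ⟨Term.equal (τ.relabel
        (Sum.map (fun r => ⟨algebraMap f D.k r, r, rfl⟩) id)) 0, Set.ext fun t => ?_⟩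
      change _ ↔ Formula.Realize _ _
      rw [Formula.realize_equal, Term.realize_relabel, Ring.realize_zero]
      change τ.realize _ = 0 ↔ _
      refine iff_of_eq (congrArg (· = 0) (congrArg (fun v => τ.realize v) (funext fun b => ?_)))
      rcases b with b | b <;> rfl
    refine realize_iff_of_mem hS (fun r => ⟨Term.var (.inl r), rfl, rfl⟩) oneSubgroup_compat
      (AddSubgroup.mem_zmultiples _) (fun i => .inl ⟨(a₁ i, a₂ i), ⟨Term.var (.inr i), rfl, rfl⟩,
        rfl, rfl⟩) φ
  · intro h
    obtain ⟨φ, hφ⟩ := Set.definable_iff_exists_formula_sum.1 h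
    have hφ' (t) : t ∈ X ↔ (φ.relabel (Sum.map (fun a => a.2.choose) id) :
        Language.ring.Formula (f ⊕ Fin n)).Realize (Sum.elim (algebraMap f D.k) t) := by
      rw [hφ, Formula.realize_relabel]
      refine iff_of_eq (congrArg φ.Realize (funext fun b => ?_))
      rcases b with b | b
      · exact b.2.choose_spec.symm
      · rfl
    obtain ⟨ψ, hψ⟩ := (funcTranslates_ofK 𝒰).exists_formula (relTranslates_ofK 𝒰) hinj
      (rsym 𝒰 .isK) (fun E m => Iff.rfl) (φ.relabel (Sum.map (fun a => a.2.choose) id) :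
        Language.ring.Formula (f ⊕ Fin n))
    refine definableInModel_of .isK (fun m => Iff.rfl)
      (BoundedFormula.subst ψ (constVarTerm 𝒰 n)) fun t => ?_
    rw [hφ', Formula.Realize, hψ, Formula.Realize, BoundedFormula.realize_subst]
    simp only [realize_constVarTerm]
    rw [Sum.comp_elim]
    refine iff_of_eq (congrArg₂ ψ.Realize (funext fun b => ?_) (Subsingleton.elim _ _))
    rcases b with b | b <;> rfl

theorem definableInModel_ofG_iff (D : Model p) (n : ℕ) (X : Set (Fin n → D.Γ)) :
    DefinableInModel 𝒰 D ((fun (t : Fin n → D.Γ) j => ofG (D := D) (t j)) '' X) ↔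
      DefinableInGroup D X := by
  have hinj (D : Model p) : Function.Injective (ofG (D := D)) := fun _ _ => Carrier.ofG.inj
  constructor
  · intro h
    obtain ⟨φ, rfl⟩ := h.exists_formula (hinj D)
    refine mem_of_realize_iff (ofG (D := D)) {Y | DefinableInGroup D Y} Set.definable_univ
      (fun s hs t ht => Set.Definable.inter hs ht) (fun s hs => Set.Definable.compl hs) φ
      fun E₁ E₂ w₁ w₂ h₁ h₂ => ?_
    choose a₁ ha₁ using fun i => realize_sortFormula.1 (h₂ (sortFormula .isG i) fun t =>
      realize_sortFormula.2 (isG_ofG 𝒰)).1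
    choose a₂ ha₂ using fun i => realize_sortFormula.1 (h₂ (sortFormula .isG i) fun t =>
      realize_sortFormula.2 (isG_ofG 𝒰)).2
    obtain rfl : w₁ = ofG ∘ a₁ := funext ha₁
    obtain rfl : w₂ = ofG ∘ a₂ := funext ha₂
    let zeroG : groupLang.Functions 0 := GroupFunc.zero
    let oneG : groupLang.Functions 0 := GroupFunc.one
    let addG : groupLang.Functions 2 := GroupFunc.add
    let negG : groupLang.Functions 1 := GroupFunc.neg
    let leG : groupLang.Relations 2 := GroupRel.le
    let G : AddSubgroup (E₁.Γ × E₂.Γ) :=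
      { carrier := {q | ∃ τ : groupLang.Term (Fin n), τ.realize a₁ = q.1 ∧ τ.realize a₂ = q.2}
        zero_mem' := ⟨Term.func zeroG Fin.elim0, rfl, rfl⟩
        add_mem' := by
          rintro ⟨_, _⟩ ⟨_, _⟩ ⟨τ, rfl, rfl⟩ ⟨σ, rfl, rfl⟩
          exact ⟨Term.func addG ![τ, σ], rfl, rfl⟩
        neg_mem' := by
          rintro ⟨_, _⟩ ⟨τ, rfl, rfl⟩
          exact ⟨Term.func negG ![τ], rfl, rfl⟩ }
    have hG : IsOrderCompat G := by
      rintro ⟨_, _⟩ ⟨τ, rfl, rfl⟩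
      obtain ⟨σ, hσ⟩ := (funcTranslates_ofG 𝒰).exists_term τ
      have h3 (E : Model p) (a : Fin n → E.Γ) :
          ((rsym 𝒰 .le).formula₂ (Term.func (sym 𝒰 .zeroG) Fin.elim0) σ).Realize
            (ofG (D := E) ∘ a) ↔ 0 ≤ τ.realize a := by
        rw [Formula.realize_rel₂, ← hσ]
        exact gLe_ofG 𝒰
      rw [← h3, ← h3]
      refine h₁ _ ?_
      simp only [h3]
      refine Set.empty_definable_iff.2 ⟨leG.formula₂ (Term.func zeroG Fin.elim0) τ,
        Set.ext fun t => ?_⟩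
      change _ ↔ Formula.Realize _ _
      rw [Formula.realize_rel₂]
      rfl
    exact realize_iff_of_mem constSubring_eq_zero (fun r => ⟨r, rfl⟩) hG
      ⟨Term.func oneG Fin.elim0, rfl, rfl⟩ (fun i => .inr ⟨(a₁ i, a₂ i), ⟨Term.var i, rfl, rfl⟩,
        rfl, rfl⟩) φ
  · intro h
    obtain ⟨φ, hφ⟩ := Set.empty_definable_iff.1 h
    obtain ⟨ψ, hψ⟩ := (funcTranslates_ofG 𝒰).exists_formula (relTranslates_ofG 𝒰) hinj
      (rsym 𝒰 .isG) (fun E m => Iff.rfl) φ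
    refine definableInModel_of .isG (fun m => Iff.rfl) ψ fun t => ?_
    rw [hφ]
    change φ.Realize t ↔ _
    rw [Formula.Realize, hψ, Formula.Realize]
    exact iff_of_eq (congrArg₂ ψ.Realize rfl (Subsingleton.elim _ _))

end

end CurveACVF
end

theorem mainTheorem8 {f : Type u} [Field f] {C : Scheme.{u}} (p : C ⟶ Spec (CommRingCat.of f))
    [SmoothOfRelativeDimension 1 p] [IsSeparated p] [GeometricallyIntegral p]
    (𝒰 : CurveACVF.Atlas p) :
    -- the models of the theory are exactly the described structures
    (∀ (M : Type u) [(CurveACVF.lang 𝒰).Structure M],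
      M ⊨ CurveACVF.theory 𝒰 ↔
        ∃ D : CurveACVF.Model p, letI := D.toStructure 𝒰
          Nonempty ((CurveACVF.lang 𝒰).Equiv M D.Carrier)) ∧
    CurveACVF.HasQuantifierElimination (CurveACVF.theory 𝒰) ∧
    (CurveACVF.theory 𝒰).IsComplete ∧
    CurveACVF.IsStablyEmbedded (CurveACVF.theory 𝒰) CurveACVF.Rel.isK ∧
    CurveACVF.IsStablyEmbedded (CurveACVF.theory 𝒰) CurveACVF.Rel.isG ∧
    -- the induced structure on `k` and on `Γ`
    (∀ (D : CurveACVF.Model p) (n : ℕ),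
      (∀ X : Set (Fin n → D.k),
        CurveACVF.DefinableInModel 𝒰 D
            ((fun (t : Fin n → D.k) j => CurveACVF.Model.Carrier.ofK (D := D) (t j)) '' X) ↔
          CurveACVF.DefinableInAlgebra D X) ∧
      (∀ X : Set (Fin n → D.Γ),
        CurveACVF.DefinableInModel 𝒰 D
            ((fun (t : Fin n → D.Γ) j => CurveACVF.Model.Carrier.ofG (D := D) (t j)) '' X) ↔
          CurveACVF.DefinableInGroup D X)) := by
  obtain ⟨D⟩ := CurveACVF.nonempty_model 𝒰
  exact ⟨fun M _ => CurveACVF.models_iff M, CurveACVF.hasQuantifierElimination 𝒰,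
    CurveACVF.isComplete_of_model 𝒰 D, CurveACVF.isStablyEmbedded_isK 𝒰,
    CurveACVF.isStablyEmbedded_isG 𝒰, fun D n =>
      ⟨CurveACVF.definableInModel_ofK_iff D n, CurveACVF.definableInModel_ofG_iff D n⟩⟩
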